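/- Let $P$ be a non-self-intersecting rectilinear polygon, possibly with holes, with $2n$ edges in total (holes included). Holes lie in the region enclosed by the outer contour and meet it at most in common vertices; any two holes have at most one common point, which is then a vertex of both. The region $\mathcal I(P)$ is what the outer contour encloses minus the open interiors of the holes. From every concave vertex of $P$ (a vertex whose interior angle is not $\pi/2$) extend a horizontal and a vertical ray through the interior of $P$ until it meets an edge; the rays cut the interior into the base rectangles $\mathcal B(P)$. The base rectangle graph has $\mathcal B(P)$ as nodes, and the left, top, right, bottom neighbours $\ell(B),t(B),r(B),b(B)$ of a node $B$ (each may be missing) are the base rectangles that share the whole left, top, right, bottom side of $B$. Let $h(B)$ be the length of the longest path from $B$ that repeatedly moves to the bottom neighbour. The strip cover algorithm obtains the base rectangle graph of $P$ and computes all $h(B)$. For each node $B$ without top neighbour it then walks from $B$ to the left until a node $B'$ that has no left neighbour or has $h(\ell(B'))<h(B)$, walks from $B$ to the right until a node $B''$ that has no right neighbour or has $h(r(B''))<h(B)$, walks from $B''$ downwards $h(B)$ steps to a node $B'''$, and reports the rectangle whose top left vertex is that of $B'$ and whose bottom right vertex is that of $B'''$, unless it has already been reported. There is an absolute constant $C$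 such that for every such $P$ the following holds. The set $\mathcal B(P)$ is finite. On a unit-cost random access machine that can copy and compare real coordinates, copy, compare, increment and decrement natural numbers, and access arrays, the base rectangle graph can be computed from $P$, the strip cover algorithm can be run on the base rectangle graph (whatever the numbering of its nodes), and hence the whole algorithm can be run on $P$, each in at most $C n^2$ steps and with at most $C\,|\mathcal B(P)|$ memory cells in each of a fixed number of arrays, that is, in $O(n^2)$ time and $O(|\mathcal B(P)|)$ space. The set $\mathcal C$ of the reported rectangles is a cover of $P$ (all its rectangles lie in $\mathcal I(P)$ and their union is $\mathcal I(P)$), every rectangle in $\mathcal C$ is maximal (no larger axis-parallel rectangle lies in $\mathcal I(P)$), and $|\mathcal C|\le C n$. -/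

import Mathlib

/-! Rectangles, rectilinear polygons with holes, base rectangles, the base rectangle graph, the
strip cover, a small random access machine language with a step count, and the strip cover
algorithm as a program of that language. Points are pairs `(x, y)`; "top" is larger `y`. -/

/-! ### Rectangles and polygons -/

/-- A (non-degenerate) axis-parallel rectangle. -/
@[ext] structure Rect where
  left : ℝ
  right : ℝ
  bottom : ℝ
  top : ℝ
  left_lt_right : left < right
  bottom_lt_top : bottom < top

/-- The rectangle as a closed set. -/
def Rect.region (R : Rect) : Set (ℝ × ℝ) :=
  Set.Icc R.left R.right ×ˢ Set.Icc R.bottom R.top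

/-- The open rectangle. -/
def Rect.openRegion (R : Rect) : Set (ℝ × ℝ) :=
  Set.Ioo R.left R.right ×ˢ Set.Ioo R.bottom R.top

/-- The cyclic successor of an index. -/
def cyclicNext {m : ℕ} (i : Fin m) : Fin m :=
  ⟨(i.1 + 1) % m, Nat.mod_lt _ (Nat.lt_of_le_of_lt (Nat.zero_le _) i.2)⟩

/-- The horizontal edge number `i` of the closed alternating chain
`… (x i, y i), (x (i+1), y i), (x (i+1), y (i+1)), …`. -/
def horizontalEdge {m : ℕ} (x y : Fin m → ℝ) (i : Fin m) : Set (ℝ × ℝ) :=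
  segment ℝ (x i, y i) (x (cyclicNext i), y i)

/-- The vertical edge number `i` of the same chain; it follows the horizontal edge number `i`. -/
def verticalEdge {m : ℕ} (x y : Fin m → ℝ) (i : Fin m) : Set (ℝ × ℝ) :=
  segment ℝ (x (cyclicNext i), y i) (x (cyclicNext i), y (cyclicNext i))

/-- A hole-free, non-self-intersecting rectilinear polygon: a cyclic alternating list of `m`
horizontal and `m` vertical edges (of positive length) such that edges that are not adjacent are
disjoint. (Adjacent edges are perpendicular and meet in their common vertex only.) -/
structure Contour where
  m : ℕ
  two_le : 2 ≤ m
  x : Fin m → ℝ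
  y : Fin m → ℝ
  x_ne : ∀ i, x i ≠ x (cyclicNext i)
  y_ne : ∀ i, y i ≠ y (cyclicNext i)
  disjoint_horizontal : ∀ i j, i ≠ j →
    Disjoint (horizontalEdge x y i) (horizontalEdge x y j)
  disjoint_vertical : ∀ i j, i ≠ j →
    Disjoint (verticalEdge x y i) (verticalEdge x y j)
  disjoint_mixed : ∀ i j, j ≠ i → cyclicNext j ≠ i →
    Disjoint (horizontalEdge x y i) (verticalEdge x y j)

namespace Contour

/-- The union of all edges. -/
def boundary (c : Contour) : Set (ℝ × ℝ) :=
  ⋃ i, horizontalEdge c.x c.y i ∪ verticalEdge c.x c.y i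

/-- The set of vertices. -/
def vertices (c : Contour) : Set (ℝ × ℝ) :=
  {p | ∃ i, p = (c.x i, c.y i) ∨ p = (c.x (cyclicNext i), c.y i)}

/-- The open region enclosed by the polygon (even-odd rule): the points off the boundary from which
the horizontal ray to the right crosses an odd number of vertical edges. -/
def inside (c : Contour) : Set (ℝ × ℝ) :=
  {p | p ∉ c.boundary ∧
    Odd (Set.ncard {i : Fin c.m | p.1 < c.x (cyclicNext i) ∧
      min (c.y i) (c.y (cyclicNext i)) ≤ p.2 ∧ p.2 < max (c.y i) (c.y (cyclicNext i))})}

/-- The closed region enclosed by the polygon. -/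
def region (c : Contour) : Set (ℝ × ℝ) := c.inside ∪ c.boundary

end Contour

/-- A non-self-intersecting rectilinear polygon with holes. Holes lie in the region enclosed by the
outer contour and do not meet the outer contour, except possibly in common vertices; any two
holes have at most one point in common, which is then a vertex of both. -/
structure RectilinearPolygon where
  outer : Contour
  holes : List Contour
  hole_subset : ∀ H ∈ holes, H.region ⊆ outer.region
  hole_boundary : ∀ H ∈ holes, H.boundary ∩ outer.boundary ⊆ H.vertices ∩ outer.vertices
  holes_pairwise : holes.Pairwise fun H K =>
    (H.region ∩ K.region).Subsingleton ∧ H.region ∩ K.region ⊆ H.vertices ∩ K.vertices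

namespace RectilinearPolygon

/-- All contours: the outer one, then the holes. -/
def contours (P : RectilinearPolygon) : List Contour := P.outer :: P.holes

/-- The size `n(P)`: half the number of all edges, i.e. the number of all horizontal edges. -/
def size (P : RectilinearPolygon) : ℕ := (P.contours.map Contour.m).sum

/-- All points on edges of the polygon, including those of its holes. -/
def boundary (P : RectilinearPolygon) : Set (ℝ × ℝ) := {p | ∃ c ∈ P.contours, p ∈ c.boundary}

/-- All vertices of the polygon, including those of its holes. -/
def vertices (P : RectilinearPolygon) : Set (ℝ × ℝ) := {p | ∃ c ∈ P.contours, p ∈ c.vertices}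

/-- The (closed) region of `P`: what the outer contour encloses, minus the interiors of the
holes. -/
def region (P : RectilinearPolygon) : Set (ℝ × ℝ) := {p | p ∈ P.outer.region ∧ ∀ H ∈ P.holes, p ∉ H.inside}

/-- The inner points of `P`: those of its region that are on no edge. -/
def inner (P : RectilinearPolygon) : Set (ℝ × ℝ) := P.region \ P.boundary

/-- A set of rectangles is a cover of `P` if their union is the region of `P` (and each of them
lies in the region of `P`). -/
def IsCover (P : RectilinearPolygon) (S : Set Rect) : Prop :=
  (∀ R ∈ S, R.region ⊆ P.region) ∧ P.region = ⋃ R ∈ S, R.region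

/-- Maximal rectangles of `P`: no larger rectangle lies in the region of `P`. -/
def IsMaximalRect (P : RectilinearPolygon) (R : Rect) : Prop :=
  R.region ⊆ P.region ∧ ∀ R' : Rect, R.region ⊆ R'.region → R'.region ⊆ P.region → R' = R

/-! ### Base rectangles and the base rectangle graph -/

/-- Near `v`, the open quadrant with the given signs consists of inner points of `P`. -/
def QuadrantInside (P : RectilinearPolygon) (v : ℝ × ℝ) (q : ℤˣ × ℤˣ) : Prop :=
  ∃ ε > (0 : ℝ), ∀ a b : ℝ, 0 < a → a < ε → 0 < b → b < ε →
    (v.1 + ((q.1 : ℤ) : ℝ) * a, v.2 + ((q.2 : ℤ) : ℝ) * b) ∈ P.inner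

/-- A vertex with interior angle `π / 2`. -/
def IsConvexVertex (P : RectilinearPolygon) (v : ℝ × ℝ) : Prop :=
  v ∈ P.vertices ∧ ∃! q : ℤˣ × ℤˣ, P.QuadrantInside v q

/-- A vertex that is not convex. -/
def IsConcaveVertex (P : RectilinearPolygon) (v : ℝ × ℝ) : Prop :=
  v ∈ P.vertices ∧ ¬ P.IsConvexVertex v

/-- The union of all horizontal and vertical rays that start in a concave vertex (exclusive) and
run through inner points of `P` until they meet an edge (exclusive). A direction that does not lead
from the vertex into the interior contributes nothing. -/
def rays (P : RectilinearPolygon) : Set (ℝ × ℝ) :=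
  {p | ∃ v, P.IsConcaveVertex v ∧ p ≠ v ∧ (p.1 = v.1 ∨ p.2 = v.2) ∧
    ∀ q ∈ segment ℝ v p, q ≠ v → q ∈ P.inner}

/-- The base rectangles of `P`: the rays cut the interior of `P` into connected components, the
open base rectangles. -/
def baseRects (P : RectilinearPolygon) : Set Rect :=
  {R | ∃ p ∈ P.inner \ P.rays, connectedComponentIn (P.inner \ P.rays) p = R.openRegion}

/-- `A` is the left neighbour `ℓ(B)` in the base rectangle graph. -/
def IsLeft (P : RectilinearPolygon) (B A : Rect) : Prop :=
  B ∈ P.baseRects ∧ A ∈ P.baseRects ∧ A.right = B.left ∧ A.bottom = B.bottom ∧ A.top = B.top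

/-- `A` is the top neighbour `t(B)`. -/
def IsTop (P : RectilinearPolygon) (B A : Rect) : Prop :=
  B ∈ P.baseRects ∧ A ∈ P.baseRects ∧ A.bottom = B.top ∧ A.left = B.left ∧ A.right = B.right

/-- `A` is the right neighbour `r(B)`. -/
def IsRight (P : RectilinearPolygon) (B A : Rect) : Prop :=
  B ∈ P.baseRects ∧ A ∈ P.baseRects ∧ A.left = B.right ∧ A.bottom = B.bottom ∧ A.top = B.top

/-- `A` is the bottom neighbour `b(B)`. -/
def IsBottom (P : RectilinearPolygon) (B A : Rect) : Prop :=
  B ∈ P.baseRects ∧ A ∈ P.baseRects ∧ A.top = B.bottom ∧ A.left = B.left ∧ A.right = B.right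

/-- `A` is reached from `B` by `k` steps to bottom neighbours. -/
def BottomSteps (P : RectilinearPolygon) : ℕ → Rect → Rect → Prop
  | 0, B, A => A = B
  | k + 1, B, A => ∃ D, P.IsBottom B D ∧ P.BottomSteps k D A

/-- The height `h(B)`: the length of the longest bottom-going path that starts in `B`. -/
noncomputable def height (P : RectilinearPolygon) (B : Rect) : ℕ :=
  sSup {k | ∃ A, P.BottomSteps k B A}

/-- `R` is the rectangle that is reported for the base rectangle `B`, which has no top neighbour:
from `B` walk to the left, to `B₁`, and to the right, to `B₂`, as long as there is a next
base rectangle and its height is at least that of `B`; then walk from `B₂` down `h(B)` steps, to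
`B₃`. The top left vertex of `R` is that of `B₁`, its bottom right vertex is that of `B₃`. -/
def Reports (P : RectilinearPolygon) (B R : Rect) : Prop :=
  B ∈ P.baseRects ∧ (¬ ∃ A, P.IsTop B A) ∧ ∃ B₁ B₂ B₃ : Rect,
    Relation.ReflTransGen (fun D A => P.IsLeft D A ∧ P.height B ≤ P.height A) B B₁ ∧
    (∀ A, P.IsLeft B₁ A → P.height A < P.height B) ∧
    Relation.ReflTransGen (fun D A => P.IsRight D A ∧ P.height B ≤ P.height A) B B₂ ∧
    (∀ A, P.IsRight B₂ A → P.height A < P.height B) ∧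
    P.BottomSteps (P.height B) B₂ B₃ ∧
    R.left = B₁.left ∧ R.top = B₁.top ∧ R.right = B₃.right ∧ R.bottom = B₃.bottom

/-- The strip cover of `P`: the set of all reported rectangles. -/
def stripCover (P : RectilinearPolygon) : Set Rect := {R | ∃ B, P.Reports B R}

end RectilinearPolygon

/-! ### The machine model

A program has finitely many registers and arrays, each holding natural numbers (counters and
indices) or real numbers (coordinates). Natural numbers can be copied, incremented, decremented and
compared, real numbers can only be copied and compared; arrays are accessed through index registers.
Each instruction and each evaluation of a test takes one step. As there is no arithmetic on numbers
beyond increments, a natural number in memory never exceeds the largest initial one by more than the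
number of steps. -/

/-- Memory contents: registers and arrays for natural and for real numbers. -/
structure MState where
  nreg : ℕ → ℕ
  rreg : ℕ → ℝ
  narr : ℕ → ℕ → ℕ
  rarr : ℕ → ℕ → ℝ

/-- Unit cost instructions. Arguments are numbers of registers and arrays. -/
inductive Instr where
  /-- `a := 0` -/
  | zero (a : ℕ)
  /-- `a := b` -/
  | copy (a b : ℕ)
  /-- `a := a + 1` -/
  | succ (a : ℕ)
  /-- `a := a - 1` (and `0` stays `0`) -/
  | pred (a : ℕ)
  /-- `a := A[i]` -/
  | load (a A i : ℕ)
  /-- `A[i] := a` -/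
  | store (A i a : ℕ)
  /-- `a := b` for real registers -/
  | rcopy (a b : ℕ)
  /-- `a := A[i]` for a real register and array -/
  | rload (a A i : ℕ)
  /-- `A[i] := a` for a real register and array -/
  | rstore (A i a : ℕ)

/-- The effect of an instruction. -/
noncomputable def Instr.apply : Instr → MState → MState
  | zero a, s => { s with nreg := Function.update s.nreg a 0 }
  | copy a b, s => { s with nreg := Function.update s.nreg a (s.nreg b) }
  | succ a, s => { s with nreg := Function.update s.nreg a (s.nreg a + 1) }
  | pred a, s => { s with nreg := Function.update s.nreg a (s.nreg a - 1) }
  | load a A i, s => { s with nreg := Function.update s.nreg a (s.narr A (s.nreg i)) }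
  | store A i a, s =>
      { s with narr :=
          Function.update s.narr A (Function.update (s.narr A) (s.nreg i) (s.nreg a)) }
  | rcopy a b, s => { s with rreg := Function.update s.rreg a (s.rreg b) }
  | rload a A i, s => { s with rreg := Function.update s.rreg a (s.rarr A (s.nreg i)) }
  | rstore A i a, s =>
      { s with rarr :=
          Function.update s.rarr A (Function.update (s.rarr A) (s.nreg i) (s.rreg a)) }

/-- The instruction accesses arrays only at indices below `M`. -/
def Instr.Within (M : ℕ) : Instr → MState → Prop
  | load _ _ i, s => s.nreg i < M
  | store _ i _, s => s.nreg i < M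
  | rload _ _ i, s => s.nreg i < M
  | rstore _ i _, s => s.nreg i < M
  | _, _ => True

/-- Unit cost tests. -/
inductive Test where
  /-- `a < b` for registers of natural numbers -/
  | lt (a b : ℕ)
  /-- `a < b` for real registers -/
  | rlt (a b : ℕ)
  /-- `a = b` for real registers -/
  | req (a b : ℕ)

/-- The outcome of a test. -/
def Test.Holds : Test → MState → Prop
  | lt a b, s => s.nreg a < s.nreg b
  | rlt a b, s => s.rreg a < s.rreg b
  | req a b, s => s.rreg a = s.rreg b

/-- Programs. -/
inductive Prog where
  | skip
  | instr (c : Instr)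
  | seq (p q : Prog)
  | ite (b : Test) (p q : Prog)
  | loop (b : Test) (p : Prog)

/-- `Exec M p s s' t`: started on memory `s`, the program `p` stops after `t` steps with memory
`s'`, and all array accesses on the way are to indices below `M`; thus `M` cells for each
array of the program (and its registers) are all the memory that it uses. -/
inductive Exec (M : ℕ) : Prog → MState → MState → ℕ → Prop where
  | skip (s : MState) : Exec M .skip s s 0
  | instr (c : Instr) (s : MState) (h : c.Within M s) : Exec M (.instr c) s (c.apply s) 1
  | seq {p q : Prog} {s s₁ s₂ : MState} {t₁ t₂ : ℕ} (h₁ : Exec M p s s₁ t₁)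
      (h₂ : Exec M q s₁ s₂ t₂) : Exec M (.seq p q) s s₂ (t₁ + t₂)
  | iteTrue {b : Test} {p q : Prog} {s s' : MState} {t : ℕ} (hb : b.Holds s)
      (h : Exec M p s s' t) : Exec M (.ite b p q) s s' (t + 1)
  | iteFalse {b : Test} {p q : Prog} {s s' : MState} {t : ℕ} (hb : ¬ b.Holds s)
      (h : Exec M q s s' t) : Exec M (.ite b p q) s s' (t + 1)
  | loopStop {b : Test} {p : Prog} {s : MState} (hb : ¬ b.Holds s) :
      Exec M (.loop b p) s s 1
  | loopStep {b : Test} {p : Prog} {s s₁ s₂ : MState} {t₁ t₂ : ℕ} (hb : b.Holds s)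
      (h₁ : Exec M p s s₁ t₁) (h₂ : Exec M (.loop b p) s₁ s₂ t₂) :
      Exec M (.loop b p) s s₂ (t₁ + t₂ + 1)

/-- Execute a list of programs one after the other. -/
def Prog.block : List Prog → Prog
  | [] => .skip
  | p :: ps => .seq p (Prog.block ps)

/-! ### Inputs and outputs -/

/-- The list of the records `(x i, y i, index of the record of the cyclic successor of i)` of the
given contours, one contour after the other, where the first record has index `k`. -/
def contourRecords (k : ℕ) : List Contour → List (ℝ × ℝ × ℕ)
  | [] => []
  | c :: cs => List.ofFn (fun i => (c.x i, c.y i, k + (cyclicNext i).1)) ++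
      contourRecords (k + c.m) cs

/-- The memory holds the polygon `P` as input: register `0` holds `n(P)`, and the first `n(P)` cells
of the real arrays `0`, `1` and of the natural number array `0` hold the cyclic lists of the outer
contour and of the holes. -/
def HoldsPolygon (P : RectilinearPolygon) (s : MState) : Prop :=
  s.nreg 0 = P.size ∧
    ∀ (k : ℕ) (hk : k < (contourRecords 0 P.contours).length),
      (s.rarr 0 k, s.rarr 1 k, s.narr 0 k) = (contourRecords 0 P.contours)[k]

/-- The memory holds the base rectangle graph of `P`: register `0` holds the number `N` of nodes,
which are numbered from `0` to `N - 1` in some order. Cell `i` of the natural number arrays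
`0`, `1`, `2`, `3` holds the number of the left, top, right, bottom neighbour of node `i`, or `N`
if there is no such neighbour; cell `i` of the real arrays `0`, `1`, `2`, `3` holds the
left, top, right, bottom coordinate of node `i`. -/
def HoldsGraph (P : RectilinearPolygon) (s : MState) : Prop :=
  ∃ node : ℕ → Rect, Set.BijOn node (Set.Iio (s.nreg 0)) P.baseRects ∧
    ∀ i < s.nreg 0,
      s.rarr 0 i = (node i).left ∧ s.rarr 1 i = (node i).top ∧
      s.rarr 2 i = (node i).right ∧ s.rarr 3 i = (node i).bottom ∧
      ∀ d : Fin 4, let nbr : Rect → Rect → Prop := ![P.IsLeft, P.IsTop, P.IsRight, P.IsBottom] d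
        (s.narr d i < s.nreg 0 ∧ nbr (node i) (node (s.narr d i))) ∨
        (s.narr d i = s.nreg 0 ∧ ¬ ∃ A, nbr (node i) A)

/-- The memory holds a list without repetitions of the rectangles in `S`: register `1` holds
their number, the real arrays `4`, `5`, `6`, `7` their left, top, right, bottom coordinates. -/
def HoldsOutput (S : Set Rect) (s : MState) : Prop :=
  ∃ out : ℕ → Rect, Set.BijOn out (Set.Iio (s.nreg 1)) S ∧
    ∀ i < s.nreg 1,
      s.rarr 4 i = (out i).left ∧ s.rarr 5 i = (out i).top ∧
      s.rarr 6 i = (out i).right ∧ s.rarr 7 i = (out i).bottom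

/-! ### The strip cover algorithm, run on the base rectangle graph

Registers: `0` number of nodes `N`; `1` number of rectangles reported so far; `2` current node `B`;
`3` height of `B`; `4`, `5` nodes on the way; `6` next node; `7` a height or counter;
`8` a position in the output; `9`, `10` the constants `0`, `1`; `11` a flag. Array `4` of natural
numbers holds the heights, and the real registers `0`, `1`, `2`, `3` the rectangle
to be reported. -/

open Instr Test in
/-- Compute the heights of all nodes: from each node without bottom neighbour walk upwards. -/
def computeHeights : Prog :=
  .block [
    .instr (zero 2),
    .loop (lt 2 0) (.block [
      .instr (load 6 3 2),
      .ite (lt 6 0) .skip (.block [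
        .instr (copy 4 2),
        .instr (zero 7),
        .loop (lt 4 0) (.block [
          .instr (store 4 4 7),
          .instr (succ 7),
          .instr (load 4 1 4)])]),
      .instr (succ 2)])]

open Instr Test in
/-- Walk from the node in register `2` (of height in register `3`) to the neighbours given by array
`d` as long as the next node exists and is at least as high; the last node goes to register
`a`. -/
def walk (d a : ℕ) : Prog :=
  .block [
    .instr (copy a 2),
    .instr (load 6 d 2),
    .loop (lt 6 0) (.block [
      .instr (load 7 4 6),
      .ite (lt 7 3)
        (.instr (copy 6 0))
        (.block [.instr (copy a 6), .instr (load 6 d a)])])]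

open Instr Test in
/-- Set the flag if the rectangle in the real registers `0`, `1`, `2`, `3` has been reported
before, and report it otherwise. -/
def reportNew : Prog :=
  .block [
    .instr (zero 11),
    .instr (zero 8),
    .loop (lt 8 1) (.block [
      .instr (rload 4 4 8),
      .instr (rload 5 5 8),
      .instr (rload 6 6 8),
      .instr (rload 7 7 8),
      .ite (req 0 4) (.ite (req 1 5) (.ite (req 2 6) (.ite (req 3 7)
        (.instr (copy 11 10)) .skip) .skip) .skip) .skip,
      .instr (succ 8)]),
    .ite (lt 9 11) .skip (.block [
      .instr (rstore 4 1 0),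
      .instr (rstore 5 1 1),
      .instr (rstore 6 1 2),
      .instr (rstore 7 1 3),
      .instr (succ 1)])]

open Instr Test in
/-- The strip cover algorithm. -/
def stripCoverProg : Prog :=
  .block [
    computeHeights,
    .instr (zero 9),
    .instr (zero 10),
    .instr (succ 10),
    .instr (zero 1),
    .instr (zero 2),
    .loop (lt 2 0) (.block [
      .instr (load 6 1 2),
      .ite (lt 6 0) .skip (.block [
        .instr (load 3 4 2),
        walk 0 4,
        walk 2 5,
        .instr (rload 0 0 4),
        .instr (rload 1 1 4),
        .instr (zero 7),
        .loop (lt 7 3) (.block [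
          .instr (load 5 3 5),
          .instr (succ 7)]),
        .instr (rload 2 2 5),
        .instr (rload 3 3 5),
        reportNew]),
      .instr (succ 2)])]

/-! Replacing each coordinate by its rank among the edge coordinates turns `P` into a set of unit
cells of an n × n grid. A wall is an edge or its prolongation, in both directions, until it meets a
perpendicular edge. The base rectangles become the blocks: rectangles of inside cells bounded by
walls and crossed by none (`In.exists_block`, `Represents.baseRects_eq`). Walls may also run outside
of `P`, but a wall through an inner point comes from a vertex between two inner quadrants, hence
from a concave one, and is a ray (`exists_ray_of_wV`).

Whether a cell is inside is decided by a parity that flips at each edge. Two neighbouring inside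
cells have no edge between them, so the walls perpendicular to their common side pass from one to
the other. Hence base rectangles that share a part of a side share all of it (`IsBlock.side_eq`),
and moving down commutes with moving sideways in the graph (`left_of_steps`).

A walk through columns at least as high as that of `B` therefore sweeps out a rectangle inside `P`.
It cannot grow upwards or downwards because the column of `B` ends there, nor sideways because a
missing or a lower neighbouring column is met (`isMaximalRect_of_reports`). Each base rectangle lies
below one without top neighbour, within its height, so the reported rectangles cover `P`.

A block with no top neighbour is charged through its top left corner to a horizontal edge or to an
end of a vertical edge, which leaves at most 3n of them (`exists_injOn_topless`). This bounds the
cover. It also bounds the time: walks take at most n steps, only O(n) nodes start a walk, and a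
search for duplicates meets O(n) rectangles. A block is determined by its lower left cell, so there
are at most n² nodes; each horizontal edge is the top or the bottom of a block at its left end, so n
is at most twice the number of nodes, which gives the space bound.

The graph is built by computing the ranks and the extent of each wall in O(n²) steps and then
sweeping the grid row by row, remembering the block numbers of one row only. A first sweep counts
the blocks, a second one records neighbours and coordinates (`CellData.sweepProg_spec`). The
properties collected in `IsTiled` separate this geometry from the reasoning about the graph. -/

/-! ### Systems of horizontal and vertical edges -/

/-- A finite system of horizontal edges `[hl k, hr k] × {hy k}` and vertical edges
`{vx k} × [vb k, vt k]` that meet in common end points only, such that the two ways of counting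
crossings have the same parity. -/
structure EdgeSystem (ι α : Type) [Fintype ι] [LinearOrder α] where
  hy : ι → α
  hl : ι → α
  hr : ι → α
  vx : ι → α
  vb : ι → α
  vt : ι → α
  hl_lt : ∀ k, hl k < hr k
  vb_lt : ∀ k, vb k < vt k
  -- Edges are half-open, closed at the lower or left end, so the parity belongs to the quadrant
  -- just above and to the right of `(a, b)`; on the integer grid this is a unit cell.
  par_eq : ∀ a b, Odd (Finset.univ.filter fun m => vx m ≤ a ∧ vb m ≤ b ∧ b < vt m).card ↔
    Odd (Finset.univ.filter fun k => hy k ≤ b ∧ hl k ≤ a ∧ a < hr k).card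
  h_end_left : ∀ k, ∃ m, vx m = hl k ∧ (hy k = vb m ∨ hy k = vt m)
  h_end_right : ∀ k, ∃ m, vx m = hr k ∧ (hy k = vb m ∨ hy k = vt m)
  v_end_bottom : ∀ m, ∃ k, hy k = vb m ∧ (vx m = hl k ∨ vx m = hr k)
  v_end_top : ∀ m, ∃ k, hy k = vt m ∧ (vx m = hl k ∨ vx m = hr k)
  hh : ∀ k m, k ≠ m → hy k = hy m → hr k ≤ hl m ∨ hr m ≤ hl k
  vv : ∀ k m, k ≠ m → vx k = vx m → vt k ≤ vb m ∨ vt m ≤ vb k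
  hv : ∀ k m, hl k ≤ vx m → vx m ≤ hr k → vb m ≤ hy k → hy k ≤ vt m →
    (vx m = hl k ∨ vx m = hr k) ∧ (hy k = vb m ∨ hy k = vt m)

namespace EdgeSystem

variable {ι α : Type} [Fintype ι] [LinearOrder α]

/-- The reflection in the diagonal. -/
def swap (S : EdgeSystem ι α) : EdgeSystem ι α where
  hy := S.vx
  hl := S.vb
  hr := S.vt
  vx := S.hy
  vb := S.hl
  vt := S.hr
  hl_lt := S.vb_lt
  vb_lt := S.hl_lt
  par_eq := fun a b => (S.par_eq b a).symm
  h_end_left := S.v_end_bottom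
  h_end_right := S.v_end_top
  v_end_bottom := S.h_end_left
  v_end_top := S.h_end_right
  hh := S.vv
  vv := S.hh
  hv := fun k m h₁ h₂ h₃ h₄ => (S.hv m k h₃ h₄ h₁ h₂).symm

/-- The parity of the number of vertical edges to the left, at or just above height `b`. -/
def In (S : EdgeSystem ι α) (a b : α) : Prop :=
  Odd (Finset.univ.filter fun m => S.vx m ≤ a ∧ S.vb m ≤ b ∧ b < S.vt m).card

/-- `(a, b)` is a vertex. -/
def Vert (S : EdgeSystem ι α) (a b : α) : Prop := ∃ m, S.vx m = a ∧ (b = S.vb m ∨ b = S.vt m)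

/-- `(a, b)` lies on a horizontal edge. -/
def HHit (S : EdgeSystem ι α) (a b : α) : Prop := ∃ k, S.hy k = b ∧ S.hl k ≤ a ∧ a ≤ S.hr k

/-- `(a, b)` lies on a vertical edge. -/
def VHit (S : EdgeSystem ι α) (a b : α) : Prop := S.swap.HHit b a

/-- A vertical edge runs upwards from `(a, b)`. -/
def VE (S : EdgeSystem ι α) (a b : α) : Prop := ∃ m, S.vx m = a ∧ S.vb m ≤ b ∧ b < S.vt m

/-- A horizontal edge runs to the right from `(a, b)`. -/
def HE (S : EdgeSystem ι α) (a b : α) : Prop := S.swap.VE b a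

/-- A vertical wall runs upwards from `(a, b)`: a vertical edge, or its extension up to
the next horizontal edge. -/
def WV (S : EdgeSystem ι α) (a b : α) : Prop :=
  ∃ s, S.Vert a s ∧ ((s ≤ b ∧ ∀ t, s < t → t ≤ b → ¬ S.HHit a t) ∨
    (b < s ∧ ∀ t, b < t → t < s → ¬ S.HHit a t))

/-- A horizontal wall runs to the right from `(a, b)`. -/
def WH (S : EdgeSystem ι α) (a b : α) : Prop := S.swap.WV b a

variable (S : EdgeSystem ι α)

theorem in_swap {a b : α} : S.swap.In b a ↔ S.In a b := (S.par_eq a b).symm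

/-- Every end of a horizontal edge is an end of a vertical one and conversely, so the definition
through vertical edges is symmetric. This allows statements about vertical walls to be reused for
horizontal ones through `swap`. -/
theorem vert_swap {a b : α} : S.swap.Vert b a ↔ S.Vert a b := by
  constructor
  · rintro ⟨k, hk, h | h⟩
    · obtain ⟨m, h1, h2⟩ := S.h_end_left k
      exact ⟨m, h1.trans h.symm, by rw [← hk]; exact h2⟩
    · obtain ⟨m, h1, h2⟩ := S.h_end_right k
      exact ⟨m, h1.trans h.symm, by rw [← hk]; exact h2⟩
  · rintro ⟨k, hk, h | h⟩
    · obtain ⟨m, h1, h2⟩ := S.v_end_bottom k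
      exact ⟨m, h1.trans h.symm, by rw [← hk]; exact h2⟩
    · obtain ⟨m, h1, h2⟩ := S.v_end_top k
      exact ⟨m, h1.trans h.symm, by rw [← hk]; exact h2⟩

variable {S}

theorem Vert.hHit {a b : α} (h : S.Vert a b) : S.HHit a b := by
  obtain ⟨k, hk, h⟩ := S.vert_swap.2 h
  have := S.hl_lt k
  refine ⟨k, hk, ?_⟩
  rcases h with rfl | rfl
  · exact ⟨le_rfl, this.le⟩
  · exact ⟨this.le, le_rfl⟩

theorem Vert.vHit {a b : α} (h : S.Vert a b) : S.VHit a b := (S.vert_swap.2 h).hHit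

theorem Vert.wV {a b : α} (h : S.Vert a b) : S.WV a b :=
  ⟨b, h, Or.inl ⟨le_rfl, fun _ h1 h2 => absurd h1 h2.not_gt⟩⟩

theorem Vert.wH {a b : α} (h : S.Vert a b) : S.WH a b := (S.vert_swap.2 h).wV

theorem VE.vHit {a b : α} (h : S.VE a b) : S.VHit a b := by
  obtain ⟨m, h1, h2, h3⟩ := h
  exact ⟨m, h1, h2, h3.le⟩

/-- The wall starts at the lower end of the edge: by `hv`, horizontal edges meet a vertical edge in
its ends only. -/
theorem VE.wV {a b : α} (h : S.VE a b) : S.WV a b := by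
  obtain ⟨m, rfl, h2, h3⟩ := h
  refine ⟨S.vb m, ⟨m, rfl, Or.inl rfl⟩, Or.inl ⟨h2, ?_⟩⟩
  rintro t ht1 ht2 ⟨k, rfl, hk1, hk2⟩
  rcases (S.hv k m hk1 hk2 ht1.le (ht2.trans h3.le)).2 with h | h
  · exact ht1.ne' h
  · exact (ht2.trans_lt h3).ne h

theorem HE.wH {a b : α} (h : S.HE a b) : S.WH a b := VE.wV h

theorem HE.hHit {a b : α} (h : S.HE a b) : S.HHit a b := VE.vHit h

theorem VHit.vert_or {a b : α} (h : S.VHit a b) :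
    S.Vert a b ∨ ∃ m, S.vx m = a ∧ S.vb m < b ∧ b < S.vt m := by
  obtain ⟨m, h1, h2, h3⟩ := h
  change S.vx m = a at h1
  change S.vb m ≤ b at h2
  change b ≤ S.vt m at h3
  rcases h2.eq_or_lt with h | h
  · exact Or.inl ⟨m, h1, Or.inl h.symm⟩
  rcases h3.eq_or_lt with h' | h'
  · exact Or.inl ⟨m, h1, Or.inr h'⟩
  · exact Or.inr ⟨m, h1, h, h'⟩

theorem VHit.wV {a b : α} (h : S.VHit a b) : S.WV a b := by
  rcases h.vert_or with h | ⟨m, h1, h2, h3⟩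
  · exact h.wV
  · exact VE.wV ⟨m, h1, h2.le, h3⟩

theorem HHit.wH {a b : α} (h : S.HHit a b) : S.WH a b :=
  VHit.wV (S := S.swap) h

/-- Walls continue through points without horizontal edges. -/
theorem wV_iff_of_not_hHit {a b b' : α} (hb : b ≤ b')
    (h : ∀ t, b < t → t ≤ b' → ¬ S.HHit a t) : S.WV a b ↔ S.WV a b' := by
  constructor
  · rintro ⟨s, hs, ⟨h1, h2⟩ | ⟨h1, h2⟩⟩
    · refine ⟨s, hs, Or.inl ⟨h1.trans hb, fun t ht1 ht2 => ?_⟩⟩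
      rcases le_or_gt t b with h3 | h3
      exacts [h2 t ht1 h3, h t h3 ht2]
    · rcases le_or_gt s b' with h3 | h3
      · exact absurd hs.hHit (h s h1 h3)
      · exact ⟨s, hs, Or.inr ⟨h3, fun t ht1 ht2 => h2 t (hb.trans_lt ht1) ht2⟩⟩
  · rintro ⟨s, hs, ⟨h1, h2⟩ | ⟨h1, h2⟩⟩
    · rcases le_or_gt s b with h3 | h3
      · exact ⟨s, hs, Or.inl ⟨h3, fun t ht1 ht2 => h2 t ht1 (ht2.trans hb)⟩⟩
      · exact absurd hs.hHit (h s h3 h1)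
    · refine ⟨s, hs, Or.inr ⟨hb.trans_lt h1, fun t ht1 ht2 => ?_⟩⟩
      rcases le_or_gt t b' with h3 | h3
      exacts [h t ht1 h3, h2 t h3 ht2]

theorem wH_iff_of_not_vHit {a a' b : α} (ha : a ≤ a')
    (h : ∀ t, a < t → t ≤ a' → ¬ S.VHit t b) : S.WH a b ↔ S.WH a' b :=
  wV_iff_of_not_hHit (S := S.swap) ha h

/-! ### Parity along rows and columns -/

theorem in_iff_of_not_vE {a a' b : α} (ha : a ≤ a')
    (h : ∀ c, a < c → c ≤ a' → ¬ S.VE c b) : S.In a b ↔ S.In a' b := by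
  unfold In
  have : (Finset.univ.filter fun m => S.vx m ≤ a ∧ S.vb m ≤ b ∧ b < S.vt m) =
      Finset.univ.filter fun m => S.vx m ≤ a' ∧ S.vb m ≤ b ∧ b < S.vt m := by
    ext m
    simp only [Finset.mem_filter, Finset.mem_univ, true_and]
    constructor
    · rintro ⟨h1, h2⟩
      exact ⟨h1.trans ha, h2⟩
    · rintro ⟨h1, h2⟩
      refine ⟨?_, h2⟩
      by_contra h3
      exact h _ (not_le.1 h3) h1 ⟨m, rfl, h2⟩
  rw [this]

theorem in_iff_of_not_hE {a b b' : α} (hb : b ≤ b')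
    (h : ∀ c, b < c → c ≤ b' → ¬ S.HE a c) : S.In a b ↔ S.In a b' := by
  rw [← S.in_swap, ← S.in_swap]
  exact in_iff_of_not_vE hb h

/-- Edges on one line do not overlap by `vv`, so exactly one edge joins the count when the line of
`a'` is reached. -/
theorem in_iff_not_in_of_vE {a a' b : α} (ha : a < a')
    (h : ∀ c, a < c → c < a' → ¬ S.VE c b) (h' : S.VE a' b) : S.In a' b ↔ ¬ S.In a b := by
  classical
  obtain ⟨m, hm, h1, h2⟩ := h'
  unfold In
  have : (Finset.univ.filter fun m => S.vx m ≤ a' ∧ S.vb m ≤ b ∧ b < S.vt m) =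
      insert m (Finset.univ.filter fun m => S.vx m ≤ a ∧ S.vb m ≤ b ∧ b < S.vt m) := by
    ext k
    simp only [Finset.mem_filter, Finset.mem_univ, true_and, Finset.mem_insert]
    constructor
    · rintro ⟨h3, h4⟩
      by_contra h5
      push Not at h5
      obtain ⟨h5, h6⟩ := h5
      have h7 : a < S.vx k := by
        by_contra h8
        exact (h6 (not_lt.1 h8) h4.1).not_gt h4.2
      rcases h3.eq_or_lt with h8 | h8
      · rcases S.vv k m h5 (h8.trans hm.symm) with h9 | h9
        · exact (h9.trans h1).not_gt h4.2
        · exact (h9.trans h4.1).not_gt h2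
      · exact h _ h7 h8 ⟨k, rfl, h4⟩
    · rintro (rfl | ⟨h3, h4⟩)
      · exact ⟨hm.le, h1, h2⟩
      · exact ⟨h3.trans ha.le, h4⟩
  rw [this, Finset.card_insert_of_notMem, Nat.odd_add_one]
  simp [hm, ha]

theorem in_iff_not_in_of_hE {a b b' : α} (hb : b < b')
    (h : ∀ c, b < c → c < b' → ¬ S.HE a c) (h' : S.HE a b') : S.In a b' ↔ ¬ S.In a b := by
  rw [← S.in_swap, ← S.in_swap]
  exact in_iff_not_in_of_vE hb h h'

theorem In.exists_vE {a b : α} (h : S.In a b) : ∃ c ≤ a, S.VE c b := by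
  by_contra h'
  push Not at h'
  have : (Finset.univ.filter fun m => S.vx m ≤ a ∧ S.vb m ≤ b ∧ b < S.vt m) = ∅ := by
    ext m
    simp only [Finset.mem_filter, Finset.mem_univ, true_and, Finset.notMem_empty, iff_false]
    exact fun h2 => h' _ h2.1 ⟨m, rfl, h2.2⟩
  rw [In, this] at h
  simp at h

/-- The parity can also be computed from the horizontal edges, and no such edge extends beyond the
largest right end. So the parity has to change on the way there. -/
theorem In.exists_vE_gt {a b : α} (h : S.In a b) : ∃ c, a < c ∧ S.VE c b := by
  by_contra h'
  push Not at h'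
  obtain ⟨k, hk⟩ : ∃ k, ∀ m, S.hr m ≤ S.hr k := by
    obtain ⟨c, -, m, -⟩ := h.exists_vE
    have : Nonempty ι := ⟨m⟩
    exact Finite.exists_max S.hr
  have h1 : S.In (max a (S.hr k)) b := by
    rw [← in_iff_of_not_vE (le_max_left _ _)]
    · exact h
    · exact fun c hc _ => h' c hc
  rw [← in_swap, In] at h1
  have : (Finset.univ.filter fun m => S.swap.vx m ≤ b ∧ S.swap.vb m ≤ max a (S.hr k) ∧
      max a (S.hr k) < S.swap.vt m) = ∅ := by
    ext m
    simp only [Finset.mem_filter, Finset.mem_univ, true_and, Finset.notMem_empty, iff_false]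
    exact fun h2 => absurd (hk m) (not_le.2 ((le_max_right _ _).trans_lt h2.2.2))
  rw [this] at h1
  simp at h1

theorem In.exists_hE {a b : α} (h : S.In a b) : ∃ c ≤ b, S.HE a c :=
  In.exists_vE (S := S.swap) (S.in_swap.2 h)

theorem In.exists_hE_gt {a b : α} (h : S.In a b) : ∃ c, b < c ∧ S.HE a c :=
  In.exists_vE_gt (S := S.swap) (S.in_swap.2 h)

end EdgeSystem

/-! ### Blocks of cells -/

/-- A block of cells: the columns `l, …, r - 1` and the rows `b, …, t - 1`. -/
@[ext] structure Blk where
  l : ℕ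
  r : ℕ
  b : ℕ
  t : ℕ

/-- The block contains the cell in column `i` and row `j`. -/
def Blk.Has (β : Blk) (i j : ℕ) : Prop := β.l ≤ i ∧ i < β.r ∧ β.b ≤ j ∧ j < β.t

/-- The reflection in the diagonal. -/
def Blk.swap (β : Blk) : Blk := ⟨β.b, β.t, β.l, β.r⟩

theorem Nat.exists_greatest_le {P : ℕ → Prop} {c i : ℕ} (hc : c ≤ i) (h : P c) :
    ∃ l ≤ i, P l ∧ ∀ d, l < d → d ≤ i → ¬ P d := by
  classical
  exact ⟨Nat.findGreatest P i, Nat.findGreatest_le i, Nat.findGreatest_spec hc h,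
    fun d h1 h2 => Nat.findGreatest_is_greatest h1 h2⟩

theorem Nat.exists_least_gt {P : ℕ → Prop} {c i : ℕ} (hc : i < c) (h : P c) :
    ∃ l, i < l ∧ P l ∧ ∀ d, i < d → d < l → ¬ P d := by
  classical
  have h0 : ∃ l, i < l ∧ P l := ⟨c, hc, h⟩
  exact ⟨Nat.find h0, (Nat.find_spec h0).1, (Nat.find_spec h0).2,
    fun d h1 h2 h3 => Nat.find_min h0 h2 ⟨h1, h3⟩⟩

namespace EdgeSystem

variable {ι : Type} [Fintype ι] {S : EdgeSystem ι ℕ}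

/-- The block is a base rectangle: all cells are inside, there are no walls in its interior, and
there are walls all around. -/
structure IsBlock (S : EdgeSystem ι ℕ) (β : Blk) : Prop where
  lr : β.l < β.r
  bt : β.b < β.t
  inside : ∀ i j, β.Has i j → S.In i j
  no_wV : ∀ i j, β.Has i j → β.l < i → ¬ S.WV i j
  no_wH : ∀ i j, β.Has i j → β.b < j → ¬ S.WH i j
  left : ∀ j, β.b ≤ j → j < β.t → S.WV β.l j
  right : ∀ j, β.b ≤ j → j < β.t → S.WV β.r j
  bottom : ∀ i, β.l ≤ i → i < β.r → S.WH i β.b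
  top : ∀ i, β.l ≤ i → i < β.r → S.WH i β.t

theorem IsBlock.swap {β : Blk} (h : S.IsBlock β) : S.swap.IsBlock β.swap where
  lr := h.bt
  bt := h.lr
  inside := fun i j hij => S.in_swap.2 (h.inside j i ⟨hij.2.2.1, hij.2.2.2, hij.1, hij.2.1⟩)
  no_wV := fun i j hij => h.no_wH j i ⟨hij.2.2.1, hij.2.2.2, hij.1, hij.2.1⟩
  no_wH := fun i j hij => h.no_wV j i ⟨hij.2.2.1, hij.2.2.2, hij.1, hij.2.1⟩
  left := h.bottom
  right := h.top
  bottom := h.left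
  top := h.right

/-- Nothing lies strictly between `a` and `a + 1`, so an edge that only begins at `a + 1` still
covers the step from `a` by the prolongation of its left end. -/
theorem HHit.wH_pred {a b : ℕ} (h : S.HHit (a + 1) b) : S.WH a b := by
  obtain ⟨k, h1, h2, h3⟩ := h
  rcases Nat.lt_or_ge a (S.hl k) with h4 | h4
  · refine ⟨a + 1, S.vert_swap.2 ?_, Or.inr ⟨Nat.lt_succ_self a, fun t h5 h6 => by omega⟩⟩
    obtain ⟨m, h5, h6⟩ := S.h_end_left k
    exact ⟨m, by omega, by rwa [← h1]⟩
  · exact HE.wH ⟨k, h1, h4, show a < S.hr k by omega⟩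

theorem VHit.wV_pred {a b : ℕ} (h : S.VHit a (b + 1)) : S.WV a b :=
  HHit.wH_pred (S := S.swap) h

/-- Walls at two consecutive rows of cells that are not separated by a horizontal wall. -/
theorem wall_step {l r i s : ℕ} (hli : l ≤ i) (hir : i < r)
    (hv : ∀ c, l < c → c < r → ¬ S.VHit c (s + 1)) (hi : ¬ S.WH i (s + 1)) :
    (∀ a, l ≤ a → a < r → ¬ S.WH a (s + 1)) ∧
      ∀ a, l ≤ a → a ≤ r → (S.WV a s ↔ S.WV a (s + 1)) := by
  have h1 : ∀ a, l ≤ a → a < r → ¬ S.WH a (s + 1) := by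
    intro a h2 h3 h4
    apply hi
    rcases le_total a i with h5 | h5
    · exact (wH_iff_of_not_vHit h5 fun t h6 h7 => hv t (by omega) (by omega)).1 h4
    · exact (wH_iff_of_not_vHit h5 fun t h6 h7 => hv t (by omega) (by omega)).2 h4
  refine ⟨h1, fun a h2 h3 => wV_iff_of_not_hHit (Nat.le_succ s) fun t h4 h5 h6 => ?_⟩
  obtain rfl : t = s + 1 := by omega
  -- On the right border of the strip a horizontal edge is seen from the last column, `r - 1`.
  rcases h3.eq_or_lt with rfl | h7
  · obtain ⟨a, rfl⟩ : ∃ a', a = a' + 1 := ⟨a - 1, by omega⟩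
    exact h1 a (by omega) (by omega) h6.wH_pred
  · exact h1 a h2 h7 h6.wH

/-- Every cell inside lies in a block. -/
theorem In.exists_block {i j : ℕ} (h : S.In i j) : ∃ β, S.IsBlock β ∧ β.Has i j := by
  obtain ⟨c, hc, hc'⟩ := h.exists_vE
  obtain ⟨l, hl, hlw, hl'⟩ := Nat.exists_greatest_le (P := fun a => S.WV a j) hc hc'.wV
  obtain ⟨c, hc, hc'⟩ := h.exists_vE_gt
  obtain ⟨r, hr, hrw, hr'⟩ := Nat.exists_least_gt (P := fun a => S.WV a j) hc hc'.wV
  obtain ⟨c, hc, hc'⟩ := h.exists_hE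
  obtain ⟨b, hb, hbw, hb'⟩ := Nat.exists_greatest_le (P := fun a => S.WH i a) hc hc'.wH
  obtain ⟨c, hc, hc'⟩ := h.exists_hE_gt
  obtain ⟨t, ht, htw, ht'⟩ := Nat.exists_least_gt (P := fun a => S.WH i a) hc hc'.wH
  have row : ∀ a, l < a → a < r → ¬ S.WV a j := by
    intro a h1 h2
    rcases le_or_gt a i with h3 | h3
    exacts [hl' a h1 h3, hr' a h3 h2]
  -- `l`, `r`, `b`, `t` are the nearest walls around the cell in its own row and column. The pattern
  -- of vertical walls in row `j` is carried from row to row by `wall_step`, which also excludes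
  -- horizontal walls anywhere in the strip before `t`.
  have up : ∀ s, j ≤ s → s < t → (∀ a, l ≤ a → a ≤ r → (S.WV a j ↔ S.WV a s)) ∧
      (j < s → ∀ a, l ≤ a → a < r → ¬ S.WH a s) := by
    intro s hs
    induction s, hs using Nat.le_induction with
    | base => exact fun _ => ⟨fun _ _ _ => Iff.rfl, fun h => absurd h (lt_irrefl _)⟩
    | succ s hs ih =>
      intro hst
      obtain ⟨ih1, -⟩ := ih (by omega)
      obtain ⟨h1, h2⟩ := wall_step (S := S) (s := s) hl hr
        (fun c h1 h2 h3 => row c h1 h2 ((ih1 c h1.le h2.le).2 h3.wV_pred))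
        (ht' _ (by omega) hst)
      exact ⟨fun a h3 h4 => (ih1 a h3 h4).trans (h2 a h3 h4), fun _ => h1⟩
  -- Downwards, the row `j - k` may itself lie on the bottom wall; hence the second claim is made
  -- only while `b + k < j`.
  have down : ∀ k, b + k ≤ j → (∀ a, l ≤ a → a ≤ r → (S.WV a j ↔ S.WV a (j - k))) ∧
      (b + k < j → ∀ a, l ≤ a → a < r → ¬ S.WH a (j - k)) := by
    intro k
    have key : ∀ k, b + k < j → (∀ a, l ≤ a → a ≤ r → (S.WV a j ↔ S.WV a (j - k))) →
        (∀ a, l ≤ a → a < r → ¬ S.WH a (j - k)) ∧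
        ∀ a, l ≤ a → a ≤ r → (S.WV a j ↔ S.WV a (j - (k + 1))) := by
      intro k hk ih
      obtain ⟨s, hs⟩ : ∃ s, j - k = s + 1 := ⟨j - k - 1, by omega⟩
      have hs' : j - (k + 1) = s := by omega
      rw [hs] at ih ⊢
      rw [hs']
      obtain ⟨h1, h2⟩ := wall_step (S := S) (s := s) hl hr
        (fun c h1 h2 h3 => row c h1 h2 ((ih c h1.le h2.le).2 h3.wV))
        (hb' _ (by omega) (by omega))
      exact ⟨h1, fun a h3 h4 => (ih a h3 h4).trans (h2 a h3 h4).symm⟩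
    have first : b + k ≤ j → ∀ a, l ≤ a → a ≤ r → (S.WV a j ↔ S.WV a (j - k)) := by
      induction k with
      | zero => exact fun _ _ _ _ => Iff.rfl
      | succ k ih => exact fun hk => (key k (by omega) (ih (by omega))).2
    exact fun hk => ⟨first hk, fun hk' => (key k hk' (first hk)).1⟩
  have rows : ∀ s, b ≤ s → s < t → ∀ a, l ≤ a → a ≤ r → (S.WV a j ↔ S.WV a s) := by
    intro s h1 h2
    rcases le_total j s with h3 | h3
    · exact (up s h3 h2).1
    · have := (down (j - s) (by omega)).1
      rwa [Nat.sub_sub_self h3] at this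
  have cols : ∀ s, b < s → s < t → ∀ a, l ≤ a → a < r → ¬ S.WH a s := by
    intro s h1 h2
    rcases lt_or_ge j s with h3 | h3
    · exact (up s h3.le h2).2 h3
    · have := (down (j - s) (by omega)).2 (by omega)
      rwa [Nat.sub_sub_self h3] at this
  have nowV : ∀ a s, b ≤ s → s < t → l < a → a < r → ¬ S.WV a s :=
    fun a s h1 h2 h3 h4 h5 => row a h3 h4 ((rows s h1 h2 a h3.le h4.le).2 h5)
  refine ⟨⟨l, r, b, t⟩, ⟨by simp only; omega, by simp only; omega, ?_, ?_, ?_, ?_, ?_, ?_, ?_⟩,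
    hl, hr, hb, ht⟩
  · rintro a s ⟨h1, h2, h3, h4⟩
    simp only at h1 h2 h3 h4
    have h5 : S.In a j := by
      rcases le_total a i with h6 | h6
      · exact (in_iff_of_not_vE h6 fun c h7 h8 h9 => row c (by omega) (by omega) h9.wV).2 h
      · exact (in_iff_of_not_vE h6 fun c h7 h8 h9 => row c (by omega) (by omega) h9.wV).1 h
    rcases le_total s j with h6 | h6
    · exact (in_iff_of_not_hE h6 fun c h7 h8 h9 =>
        cols c (by omega) (by omega) a h1 h2 h9.wH).2 h5
    · exact (in_iff_of_not_hE h6 fun c h7 h8 h9 =>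
        cols c (by omega) (by omega) a h1 h2 h9.wH).1 h5
  · rintro a s ⟨h1, h2, h3, h4⟩ h5
    exact nowV a s h3 h4 h5 h2
  · rintro a s ⟨h1, h2, h3, h4⟩ h5
    exact cols s h5 h4 a h1 h2
  · exact fun s h1 h2 => (rows s h1 h2 l le_rfl (by omega)).1 hlw
  · exact fun s h1 h2 => (rows s h1 h2 r (by omega) le_rfl).1 hrw
  · intro a h1 h2
    simp only at h1 h2 ⊢
    have h0 : ∀ c, l < c → c < r → ¬ S.VHit c b :=
      fun c h3 h4 h5 => nowV c b le_rfl (by omega) h3 h4 h5.wV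
    rcases le_total a i with h6 | h6
    · exact (wH_iff_of_not_vHit h6 fun c h7 h8 => h0 c (by omega) (by omega)).2 hbw
    · exact (wH_iff_of_not_vHit h6 fun c h7 h8 => h0 c (by omega) (by omega)).1 hbw
  · intro a h1 h2
    simp only at h1 h2 ⊢
    have h0 : ∀ c, l < c → c < r → ¬ S.VHit c t := by
      intro c h3 h4 h5
      obtain ⟨t, rfl⟩ : ∃ t', t = t' + 1 := ⟨t - 1, by omega⟩
      exact nowV c t (by omega) (by omega) h3 h4 h5.wV_pred
    rcases le_total a i with h6 | h6
    · exact (wH_iff_of_not_vHit h6 fun c h7 h8 => h0 c (by omega) (by omega)).2 htw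
    · exact (wH_iff_of_not_vHit h6 fun c h7 h8 => h0 c (by omega) (by omega)).1 htw

/-- A side of one block is a wall, which cannot cut the other block in the row or column of the
common cell; so neither block extends beyond the other. -/
theorem IsBlock.ext_of_has {β γ : Blk} (hβ : S.IsBlock β) (hγ : S.IsBlock γ) {i j : ℕ}
    (h : β.Has i j) (h' : γ.Has i j) : β = γ := by
  have key : ∀ {T : EdgeSystem ι ℕ} {β γ : Blk} {i j : ℕ}, T.IsBlock β → T.IsBlock γ →
      β.Has i j → γ.Has i j → β.l ≤ γ.l ∧ β.r ≤ γ.r := by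
    intro T β γ i j hβ hγ ⟨h1, h2, h3, h4⟩ ⟨h5, h6, h7, h8⟩
    constructor
    · by_contra h
      exact hγ.no_wV β.l j ⟨by omega, by omega, h7, h8⟩ (by omega) (hβ.left j h3 h4)
    · by_contra h
      exact hβ.no_wV γ.r j ⟨by omega, by omega, h3, h4⟩ (by omega) (hγ.right j h7 h8)
  have h1 := key hβ hγ h h'
  have h2 := key hγ hβ h' h
  have hs : β.swap.Has j i := ⟨h.2.2.1, h.2.2.2, h.1, h.2.1⟩
  have hs' : γ.swap.Has j i := ⟨h'.2.2.1, h'.2.2.2, h'.1, h'.2.1⟩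
  have h3 := key hβ.swap hγ.swap hs hs'
  have h4 := key hγ.swap hβ.swap hs' hs
  simp only [Blk.swap] at h3 h4
  ext <;> omega

/-- A horizontal wall is stopped on the line between two columns by a vertical edge only. Where no
horizontal edge is met, this is an interior point of that edge, which then also separates the two
cells in row `x` and makes their parities differ. -/
theorem wH_iff_of_in {a t x : ℕ} (hx : x = t ∨ x + 1 = t) (ht : ¬ S.HHit (a + 1) t)
    (h1 : S.In a x) (h2 : S.In (a + 1) x) : S.WH a t ↔ S.WH (a + 1) t := by
  refine wH_iff_of_not_vHit (Nat.le_succ a) fun c h3 h4 h5 => ?_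
  obtain rfl : c = a + 1 := by omega
  rcases h5.vert_or with h6 | ⟨m, h6, h7, h8⟩
  · exact ht h6.hHit
  · exact (in_iff_not_in_of_vE (Nat.lt_succ_self a) (fun c _ _ => by omega)
      ⟨m, h6, by omega, by omega⟩).1 h2 h1

/-- Blocks that share a part of a vertical side share all of it. -/
theorem IsBlock.side_eq {β γ : Blk} (hβ : S.IsBlock β) (hγ : S.IsBlock γ) {j : ℕ}
    (h : β.r = γ.l) (h1 : β.b ≤ j) (h2 : j < β.t) (h3 : γ.b ≤ j) (h4 : j < γ.t) :
    β.b = γ.b ∧ β.t = γ.t := by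
  have hlr := hβ.lr
  have hlr' := hγ.lr
  obtain ⟨a, ha⟩ : ∃ a, β.r = a + 1 := ⟨β.r - 1, by omega⟩
  have inβ : ∀ x, β.b ≤ x → x < β.t → S.In a x :=
    fun x h5 h6 => hβ.inside a x ⟨by omega, by omega, h5, h6⟩
  have inγ : ∀ x, γ.b ≤ x → x < γ.t → S.In (a + 1) x :=
    fun x h5 h6 => hγ.inside _ x ⟨by omega, by omega, h5, h6⟩
  have noβ : ∀ x, β.b < x → x < β.t → ¬ S.WH a x :=
    fun x h5 h6 => hβ.no_wH a x ⟨by omega, by omega, h5.le, h6⟩ h5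
  have noγ : ∀ x, γ.b < x → x < γ.t → ¬ S.WH (a + 1) x :=
    fun x h5 h6 => hγ.no_wH _ x ⟨by omega, by omega, h5.le, h6⟩ h5
  have b1 := hβ.bottom a (by omega) (by omega)
  have t1 := hβ.top a (by omega) (by omega)
  have b2 := hγ.bottom (a + 1) (by omega) (by omega)
  have t2 := hγ.top (a + 1) (by omega) (by omega)
  constructor
  -- The higher one of two different bottom walls would continue across the common side into the
  -- other block.
  · rcases lt_trichotomy β.b γ.b with h5 | h5 | h5
    · have h6 := noβ γ.b h5 (by omega)
      exact absurd ((wH_iff_of_in (Or.inl rfl) (fun h7 => h6 h7.wH_pred)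
        (inβ _ (by omega) (by omega)) (inγ _ (by omega) (by omega))).2 b2) h6
    · exact h5
    · have h6 := noγ β.b h5 (by omega)
      exact absurd ((wH_iff_of_in (Or.inl rfl) (fun h7 => h6 h7.wH)
        (inβ _ (by omega) (by omega)) (inγ _ (by omega) (by omega))).1 b1) h6
  · rcases lt_trichotomy β.t γ.t with h5 | h5 | h5
    · have h6 := noγ β.t (by omega) h5
      exact absurd ((wH_iff_of_in (x := β.t - 1) (by omega) (fun h7 => h6 h7.wH)
        (inβ _ (by omega) (by omega)) (inγ _ (by omega) (by omega))).1 t1) h6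
    · exact h5
    · have h6 := noβ γ.t (by omega) h5
      exact absurd ((wH_iff_of_in (x := γ.t - 1) (by omega) (fun h7 => h6 h7.wH_pred)
        (inβ _ (by omega) (by omega)) (inγ _ (by omega) (by omega))).2 t2) h6

theorem IsBlock.l_eq_of_wV {β : Blk} (hβ : S.IsBlock β) {i j : ℕ} (h : β.Has i j)
    (hw : S.WV i j) : β.l = i := by
  by_contra h1
  exact hβ.no_wV i j h (lt_of_le_of_ne h.1 h1) hw

theorem IsBlock.b_eq_of_wH {β : Blk} (hβ : S.IsBlock β) {i j : ℕ} (h : β.Has i j)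
    (hw : S.WH i j) : β.b = j := by
  by_contra h1
  exact hβ.no_wH i j h (lt_of_le_of_ne h.2.2.1 h1) hw

theorem IsBlock.r_eq_of_wV {β : Blk} (hβ : S.IsBlock β) {i j : ℕ} (h : β.Has i j)
    (hw : S.WV (i + 1) j) : β.r = i + 1 := by
  by_contra h1
  obtain ⟨h2, h3, h4, h5⟩ := h
  exact hβ.no_wV (i + 1) j ⟨by omega, by omega, h4, h5⟩ (by omega) hw

theorem IsBlock.t_eq_of_wH {β : Blk} (hβ : S.IsBlock β) {i j : ℕ} (h : β.Has i j)
    (hw : S.WH i (j + 1)) : β.t = j + 1 := by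
  by_contra h1
  obtain ⟨h2, h3, h4, h5⟩ := h
  exact hβ.no_wH i (j + 1) ⟨by omega, by omega, by omega, by omega⟩ (by omega) hw

/-- The blocks whose top side lies on the boundary are few. -/
theorem exists_injOn_topless [Nonempty ι] (S : EdgeSystem ι ℕ) : ∃ f : Blk → ι ⊕ ι ⊕ ι,
    Set.InjOn f {β | S.IsBlock β ∧ ¬ S.In β.l β.t} := by
  classical
  -- The top left corner is charged to the horizontal edge that starts there, or else to the lower
  -- or upper end of the vertical edge from which the left wall comes up; the corner is then the
  -- first point above this end on a horizontal edge. A charge determines the corner and so the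
  -- block.
  have key : ∀ β, S.IsBlock β ∧ ¬ S.In β.l β.t → ∃ x : ι ⊕ ι ⊕ ι, S.HHit β.l β.t ∧
      Sum.elim (fun k => S.hl k = β.l ∧ S.hy k = β.t)
        (Sum.elim
          (fun m => S.vx m = β.l ∧ S.vb m < β.t ∧ ∀ t, S.vb m < t → t < β.t → ¬ S.HHit β.l t)
          (fun m => S.vx m = β.l ∧ S.vt m < β.t ∧ ∀ t, S.vt m < t → t < β.t → ¬ S.HHit β.l t))
        x := by
    rintro β ⟨hβ, hin⟩
    have h1 := hβ.lr
    have h2 := hβ.bt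
    obtain ⟨t, ht⟩ : ∃ t, β.t = t + 1 := ⟨β.t - 1, by omega⟩
    have h3 : S.In β.l t := hβ.inside _ _ ⟨le_rfl, h1, by omega, by omega⟩
    have h4 : S.HE β.l β.t := by
      by_contra h5
      refine hin ((in_iff_of_not_hE (b := t) (by omega) fun c h6 h7 => ?_).1 h3)
      obtain rfl : c = β.t := by omega
      exact h5
    obtain ⟨k, hk, h5, h6⟩ := id h4
    change S.hy k = β.t at hk
    change S.hl k ≤ β.l at h5
    change β.l < S.hr k at h6
    rcases h5.eq_or_lt with h7 | h7
    · exact ⟨Sum.inl k, h4.hHit, h7, hk⟩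
    · obtain ⟨s, ⟨m, hm, hs⟩, ⟨h8, h9⟩ | ⟨h8, h9⟩⟩ := hβ.left t (by omega) (by omega)
      · rcases hs with rfl | rfl
        · exact ⟨Sum.inr (Sum.inl m), h4.hHit, hm, by omega,
            fun t h10 h11 => h9 t h10 (by omega)⟩
        · exact ⟨Sum.inr (Sum.inr m), h4.hHit, hm, by omega,
            fun t h10 h11 => h9 t h10 (by omega)⟩
      -- A left wall coming down from a vertex above would cross the horizontal edge on top, or meet
      -- it in a vertex that is not one of its ends.
      · exfalso
        rcases Nat.lt_or_ge β.t s with h10 | h10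
        · exact h9 β.t (by omega) h10 h4.hHit
        · obtain rfl : s = β.t := by omega
          have := (S.hv k m (by omega) (by omega) (by have := S.vb_lt m; omega)
            (by have := S.vb_lt m; omega)).1
          omega
  choose! f hf using key
  refine ⟨f, fun β hβ γ hγ hfe => ?_⟩
  obtain ⟨hitβ, h1⟩ := hf β hβ
  obtain ⟨hitγ, h2⟩ := hf γ hγ
  have hlt : β.l = γ.l ∧ β.t = γ.t := by
    rw [hfe] at h1
    rcases h : f γ with k | m | m <;> rw [h] at h1 h2 <;> simp only [Sum.elim_inl, Sum.elim_inr] at h1 h2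
    · omega
    all_goals
      refine ⟨by omega, ?_⟩
      have hl : β.l = γ.l := by omega
      rcases lt_trichotomy β.t γ.t with h3 | h3 | h3
      · exact absurd (hl ▸ hitβ) (h2.2.2 _ h1.2.1 h3)
      · exact h3
      · exact absurd (hl ▸ hitγ) (h1.2.2 _ h2.2.1 h3)
  have b1 := hβ.1.lr
  have b2 := hβ.1.bt
  have g1 := hγ.1.lr
  have g2 := hγ.1.bt
  exact hβ.1.ext_of_has hγ.1 (i := β.l) (j := β.t - 1)
    ⟨by omega, by omega, by omega, by omega⟩ ⟨by omega, by omega, by omega, by omega⟩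

/-- Every horizontal edge is the bottom or top side of a block at its left end. -/
theorem exists_injective_block (S : EdgeSystem ι ℕ) (hpos : ∀ k, 0 < S.hy k) :
    ∃ f : ι → Blk × Bool, Function.Injective f ∧ ∀ k, S.IsBlock (f k).1 := by
  have key : ∀ k, ∃ x : Blk × Bool, S.IsBlock x.1 ∧ x.1.l = S.hl k ∧
      cond x.2 x.1.b x.1.t = S.hy k := by
    intro k
    have hv : S.Vert (S.hl k) (S.hy k) := by
      obtain ⟨m, h1, h2⟩ := S.h_end_left k
      exact ⟨m, h1, h2⟩
    have hE : S.HE (S.hl k) (S.hy k) := ⟨k, rfl, le_rfl, S.hl_lt k⟩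
    obtain ⟨y, hy⟩ : ∃ y, S.hy k = y + 1 := ⟨S.hy k - 1, by have := hpos k; omega⟩
    rw [hy] at hv hE ⊢
    -- The edge separates the cells above and below it at its left end, so exactly one of them is
    -- inside; the flag records which. Two edges with the same block and flag would overlap,
    -- contrary to `hh`.
    by_cases hin : S.In (S.hl k) (y + 1)
    · obtain ⟨β, hβ, h⟩ := hin.exists_block
      exact ⟨(β, true), hβ, hβ.l_eq_of_wV h hv.wV, hβ.b_eq_of_wH h hv.wH⟩
    · have h1 : S.In (S.hl k) y := by
        by_contra h2
        exact hin ((in_iff_not_in_of_hE (Nat.lt_succ_self y) (fun c _ _ => by omega) hE).2 h2)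
      obtain ⟨β, hβ, h⟩ := h1.exists_block
      exact ⟨(β, false), hβ, hβ.l_eq_of_wV h hv.vHit.wV_pred, hβ.t_eq_of_wH h hv.wH⟩
  choose f h1 h2 h3 using key
  refine ⟨f, fun k m hkm => ?_, h1⟩
  have h4 := h2 k
  have h5 := h3 k
  rw [hkm] at h4 h5
  by_contra h6
  have h7 := S.hh k m h6 (h5.symm.trans (h3 m))
  have h8 := h2 m
  have := S.hl_lt k
  have := S.hl_lt m
  omega

end EdgeSystem

namespace EdgeSystem

variable {ι : Type} [Fintype ι]

/-! ### Edge systems in the plane -/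

section Plane

variable {α : Type} [LinearOrder α]

/-- `(a, b)` lies on an edge. -/
def Bd (S : EdgeSystem ι α) (a b : α) : Prop := S.HHit a b ∨ S.VHit a b

/-- `(a, b)` is an inner point. -/
def Inn (S : EdgeSystem ι α) (a b : α) : Prop := ¬ S.Bd a b ∧ S.In a b

variable {S : EdgeSystem ι α}

theorem bd_swap {a b : α} : S.swap.Bd b a ↔ S.Bd a b := or_comm

theorem inn_swap {a b : α} : S.swap.Inn b a ↔ S.Inn a b := by
  rw [Inn, Inn, bd_swap, in_swap]

end Plane

variable {S : EdgeSystem ι ℝ}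

theorem exists_gap_family (f : ι → ℝ) (t : ℝ) :
    ∀ᶠ ε in nhdsWithin (0 : ℝ) (Set.Ioi 0), ∀ k, |f k - t| < ε → f k = t := by
  rw [Filter.eventually_all]
  intro k
  by_cases h : f k = t
  · exact Filter.Eventually.of_forall fun _ _ => h
  · have h1 : 0 < |f k - t| := abs_pos.2 (sub_ne_zero.2 h)
    filter_upwards [Ioo_mem_nhdsGT h1] with ε hε h2
    exact absurd h2 hε.2.not_gt

/-- A distance below which all coordinates of edges agree with those of the given point. -/
theorem exists_gap (S : EdgeSystem ι ℝ) (a b : ℝ) : ∃ ε > (0 : ℝ), ∀ k,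
    (|S.vx k - a| < ε → S.vx k = a) ∧ (|S.hl k - a| < ε → S.hl k = a) ∧
    (|S.hr k - a| < ε → S.hr k = a) ∧ (|S.hy k - b| < ε → S.hy k = b) ∧
    (|S.vb k - b| < ε → S.vb k = b) ∧ (|S.vt k - b| < ε → S.vt k = b) := by
  have h0 : ∀ᶠ ε in nhdsWithin (0 : ℝ) (Set.Ioi 0), 0 < ε := self_mem_nhdsWithin
  obtain ⟨ε, h0, h1, h2, h3, h4, h5, h6⟩ := (h0.and
    ((exists_gap_family S.vx a).and ((exists_gap_family S.hl a).and
    ((exists_gap_family S.hr a).and ((exists_gap_family S.hy b).and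
    ((exists_gap_family S.vb b).and (exists_gap_family S.vt b))))))).exists
  exact ⟨ε, h0, fun k => ⟨h1 k, h2 k, h3 k, h4 k, h5 k, h6 k⟩⟩

/-- Off the edges, being inside is locally constant. -/
theorem locally_constant {a b : ℝ} (h : ¬ S.Bd a b) : ∃ ε > (0 : ℝ), ∀ x y,
    |x - a| < ε → |y - b| < ε → ¬ S.Bd x y ∧ (S.In x y ↔ S.In a b) := by
  obtain ⟨ε, hε, hg⟩ := S.exists_gap a b
  -- Below the gap, a weak comparison of an edge coordinate with the nearby point also holds at the
  -- centre. So an edge meeting the neighbourhood would already pass through `(a, b)`.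
  have le1 : ∀ c x t : ℝ, (|c - t| < ε → c = t) → |x - t| < ε → c ≤ x → c ≤ t := by
    intro c x t h1 h2 h3
    by_contra h4
    rw [abs_lt] at h2
    exact h4 (h1 (by rw [abs_lt]; constructor <;> linarith)).le
  have le2 : ∀ c x t : ℝ, (|c - t| < ε → c = t) → |x - t| < ε → x ≤ c → t ≤ c := by
    intro c x t h1 h2 h3
    by_contra h4
    rw [abs_lt] at h2
    exact h4 (h1 (by rw [abs_lt]; constructor <;> linarith)).ge
  have hvE : ∀ y, |y - b| < ε → ∀ c, |c - a| < ε → ¬ S.VHit c y := by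
    rintro y hy c hc ⟨k, h1, h2, h3⟩
    obtain ⟨g1, g2, g3, g4, g5, g6⟩ := hg k
    change S.vx k = c at h1
    change S.vb k ≤ y at h2
    change y ≤ S.vt k at h3
    exact h (Or.inr ⟨k, g1 (h1 ▸ hc), le1 _ _ _ g5 hy h2, le2 _ _ _ g6 hy h3⟩)
  have hhE : ∀ x, |x - a| < ε → ∀ c, |c - b| < ε → ¬ S.HHit x c := by
    rintro x hx c hc ⟨k, h1, h2, h3⟩
    obtain ⟨g1, g2, g3, g4, g5, g6⟩ := hg k
    exact h (Or.inl ⟨k, g4 (h1 ▸ hc), le1 _ _ _ g2 hx h2, le2 _ _ _ g3 hx h3⟩)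
  refine ⟨ε, hε, fun x y hx hy => ⟨?_, ?_⟩⟩
  · rintro (h1 | h1)
    exacts [hhE x hx y hy h1, hvE y hy x hx h1]
  · have e1 : S.In x y ↔ S.In a y := by
      rcases le_total x a with h1 | h1
      · refine in_iff_of_not_vE h1 fun c h2 h3 h4 => hvE y hy c ?_ h4.vHit
        rw [abs_lt] at hx ⊢
        constructor <;> linarith
      · refine (in_iff_of_not_vE h1 fun c h2 h3 h4 => hvE y hy c ?_ h4.vHit).symm
        rw [abs_lt] at hx ⊢
        constructor <;> linarith
    have e2 : S.In a y ↔ S.In a b := by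
      have h0 : |a - a| < ε := by simpa using hε
      rcases le_total y b with h1 | h1
      · refine in_iff_of_not_hE h1 fun c h2 h3 h4 => hhE a h0 c ?_ h4.hHit
        rw [abs_lt] at hy ⊢
        constructor <;> linarith
      · refine (in_iff_of_not_hE h1 fun c h2 h3 h4 => hhE a h0 c ?_ h4.hHit).symm
        rw [abs_lt] at hy ⊢
        constructor <;> linarith
    exact e1.trans e2

/-- A short move along the edge leaves all vertical lines of the system, and short moves up and down
from there cross this edge and no other. So exactly one of the two points is inside. -/
theorem exists_both_sides_of_hHit {a b : ℝ} (h : S.HHit a b) {δ : ℝ} (hδ : 0 < δ) :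
    ∃ x y z, |x - a| < δ ∧ |y - b| < δ ∧ |z - b| < δ ∧ S.Inn x y ∧ ¬ S.Bd x z ∧ ¬ S.In x z := by
  obtain ⟨ε, hε, hg⟩ := S.exists_gap a b
  obtain ⟨k, rfl, h1, h2⟩ := h
  obtain ⟨e, he0, he⟩ := exists_between (lt_min hε hδ)
  have he1 := he.trans_le (min_le_left _ _)
  have he2 := he.trans_le (min_le_right _ _)
  obtain ⟨x, hx, hl, hr⟩ : ∃ x, |x - a| = e ∧ S.hl k < x ∧ x < S.hr k := by
    rcases h2.eq_or_lt with h3 | h3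
    · refine ⟨a - e, by simp [abs_of_pos he0], ?_, by linarith⟩
      by_contra h4
      have h5 := (hg k).2.1 (by rw [abs_lt]; constructor <;> linarith)
      have := S.hl_lt k
      linarith
    · refine ⟨a + e, by simp [abs_of_pos he0], by linarith, ?_⟩
      by_contra h4
      have h5 := (hg k).2.2.1 (by rw [abs_lt]; constructor <;> linarith)
      linarith
  have hnb : ∀ y, |y - S.hy k| = e → ¬ S.Bd x y := by
    rintro y hy (⟨m, h3, -⟩ | ⟨m, h3, -⟩)
    · have h4 := (hg m).2.2.2.1 (by rw [h3, hy]; exact he1)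
      rw [h3] at h4
      simp [h4] at hy
      linarith
    · change S.vx m = x at h3
      have h4 := (hg m).1 (by rw [h3, hx]; exact he1)
      rw [h3] at h4
      simp [h4] at hx
      linarith
  have u : |S.hy k + e - S.hy k| = e := by simp [abs_of_pos he0]
  have d : |S.hy k - e - S.hy k| = e := by simp [abs_of_pos he0]
  have e1 : S.In x (S.hy k) ↔ S.In x (S.hy k + e) := by
    refine in_iff_of_not_hE (by linarith) ?_
    rintro c h3 h4 ⟨m, h5, -⟩
    change S.hy m = c at h5
    have h6 := (hg m).2.2.2.1 (by rw [abs_lt]; constructor <;> linarith)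
    linarith
  have e2 : S.In x (S.hy k) ↔ ¬ S.In x (S.hy k - e) := by
    refine in_iff_not_in_of_hE (by linarith) ?_ ⟨k, rfl, hl.le, hr⟩
    rintro c h3 h4 ⟨m, h5, -⟩
    change S.hy m = c at h5
    have h6 := (hg m).2.2.2.1 (by rw [abs_lt]; constructor <;> linarith)
    linarith
  by_cases h3 : S.In x (S.hy k)
  · exact ⟨x, S.hy k + e, S.hy k - e, hx.trans_lt he2, u.trans_lt he2, d.trans_lt he2, ⟨hnb _ u, e1.1 h3⟩, hnb _ d,
      e2.1 h3⟩
  · exact ⟨x, S.hy k - e, S.hy k + e, hx.trans_lt he2, d.trans_lt he2, u.trans_lt he2,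
      ⟨hnb _ d, by by_contra h4; exact h3 (e2.2 h4)⟩, hnb _ u, fun h4 => h3 (e1.2 h4)⟩

/-- Every point of an edge is a limit of inner points and of outer points. -/
theorem exists_both_sides {a b : ℝ} (h : S.Bd a b) {δ : ℝ} (hδ : 0 < δ) :
    (∃ x y, |x - a| < δ ∧ |y - b| < δ ∧ S.Inn x y) ∧
    ∃ x y, |x - a| < δ ∧ |y - b| < δ ∧ ¬ S.Bd x y ∧ ¬ S.In x y := by
  rcases h with h | h
  · obtain ⟨x, y, z, h1, h2, h3, h4, h5⟩ := exists_both_sides_of_hHit h hδ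
    exact ⟨⟨x, y, h1, h2, h4⟩, ⟨x, z, h1, h3, h5⟩⟩
  · obtain ⟨x, y, z, h1, h2, h3, h4, h5, h6⟩ := exists_both_sides_of_hHit h hδ
    exact ⟨⟨y, x, h2, h1, inn_swap.1 h4⟩,
      ⟨z, x, h3, h1, fun h => h5 (bd_swap.2 h), fun h => h6 (S.in_swap.2 h)⟩⟩

/-! ### Ranks of coordinates -/

/-- The number of vertical edges that are not to the right of `t`. -/
noncomputable def rankX (S : EdgeSystem ι ℝ) (t : ℝ) : ℕ :=
  (Finset.univ.filter fun l => S.vx l ≤ t).card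

/-- The number of horizontal edges that are not above `t`. -/
noncomputable def rankY (S : EdgeSystem ι ℝ) (t : ℝ) : ℕ := S.swap.rankX t

theorem rankX_mono : Monotone S.rankX := fun _ _ h => Finset.card_le_card
  (Finset.monotone_filter_right _ fun _ _ h1 => le_trans h1 h)

/-- Ranks are faithful against coordinates of edges: the edge at `c` counts for `c` but for no
smaller number. -/
theorem rankX_le_iff {c t : ℝ} (hc : ∃ k, S.vx k = c) : S.rankX c ≤ S.rankX t ↔ c ≤ t := by
  refine ⟨fun h => ?_, fun h => rankX_mono h⟩
  by_contra h1
  push Not at h1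
  refine absurd (Finset.card_lt_card ?_) (not_lt.2 h)
  rw [Finset.ssubset_iff_of_subset
    (Finset.monotone_filter_right _ fun _ _ h2 => le_trans h2 h1.le)]
  obtain ⟨k, rfl⟩ := hc
  exact ⟨k, by simp, by simpa using h1⟩

theorem rankX_lt_iff {c t : ℝ} (hc : ∃ k, S.vx k = c) : S.rankX t < S.rankX c ↔ t < c := by
  rw [← not_le, rankX_le_iff hc, not_le]

theorem rankX_inj {c d : ℝ} (hc : ∃ k, S.vx k = c) (hd : ∃ k, S.vx k = d) :
    S.rankX c = S.rankX d ↔ c = d := by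
  rw [le_antisymm_iff, le_antisymm_iff, rankX_le_iff hc, rankX_le_iff hd]

theorem rankX_pos (k : ι) : 0 < S.rankX (S.vx k) :=
  Finset.card_pos.2 ⟨k, by simp⟩

theorem rankX_le_card (t : ℝ) : S.rankX t ≤ Fintype.card ι := Finset.card_le_univ _

/-- Every natural number cuts the ranks as some real threshold cuts the coordinates. This transfers
`par_eq` to all pairs of natural numbers, also to those that are no ranks. -/
theorem exists_rankX_le (S : EdgeSystem ι ℝ) (a : ℕ) :
    ∃ t, ∀ c, (∃ k, S.vx k = c) → (S.rankX c ≤ a ↔ c ≤ t) := by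
  classical
  rcases (Finset.univ.filter fun k => S.rankX (S.vx k) ≤ a).eq_empty_or_nonempty with h | h
  · obtain ⟨t, ht⟩ := (Set.finite_range S.vx).bddBelow
    refine ⟨t - 1, ?_⟩
    rintro c ⟨k, rfl⟩
    have h1 := ht ⟨k, rfl⟩
    have h2 : k ∉ Finset.univ.filter fun k => S.rankX (S.vx k) ≤ a := by simp [h]
    simp only [Finset.mem_filter, Finset.mem_univ, true_and] at h2
    exact ⟨fun h3 => absurd h3 h2, fun h3 => by linarith⟩
  · obtain ⟨m, hm, hmax⟩ := Finset.exists_max_image _ S.vx h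
    refine ⟨S.vx m, ?_⟩
    rintro c ⟨k, rfl⟩
    simp only [Finset.mem_filter, Finset.mem_univ, true_and] at hm hmax
    exact ⟨fun h3 => hmax k h3, fun h3 => (rankX_mono h3).trans hm⟩

theorem hl_mem (S : EdgeSystem ι ℝ) (k : ι) : ∃ m, S.vx m = S.hl k :=
  (S.h_end_left k).imp fun _ h => h.1

theorem hr_mem (S : EdgeSystem ι ℝ) (k : ι) : ∃ m, S.vx m = S.hr k :=
  (S.h_end_right k).imp fun _ h => h.1

theorem vb_mem (S : EdgeSystem ι ℝ) (k : ι) : ∃ m, S.hy m = S.vb k := S.swap.hl_mem k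

theorem vt_mem (S : EdgeSystem ι ℝ) (k : ι) : ∃ m, S.hy m = S.vt k := S.swap.hr_mem k

theorem rankY_le_iff {c t : ℝ} (hc : ∃ k, S.hy k = c) : S.rankY c ≤ S.rankY t ↔ c ≤ t :=
  rankX_le_iff (S := S.swap) hc

theorem rankY_lt_iff {c t : ℝ} (hc : ∃ k, S.hy k = c) : S.rankY t < S.rankY c ↔ t < c :=
  rankX_lt_iff (S := S.swap) hc

theorem rankY_inj {c d : ℝ} (hc : ∃ k, S.hy k = c) (hd : ∃ k, S.hy k = d) :
    S.rankY c = S.rankY d ↔ c = d :=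
  rankX_inj (S := S.swap) hc hd

/-- The edge system with all coordinates replaced by their ranks. -/
noncomputable def rank (S : EdgeSystem ι ℝ) : EdgeSystem ι ℕ where
  hy := fun k => S.rankY (S.hy k)
  hl := fun k => S.rankX (S.hl k)
  hr := fun k => S.rankX (S.hr k)
  vx := fun k => S.rankX (S.vx k)
  vb := fun k => S.rankY (S.vb k)
  vt := fun k => S.rankY (S.vt k)
  hl_lt := fun k => (rankX_lt_iff (S.hr_mem k)).2 (S.hl_lt k)
  vb_lt := fun k => (rankY_lt_iff (S.vt_mem k)).2 (S.vb_lt k)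
  par_eq := by
    intro a b
    obtain ⟨s, hs⟩ := S.exists_rankX_le a
    obtain ⟨t, ht⟩ := S.swap.exists_rankX_le b
    have ht : ∀ c, (∃ k, S.hy k = c) → (S.rankY c ≤ b ↔ c ≤ t) := ht
    have h1 : ∀ k, (S.rankX (S.vx k) ≤ a ∧ S.rankY (S.vb k) ≤ b ∧ b < S.rankY (S.vt k)) ↔
        S.vx k ≤ s ∧ S.vb k ≤ t ∧ t < S.vt k := fun k => by
      rw [← not_le, ← not_le, hs _ ⟨k, rfl⟩, ht _ (S.vb_mem k), ht _ (S.vt_mem k)]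
    have h2 : ∀ k, (S.rankY (S.hy k) ≤ b ∧ S.rankX (S.hl k) ≤ a ∧ a < S.rankX (S.hr k)) ↔
        S.hy k ≤ t ∧ S.hl k ≤ s ∧ s < S.hr k := fun k => by
      rw [← not_le, ← not_le, hs _ (S.hl_mem k), ht _ ⟨k, rfl⟩, hs _ (S.hr_mem k)]
    simp only [h1, h2]
    exact S.par_eq s t
  h_end_left := fun k => (S.h_end_left k).imp fun m h =>
    ⟨by rw [h.1], h.2.imp (fun h => by rw [h]) (fun h => by rw [h])⟩
  h_end_right := fun k => (S.h_end_right k).imp fun m h =>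
    ⟨by rw [h.1], h.2.imp (fun h => by rw [h]) (fun h => by rw [h])⟩
  v_end_bottom := fun k => (S.v_end_bottom k).imp fun m h =>
    ⟨by rw [h.1], h.2.imp (fun h => by rw [h]) (fun h => by rw [h])⟩
  v_end_top := fun k => (S.v_end_top k).imp fun m h =>
    ⟨by rw [h.1], h.2.imp (fun h => by rw [h]) (fun h => by rw [h])⟩
  hh := by
    intro k m hkm h
    rw [rankY_inj ⟨k, rfl⟩ ⟨m, rfl⟩] at h
    rw [rankX_le_iff (S.hr_mem k), rankX_le_iff (S.hr_mem m)]
    exact S.hh k m hkm h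
  vv := by
    intro k m hkm h
    rw [rankX_inj ⟨k, rfl⟩ ⟨m, rfl⟩] at h
    rw [rankY_le_iff (S.vt_mem k), rankY_le_iff (S.vt_mem m)]
    exact S.vv k m hkm h
  hv := by
    intro k m
    rw [rankX_le_iff (S.hl_mem k), rankX_le_iff ⟨m, rfl⟩, rankY_le_iff (S.vb_mem m),
      rankY_le_iff ⟨k, rfl⟩, rankX_inj ⟨m, rfl⟩ (S.hl_mem k), rankX_inj ⟨m, rfl⟩ (S.hr_mem k),
      rankY_inj ⟨k, rfl⟩ (S.vb_mem m), rankY_inj ⟨k, rfl⟩ (S.vt_mem m)]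
    exact S.hv k m

theorem rank_in {x y : ℝ} : S.rank.In (S.rankX x) (S.rankY y) ↔ S.In x y := by
  unfold In
  rw [Finset.filter_congr (q := fun m => S.vx m ≤ x ∧ S.vb m ≤ y ∧ y < S.vt m)]
  intro k _
  change S.rankX (S.vx k) ≤ S.rankX x ∧ S.rankY (S.vb k) ≤ S.rankY y ∧
    S.rankY y < S.rankY (S.vt k) ↔ _
  rw [rankX_le_iff ⟨k, rfl⟩, rankY_le_iff (S.vb_mem k), rankY_lt_iff (S.vt_mem k)]

theorem HHit.rank {x y : ℝ} (h : S.HHit x y) : S.rank.HHit (S.rankX x) (S.rankY y) := by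
  obtain ⟨k, rfl, h1, h2⟩ := h
  exact ⟨k, rfl, rankX_mono h1, rankX_mono h2⟩

theorem VHit.rank {x y : ℝ} (h : S.VHit x y) : S.rank.VHit (S.rankX x) (S.rankY y) :=
  HHit.rank (S := S.swap) h

theorem hHit_of_rank {x y : ℝ} (hx : ∃ k, S.vx k = x) (hy : ∃ k, S.hy k = y)
    (h : S.rank.HHit (S.rankX x) (S.rankY y)) : S.HHit x y := by
  obtain ⟨k, h0, h1, h2⟩ := h
  exact ⟨k, (rankY_inj ⟨k, rfl⟩ hy).1 h0, (rankX_le_iff (S.hl_mem k)).1 h1,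
    (rankX_le_iff hx).1 h2⟩

/-! ### Rays -/

/-- A wall through inner points is a part of a ray from a vertex with two inner quadrants. -/
theorem exists_ray_of_wV {a b : ℝ} (ha : ∃ k, S.vx k = a) (hin : S.Inn a b)
    (hw : S.rank.WV (S.rankX a) (S.rankY b)) :
    ∃ e, e ≠ b ∧ S.Vert a e ∧ (∀ y ∈ Set.uIcc e b, y ≠ e → S.Inn a y) ∧
      ∃ σ : ℤˣ, ∀ τ : ℤˣ, ∃ ε > (0 : ℝ), ∀ u w, 0 < u → u < ε → 0 < w → w < ε →
        S.Inn (a + ((τ : ℤ) : ℝ) * u) (e + ((σ : ℤ) : ℝ) * w) := by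
  obtain ⟨hnb, hib⟩ := hin
  have hv : ∃ e, (∃ k, S.hy k = e) ∧ S.Vert a e ∧
      ((S.rankY e ≤ S.rankY b ∧
        ∀ t, S.rankY e < t → t ≤ S.rankY b → ¬ S.rank.HHit (S.rankX a) t) ∨
      (S.rankY b < S.rankY e ∧
        ∀ t, S.rankY b < t → t < S.rankY e → ¬ S.rank.HHit (S.rankX a) t)) := by
    obtain ⟨s, ⟨m, h1, h2⟩, h⟩ := hw
    have h1 : S.vx m = a := (rankX_inj ⟨m, rfl⟩ ha).1 h1
    rcases h2 with rfl | rfl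
    · exact ⟨S.vb m, S.vb_mem m, ⟨m, h1, Or.inl rfl⟩, h⟩
    · exact ⟨S.vt m, S.vt_mem m, ⟨m, h1, Or.inr rfl⟩, h⟩
  obtain ⟨e, hey, hve, h⟩ := hv
  have heb : e ≠ b := by
    rintro rfl
    exact hnb (Or.inl hve.hHit)
  -- No horizontal edge meets the wall between the vertex and `b`. A vertical edge meeting it
  -- without containing `(a, b)` would have an end there, and with it a horizontal edge.
  have hseg : ∀ y ∈ Set.uIcc e b, y ≠ e → S.Inn a y := by
    intro y hy hye
    rcases h with ⟨h1, h2⟩ | ⟨h1, h2⟩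
    · rw [rankY_le_iff hey] at h1
      rw [Set.uIcc_of_le h1] at hy
      have hey' : e < y := lt_of_le_of_ne hy.1 hye.symm
      have nh : ∀ z, e < z → z ≤ b → ¬ S.HHit a z := by
        rintro z h3 h4 ⟨k, rfl, h5⟩
        exact h2 _ ((rankY_lt_iff ⟨k, rfl⟩).2 h3) ((rankY_le_iff ⟨k, rfl⟩).2 h4)
          (HHit.rank ⟨k, rfl, h5⟩)
      refine ⟨?_, (in_iff_of_not_hE hy.2 fun c h3 h4 h5 =>
        nh c (hey'.trans h3) h4 h5.hHit).2 hib⟩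
      rintro (h3 | ⟨m, h3, h4, h5⟩)
      · exact nh y hey' hy.2 h3
      · change S.vx m = a at h3
        change S.vb m ≤ y at h4
        change y ≤ S.vt m at h5
        rcases le_or_gt b (S.vt m) with h6 | h6
        · exact hnb (Or.inr ⟨m, h3, h4.trans hy.2, h6⟩)
        · exact nh (S.vt m) (hey'.trans_le h5) h6.le (Vert.hHit ⟨m, h3, Or.inr rfl⟩)
    · rw [rankY_lt_iff hey] at h1
      rw [Set.uIcc_of_ge h1.le] at hy
      have hey' : y < e := lt_of_le_of_ne hy.2 hye
      have nh : ∀ z, b ≤ z → z < e → ¬ S.HHit a z := by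
        rintro z h3 h4 h5
        rcases h3.eq_or_lt with rfl | h3
        · exact hnb (Or.inl h5)
        · obtain ⟨k, rfl, h5⟩ := h5
          exact h2 _ ((rankY_lt_iff ⟨k, rfl⟩).2 h3) ((rankY_lt_iff hey).2 h4)
            (HHit.rank ⟨k, rfl, h5⟩)
      refine ⟨?_, (in_iff_of_not_hE hy.1 fun c h3 h4 h5 =>
        nh c h3.le (h4.trans_lt hey') h5.hHit).1 hib⟩
      rintro (h3 | ⟨m, h3, h4, h5⟩)
      · exact nh y hy.1 hey' h3
      · change S.vx m = a at h3
        change S.vb m ≤ y at h4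
        change y ≤ S.vt m at h5
        rcases le_or_gt (S.vb m) b with h6 | h6
        · exact hnb (Or.inr ⟨m, h3, h6, hy.1.trans h5⟩)
        · exact nh (S.vb m) h6.le (h4.trans_lt hey') (Vert.hHit ⟨m, h3, Or.inl rfl⟩)
  refine ⟨e, heb, hve, hseg, ?_⟩
  -- `σ` is the direction of the ray. Near the vertex, points beside the ray are reached from its
  -- inner points by a short horizontal move that meets no edge, for both signs `τ`.
  obtain ⟨σ, hσ⟩ : ∃ σ : ℤˣ, ((σ : ℤ) : ℝ) * (b - e) = |b - e| ∧
      (((σ : ℤ) : ℝ) = 1 ∧ e < b ∨ ((σ : ℤ) : ℝ) = -1 ∧ b < e) := by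
    rcases lt_or_gt_of_ne heb with h1 | h1
    · exact ⟨1, by rw [abs_of_pos (by linarith)]; simp, Or.inl ⟨by simp, h1⟩⟩
    · exact ⟨-1, by rw [abs_of_neg (by linarith)]; simp, Or.inr ⟨by simp, h1⟩⟩
  refine ⟨σ, fun τ => ?_⟩
  obtain ⟨ε, hε, hg⟩ := S.exists_gap a e
  refine ⟨min ε |b - e|, lt_min hε (abs_pos.2 (sub_ne_zero.2 heb.symm)),
    fun u w hu hu' hw hw' => ?_⟩
  have hu1 := hu'.trans_le (min_le_left _ _)
  have hw1 := hw'.trans_le (min_le_left _ _)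
  have hw2 := hw'.trans_le (min_le_right _ _)
  set y := e + ((σ : ℤ) : ℝ) * w with hy
  have hye : |y - e| = w := by
    rcases hσ.2 with ⟨h1, -⟩ | ⟨h1, -⟩ <;> rw [hy, h1] <;> simp [abs_of_pos hw]
  have hy1 : S.Inn a y := by
    apply hseg
    · rcases hσ.2 with ⟨h1, h2⟩ | ⟨h1, h2⟩
      · rw [Set.uIcc_of_le h2.le, hy, h1]
        rw [abs_of_pos (by linarith)] at hw2
        constructor <;> linarith
      · rw [Set.uIcc_of_ge h2.le, hy, h1]
        rw [abs_of_neg (by linarith)] at hw2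
        constructor <;> linarith
    · intro h1
      rw [h1] at hye
      simp at hye
      linarith
  have hτ : ((τ : ℤ) : ℝ) = 1 ∨ ((τ : ℤ) : ℝ) = -1 := by
    rcases Int.units_eq_one_or τ with rfl | rfl
    · left; simp
    · right; simp
  set x := a + ((τ : ℤ) : ℝ) * u with hx
  have hxa : |x - a| = u := by
    rcases hτ with h1 | h1 <;> rw [hx, h1] <;> simp [abs_of_pos hu]
  constructor
  · rintro (⟨m, h3, -⟩ | ⟨m, h3, -⟩)
    · have h4 := (hg m).2.2.2.1 (by rw [h3, hye]; exact hw1)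
      rw [h3] at h4
      rw [h4] at hye
      simp at hye
      linarith
    · change S.vx m = x at h3
      have h4 := (hg m).1 (by rw [h3, hxa]; exact hu1)
      rw [h3] at h4
      rw [h4] at hxa
      simp at hxa
      linarith
  · rcases hτ with h1 | h1
    · refine (in_iff_of_not_vE (a := a) (by rw [hx, h1]; linarith) ?_).1 hy1.2
      rintro c h3 h4 ⟨m, h5, -⟩
      rw [hx, h1] at h4
      have h6 := (hg m).1 (by rw [h5, abs_lt]; constructor <;> linarith)
      linarith
    · refine (in_iff_of_not_vE (a' := a) (by rw [hx, h1]; linarith) ?_).2 hy1.2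
      rintro c h3 h4 h5
      rcases h4.eq_or_lt with rfl | h4
      · exact hy1.1 (Or.inr h5.vHit)
      · obtain ⟨m, h5, -⟩ := h5
        rw [hx, h1] at h3
        have h6 := (hg m).1 (by rw [h5, abs_lt]; constructor <;> linarith)
        linarith

/-- The points that are joined to a vertex by a vertical segment without edges lie on a wall. -/
theorem wV_of_ray {a b e : ℝ} (he : e ≠ b) (hv : S.Vert a e)
    (hseg : ∀ y ∈ Set.uIcc e b, y ≠ e → ¬ S.Bd a y) :
    S.rank.WV (S.rankX a) (S.rankY b) := by
  have hey : ∃ k, S.hy k = e := hv.hHit.imp fun _ h => h.1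
  have hax : ∃ k, S.vx k = a := hv.imp fun _ h => h.1
  refine ⟨S.rankY e, ?_, ?_⟩
  · obtain ⟨m, rfl, rfl | rfl⟩ := hv
    exacts [⟨m, rfl, Or.inl rfl⟩, ⟨m, rfl, Or.inr rfl⟩]
  rcases lt_or_gt_of_ne he with h1 | h1
  · refine Or.inl ⟨(rankY_le_iff hey).2 h1.le, fun t h2 h3 h4 => ?_⟩
    obtain ⟨k, rfl, -⟩ := id h4
    have h2 := (rankY_lt_iff ⟨k, rfl⟩).1 h2
    refine hseg (S.hy k) ?_ h2.ne' (Or.inl (hHit_of_rank hax ⟨k, rfl⟩ h4))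
    rw [Set.uIcc_of_le h1.le]
    exact ⟨h2.le, (rankY_le_iff ⟨k, rfl⟩).1 h3⟩
  · refine Or.inr ⟨(rankY_lt_iff hey).2 h1, fun t h2 h3 h4 => ?_⟩
    obtain ⟨k, rfl, -⟩ := id h4
    have h3 := (rankY_lt_iff hey).1 h3
    refine hseg (S.hy k) ?_ h3.ne (Or.inl (hHit_of_rank hax ⟨k, rfl⟩ h4))
    rw [Set.uIcc_of_ge h1.le]
    exact ⟨((rankY_lt_iff ⟨k, rfl⟩).1 h2).le, h3.le⟩

end EdgeSystem

namespace EdgeSystem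

variable {ι : Type} [Fintype ι]

/-! ### Base rectangles are blocks -/

/-- The edge system consists of the edges of the polygon. -/
structure Represents (S : EdgeSystem ι ℝ) (P : RectilinearPolygon) : Prop where
  inner : ∀ p, p ∈ P.inner ↔ S.Inn p.1 p.2
  region : ∀ p, p ∈ P.region ↔ S.Inn p.1 p.2 ∨ S.Bd p.1 p.2
  vertices : ∀ p, p ∈ P.vertices ↔ S.Vert p.1 p.2

variable {S : EdgeSystem ι ℝ} {P : RectilinearPolygon}

open Classical in
/-- The coordinate of the given rank. -/
noncomputable def valX (S : EdgeSystem ι ℝ) (i : ℕ) : ℝ :=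
  if h : ∃ k, S.rankX (S.vx k) = i then S.vx h.choose else 0

/-- The coordinate of the given rank. -/
noncomputable def valY (S : EdgeSystem ι ℝ) (j : ℕ) : ℝ := S.swap.valX j

theorem valX_mem {i : ℕ} (h : ∃ k, S.rank.vx k = i) : ∃ k, S.vx k = S.valX i := by
  change ∃ k, S.rankX (S.vx k) = i at h
  rw [valX, dif_pos h]
  exact ⟨_, rfl⟩

theorem rankX_valX {i : ℕ} (h : ∃ k, S.rank.vx k = i) : S.rankX (S.valX i) = i := by
  change ∃ k, S.rankX (S.vx k) = i at h
  rw [valX, dif_pos h]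
  exact h.choose_spec

theorem valX_rankX {c : ℝ} (h : ∃ k, S.vx k = c) : S.valX (S.rankX c) = c := by
  have h1 : ∃ k, S.rank.vx k = S.rankX c := by
    obtain ⟨k, rfl⟩ := h
    exact ⟨k, rfl⟩
  exact (rankX_inj (valX_mem h1) h).1 (rankX_valX h1)

theorem valX_le_iff {i : ℕ} {t : ℝ} (h : ∃ k, S.rank.vx k = i) :
    S.valX i ≤ t ↔ i ≤ S.rankX t := by
  rw [← rankX_le_iff (valX_mem h), rankX_valX h]

theorem lt_valX_iff {i : ℕ} {t : ℝ} (h : ∃ k, S.rank.vx k = i) :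
    t < S.valX i ↔ S.rankX t < i := by
  rw [← not_le, valX_le_iff h, not_le]

theorem valY_mem {i : ℕ} (h : ∃ k, S.rank.hy k = i) : ∃ k, S.hy k = S.valY i :=
  valX_mem (S := S.swap) h

theorem rankY_valY {i : ℕ} (h : ∃ k, S.rank.hy k = i) : S.rankY (S.valY i) = i :=
  rankX_valX (S := S.swap) h

theorem valY_le_iff {i : ℕ} {t : ℝ} (h : ∃ k, S.rank.hy k = i) :
    S.valY i ≤ t ↔ i ≤ S.rankY t :=
  valX_le_iff (S := S.swap) h

theorem lt_valY_iff {i : ℕ} {t : ℝ} (h : ∃ k, S.rank.hy k = i) :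
    t < S.valY i ↔ S.rankY t < i :=
  lt_valX_iff (S := S.swap) h

theorem WV.exists_vx {α : Type} [LinearOrder α] {T : EdgeSystem ι α} {a b : α} (h : T.WV a b) :
    ∃ k, T.vx k = a := by
  obtain ⟨s, ⟨m, h, -⟩, -⟩ := h
  exact ⟨m, h⟩

theorem WH.exists_hy {α : Type} [LinearOrder α] {T : EdgeSystem ι α} {a b : α} (h : T.WH a b) :
    ∃ k, T.hy k = b :=
  WV.exists_vx (T := T.swap) h

namespace IsBlock

variable {T : EdgeSystem ι ℕ} {β : Blk}

theorem l_mem (h : T.IsBlock β) : ∃ k, T.vx k = β.l := (h.left _ le_rfl h.bt).exists_vx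
theorem r_mem (h : T.IsBlock β) : ∃ k, T.vx k = β.r := (h.right _ le_rfl h.bt).exists_vx
theorem b_mem (h : T.IsBlock β) : ∃ k, T.hy k = β.b := (h.bottom _ le_rfl h.lr).exists_hy
theorem t_mem (h : T.IsBlock β) : ∃ k, T.hy k = β.t := (h.top _ le_rfl h.lr).exists_hy

end IsBlock

theorem IsBlock.valX_lt {β : Blk} (h : S.rank.IsBlock β) : S.valX β.l < S.valX β.r := by
  rw [lt_valX_iff h.r_mem, rankX_valX h.l_mem]
  exact h.lr

theorem IsBlock.valY_lt {β : Blk} (h : S.rank.IsBlock β) : S.valY β.b < S.valY β.t := by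
  rw [lt_valY_iff h.t_mem, rankY_valY h.b_mem]
  exact h.bt

open Classical in
/-- The rectangle covered by a block. -/
noncomputable def blockRect (S : EdgeSystem ι ℝ) (β : Blk) : Rect :=
  if h : S.valX β.l < S.valX β.r ∧ S.valY β.b < S.valY β.t then
    ⟨S.valX β.l, S.valX β.r, S.valY β.b, S.valY β.t, h.1, h.2⟩
  else ⟨0, 1, 0, 1, one_pos, one_pos⟩

theorem IsBlock.blockRect_eq {β : Blk} (h : S.rank.IsBlock β) : S.blockRect β =
    ⟨S.valX β.l, S.valX β.r, S.valY β.b, S.valY β.t, h.valX_lt, h.valY_lt⟩ :=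
  dif_pos ⟨h.valX_lt, h.valY_lt⟩

theorem mem_vertical_segment {a b e : ℝ} {q : ℝ × ℝ} :
    q ∈ segment ℝ (a, e) (a, b) ↔ q.1 = a ∧ q.2 ∈ Set.uIcc e b := by
  rw [← Prod.image_mk_segment_right, segment_eq_uIcc]
  constructor
  · rintro ⟨y, hy, rfl⟩
    exact ⟨rfl, hy⟩
  · rintro ⟨rfl, h⟩
    exact ⟨q.2, h, rfl⟩

theorem mem_horizontal_segment {a b e : ℝ} {q : ℝ × ℝ} :
    q ∈ segment ℝ (e, a) (b, a) ↔ q.2 = a ∧ q.1 ∈ Set.uIcc e b := by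
  rw [← Prod.image_mk_segment_left, segment_eq_uIcc]
  constructor
  · rintro ⟨y, hy, rfl⟩
    exact ⟨rfl, hy⟩
  · rintro ⟨rfl, h⟩
    exact ⟨q.1, h, rfl⟩

theorem Represents.wall_of_mem_rays (h : S.Represents P) {p : ℝ × ℝ} (hp : p ∈ P.rays) :
    ((∃ k, S.vx k = p.1) ∧ S.rank.WV (S.rankX p.1) (S.rankY p.2)) ∨
    ((∃ k, S.hy k = p.2) ∧ S.rank.WH (S.rankX p.1) (S.rankY p.2)) := by
  obtain ⟨⟨v1, v2⟩, ⟨hv, -⟩, hne, hor, hseg⟩ := hp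
  obtain ⟨p1, p2⟩ := p
  have hv : S.Vert v1 v2 := (h.vertices _).1 hv
  rcases hor with h1 | h1 <;> simp only at h1 <;> subst h1
  · left
    refine ⟨hv.imp fun _ h => h.1, wV_of_ray (e := v2) (by rintro rfl; exact hne rfl) hv
      fun y hy hye => ?_⟩
    exact ((h.inner (p1, y)).1 (hseg (p1, y) (mem_vertical_segment.2 ⟨rfl, hy⟩)
      (by simpa using hye))).1
  · right
    refine ⟨hv.hHit.imp fun _ h => h.1, wV_of_ray (S := S.swap) (e := v1)
      (by rintro rfl; exact hne rfl) (S.vert_swap.2 hv) fun y hy hye hb => ?_⟩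
    exact ((h.inner (y, p2)).1 (hseg (y, p2) (mem_horizontal_segment.2 ⟨rfl, hy⟩)
      (by simpa using hye))).1 (bd_swap.1 hb)

/-- The wall may have started at any vertex. Since it runs through inner points, both quadrants
beside it at the vertex are inner, so the vertex has no unique inner quadrant and is concave. -/
theorem Represents.mem_rays_of_wV (h : S.Represents P) {p : ℝ × ℝ} (hp : S.Inn p.1 p.2)
    (ha : ∃ k, S.vx k = p.1) (hw : S.rank.WV (S.rankX p.1) (S.rankY p.2)) : p ∈ P.rays := by
  obtain ⟨a, b⟩ := p
  obtain ⟨e, he, hv, hseg, σ, hσ⟩ := exists_ray_of_wV ha hp hw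
  refine ⟨(a, e), ⟨(h.vertices _).2 hv, ?_⟩, by simpa using he.symm, Or.inl rfl, ?_⟩
  · rintro ⟨-, q, -, hq⟩
    have key : ∀ τ : ℤˣ, P.QuadrantInside (a, e) (τ, σ) := by
      intro τ
      obtain ⟨ε, hε, h1⟩ := hσ τ
      exact ⟨ε, hε, fun u w h2 h3 h4 h5 => (h.inner _).2 (h1 u w h2 h3 h4 h5)⟩
    have h2 := (hq _ (key 1)).trans (hq _ (key (-1))).symm
    simp at h2
  · intro q hq hne
    obtain ⟨h1, h2⟩ := mem_vertical_segment.1 hq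
    rw [h.inner, h1]
    exact hseg _ h2 fun h3 => hne (Prod.ext h1 h3)

theorem Represents.mem_rays_of_wH (h : S.Represents P) {p : ℝ × ℝ} (hp : S.Inn p.1 p.2)
    (hb : ∃ k, S.hy k = p.2) (hw : S.rank.WH (S.rankX p.1) (S.rankY p.2)) : p ∈ P.rays := by
  obtain ⟨a, b⟩ := p
  obtain ⟨e, he, hv, hseg, σ, hσ⟩ := exists_ray_of_wV (S := S.swap) hb (inn_swap.2 hp) hw
  refine ⟨(e, b), ⟨(h.vertices _).2 (S.vert_swap.1 hv), ?_⟩, by simpa using he.symm, Or.inr rfl, ?_⟩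
  · rintro ⟨-, q, -, hq⟩
    have key : ∀ τ : ℤˣ, P.QuadrantInside (e, b) (σ, τ) := by
      intro τ
      obtain ⟨ε, hε, h1⟩ := hσ τ
      exact ⟨ε, hε, fun u w h2 h3 h4 h5 => (h.inner _).2 (inn_swap.1 (h1 w u h4 h5 h2 h3))⟩
    have h2 := (hq _ (key 1)).trans (hq _ (key (-1))).symm
    simp at h2
  · intro q hq hne
    obtain ⟨h1, h2⟩ := mem_horizontal_segment.1 hq
    rw [h.inner, h1]
    exact inn_swap.1 (hseg _ h2 fun h3 => hne (Prod.ext h3 h1))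

theorem IsBlock.mem_openRegion_iff {β : Blk} (hβ : S.rank.IsBlock β) {p : ℝ × ℝ} :
    p ∈ (S.blockRect β).openRegion ↔
      (S.valX β.l < p.1 ∧ p.1 < S.valX β.r) ∧ S.valY β.b < p.2 ∧ p.2 < S.valY β.t := by
  rw [hβ.blockRect_eq]
  rfl

theorem IsBlock.mem_region_iff {β : Blk} (hβ : S.rank.IsBlock β) {p : ℝ × ℝ} :
    p ∈ (S.blockRect β).region ↔
      (S.valX β.l ≤ p.1 ∧ p.1 ≤ S.valX β.r) ∧ S.valY β.b ≤ p.2 ∧ p.2 ≤ S.valY β.t := by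
  rw [hβ.blockRect_eq]
  rfl

theorem IsBlock.has_of_mem {β : Blk} (hβ : S.rank.IsBlock β) {p : ℝ × ℝ}
    (hp : p ∈ (S.blockRect β).openRegion) : β.Has (S.rankX p.1) (S.rankY p.2) := by
  rw [hβ.mem_openRegion_iff] at hp
  exact ⟨(valX_le_iff hβ.l_mem).1 hp.1.1.le, (lt_valX_iff hβ.r_mem).1 hp.1.2,
    (valY_le_iff hβ.b_mem).1 hp.2.1.le, (lt_valY_iff hβ.t_mem).1 hp.2.2⟩

theorem IsBlock.inn_of_mem {β : Blk} (hβ : S.rank.IsBlock β) {p : ℝ × ℝ}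
    (hp : p ∈ (S.blockRect β).openRegion) : S.Inn p.1 p.2 ∧
      ¬ ((∃ k, S.vx k = p.1) ∧ S.rank.WV (S.rankX p.1) (S.rankY p.2)) ∧
      ¬ ((∃ k, S.hy k = p.2) ∧ S.rank.WH (S.rankX p.1) (S.rankY p.2)) := by
  have hhas := hβ.has_of_mem hp
  rw [hβ.mem_openRegion_iff] at hp
  have h1 : ¬ ((∃ k, S.vx k = p.1) ∧ S.rank.WV (S.rankX p.1) (S.rankY p.2)) := by
    rintro ⟨h2, h3⟩
    refine hβ.no_wV _ _ hhas ?_ h3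
    have h4 := (rankX_lt_iff h2).2 hp.1.1
    rwa [rankX_valX hβ.l_mem] at h4
  have h2 : ¬ ((∃ k, S.hy k = p.2) ∧ S.rank.WH (S.rankX p.1) (S.rankY p.2)) := by
    rintro ⟨h2, h3⟩
    refine hβ.no_wH _ _ hhas ?_ h3
    have h4 := (rankY_lt_iff h2).2 hp.2.1
    rwa [rankY_valY hβ.b_mem] at h4
  refine ⟨⟨?_, rank_in.1 (hβ.inside _ _ hhas)⟩, h1, h2⟩
  rintro (h3 | h3)
  · exact h2 ⟨h3.imp fun _ h => h.1, h3.rank.wH⟩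
  · exact h1 ⟨h3.imp fun _ h => h.1, h3.rank.wV⟩

/-- The half-open sides say nothing about their upper ends. There the wall is taken from the row
below and continues unless a horizontal edge stops it. -/
theorem IsBlock.wV_closed {T : EdgeSystem ι ℕ} {β : Blk} (hβ : T.IsBlock β) {i j : ℕ}
    (hi : i = β.l ∨ i = β.r) (hb : β.b ≤ j) (ht : j ≤ β.t) (hh : ¬ T.HHit i j) : T.WV i j := by
  have h1 : ∀ j, β.b ≤ j → j < β.t → T.WV i j := by
    rcases hi with rfl | rfl
    exacts [hβ.left, hβ.right]
  rcases ht.eq_or_lt with rfl | h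
  · have := hβ.bt
    refine (wV_iff_of_not_hHit (Nat.sub_le _ 1) fun t h2 h3 => ?_).1
      (h1 (β.t - 1) (by omega) (by omega))
    obtain rfl : t = β.t := by omega
    exact hh
  · exact h1 j hb h

/-- The sides of a block are walls, and walls at inner points are rays. The delicate points are the
upper corners: an inner point lies on no horizontal edge, so the vertical wall does not stop there.
-/
theorem Represents.mem_rays_of_side (h : S.Represents P) {β : Blk} (hβ : S.rank.IsBlock β)
    {p : ℝ × ℝ} (hp : p ∈ (S.blockRect β).region) (hp' : p ∉ (S.blockRect β).openRegion)
    (hin : S.Inn p.1 p.2) : p ∈ P.rays := by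
  rw [hβ.mem_region_iff] at hp
  rw [hβ.mem_openRegion_iff] at hp'
  obtain ⟨⟨p1, p2⟩, p3, p4⟩ := hp
  have b1 : β.l ≤ S.rankX p.1 := (valX_le_iff hβ.l_mem).1 p1
  have b2 : S.rankX p.1 ≤ β.r := (rankX_mono p2).trans (rankX_valX hβ.r_mem).le
  have b3 : β.b ≤ S.rankY p.2 := (valY_le_iff hβ.b_mem).1 p3
  have b4 : S.rankY p.2 ≤ β.t :=
    (rankX_mono (S := S.swap) p4).trans (rankY_valY hβ.t_mem).le
  by_cases hx : S.valX β.l < p.1 ∧ p.1 < S.valX β.r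
  · have hy : p.2 = S.valY β.b ∨ p.2 = S.valY β.t := by
      by_contra h1
      push Not at h1
      exact hp' ⟨hx, lt_of_le_of_ne p3 h1.1.symm, lt_of_le_of_ne p4 h1.2⟩
    have hm : ∃ k, S.hy k = p.2 := by
      rcases hy with h1 | h1 <;> rw [h1]
      exacts [valY_mem hβ.b_mem, valY_mem hβ.t_mem]
    refine h.mem_rays_of_wH hin hm ?_
    have h2 := (lt_valX_iff hβ.r_mem).1 hx.2
    rcases hy with h1 | h1
    · rw [h1, rankY_valY hβ.b_mem]
      exact hβ.bottom _ b1 h2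
    · rw [h1, rankY_valY hβ.t_mem]
      exact hβ.top _ b1 h2
  · have hx' : p.1 = S.valX β.l ∨ p.1 = S.valX β.r := by
      by_contra h1
      push Not at h1
      exact hx ⟨lt_of_le_of_ne p1 h1.1.symm, lt_of_le_of_ne p2 h1.2⟩
    have hm : ∃ k, S.vx k = p.1 := by
      rcases hx' with h1 | h1 <;> rw [h1]
      exacts [valX_mem hβ.l_mem, valX_mem hβ.r_mem]
    have hr : S.rankX p.1 = β.l ∨ S.rankX p.1 = β.r := by
      rcases hx' with h1 | h1 <;> rw [h1]
      exacts [Or.inl (rankX_valX hβ.l_mem), Or.inr (rankX_valX hβ.r_mem)]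
    by_cases hhit : S.rank.HHit (S.rankX p.1) (S.rankY p.2)
    · have hyt : ¬ S.rankY p.2 < β.t ∨ S.rank.WV (S.rankX p.1) (S.rankY p.2) := by
        by_cases h1 : S.rankY p.2 < β.t
        · rcases hr with h2 | h2 <;> rw [h2]
          exacts [Or.inr (hβ.left _ b3 h1), Or.inr (hβ.right _ b3 h1)]
        · exact Or.inl h1
      rcases hyt with h1 | h1
      -- A hit in ranks is a hit in the plane only at coordinates of edges; here both coordinates
      -- are such, and the point is on an edge after all.
      · have h2 : p.2 = S.valY β.t := le_antisymm p4 ((valY_le_iff hβ.t_mem).2 (by omega))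
        exact absurd (Or.inl (hHit_of_rank hm (h2 ▸ valY_mem hβ.t_mem) hhit)) hin.1
      · exact h.mem_rays_of_wV hin hm h1
    · exact h.mem_rays_of_wV hin hm (hβ.wV_closed hr b3 b4 hhit)

theorem _root_.Rect.openRegion_nonempty (R : Rect) : R.openRegion.Nonempty :=
  (Set.nonempty_Ioo.2 R.left_lt_right).prod (Set.nonempty_Ioo.2 R.bottom_lt_top)

theorem _root_.Rect.closure_openRegion (R : Rect) : closure R.openRegion = R.region := by
  rw [Rect.openRegion, closure_prod_eq, closure_Ioo R.left_lt_right.ne,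
    closure_Ioo R.bottom_lt_top.ne, Rect.region]

theorem _root_.Rect.isOpen_openRegion (R : Rect) : IsOpen R.openRegion := isOpen_Ioo.prod isOpen_Ioo

theorem _root_.Rect.openRegion_injective : Function.Injective Rect.openRegion := by
  intro R R' h
  have h1 : R.region = R'.region := by
    rw [← Rect.closure_openRegion, ← Rect.closure_openRegion, h]
  have e1 := (R.left_lt_right).le
  have e2 := (R.bottom_lt_top).le
  have e3 := (R'.left_lt_right).le
  have e4 := (R'.bottom_lt_top).le
  have m1 : (R.left, R.bottom) ∈ R'.region := h1 ▸ ⟨⟨le_rfl, e1⟩, ⟨le_rfl, e2⟩⟩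
  have m2 : (R.right, R.top) ∈ R'.region := h1 ▸ ⟨⟨e1, le_rfl⟩, ⟨e2, le_rfl⟩⟩
  have m3 : (R'.left, R'.bottom) ∈ R.region := h1 ▸ ⟨⟨le_rfl, e3⟩, ⟨le_rfl, e4⟩⟩
  have m4 : (R'.right, R'.top) ∈ R.region := h1 ▸ ⟨⟨e3, le_rfl⟩, ⟨e4, le_rfl⟩⟩
  ext
  · exact le_antisymm m3.1.1 m1.1.1
  · exact le_antisymm m2.1.2 m4.1.2
  · exact le_antisymm m3.2.1 m1.2.1
  · exact le_antisymm m2.2.2 m4.2.2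

/-- The open rectangle is connected and misses all edges and rays, while each inner point on its
frontier lies on a ray. So it is open and relatively closed in the remaining set. -/
theorem Represents.component_eq (h : S.Represents P) {β : Blk} (hβ : S.rank.IsBlock β)
    {p : ℝ × ℝ} (hp : p ∈ (S.blockRect β).openRegion) :
    p ∈ P.inner \ P.rays ∧
      connectedComponentIn (P.inner \ P.rays) p = (S.blockRect β).openRegion := by
  have hsub : (S.blockRect β).openRegion ⊆ P.inner \ P.rays := by
    intro q hq
    obtain ⟨h1, h2, h3⟩ := hβ.inn_of_mem hq
    exact ⟨(h.inner q).2 h1, fun h4 => (h.wall_of_mem_rays h4).elim h2 h3⟩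
  refine ⟨hsub hp, Set.Subset.antisymm ?_ ?_⟩
  · refine isPreconnected_connectedComponentIn.subset_of_closure_inter_subset
      (Rect.isOpen_openRegion _) ⟨p, mem_connectedComponentIn (hsub hp), hp⟩ ?_
    rintro q ⟨hq1, hq2⟩
    rw [Rect.closure_openRegion] at hq1
    by_contra hq3
    have hq4 := connectedComponentIn_subset _ _ hq2
    exact hq4.2 (h.mem_rays_of_side hβ hq1 hq3 ((h.inner q).1 hq4.1))
  · exact ((convex_Ioo _ _).prod (convex_Ioo _ _)).isPreconnected.subset_connectedComponentIn
      hp hsub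

theorem Represents.exists_block_of_mem (h : S.Represents P) {p : ℝ × ℝ}
    (hp : p ∈ P.inner \ P.rays) :
    ∃ β, S.rank.IsBlock β ∧ p ∈ (S.blockRect β).openRegion := by
  have hin := (h.inner p).1 hp.1
  obtain ⟨β, hβ, h1, h2, h3, h4⟩ := (rank_in.2 hin.2).exists_block
  refine ⟨β, hβ, ?_⟩
  have hreg : p ∈ (S.blockRect β).region := hβ.mem_region_iff.2
    ⟨⟨(valX_le_iff hβ.l_mem).2 h1, ((lt_valX_iff hβ.r_mem).2 h2).le⟩,
      (valY_le_iff hβ.b_mem).2 h3, ((lt_valY_iff hβ.t_mem).2 h4).le⟩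
  by_contra h5
  exact hp.2 (h.mem_rays_of_side hβ hreg h5 hin)

/-- The base rectangles are the rectangles of the blocks. -/
theorem Represents.baseRects_eq (h : S.Represents P) :
    P.baseRects = S.blockRect '' {β | S.rank.IsBlock β} := by
  ext R
  constructor
  · rintro ⟨p, hp, hR⟩
    obtain ⟨β, hβ, hpβ⟩ := h.exists_block_of_mem hp
    refine ⟨β, hβ, Rect.openRegion_injective ?_⟩
    rw [← hR, (h.component_eq hβ hpβ).2]
  · rintro ⟨β, hβ, rfl⟩
    obtain ⟨p, hp⟩ := (S.blockRect β).openRegion_nonempty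
    exact ⟨p, h.component_eq hβ hp⟩

theorem blockRect_injOn : Set.InjOn S.blockRect {β | S.rank.IsBlock β} := by
  intro β hβ γ hγ h
  obtain ⟨p, hp⟩ := (S.blockRect β).openRegion_nonempty
  exact IsBlock.ext_of_has hβ hγ (IsBlock.has_of_mem hβ hp) (IsBlock.has_of_mem hγ (h ▸ hp))

end EdgeSystem

/-! ### Tilings by base rectangles -/

namespace RectilinearPolygon

/-- What the strip cover needs to know about the base rectangles. -/
structure IsTiled (P : RectilinearPolygon) : Prop where
  finite : P.baseRects.Finite
  eq_of_mem : ∀ A ∈ P.baseRects, ∀ B ∈ P.baseRects, ∀ p ∈ A.openRegion, p ∈ B.openRegion → A = B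
  region_eq : P.region = ⋃ B ∈ P.baseRects, B.region
  touch_x : ∀ A ∈ P.baseRects, ∀ B ∈ P.baseRects, A.right = B.left → A.bottom < B.top →
    B.bottom < A.top → A.bottom = B.bottom ∧ A.top = B.top
  touch_y : ∀ A ∈ P.baseRects, ∀ B ∈ P.baseRects, A.top = B.bottom → A.left < B.right →
    B.left < A.right → A.left = B.left ∧ A.right = B.right
  ncard_le : P.baseRects.ncard ≤ P.size ^ 2
  size_le : P.size ≤ 2 * P.baseRects.ncard
  topless_le : {B ∈ P.baseRects | ¬ ∃ A, P.IsTop B A}.ncard ≤ 3 * P.size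
  lefts_le : (Rect.left '' P.baseRects).ncard ≤ P.size
  bottoms_le : (Rect.bottom '' P.baseRects).ncard ≤ P.size

end RectilinearPolygon

/-! ### The blocks of an edge system form a tiling -/

namespace EdgeSystem

variable {ι : Type} [Fintype ι] {S : EdgeSystem ι ℝ} {P : RectilinearPolygon}

theorem IsBlock.l_mem_Icc {β : Blk} (h : S.rank.IsBlock β) :
    β.l ∈ Finset.Icc 1 (Fintype.card ι) := by
  obtain ⟨k, hk⟩ := h.l_mem
  rw [Finset.mem_Icc, ← hk]
  exact ⟨rankX_pos k, rankX_le_card _⟩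

theorem IsBlock.b_mem_Icc {β : Blk} (h : S.rank.IsBlock β) :
    β.b ∈ Finset.Icc 1 (Fintype.card ι) :=
  IsBlock.l_mem_Icc (S := S.swap) h.swap

/-- Both entries of the corner are ranks between 1 and n, which gives the bound n² on the number of
base rectangles. -/
theorem blocks_injOn_corner {T : EdgeSystem ι ℕ} :
    Set.InjOn (fun β : Blk => (β.l, β.b)) {β | T.IsBlock β} := by
  intro β hβ γ hγ h
  rw [Prod.mk.injEq] at h
  refine IsBlock.ext_of_has hβ hγ (i := β.l) (j := β.b) ⟨le_rfl, hβ.lr, le_rfl, hβ.bt⟩ ?_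
  rw [h.1, h.2]
  exact ⟨le_rfl, hγ.lr, le_rfl, hγ.bt⟩

theorem blocks_mapsTo_corner : Set.MapsTo (fun β : Blk => (β.l, β.b)) {β | S.rank.IsBlock β}
    ↑(Finset.Icc 1 (Fintype.card ι) ×ˢ Finset.Icc 1 (Fintype.card ι)) := fun β hβ => by
  rw [Finset.mem_coe, Finset.mem_product]
  exact ⟨IsBlock.l_mem_Icc hβ, IsBlock.b_mem_Icc hβ⟩

theorem finite_blocks (S : EdgeSystem ι ℝ) : {β | S.rank.IsBlock β}.Finite :=
  Set.Finite.of_injOn blocks_mapsTo_corner blocks_injOn_corner (Finset.finite_toSet _)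

theorem valX_inj {i j : ℕ} (hi : ∃ k, S.rank.vx k = i) (hj : ∃ k, S.rank.vx k = j) :
    S.valX i = S.valX j ↔ i = j :=
  ⟨fun h => by rw [← rankX_valX hi, h, rankX_valX hj], fun h => by rw [h]⟩

theorem valX_lt_iff {i j : ℕ} (hi : ∃ k, S.rank.vx k = i) (hj : ∃ k, S.rank.vx k = j) :
    S.valX i < S.valX j ↔ i < j := by
  rw [lt_valX_iff hj, rankX_valX hi]

theorem valY_inj {i j : ℕ} (hi : ∃ k, S.rank.hy k = i) (hj : ∃ k, S.rank.hy k = j) :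
    S.valY i = S.valY j ↔ i = j :=
  valX_inj (S := S.swap) hi hj

theorem valY_lt_iff {i j : ℕ} (hi : ∃ k, S.rank.hy k = i) (hj : ∃ k, S.rank.hy k = j) :
    S.valY i < S.valY j ↔ i < j :=
  valX_lt_iff (S := S.swap) hi hj

theorem Represents.ncard_baseRects (h : S.Represents P) :
    P.baseRects.ncard = {β | S.rank.IsBlock β}.ncard := by
  rw [h.baseRects_eq, blockRect_injOn.ncard_image]

theorem Represents.isLeft_iff (h : S.Represents P) {β γ : Blk} (hβ : S.rank.IsBlock β)
    (hγ : S.rank.IsBlock γ) : P.IsLeft (S.blockRect β) (S.blockRect γ) ↔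
      γ.r = β.l ∧ γ.b = β.b ∧ γ.t = β.t := by
  rw [RectilinearPolygon.IsLeft, h.baseRects_eq, hβ.blockRect_eq, hγ.blockRect_eq]
  simp only [valX_inj hγ.r_mem hβ.l_mem, valY_inj hγ.b_mem hβ.b_mem, valY_inj hγ.t_mem hβ.t_mem]
  rw [← hβ.blockRect_eq, ← hγ.blockRect_eq]
  exact ⟨fun h => h.2.2, fun h => ⟨⟨β, hβ, rfl⟩, ⟨γ, hγ, rfl⟩, h⟩⟩

theorem Represents.isRight_iff (h : S.Represents P) {β γ : Blk} (hβ : S.rank.IsBlock β)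
    (hγ : S.rank.IsBlock γ) : P.IsRight (S.blockRect β) (S.blockRect γ) ↔
      γ.l = β.r ∧ γ.b = β.b ∧ γ.t = β.t := by
  rw [RectilinearPolygon.IsRight, h.baseRects_eq, hβ.blockRect_eq, hγ.blockRect_eq]
  simp only [valX_inj hγ.l_mem hβ.r_mem, valY_inj hγ.b_mem hβ.b_mem, valY_inj hγ.t_mem hβ.t_mem]
  rw [← hβ.blockRect_eq, ← hγ.blockRect_eq]
  exact ⟨fun h => h.2.2, fun h => ⟨⟨β, hβ, rfl⟩, ⟨γ, hγ, rfl⟩, h⟩⟩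

theorem Represents.isTop_iff (h : S.Represents P) {β γ : Blk} (hβ : S.rank.IsBlock β)
    (hγ : S.rank.IsBlock γ) : P.IsTop (S.blockRect β) (S.blockRect γ) ↔
      γ.b = β.t ∧ γ.l = β.l ∧ γ.r = β.r := by
  rw [RectilinearPolygon.IsTop, h.baseRects_eq, hβ.blockRect_eq, hγ.blockRect_eq]
  simp only [valY_inj hγ.b_mem hβ.t_mem, valX_inj hγ.l_mem hβ.l_mem, valX_inj hγ.r_mem hβ.r_mem]
  rw [← hβ.blockRect_eq, ← hγ.blockRect_eq]
  exact ⟨fun h => h.2.2, fun h => ⟨⟨β, hβ, rfl⟩, ⟨γ, hγ, rfl⟩, h⟩⟩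

theorem Represents.isBottom_iff (h : S.Represents P) {β γ : Blk} (hβ : S.rank.IsBlock β)
    (hγ : S.rank.IsBlock γ) : P.IsBottom (S.blockRect β) (S.blockRect γ) ↔
      γ.t = β.b ∧ γ.l = β.l ∧ γ.r = β.r := by
  rw [RectilinearPolygon.IsBottom, h.baseRects_eq, hβ.blockRect_eq, hγ.blockRect_eq]
  simp only [valY_inj hγ.t_mem hβ.b_mem, valX_inj hγ.l_mem hβ.l_mem, valX_inj hγ.r_mem hβ.r_mem]
  rw [← hβ.blockRect_eq, ← hγ.blockRect_eq]
  exact ⟨fun h => h.2.2, fun h => ⟨⟨β, hβ, rfl⟩, ⟨γ, hγ, rfl⟩, h⟩⟩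

/-- The block to the right of a block, if the cells there are inside. -/
theorem IsBlock.exists_right {T : EdgeSystem ι ℕ} {β : Blk} (hβ : T.IsBlock β) {j : ℕ}
    (h1 : β.b ≤ j) (h2 : j < β.t) (hin : T.In β.r j) :
    ∃ γ, T.IsBlock γ ∧ γ.Has β.r j ∧ γ.l = β.r ∧ γ.b = β.b ∧ γ.t = β.t := by
  obtain ⟨γ, hγ, hhas⟩ := hin.exists_block
  have h3 := hγ.l_eq_of_wV hhas (hβ.right j h1 h2)
  have h4 := hβ.side_eq hγ h3.symm h1 h2 hhas.2.2.1 hhas.2.2.2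
  exact ⟨γ, hγ, hhas, h3, h4.1.symm, h4.2.symm⟩

/-- The block above a block, if the cells there are inside. -/
theorem IsBlock.exists_top {T : EdgeSystem ι ℕ} {β : Blk} (hβ : T.IsBlock β) {i : ℕ}
    (h1 : β.l ≤ i) (h2 : i < β.r) (hin : T.In i β.t) :
    ∃ γ, T.IsBlock γ ∧ γ.Has i β.t ∧ γ.b = β.t ∧ γ.l = β.l ∧ γ.r = β.r := by
  obtain ⟨γ, hγ, h, h3⟩ := hβ.swap.exists_right (T := T.swap) h1 h2 (T.in_swap.2 hin)
  exact ⟨γ.swap, hγ.swap, ⟨h.2.2.1, h.2.2.2, h.1, h.2.1⟩, h3⟩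

/-- Edges belong to the region. Off the edges, a limit of inner points is inside because the parity
is locally constant. -/
theorem Represents.mem_region_of_mem (h : S.Represents P) {β : Blk} (hβ : S.rank.IsBlock β)
    {p : ℝ × ℝ} (hp : p ∈ (S.blockRect β).region) : p ∈ P.region := by
  rw [h.region]
  by_cases hb : S.Bd p.1 p.2
  · exact Or.inr hb
  refine Or.inl ⟨hb, ?_⟩
  obtain ⟨ε, hε, h1⟩ := locally_constant hb
  rw [← Rect.closure_openRegion, Metric.mem_closure_iff] at hp
  obtain ⟨q, hq, hd⟩ := hp ε hε
  rw [dist_comm, Prod.dist_eq, max_lt_iff] at hd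
  exact (h1 q.1 q.2 hd.1 hd.2).2.1 (hβ.inn_of_mem hq).1.2

/-- An inner point lies in the closed rectangle of the block of its cell. Points on edges are limits
of inner points, and a finite union of closed rectangles is closed. -/
theorem Represents.region_eq (h : S.Represents P) : P.region = ⋃ B ∈ P.baseRects, B.region := by
  have hfin : P.baseRects.Finite := by
    rw [h.baseRects_eq]
    exact S.finite_blocks.image _
  have hclosed : IsClosed (⋃ B ∈ P.baseRects, B.region) :=
    hfin.isClosed_biUnion fun B _ => by
      rw [← Rect.closure_openRegion]
      exact isClosed_closure
  have hinn : ∀ p : ℝ × ℝ, S.Inn p.1 p.2 → p ∈ ⋃ B ∈ P.baseRects, B.region := by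
    intro p hp
    obtain ⟨β, hβ, h1, h2, h3, h4⟩ := (rank_in.2 hp.2).exists_block
    refine Set.mem_biUnion (h.baseRects_eq ▸ ⟨β, hβ, rfl⟩) (hβ.mem_region_iff.2
      ⟨⟨(valX_le_iff hβ.l_mem).2 h1, ((lt_valX_iff hβ.r_mem).2 h2).le⟩,
        (valY_le_iff hβ.b_mem).2 h3, ((lt_valY_iff hβ.t_mem).2 h4).le⟩)
  apply Set.Subset.antisymm
  · intro p hp
    rcases (h.region p).1 hp with h1 | h1
    · exact hinn p h1
    · rw [← hclosed.closure_eq, Metric.mem_closure_iff]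
      intro ε hε
      obtain ⟨x, y, h2, h3, h4⟩ := (exists_both_sides h1 hε).1
      refine ⟨(x, y), hinn (x, y) h4, ?_⟩
      rw [dist_comm, Prod.dist_eq, max_lt_iff]
      exact ⟨h2, h3⟩
  · refine Set.iUnion₂_subset fun B hB => ?_
    rw [h.baseRects_eq] at hB
    obtain ⟨β, hβ, rfl⟩ := hB
    exact fun p hp => h.mem_region_of_mem hβ hp

theorem Represents.isTiled [Nonempty ι] (h : S.Represents P) (hn : Fintype.card ι = P.size) :
    P.IsTiled where
  finite := by
    rw [h.baseRects_eq]
    exact S.finite_blocks.image _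
  eq_of_mem := by
    intro A hA B hB p hp hq
    rw [h.baseRects_eq] at hA hB
    obtain ⟨β, hβ, rfl⟩ := hA
    obtain ⟨γ, hγ, rfl⟩ := hB
    rw [IsBlock.ext_of_has hβ hγ (IsBlock.has_of_mem hβ hp) (IsBlock.has_of_mem hγ hq)]
  region_eq := h.region_eq
  touch_x := by
    intro A hA B hB h1 h2 h3
    rw [h.baseRects_eq] at hA hB
    obtain ⟨β, hβ, rfl⟩ := hA
    obtain ⟨γ, hγ, rfl⟩ := hB
    have hβ : S.rank.IsBlock β := hβ
    have hγ : S.rank.IsBlock γ := hγ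
    rw [hβ.blockRect_eq, hγ.blockRect_eq] at *
    simp only [valX_inj hβ.r_mem hγ.l_mem, valY_lt_iff hβ.b_mem hγ.t_mem,
      valY_lt_iff hγ.b_mem hβ.t_mem, valY_inj hβ.b_mem hγ.b_mem,
      valY_inj hβ.t_mem hγ.t_mem] at *
    have := hβ.bt
    have := hγ.bt
    exact hβ.side_eq hγ (j := max β.b γ.b) h1 (le_max_left _ _) (max_lt hβ.bt h3)
      (le_max_right _ _) (max_lt h2 hγ.bt)
  touch_y := by
    intro A hA B hB h1 h2 h3
    rw [h.baseRects_eq] at hA hB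
    obtain ⟨β, hβ, rfl⟩ := hA
    obtain ⟨γ, hγ, rfl⟩ := hB
    have hβ : S.rank.IsBlock β := hβ
    have hγ : S.rank.IsBlock γ := hγ
    rw [hβ.blockRect_eq, hγ.blockRect_eq] at *
    simp only [valY_inj hβ.t_mem hγ.b_mem, valX_lt_iff hβ.l_mem hγ.r_mem,
      valX_lt_iff hγ.l_mem hβ.r_mem, valX_inj hβ.l_mem hγ.l_mem,
      valX_inj hβ.r_mem hγ.r_mem] at *
    exact hβ.swap.side_eq hγ.swap (j := max β.l γ.l) h1 (le_max_left _ _) (max_lt hβ.lr h3)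
      (le_max_right _ _) (max_lt h2 hγ.lr)
  ncard_le := by
    rw [h.ncard_baseRects, ← hn]
    refine (Set.ncard_le_ncard_of_injOn _ blocks_mapsTo_corner blocks_injOn_corner
      (Finset.finite_toSet _)).trans ?_
    rw [Set.ncard_coe_finset, Finset.card_product, Nat.card_Icc, pow_two]
    simp
  -- This inequality turns memory bounds in terms of n into bounds in terms of the number of base
  -- rectangles.
  size_le := by
    classical
    rw [h.ncard_baseRects, ← hn]
    obtain ⟨f, hf, hfb⟩ := S.rank.exists_injective_block
      (fun k => rankX_pos (S := S.swap) k)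
    have h1 : (Set.range f).ncard ≤ ({β | S.rank.IsBlock β} ×ˢ (Set.univ : Set Bool)).ncard :=
      Set.ncard_le_ncard (by rintro _ ⟨k, rfl⟩; exact ⟨hfb k, trivial⟩)
        (S.finite_blocks.prod Set.finite_univ)
    rw [← Set.image_univ, Set.ncard_image_of_injective _ hf, Set.ncard_univ, Set.ncard_prod,
      Set.ncard_univ, Nat.card_eq_fintype_card, Nat.card_eq_fintype_card, Fintype.card_bool] at h1
    omega
  topless_le := by
    classical
    obtain ⟨f, hf⟩ := exists_injOn_topless S.rank
    have h1 : {B ∈ P.baseRects | ¬ ∃ A, P.IsTop B A} ⊆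
        S.blockRect '' {β | S.rank.IsBlock β ∧ ¬ S.rank.In β.l β.t} := by
      rintro B ⟨hB, hB'⟩
      rw [h.baseRects_eq] at hB
      obtain ⟨β, hβ, rfl⟩ := hB
      refine ⟨β, ⟨hβ, fun hin => hB' ?_⟩, rfl⟩
      obtain ⟨γ, hγ, -, h2⟩ := IsBlock.exists_top hβ le_rfl (IsBlock.lr hβ) hin
      exact ⟨S.blockRect γ, (h.isTop_iff hβ hγ).2 h2⟩
    have hfin : {β | S.rank.IsBlock β ∧ ¬ S.rank.In β.l β.t}.Finite :=
      S.finite_blocks.subset fun β hβ => hβ.1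
    refine (Set.ncard_le_ncard h1 (hfin.image _)).trans ((Set.ncard_image_le hfin).trans ?_)
    refine (Set.ncard_le_ncard_of_injOn f (t := Set.univ) (fun _ _ => trivial) hf
      Set.finite_univ).trans ?_
    rw [Set.ncard_univ, Nat.card_eq_fintype_card, Fintype.card_sum, Fintype.card_sum]
    omega
  lefts_le := by
    rw [← hn]
    have h1 : Rect.left '' P.baseRects ⊆ Set.range S.vx := by
      rintro _ ⟨B, hB, rfl⟩
      rw [h.baseRects_eq] at hB
      obtain ⟨β, hβ, rfl⟩ := hB
      rw [IsBlock.blockRect_eq hβ]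
      exact valX_mem (IsBlock.l_mem hβ)
    refine (Set.ncard_le_ncard h1 (Set.finite_range _)).trans ?_
    rw [← Set.image_univ]
    refine (Set.ncard_image_le Set.finite_univ).trans ?_
    rw [Set.ncard_univ, Nat.card_eq_fintype_card]
  bottoms_le := by
    rw [← hn]
    have h1 : Rect.bottom '' P.baseRects ⊆ Set.range S.hy := by
      rintro _ ⟨B, hB, rfl⟩
      rw [h.baseRects_eq] at hB
      obtain ⟨β, hβ, rfl⟩ := hB
      rw [IsBlock.blockRect_eq hβ]
      exact valY_mem (IsBlock.b_mem hβ)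
    refine (Set.ncard_le_ncard h1 (Set.finite_range _)).trans ?_
    rw [← Set.image_univ]
    refine (Set.ncard_image_le Set.finite_univ).trans ?_
    rw [Set.ncard_univ, Nat.card_eq_fintype_card]

end EdgeSystem

namespace RectilinearPolygon

variable {P : RectilinearPolygon}

/-! ### Neighbours and heights -/

theorem isLeft_iff_isRight {A B : Rect} : P.IsLeft B A ↔ P.IsRight A B :=
  ⟨fun ⟨h1, h2, h3, h4, h5⟩ => ⟨h2, h1, h3.symm, h4.symm, h5.symm⟩,
    fun ⟨h1, h2, h3, h4, h5⟩ => ⟨h2, h1, h3.symm, h4.symm, h5.symm⟩⟩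

theorem isTop_iff_isBottom {A B : Rect} : P.IsTop B A ↔ P.IsBottom A B :=
  ⟨fun ⟨h1, h2, h3, h4, h5⟩ => ⟨h2, h1, h3.symm, h4.symm, h5.symm⟩,
    fun ⟨h1, h2, h3, h4, h5⟩ => ⟨h2, h1, h3.symm, h4.symm, h5.symm⟩⟩

namespace IsTiled

theorem eq_of_lt (h : P.IsTiled) {A B : Rect} (hA : A ∈ P.baseRects) (hB : B ∈ P.baseRects)
    (h1 : A.left < B.right) (h2 : B.left < A.right) (h3 : A.bottom < B.top)
    (h4 : B.bottom < A.top) : A = B := by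
  obtain ⟨x, hx⟩ := exists_between (max_lt (lt_min A.left_lt_right h1) (lt_min h2 B.left_lt_right))
  obtain ⟨y, hy⟩ := exists_between (max_lt (lt_min A.bottom_lt_top h3) (lt_min h4 B.bottom_lt_top))
  simp only [max_lt_iff, lt_min_iff] at hx hy
  exact h.eq_of_mem A hA B hB (x, y) ⟨⟨hx.1.1, hx.2.1⟩, ⟨hy.1.1, hy.2.1⟩⟩
    ⟨⟨hx.1.2, hx.2.2⟩, ⟨hy.1.2, hy.2.2⟩⟩

theorem left_unique (h : P.IsTiled) {B A A' : Rect} (h1 : P.IsLeft B A) (h2 : P.IsLeft B A') :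
    A = A' := by
  obtain ⟨-, a1, a2, a3, a4⟩ := h1
  obtain ⟨-, b1, b2, b3, b4⟩ := h2
  have := A.left_lt_right
  have := A'.left_lt_right
  have := B.bottom_lt_top
  exact h.eq_of_lt a1 b1 (by linarith) (by linarith) (by linarith) (by linarith)

theorem right_unique (h : P.IsTiled) {B A A' : Rect} (h1 : P.IsRight B A) (h2 : P.IsRight B A') :
    A = A' := by
  obtain ⟨-, a1, a2, a3, a4⟩ := h1
  obtain ⟨-, b1, b2, b3, b4⟩ := h2
  have := A.left_lt_right
  have := A'.left_lt_right
  have := B.bottom_lt_top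
  exact h.eq_of_lt a1 b1 (by linarith) (by linarith) (by linarith) (by linarith)

theorem top_unique (h : P.IsTiled) {B A A' : Rect} (h1 : P.IsTop B A) (h2 : P.IsTop B A') :
    A = A' := by
  obtain ⟨-, a1, a2, a3, a4⟩ := h1
  obtain ⟨-, b1, b2, b3, b4⟩ := h2
  have := A.bottom_lt_top
  have := A'.bottom_lt_top
  have := B.left_lt_right
  exact h.eq_of_lt a1 b1 (by linarith) (by linarith) (by linarith) (by linarith)

theorem bottom_unique (h : P.IsTiled) {B A A' : Rect} (h1 : P.IsBottom B A)
    (h2 : P.IsBottom B A') : A = A' := by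
  obtain ⟨-, a1, a2, a3, a4⟩ := h1
  obtain ⟨-, b1, b2, b3, b4⟩ := h2
  have := A.bottom_lt_top
  have := A'.bottom_lt_top
  have := B.left_lt_right
  exact h.eq_of_lt a1 b1 (by linarith) (by linarith) (by linarith) (by linarith)

end IsTiled

/-- The number of left coordinates to the left of `B`. -/
noncomputable def leftRank (P : RectilinearPolygon) (B : Rect) : ℕ :=
  {x ∈ Rect.left '' P.baseRects | x < B.left}.ncard

/-- The number of left coordinates to the right of that of `B`. -/
noncomputable def rightRank (P : RectilinearPolygon) (B : Rect) : ℕ :=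
  {x ∈ Rect.left '' P.baseRects | B.left < x}.ncard

/-- The number of bottom coordinates below that of `B`. -/
noncomputable def bottomRank (P : RectilinearPolygon) (B : Rect) : ℕ :=
  {y ∈ Rect.bottom '' P.baseRects | y < B.bottom}.ncard

/-- The number of bottom coordinates above that of `B`. -/
noncomputable def topRank (P : RectilinearPolygon) (B : Rect) : ℕ :=
  {y ∈ Rect.bottom '' P.baseRects | B.bottom < y}.ncard

namespace IsTiled

/-- The left side of `A` is counted for `B` but not for `A`. As there are at most n different left
sides, a walk to the left has at most n steps; the other three ranks serve the other directions. -/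
theorem leftRank_lt (h : P.IsTiled) {B A : Rect} (hl : P.IsLeft B A) :
    P.leftRank A < P.leftRank B := by
  obtain ⟨-, hA, h1, -⟩ := hl
  have := A.left_lt_right
  refine Set.ncard_lt_ncard ⟨fun x hx => ⟨hx.1, by linarith [hx.2]⟩, fun hs => ?_⟩
    ((h.finite.image _).subset fun x hx => hx.1)
  exact lt_irrefl _ (hs ⟨⟨A, hA, rfl⟩, by linarith⟩).2

theorem rightRank_lt (h : P.IsTiled) {B A : Rect} (hl : P.IsRight B A) :
    P.rightRank A < P.rightRank B := by
  obtain ⟨-, hA, h1, -⟩ := hl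
  have := B.left_lt_right
  refine Set.ncard_lt_ncard ⟨fun x hx => ⟨hx.1, by linarith [hx.2]⟩, fun hs => ?_⟩
    ((h.finite.image _).subset fun x hx => hx.1)
  exact lt_irrefl _ (hs ⟨⟨A, hA, rfl⟩, by linarith⟩).2

theorem bottomRank_lt (h : P.IsTiled) {B A : Rect} (hl : P.IsBottom B A) :
    P.bottomRank A < P.bottomRank B := by
  obtain ⟨-, hA, h1, -⟩ := hl
  have := A.bottom_lt_top
  refine Set.ncard_lt_ncard ⟨fun x hx => ⟨hx.1, by linarith [hx.2]⟩, fun hs => ?_⟩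
    ((h.finite.image _).subset fun x hx => hx.1)
  exact lt_irrefl _ (hs ⟨⟨A, hA, rfl⟩, by linarith⟩).2

theorem topRank_lt (h : P.IsTiled) {B A : Rect} (hl : P.IsTop B A) :
    P.topRank A < P.topRank B := by
  obtain ⟨-, hA, h1, -⟩ := hl
  have := B.bottom_lt_top
  refine Set.ncard_lt_ncard ⟨fun x hx => ⟨hx.1, by linarith [hx.2]⟩, fun hs => ?_⟩
    ((h.finite.image _).subset fun x hx => hx.1)
  exact lt_irrefl _ (hs ⟨⟨A, hA, rfl⟩, by linarith⟩).2

theorem leftRank_le (h : P.IsTiled) (B : Rect) : P.leftRank B ≤ P.size :=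
  (Set.ncard_le_ncard (fun _ hx => hx.1) (h.finite.image _)).trans h.lefts_le

theorem rightRank_le (h : P.IsTiled) (B : Rect) : P.rightRank B ≤ P.size :=
  (Set.ncard_le_ncard (fun _ hx => hx.1) (h.finite.image _)).trans h.lefts_le

theorem bottomRank_le (h : P.IsTiled) (B : Rect) : P.bottomRank B ≤ P.size :=
  (Set.ncard_le_ncard (fun _ hx => hx.1) (h.finite.image _)).trans h.bottoms_le

theorem le_bottomRank (h : P.IsTiled) {k : ℕ} : ∀ {B A : Rect}, P.BottomSteps k B A →
    k ≤ P.bottomRank B := by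
  induction k with
  | zero => exact fun _ => Nat.zero_le _
  | succ k ih =>
    rintro B A ⟨D, hD, hs⟩
    exact (Nat.succ_le_succ (ih hs)).trans (h.bottomRank_lt hD)

/-- With this the supremum in `height` is a maximum; for an unbounded set `sSup` would be the
default value `0`. -/
theorem bddAbove_steps (h : P.IsTiled) (B : Rect) : BddAbove {k | ∃ A, P.BottomSteps k B A} :=
  ⟨P.bottomRank B, fun _ ⟨_, hA⟩ => h.le_bottomRank hA⟩

theorem le_height (h : P.IsTiled) {B A : Rect} {k : ℕ} (hs : P.BottomSteps k B A) :
    k ≤ P.height B := le_csSup (h.bddAbove_steps B) ⟨A, hs⟩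

theorem exists_steps_height (h : P.IsTiled) (B : Rect) : ∃ A, P.BottomSteps (P.height B) B A :=
  Nat.sSup_mem (s := {k | ∃ A, P.BottomSteps k B A}) ⟨0, B, rfl⟩ (h.bddAbove_steps B)

theorem height_le (h : P.IsTiled) (B : Rect) : P.height B ≤ P.size := by
  obtain ⟨A, hA⟩ := h.exists_steps_height B
  exact (h.le_bottomRank hA).trans (h.bottomRank_le B)

theorem height_eq_zero (h : P.IsTiled) {B : Rect} (hB : ¬ ∃ A, P.IsBottom B A) :
    P.height B = 0 := by
  obtain ⟨A, hA⟩ := h.exists_steps_height B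
  cases hk : P.height B with
  | zero => rfl
  | succ k =>
    rw [hk] at hA
    obtain ⟨D, hD, -⟩ := hA
    exact absurd ⟨D, hD⟩ hB

theorem height_succ (h : P.IsTiled) {B D : Rect} (hD : P.IsBottom B D) :
    P.height B = P.height D + 1 := by
  apply le_antisymm
  · obtain ⟨A, hA⟩ := h.exists_steps_height B
    cases hk : P.height B with
    | zero => exact Nat.zero_le _
    | succ k =>
      rw [hk] at hA
      obtain ⟨D', hD', hs⟩ := hA
      rw [h.bottom_unique hD hD']
      exact Nat.succ_le_succ (h.le_height hs)
  · obtain ⟨A, hA⟩ := h.exists_steps_height D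
    exact h.le_height ⟨D, hD, hA⟩

end IsTiled

theorem bottomSteps_add {k m : ℕ} : ∀ {B E : Rect}, P.BottomSteps (k + m) B E ↔
    ∃ D, P.BottomSteps k B D ∧ P.BottomSteps m D E := by
  induction k with
  | zero =>
    intro B E
    rw [Nat.zero_add]
    exact ⟨fun h => ⟨B, rfl, h⟩, fun ⟨D, hD, h⟩ => by rwa [← show D = B from hD]⟩
  | succ k ih =>
    intro B E
    rw [Nat.succ_add]
    constructor
    · rintro ⟨F, hF, h⟩
      obtain ⟨D, h1, h2⟩ := ih.1 h
      exact ⟨D, ⟨F, hF, h1⟩, h2⟩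
    · rintro ⟨D, ⟨F, hF, h1⟩, h2⟩
      exact ⟨F, hF, ih.2 ⟨D, h1, h2⟩⟩

theorem bottomSteps_one {B E : Rect} : P.BottomSteps 1 B E ↔ P.IsBottom B E :=
  ⟨fun ⟨_, hD, h⟩ => by rwa [show E = _ from h], fun h => ⟨E, h, rfl⟩⟩

theorem BottomSteps.bounds {k : ℕ} : ∀ {B E : Rect}, P.BottomSteps k B E → B ∈ P.baseRects →
    E ∈ P.baseRects ∧ E.left = B.left ∧ E.right = B.right ∧ E.top ≤ B.top ∧ E.bottom ≤ B.bottom ∧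
      (0 < k → E.top ≤ B.bottom) := by
  induction k with
  | zero =>
    rintro B E h hB
    obtain rfl : E = B := h
    exact ⟨hB, rfl, rfl, le_rfl, le_rfl, fun h => absurd h (lt_irrefl _)⟩
  | succ k ih =>
    rintro B E ⟨D, ⟨-, hD, h1, h2, h3⟩, hs⟩ -
    obtain ⟨g1, g2, g3, g4, g5, -⟩ := ih hs hD
    have := D.bottom_lt_top
    have := B.bottom_lt_top
    exact ⟨g1, g2.trans h2, g3.trans h3, by linarith, by linarith, fun _ => by linarith⟩

namespace IsTiled

theorem steps_unique (h : P.IsTiled) {k : ℕ} : ∀ {B E E' : Rect}, P.BottomSteps k B E →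
    P.BottomSteps k B E' → E = E' := by
  induction k with
  | zero =>
    intro B E E' h1 h2
    exact Eq.trans h1 (Eq.symm h2)
  | succ k ih =>
    rintro B E E' ⟨D, hD, hs⟩ ⟨D', hD', hs'⟩
    obtain rfl := h.bottom_unique hD hD'
    exact ih hs hs'

/-- Moving down and moving to the left commute. -/
theorem left_of_steps (h : P.IsTiled) {k : ℕ} : ∀ {D A D' A' : Rect}, P.IsLeft D A →
    P.BottomSteps k D D' → P.BottomSteps k A A' → P.IsLeft D' A' := by
  induction k with
  | zero =>
    intro D A D' A' hl h1 h2
    rwa [show D' = D from h1, show A' = A from h2]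
  | succ k ih =>
    rintro D A D' A' ⟨-, -, hl⟩ ⟨E, ⟨-, hE, e1, e2, e3⟩, h1⟩ ⟨F, ⟨-, hF, f1, f2, f3⟩, h2⟩
    refine ih ?_ h1 h2
    have := E.bottom_lt_top
    have := F.bottom_lt_top
    have ht : F.top = E.top := by rw [f1, e1, hl.2.1]
    have hr : F.right = E.left := by rw [f3, e2, hl.1]
    -- The rectangles below two neighbours touch along a part of their sides just under the common
    -- top, so they share the whole side.
    have := h.touch_x F hF E hE hr (by linarith) (by linarith)
    exact ⟨hE, hF, hr, this.1, ht⟩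

theorem steps_subset (h : P.IsTiled) {k : ℕ} : ∀ {D E : Rect}, P.BottomSteps k D E →
    D ∈ P.baseRects → ∀ x y, D.left ≤ x → x ≤ D.right → E.bottom ≤ y → y ≤ D.top →
      (x, y) ∈ P.region := by
  have self : ∀ D ∈ P.baseRects, ∀ x y, D.left ≤ x → x ≤ D.right → D.bottom ≤ y → y ≤ D.top →
      (x, y) ∈ P.region := by
    intro D hD x y h1 h2 h3 h4
    rw [h.region_eq]
    exact Set.mem_biUnion hD ⟨⟨h1, h2⟩, ⟨h3, h4⟩⟩
  induction k with
  | zero =>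
    rintro D E hs hD
    obtain rfl : E = D := hs
    exact self _ hD
  | succ k ih =>
    rintro D E ⟨F, ⟨-, hF, f1, f2, f3⟩, hs⟩ hD x y h1 h2 h3 h4
    rcases le_total y D.bottom with h5 | h5
    · exact ih hs hF x y (f2 ▸ h1) (f3 ▸ h2) h3 (f1 ▸ h5)
    · exact self D hD x y h1 h2 h5 h4

/-! ### The region next to a missing neighbour -/

/-- A point off the finitely many lines through sides, when it is in the region, lies in the open
part of a base rectangle. -/
theorem exists_overlap (h : P.IsTiled) {a b c d : ℝ} (hab : a < b) (hcd : c < d)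
    (hsub : ∀ x y, a < x → x < b → c < y → y < d → (x, y) ∈ P.region) :
    ∃ A ∈ P.baseRects, A.left < b ∧ a < A.right ∧ A.bottom < d ∧ c < A.top := by
  obtain ⟨x, hx, hx'⟩ := (Set.Ioo_infinite hab).exists_notMem_finite
    ((h.finite.image Rect.left).union (h.finite.image Rect.right))
  obtain ⟨y, hy, hy'⟩ := (Set.Ioo_infinite hcd).exists_notMem_finite
    ((h.finite.image Rect.bottom).union (h.finite.image Rect.top))
  have h1 := hsub x y hx.1 hx.2 hy.1 hy.2
  rw [h.region_eq] at h1
  obtain ⟨A, hA, ⟨h2, h3⟩, h4, h5⟩ := Set.mem_iUnion₂.1 h1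
  have e1 : A.left ≠ x := fun h6 => hx' (Or.inl ⟨A, hA, h6⟩)
  have e2 : A.right ≠ x := fun h6 => hx' (Or.inr ⟨A, hA, h6⟩)
  have e3 : A.bottom ≠ y := fun h6 => hy' (Or.inl ⟨A, hA, h6⟩)
  have e4 : A.top ≠ y := fun h6 => hy' (Or.inr ⟨A, hA, h6⟩)
  exact ⟨A, hA, (lt_of_le_of_ne h2 e1).trans hx.2, hx.1.trans (lt_of_le_of_ne h3 e2.symm),
    (lt_of_le_of_ne h4 e3).trans hy.2, hy.1.trans (lt_of_le_of_ne h5 e4.symm)⟩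

theorem _root_.Set.Finite.exists_gap_left {F : Set ℝ} (hF : F.Finite) {w c : ℝ} (hwc : w < c) :
    ∃ x, w < x ∧ x < c ∧ ∀ f ∈ F, x < f → c ≤ f := by
  have h1 : ∀ᶠ x in nhdsWithin c (Set.Iio c), ∀ f ∈ F, x < f → c ≤ f := by
    rw [Filter.eventually_all_finite hF]
    intro f _
    rcases lt_or_ge f c with h | h
    · filter_upwards [Ioo_mem_nhdsLT h] with x hx hx'
      exact absurd hx' hx.1.not_gt
    · exact Filter.Eventually.of_forall fun _ _ => h
  obtain ⟨x, h2, h3⟩ := (h1.and (Ioo_mem_nhdsLT hwc)).exists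
  exact ⟨x, h3.1, h3.2, h2⟩

theorem _root_.Set.Finite.exists_gap_right {F : Set ℝ} (hF : F.Finite) {w c : ℝ} (hwc : c < w) :
    ∃ x, c < x ∧ x < w ∧ ∀ f ∈ F, f < x → f ≤ c := by
  have h1 : ∀ᶠ x in nhdsWithin c (Set.Ioi c), ∀ f ∈ F, f < x → f ≤ c := by
    rw [Filter.eventually_all_finite hF]
    intro f _
    rcases lt_or_ge c f with h | h
    · filter_upwards [Ioo_mem_nhdsGT h] with x hx hx'
      exact absurd hx' hx.2.not_gt
    · exact Filter.Eventually.of_forall fun _ _ => h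
  obtain ⟨x, h2, h3⟩ := (h1.and (Ioo_mem_nhdsGT hwc)).exists
  exact ⟨x, h3.1, h3.2, h2⟩

/-- In a strip beside `B` so thin that no right side lies in it, an overlapping base rectangle must
reach up to `B`, and it ends there since it cannot overlap `B`. By `touch_x` it shares the whole
side, even if only a part of the side was known to border on the region. -/
theorem exists_left (h : P.IsTiled) {B : Rect} (hB : B ∈ P.baseRects) {w c d : ℝ}
    (hw : w < B.left) (hcd : c < d) (hc : B.bottom ≤ c) (hd : d ≤ B.top)
    (hsub : ∀ x y, w < x → x < B.left → c < y → y < d → (x, y) ∈ P.region) :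
    ∃ A, P.IsLeft B A := by
  obtain ⟨x, h1, h2, h3⟩ := (h.finite.image Rect.right).exists_gap_left hw
  obtain ⟨A, hA, a1, a2, a3, a4⟩ := h.exists_overlap h2 hcd
    fun x' y' g1 g2 g3 g4 => hsub x' y' (h1.trans g1) g2 g3 g4
  have h4 := h3 _ ⟨A, hA, rfl⟩ a2
  have h5 : A.right = B.left := by
    by_contra h5
    have := B.left_lt_right
    have := h.eq_of_lt hA hB (by linarith) (lt_of_le_of_ne h4 (Ne.symm h5)) (by linarith)
      (by linarith)
    rw [this] at a1
    exact lt_irrefl _ a1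
  have h6 := h.touch_x A hA B hB h5 (by linarith) (by linarith)
  exact ⟨A, hB, hA, h5, h6⟩

theorem exists_right (h : P.IsTiled) {B : Rect} (hB : B ∈ P.baseRects) {w c d : ℝ}
    (hw : B.right < w) (hcd : c < d) (hc : B.bottom ≤ c) (hd : d ≤ B.top)
    (hsub : ∀ x y, B.right < x → x < w → c < y → y < d → (x, y) ∈ P.region) :
    ∃ A, P.IsRight B A := by
  obtain ⟨x, h1, h2, h3⟩ := (h.finite.image Rect.left).exists_gap_right hw
  obtain ⟨A, hA, a1, a2, a3, a4⟩ := h.exists_overlap h1 hcd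
    fun x' y' g1 g2 g3 g4 => hsub x' y' g1 (g2.trans h2) g3 g4
  have h4 := h3 _ ⟨A, hA, rfl⟩ a1
  have h5 : A.left = B.right := by
    by_contra h5
    have := B.left_lt_right
    have := h.eq_of_lt hA hB (lt_of_le_of_ne h4 h5) (by linarith) (by linarith)
      (by linarith)
    rw [this] at a2
    exact lt_irrefl _ a2
  have h6 := h.touch_x B hB A hA h5.symm (by linarith) (by linarith)
  exact ⟨A, hB, hA, h5, h6.1.symm, h6.2.symm⟩

theorem exists_bottom (h : P.IsTiled) {B : Rect} (hB : B ∈ P.baseRects) {w a b : ℝ}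
    (hw : w < B.bottom) (hab : a < b) (ha : B.left ≤ a) (hb : b ≤ B.right)
    (hsub : ∀ x y, a < x → x < b → w < y → y < B.bottom → (x, y) ∈ P.region) :
    ∃ A, P.IsBottom B A := by
  obtain ⟨y, h1, h2, h3⟩ := (h.finite.image Rect.top).exists_gap_left hw
  obtain ⟨A, hA, a1, a2, a3, a4⟩ := h.exists_overlap hab h2
    fun x' y' g1 g2 g3 g4 => hsub x' y' g1 g2 (h1.trans g3) g4
  have h4 := h3 _ ⟨A, hA, rfl⟩ a4
  have h5 : A.top = B.bottom := by
    by_contra h5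
    have := B.bottom_lt_top
    have := h.eq_of_lt hA hB (by linarith) (by linarith) (by linarith)
      (lt_of_le_of_ne h4 (Ne.symm h5))
    rw [this] at a3
    exact lt_irrefl _ a3
  have h6 := h.touch_y A hA B hB h5 (by linarith) (by linarith)
  exact ⟨A, hB, hA, h5, h6⟩

theorem exists_top (h : P.IsTiled) {B : Rect} (hB : B ∈ P.baseRects) {w a b : ℝ}
    (hw : B.top < w) (hab : a < b) (ha : B.left ≤ a) (hb : b ≤ B.right)
    (hsub : ∀ x y, a < x → x < b → B.top < y → y < w → (x, y) ∈ P.region) :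
    ∃ A, P.IsTop B A := by
  obtain ⟨y, h1, h2, h3⟩ := (h.finite.image Rect.bottom).exists_gap_right hw
  obtain ⟨A, hA, a1, a2, a3, a4⟩ := h.exists_overlap hab h1
    fun x' y' g1 g2 g3 g4 => hsub x' y' g1 g2 g3 (g4.trans h2)
  have h4 := h3 _ ⟨A, hA, rfl⟩ a3
  have h5 : A.bottom = B.top := by
    by_contra h5
    have := B.bottom_lt_top
    have := h.eq_of_lt hA hB (by linarith) (by linarith) (lt_of_le_of_ne h4 h5)
      (by linarith)
    rw [this] at a4
    exact lt_irrefl _ a4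
  have h6 := h.touch_y B hB A hA h5.symm (by linarith) (by linarith)
  exact ⟨A, hB, hA, h5, h6.1.symm, h6.2.symm⟩

/-! ### The reported rectangles -/

/-- One step of a walk that keeps the height. -/
theorem step_column (h : P.IsTiled) {B D A E : Rect} {k : ℕ} (hs : P.IsLeft D A ∨ P.IsRight D A)
    (hh : k ≤ P.height A) (hD : D ∈ P.baseRects ∧ D.top = B.top ∧ D.bottom = B.bottom ∧
      ∃ F, P.BottomSteps k D F ∧ F.bottom = E.bottom) :
    A ∈ P.baseRects ∧ A.top = B.top ∧ A.bottom = B.bottom ∧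
      ∃ F, P.BottomSteps k A F ∧ F.bottom = E.bottom := by
  obtain ⟨-, h1, h2, F, hF, hFE⟩ := hD
  obtain ⟨G, hG⟩ := h.exists_steps_height A
  obtain ⟨m, hm⟩ := Nat.exists_eq_add_of_le hh
  rw [hm] at hG
  obtain ⟨A', hA', -⟩ := bottomSteps_add.1 hG
  rcases hs with hs | hs
  · have h3 := h.left_of_steps hs hF hA'
    exact ⟨hs.2.1, hs.2.2.2.2.trans h1, hs.2.2.2.1.trans h2, A', hA', h3.2.2.2.1.trans hFE⟩
  · have h3 := h.left_of_steps (isLeft_iff_isRight.2 hs) hA' hF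
    exact ⟨hs.2.1, hs.2.2.2.2.trans h1, hs.2.2.2.1.trans h2, A', hA', h3.2.2.2.1.symm.trans hFE⟩

/-- The invariant of the walk: each column visited goes down at least `k` steps, and by
`left_of_steps` these end at the same level in all columns. So the columns fill up a rectangle. -/
theorem walk_left (h : P.IsTiled) {B E B₁ : Rect} {k : ℕ} (hB : B ∈ P.baseRects)
    (hE : P.BottomSteps k B E)
    (hw : Relation.ReflTransGen (fun D A => P.IsLeft D A ∧ k ≤ P.height A) B B₁) :
    (B₁ ∈ P.baseRects ∧ B₁.top = B.top ∧ B₁.bottom = B.bottom ∧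
      ∃ F, P.BottomSteps k B₁ F ∧ F.bottom = E.bottom) ∧ B₁.left ≤ B.left ∧
    ∀ x y, B₁.left ≤ x → x ≤ B.right → E.bottom ≤ y → y ≤ B.top → (x, y) ∈ P.region := by
  induction hw with
  | refl => exact ⟨⟨hB, rfl, rfl, E, hE, rfl⟩, le_rfl, h.steps_subset hE hB⟩
  | @tail D A _ hs ih =>
    obtain ⟨h1, h2, h3⟩ := ih
    have h4 := h.step_column (Or.inl hs.1) hs.2 h1
    have := A.left_lt_right
    have h5 := hs.1.2.2.1
    refine ⟨h4, by linarith, fun x y g1 g2 g3 g4 => ?_⟩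
    rcases le_total x D.left with h6 | h6
    · obtain ⟨hA, h7, -, F, hF, h8⟩ := h4
      exact h.steps_subset hF hA x y g1 (by linarith) (by linarith) (by linarith)
    · exact h3 x y h6 g2 g3 g4

theorem walk_right (h : P.IsTiled) {B E B₂ : Rect} {k : ℕ} (hB : B ∈ P.baseRects)
    (hE : P.BottomSteps k B E)
    (hw : Relation.ReflTransGen (fun D A => P.IsRight D A ∧ k ≤ P.height A) B B₂) :
    (B₂ ∈ P.baseRects ∧ B₂.top = B.top ∧ B₂.bottom = B.bottom ∧
      ∃ F, P.BottomSteps k B₂ F ∧ F.bottom = E.bottom) ∧ B.right ≤ B₂.right ∧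
    ∀ x y, B.left ≤ x → x ≤ B₂.right → E.bottom ≤ y → y ≤ B.top → (x, y) ∈ P.region := by
  induction hw with
  | refl => exact ⟨⟨hB, rfl, rfl, E, hE, rfl⟩, le_rfl, h.steps_subset hE hB⟩
  | @tail D A _ hs ih =>
    obtain ⟨h1, h2, h3⟩ := ih
    have h4 := h.step_column (Or.inr hs.1) hs.2 h1
    have := A.left_lt_right
    have h5 := hs.1.2.2.1
    refine ⟨h4, by linarith, fun x y g1 g2 g3 g4 => ?_⟩
    rcases le_total x D.right with h6 | h6
    · exact h3 x y g1 h6 g3 g4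
    · obtain ⟨hA, h7, -, F, hF, h8⟩ := h4
      exact h.steps_subset hF hA x y (by linarith) g2 (by linarith) (by linarith)

/-- A neighbouring column that is lower ends above the end of the higher column. -/
theorem exists_lower_end (h : P.IsTiled) {D A F : Rect} {k : ℕ} (hs : P.IsLeft D A ∨ P.IsRight D A)
    (hF : P.BottomSteps k D F) (hk : P.height A < k) :
    ∃ A' ∈ P.baseRects, F.bottom < A'.bottom ∧ A'.top ≤ A.top ∧ A'.left = A.left ∧
      A'.right = A.right ∧ ¬ ∃ G, P.IsBottom A' G := by
  obtain ⟨m, rfl⟩ := Nat.exists_eq_add_of_le (Nat.succ_le_of_lt hk)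
  rw [Nat.succ_add, ← Nat.add_succ] at hF
  obtain ⟨D', hD', G, hG, hGF⟩ := bottomSteps_add.1 hF
  obtain ⟨A', hA'⟩ := h.exists_steps_height A
  have h1 : A ∈ P.baseRects ∧ A'.bottom = D'.bottom := by
    rcases hs with hs | hs
    · exact ⟨hs.2.1, (h.left_of_steps hs hD' hA').2.2.2.1⟩
    · exact ⟨hs.2.1, (h.left_of_steps (isLeft_iff_isRight.2 hs) hA' hD').2.2.2.1.symm⟩
  obtain ⟨b1, b2, b3, b4, -, -⟩ := hA'.bounds h1.1
  have h2 := (hGF.bounds hG.2.1).2.2.2.2.1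
  have h3 := G.bottom_lt_top
  have h4 := hG.2.2.1
  refine ⟨A', b1, by linarith [h1.2], b4, b2, b3, ?_⟩
  rintro ⟨G, hG⟩
  have := h.le_height (bottomSteps_add.2 ⟨A', hA', bottomSteps_one.2 hG⟩)
  omega

/-- A larger rectangle reaching further left would give `B₁` a left neighbour, necessarily of
smaller height. The column of that neighbour ends above the bottom of `R` although the region
continues below it, contrary to `exists_bottom`; the right side is similar. Growth downwards would
prolong the column of `B`, and growth upwards would give `B` a top neighbour. -/
theorem isMaximalRect_of_reports (h : P.IsTiled) {B R : Rect} (hR : P.Reports B R) :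
    P.IsMaximalRect R := by
  obtain ⟨hB, hBt, B₁, B₂, B₃, w1, m1, w2, m2, s3, rl, rt, rr, rb⟩ := hR
  obtain ⟨E, hE⟩ := h.exists_steps_height B
  obtain ⟨⟨hB1, t1, b1, F1, hF1, e1⟩, l1, c1⟩ := h.walk_left hB hE w1
  obtain ⟨⟨hB2, t2, b2, F2, hF2, e2⟩, l2, c2⟩ := h.walk_right hB hE w2
  obtain rfl := h.steps_unique hF2 s3
  obtain ⟨g1, g2, g3, g4, g5, -⟩ := hF2.bounds hB2
  obtain ⟨k1, k2, k3, k4, k5, -⟩ := hE.bounds hB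
  have hlr := B.left_lt_right
  have hbt := B.bottom_lt_top
  have hlr1 := B₁.left_lt_right
  have hbt1 := B₁.bottom_lt_top
  have hlr2 := B₂.left_lt_right
  have hbt2 := B₂.bottom_lt_top
  refine ⟨?_, fun R' hsub hreg => ?_⟩
  · rintro ⟨x, y⟩ ⟨⟨h1, h2⟩, h3, h4⟩
    simp only at h1 h2 h3 h4
    rcases le_total x B.right with h5 | h5
    · exact c1 x y (by linarith) h5 (by linarith) (by linarith)
    · exact c2 x y (by linarith) (by linarith) (by linarith) (by linarith)
  · have rlr := R.left_lt_right.le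
    have rbt := R.bottom_lt_top.le
    obtain ⟨⟨i1, -⟩, i2, -⟩ :=
      hsub (show (R.left, R.bottom) ∈ R.region from ⟨⟨le_rfl, rlr⟩, le_rfl, rbt⟩)
    obtain ⟨⟨-, i3⟩, -, i4⟩ :=
      hsub (show (R.right, R.top) ∈ R.region from ⟨⟨rlr, le_rfl⟩, rbt, le_rfl⟩)
    simp only at i1 i2 i3 i4
    have hreg : ∀ x y, R'.left ≤ x → x ≤ R'.right → R'.bottom ≤ y → y ≤ R'.top →
        (x, y) ∈ P.region := fun x y h1 h2 h3 h4 => hreg ⟨⟨h1, h2⟩, h3, h4⟩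
    ext
    · refine le_antisymm i1 (le_of_not_gt fun hlt => ?_)
      obtain ⟨A, hA⟩ := h.exists_left hB1 (by linarith) hbt1 le_rfl le_rfl fun x y h1 h2 h3 h4 =>
        hreg x y h1.le (by linarith) (by linarith) (by linarith)
      have hAr := hA.2.2.1
      have hAt := hA.2.2.2.2
      obtain ⟨A', hA', a1, a2, a3, a4, a5⟩ := h.exists_lower_end (Or.inl hA) hF1 (m1 A hA)
      have := A'.bottom_lt_top
      exact a5 (h.exists_bottom hA' a1
        (max_lt (by linarith) A'.left_lt_right : max R'.left A'.left < A'.right)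
        (le_max_right _ _) le_rfl fun x y h1 h2 h3 h4 => hreg x y ((le_max_left _ _).trans h1.le)
          (by linarith) (by linarith) (by linarith))
    · refine le_antisymm (le_of_not_gt fun hlt => ?_) i3
      obtain ⟨A, hA⟩ := h.exists_right hB2 (w := R'.right) (by linarith) hbt2 le_rfl le_rfl
        fun x y h1 h2 h3 h4 => hreg x y (by linarith) h2.le (by linarith) (by linarith)
      have hAr := hA.2.2.1
      have hAt := hA.2.2.2.2
      obtain ⟨A', hA', a1, a2, a3, a4, a5⟩ := h.exists_lower_end (Or.inr hA) hF2 (m2 A hA)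
      have := A'.bottom_lt_top
      exact a5 (h.exists_bottom hA' a1
        (lt_min (by linarith) A'.left_lt_right : A'.left < min R'.right A'.right)
        le_rfl (min_le_right _ _) fun x y h1 h2 h3 h4 => hreg x y (by linarith)
          (h2.le.trans (min_le_left _ _)) (by linarith) (by linarith))
    · refine le_antisymm i2 (le_of_not_gt fun hlt => ?_)
      obtain ⟨A, hA⟩ := h.exists_bottom k1 (w := R'.bottom) (by linarith) E.left_lt_right le_rfl
        le_rfl fun x y h1 h2 h3 h4 => hreg x y (by linarith) (by linarith) h3.le
          (by linarith [E.bottom_lt_top])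
      have := h.le_height (bottomSteps_add.2 ⟨E, hE, bottomSteps_one.2 hA⟩)
      omega
    · refine le_antisymm (le_of_not_gt fun hlt => ?_) i4
      exact hBt (h.exists_top hB (w := R'.top) (by linarith) hlr le_rfl
        le_rfl fun x y h1 h2 h3 h4 => hreg x y (by linarith) (by linarith) (by linarith) h4.le)

/-! ### Existence and uniqueness of reports, covering and counting -/

theorem exists_walk_left (h : P.IsTiled) (k : ℕ) (B : Rect) : ∃ B₁,
    Relation.ReflTransGen (fun D A => P.IsLeft D A ∧ k ≤ P.height A) B B₁ ∧
      ∀ A, P.IsLeft B₁ A → P.height A < k := by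
  induction hn : P.leftRank B using Nat.strong_induction_on generalizing B with
  | _ n ih =>
    by_cases hA : ∃ A, P.IsLeft B A ∧ k ≤ P.height A
    · obtain ⟨A, hA⟩ := hA
      obtain ⟨B₁, h1, h2⟩ := ih _ (hn ▸ h.leftRank_lt hA.1) A rfl
      exact ⟨B₁, .head hA h1, h2⟩
    · push Not at hA
      exact ⟨B, .refl, hA⟩

theorem exists_walk_right (h : P.IsTiled) (k : ℕ) (B : Rect) : ∃ B₂,
    Relation.ReflTransGen (fun D A => P.IsRight D A ∧ k ≤ P.height A) B B₂ ∧
      ∀ A, P.IsRight B₂ A → P.height A < k := by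
  induction hn : P.rightRank B using Nat.strong_induction_on generalizing B with
  | _ n ih =>
    by_cases hA : ∃ A, P.IsRight B A ∧ k ≤ P.height A
    · obtain ⟨A, hA⟩ := hA
      obtain ⟨B₂, h1, h2⟩ := ih _ (hn ▸ h.rightRank_lt hA.1) A rfl
      exact ⟨B₂, .head hA h1, h2⟩
    · push Not at hA
      exact ⟨B, .refl, hA⟩

theorem exists_topless (h : P.IsTiled) {D : Rect} (hD : D ∈ P.baseRects) : ∃ B ∈ P.baseRects,
    (¬ ∃ A, P.IsTop B A) ∧ ∃ k, P.BottomSteps k B D := by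
  induction hn : P.topRank D using Nat.strong_induction_on generalizing D with
  | _ n ih =>
    by_cases hA : ∃ A, P.IsTop D A
    · obtain ⟨A, hA⟩ := hA
      obtain ⟨B, h1, h2, k, h3⟩ := ih _ (hn ▸ h.topRank_lt hA) hA.2.1 rfl
      exact ⟨B, h1, h2, k + 1,
        bottomSteps_add.2 ⟨A, h3, bottomSteps_one.2 (isTop_iff_isBottom.1 hA)⟩⟩
    · exact ⟨D, hD, hA, 0, rfl⟩

theorem exists_reports (h : P.IsTiled) {B : Rect} (hB : B ∈ P.baseRects)
    (ht : ¬ ∃ A, P.IsTop B A) : ∃ R, P.Reports B R := by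
  obtain ⟨B₁, w1, m1⟩ := h.exists_walk_left (P.height B) B
  obtain ⟨B₂, w2, m2⟩ := h.exists_walk_right (P.height B) B
  obtain ⟨E, hE⟩ := h.exists_steps_height B
  obtain ⟨⟨hB1, t1, b1, F1, hF1, e1⟩, l1, -⟩ := h.walk_left hB hE w1
  obtain ⟨⟨hB2, t2, b2, F2, hF2, e2⟩, l2, -⟩ := h.walk_right hB hE w2
  have g := hF2.bounds hB2
  have g' := B₂.bottom_lt_top
  have := B.left_lt_right
  exact ⟨⟨B₁.left, F2.right, F2.bottom, B₁.top, by linarith [g.2.2.1], by linarith [g.2.2.2.2.1]⟩,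
    hB, ht, B₁, B₂, F2, w1, m1, w2, m2, hF2, rfl, rfl, rfl, rfl⟩

theorem _root_.Relation.ReflTransGen.terminal_unique {α : Type} {r : α → α → Prop}
    (hr : ∀ a b c, r a b → r a c → b = c) {a b c : α} (h1 : Relation.ReflTransGen r a b)
    (h2 : Relation.ReflTransGen r a c) (hb : ∀ d, ¬ r b d) (hc : ∀ d, ¬ r c d) : b = c := by
  have key : ∀ {x y : α}, Relation.ReflTransGen r x y → (∀ d, ¬ r x d) → x = y := fun h hx => by
    rcases h.cases_head with h | ⟨d, h, -⟩
    exacts [h, absurd h (hx d)]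
  rcases Relation.ReflTransGen.total_of_right_unique (fun a b c => hr a b c) h1 h2 with h | h
  · exact key h hb
  · exact (key h hc).symm

theorem reports_unique (h : P.IsTiled) {B R R' : Rect} (hR : P.Reports B R)
    (hR' : P.Reports B R') : R = R' := by
  obtain ⟨hB, hBt, B₁, B₂, B₃, w1, m1, w2, m2, s3, rl, rt, rr, rb⟩ := hR
  obtain ⟨-, -, B₁', B₂', B₃', w1', m1', w2', m2', s3', rl', rt', rr', rb'⟩ := hR'
  obtain rfl := Relation.ReflTransGen.terminal_unique
    (fun _ _ _ h1 h2 => h.left_unique h1.1 h2.1) w1 w1'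
    (fun d hd => (m1 d hd.1).not_ge hd.2) (fun d hd => (m1' d hd.1).not_ge hd.2)
  obtain rfl := Relation.ReflTransGen.terminal_unique
    (fun _ _ _ h1 h2 => h.right_unique h1.1 h2.1) w2 w2'
    (fun d hd => (m2 d hd.1).not_ge hd.2) (fun d hd => (m2' d hd.1).not_ge hd.2)
  obtain rfl := h.steps_unique s3 s3'
  ext <;> simp [*]

/-- A base rectangle `D` is reached from some `B` without top neighbour by `k ≤ h(B)` steps down.
The rectangle reported for `B` contains the column of `B` over its full height, and so contains `D`.
-/
theorem isCover_stripCover (h : P.IsTiled) : P.IsCover P.stripCover := by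
  have hsub : ∀ R ∈ P.stripCover, R.region ⊆ P.region :=
    fun R ⟨B, hB⟩ => (h.isMaximalRect_of_reports hB).1
  refine ⟨hsub, Set.Subset.antisymm ?_ (Set.iUnion₂_subset hsub)⟩
  intro p hp
  rw [h.region_eq] at hp
  obtain ⟨D, hD, hpD⟩ := Set.mem_iUnion₂.1 hp
  obtain ⟨B, hB, hBt, k, hk⟩ := h.exists_topless hD
  obtain ⟨R, hR⟩ := h.exists_reports hB hBt
  refine Set.mem_biUnion ⟨B, hR⟩ ?_
  obtain ⟨-, -, B₁, B₂, B₃, w1, m1, w2, m2, s3, rl, rt, rr, rb⟩ := hR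
  obtain ⟨E, hE⟩ := h.exists_steps_height B
  obtain ⟨m, hm⟩ := Nat.exists_eq_add_of_le (h.le_height hk)
  rw [hm] at hE
  obtain ⟨D', hD', hDE⟩ := bottomSteps_add.1 hE
  obtain rfl := h.steps_unique hk hD'
  rw [← hm] at hE
  obtain ⟨⟨hB1, t1, b1, F1, hF1, e1⟩, l1, -⟩ := h.walk_left hB hE w1
  obtain ⟨⟨hB2, t2, b2, F2, hF2, e2⟩, l2, -⟩ := h.walk_right hB hE w2
  obtain rfl := h.steps_unique hF2 s3
  obtain ⟨g1, g2, g3, g4, g5, -⟩ := hF2.bounds hB2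
  obtain ⟨k1, k2, k3, k4, k5, -⟩ := hk.bounds hB
  have k6 := (hDE.bounds hD).2.2.2.2.1
  obtain ⟨⟨p1, p2⟩, p3, p4⟩ := hpD
  exact ⟨⟨by linarith, by linarith⟩, by linarith, by linarith⟩

/-- Each base rectangle without top neighbour reports exactly one rectangle, so the cover is no
larger than the set of these. Elsewhere the values of `f` are arbitrary. -/
theorem stripCover_subset (h : P.IsTiled) : ∃ f : Rect → Rect,
    (∀ B R, P.Reports B R → f B = R) ∧
      P.stripCover = f '' {B ∈ P.baseRects | ¬ ∃ A, P.IsTop B A} := by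
  have : ∀ B, ∃ R', ∀ R, P.Reports B R → R' = R := by
    intro B
    by_cases hB : ∃ R, P.Reports B R
    · obtain ⟨R, hR⟩ := hB
      exact ⟨R, fun R' hR' => h.reports_unique hR hR'⟩
    · push Not at hB
      exact ⟨B, fun R hR => absurd hR (hB R)⟩
  choose f hf using this
  refine ⟨f, hf, ?_⟩
  ext R
  constructor
  · rintro ⟨B, hB⟩
    exact ⟨B, ⟨hB.1, hB.2.1⟩, hf B R hB⟩
  · rintro ⟨B, ⟨h1, h2⟩, rfl⟩
    obtain ⟨R, hR⟩ := h.exists_reports h1 h2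
    rw [hf B R hR]
    exact ⟨B, hR⟩

theorem finite_topless (h : P.IsTiled) : {B ∈ P.baseRects | ¬ ∃ A, P.IsTop B A}.Finite :=
  h.finite.subset fun _ hB => hB.1

theorem finite_stripCover (h : P.IsTiled) : P.stripCover.Finite := by
  obtain ⟨f, -, hf⟩ := h.stripCover_subset
  rw [hf]
  exact h.finite_topless.image _

theorem ncard_stripCover_le (h : P.IsTiled) : P.stripCover.ncard ≤ 3 * P.size := by
  obtain ⟨f, -, hf⟩ := h.stripCover_subset
  rw [hf]
  exact (Set.ncard_image_le h.finite_topless).trans h.topless_le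

theorem ncard_stripCover_le_ncard (h : P.IsTiled) : P.stripCover.ncard ≤ P.baseRects.ncard := by
  obtain ⟨f, -, hf⟩ := h.stripCover_subset
  rw [hf]
  exact (Set.ncard_image_le h.finite_topless).trans
    (Set.ncard_le_ncard (fun _ hB => hB.1) h.finite)

/-- There are as many ends of columns below as above. -/
theorem bottomless_le (h : P.IsTiled) :
    {B ∈ P.baseRects | ¬ ∃ A, P.IsBottom B A}.ncard ≤ 3 * P.size := by
  have hb : ∀ B, ∃ A, (∃ A, P.IsBottom B A) → P.IsBottom B A := fun B => by
    by_cases hB : ∃ A, P.IsBottom B A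
    exacts [hB.imp fun A hA _ => hA, ⟨B, fun h => absurd h hB⟩]
  choose f hf using hb
  -- The bottom neighbour maps the rectangles that have one bijectively to those that have a top
  -- neighbour. So the two complements have equal size as well.
  have h1 : {B ∈ P.baseRects | ∃ A, P.IsBottom B A}.ncard =
      {B ∈ P.baseRects | ∃ A, P.IsTop B A}.ncard := by
    refine Set.BijOn.ncard_eq (f := f) ⟨?_, ?_, ?_⟩
    · rintro B ⟨-, hB⟩
      have := hf B hB
      exact ⟨this.2.1, B, isTop_iff_isBottom.2 this⟩
    · rintro B ⟨-, hB⟩ B' ⟨-, hB'⟩ he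
      have h1 := isTop_iff_isBottom.2 (hf B hB)
      rw [he] at h1
      exact h.top_unique h1 (isTop_iff_isBottom.2 (hf B' hB'))
    · rintro A ⟨hA, B, hB⟩
      have h1 := isTop_iff_isBottom.1 hB
      exact ⟨B, ⟨h1.1, A, h1⟩, h.bottom_unique (hf B ⟨A, h1⟩) h1⟩
  have h2 : ∀ p : Rect → Prop, {B ∈ P.baseRects | p B}.ncard + {B ∈ P.baseRects | ¬ p B}.ncard =
      P.baseRects.ncard := by
    intro p
    rw [← Set.ncard_union_eq (Set.disjoint_left.2 fun B h1 h2 => h2.2 h1.2)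
      (h.finite.subset fun _ hB => hB.1) (h.finite.subset fun _ hB => hB.1)]
    congr 1
    ext B
    by_cases hp : p B <;> simp [hp]
  have h3 := h2 fun B => ∃ A, P.IsBottom B A
  have h4 := h2 fun B => ∃ A, P.IsTop B A
  have := h.topless_le
  omega

end IsTiled

end RectilinearPolygon

/-! ### The edge system of a contour -/

theorem card_filter_cast_zmod {ι : Type} [Fintype ι] (p : ι → Prop) [DecidablePred p] :
    ((Finset.univ.filter p).card : ZMod 2) = ∑ k, if p k then 1 else 0 := by
  rw [Finset.card_filter]
  push_cast
  rfl

/-- Counting the changes of `q` where `p` holds, or the changes of `p` where `q` holds, along the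
cycles of a permutation gives the same parity. -/
theorem odd_card_perm {ι : Type} [Fintype ι] (nx : Equiv.Perm ι) (p q : ι → Prop)
    [DecidablePred p] [DecidablePred q] :
    Odd (Finset.univ.filter fun m => p (nx m) ∧ (q m ↔ ¬ q (nx m))).card ↔
      Odd (Finset.univ.filter fun k => q k ∧ (p k ↔ ¬ p (nx k))).card := by
  rw [← ZMod.natCast_eq_one_iff_odd, ← ZMod.natCast_eq_one_iff_odd, card_filter_cast_zmod,
    card_filter_cast_zmod]
  -- Modulo 2, a change of a predicate is the sum of its two indicators. The mixed terms of both
  -- counts agree, and the pure terms differ by a shift along `nx`.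
  have h1 : ∀ m, (if p (nx m) ∧ (q m ↔ ¬ q (nx m)) then (1 : ZMod 2) else 0) =
      (if p (nx m) ∧ q m then 1 else 0) + if p (nx m) ∧ q (nx m) then 1 else 0 := by
    intro m
    by_cases h1 : p (nx m) <;> by_cases h2 : q m <;> by_cases h3 : q (nx m) <;> simp [h1, h2, h3]
    rfl
  have h2 : ∀ k, (if q k ∧ (p k ↔ ¬ p (nx k)) then (1 : ZMod 2) else 0) =
      (if p (nx k) ∧ q k then 1 else 0) + if p k ∧ q k then 1 else 0 := by
    intro m
    by_cases h1 : p (nx m) <;> by_cases h2 : q m <;> by_cases h3 : p m <;> simp [h1, h2, h3]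
    rfl
  simp only [h1, h2, Finset.sum_add_distrib]
  rw [Equiv.sum_comp nx fun m => if p m ∧ q m then (1 : ZMod 2) else 0]

/-- This reads a crossed edge as a change of a predicate between consecutive vertices, the form that
`odd_card_perm` needs. -/
theorem min_le_lt_max_iff {α : Type} [LinearOrder α] {s t b : α} :
    (min s t ≤ b ∧ b < max s t) ↔ (s ≤ b ↔ ¬ t ≤ b) := by
  rcases le_or_gt s b with h1 | h1 <;> rcases le_or_gt t b with h2 | h2 <;>
    simp [h1, h2, not_le.2, not_lt.2]

theorem eq_min_or_max {α : Type} [LinearOrder α] {s t c : α} (h : c = s ∨ c = t) :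
    c = min s t ∨ c = max s t := by
  rcases le_total s t with h1 | h1
  · rw [min_eq_left h1, max_eq_right h1]
    exact h
  · rw [min_eq_right h1, max_eq_left h1]
    exact h.symm

theorem cyclicNext_injective {m : ℕ} : Function.Injective (cyclicNext (m := m)) := by
  intro i j h
  simp only [cyclicNext, Fin.mk.injEq] at h
  ext
  have hi := i.2
  have hj := j.2
  rcases Nat.lt_or_ge (i.1 + 1) m with h1 | h1 <;> rcases Nat.lt_or_ge (j.1 + 1) m with h2 | h2
  · rw [Nat.mod_eq_of_lt h1, Nat.mod_eq_of_lt h2] at h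
    omega
  · rw [Nat.mod_eq_of_lt h1, show j.1 + 1 = m by omega, Nat.mod_self] at h
    omega
  · rw [Nat.mod_eq_of_lt h2, show i.1 + 1 = m by omega, Nat.mod_self] at h
    omega
  · omega

/-- The cyclic successor as a permutation. -/
noncomputable def cyclicPerm (m : ℕ) : Equiv.Perm (Fin m) :=
  Equiv.ofBijective cyclicNext (Finite.injective_iff_bijective.1 cyclicNext_injective)

theorem cyclicPerm_apply {m : ℕ} (i : Fin m) : cyclicPerm m i = cyclicNext i := rfl

theorem mem_horizontalEdge {m : ℕ} {x y : Fin m → ℝ} {i : Fin m} {p : ℝ × ℝ} :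
    p ∈ horizontalEdge x y i ↔ y i = p.2 ∧ min (x i) (x (cyclicNext i)) ≤ p.1 ∧
      p.1 ≤ max (x i) (x (cyclicNext i)) := by
  rw [horizontalEdge, EdgeSystem.mem_horizontal_segment, eq_comm]
  rfl

theorem mem_verticalEdge {m : ℕ} {x y : Fin m → ℝ} {i : Fin m} {p : ℝ × ℝ} :
    p ∈ verticalEdge x y i ↔ x (cyclicNext i) = p.1 ∧ min (y i) (y (cyclicNext i)) ≤ p.2 ∧
      p.2 ≤ max (y i) (y (cyclicNext i)) := by
  rw [verticalEdge, EdgeSystem.mem_vertical_segment, eq_comm]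
  rfl

theorem exists_prev {m : ℕ} (i : Fin m) : ∃ j, cyclicNext j = i :=
  ⟨(cyclicPerm m).symm i, (cyclicPerm m).apply_symm_apply i⟩

namespace Contour

/-- The edges of a contour. -/
noncomputable def toSystem (c : Contour) : EdgeSystem (Fin c.m) ℝ where
  hy := c.y
  hl := fun i => min (c.x i) (c.x (cyclicNext i))
  hr := fun i => max (c.x i) (c.x (cyclicNext i))
  vx := fun i => c.x (cyclicNext i)
  vb := fun i => min (c.y i) (c.y (cyclicNext i))
  vt := fun i => max (c.y i) (c.y (cyclicNext i))
  hl_lt := fun i => min_lt_max.2 (c.x_ne i)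
  vb_lt := fun i => min_lt_max.2 (c.y_ne i)
  par_eq := by
    intro a b
    simp only [min_le_lt_max_iff]
    exact odd_card_perm (cyclicPerm c.m) (fun i => c.x i ≤ a) fun i => c.y i ≤ b
  h_end_left := by
    intro k
    rcases min_choice (c.x k) (c.x (cyclicNext k)) with h | h
    · obtain ⟨j, hj⟩ := exists_prev k
      exact ⟨j, by rw [h, hj], eq_min_or_max (Or.inr (by rw [hj]))⟩
    · exact ⟨k, h.symm, eq_min_or_max (Or.inl rfl)⟩
  h_end_right := by
    intro k
    rcases max_choice (c.x k) (c.x (cyclicNext k)) with h | h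
    · obtain ⟨j, hj⟩ := exists_prev k
      exact ⟨j, by rw [h, hj], eq_min_or_max (Or.inr (by rw [hj]))⟩
    · exact ⟨k, h.symm, eq_min_or_max (Or.inl rfl)⟩
  v_end_bottom := by
    intro k
    rcases min_choice (c.y k) (c.y (cyclicNext k)) with h | h
    · exact ⟨k, h.symm, eq_min_or_max (Or.inr rfl)⟩
    · exact ⟨cyclicNext k, h.symm, eq_min_or_max (Or.inl rfl)⟩
  v_end_top := by
    intro k
    rcases max_choice (c.y k) (c.y (cyclicNext k)) with h | h
    · exact ⟨k, h.symm, eq_min_or_max (Or.inr rfl)⟩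
    · exact ⟨cyclicNext k, h.symm, eq_min_or_max (Or.inl rfl)⟩
  hh := by
    intro k m hkm hy
    by_contra h
    push Not at h
    have hk := min_le_max (a := c.x k) (b := c.x (cyclicNext k))
    have hm := min_le_max (a := c.x m) (b := c.x (cyclicNext m))
    refine (Set.disjoint_left.1 (c.disjoint_horizontal k m hkm)) (a :=
      (max (min (c.x k) (c.x (cyclicNext k))) (min (c.x m) (c.x (cyclicNext m))), c.y k))
      (mem_horizontalEdge.2 ⟨rfl, le_max_left _ _, max_le hk h.1.le⟩)
      (mem_horizontalEdge.2 ⟨hy.symm, le_max_right _ _, max_le h.2.le hm⟩)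
  vv := by
    intro k m hkm hx
    by_contra h
    push Not at h
    have hk := min_le_max (a := c.y k) (b := c.y (cyclicNext k))
    have hm := min_le_max (a := c.y m) (b := c.y (cyclicNext m))
    refine (Set.disjoint_left.1 (c.disjoint_vertical k m hkm))
      (a := (c.x (cyclicNext k),
        max (min (c.y k) (c.y (cyclicNext k))) (min (c.y m) (c.y (cyclicNext m)))))
      (mem_verticalEdge.2 ⟨rfl, le_max_left _ _, max_le hk h.1.le⟩)
      (mem_verticalEdge.2 ⟨hx.symm, le_max_right _ _, max_le h.2.le hm⟩)
  hv := by
    intro k m h1 h2 h3 h4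
    by_cases h5 : m = k
    · subst h5
      exact ⟨eq_min_or_max (Or.inr rfl), eq_min_or_max (Or.inl rfl)⟩
    by_cases h6 : cyclicNext m = k
    · subst h6
      exact ⟨eq_min_or_max (Or.inl rfl), eq_min_or_max (Or.inr rfl)⟩
    · exact ((Set.disjoint_left.1 (c.disjoint_mixed k m h5 h6)) (a := (c.x (cyclicNext m), c.y k))
        (mem_horizontalEdge.2 ⟨rfl, h1, h2⟩) (mem_verticalEdge.2 ⟨rfl, h3, h4⟩)).elim

variable {c : Contour} {p : ℝ × ℝ}

theorem mem_boundary_iff : p ∈ c.boundary ↔ c.toSystem.Bd p.1 p.2 := by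
  simp only [boundary, Set.mem_iUnion, Set.mem_union, mem_horizontalEdge, mem_verticalEdge,
    exists_or]
  rfl

theorem mem_vertices_iff : p ∈ c.vertices ↔ c.toSystem.Vert p.1 p.2 := by
  constructor
  · rintro ⟨i, rfl | rfl⟩
    · obtain ⟨j, rfl⟩ := exists_prev i
      exact ⟨j, rfl, eq_min_or_max (Or.inr rfl)⟩
    · exact ⟨i, rfl, eq_min_or_max (Or.inl rfl)⟩
  · rintro ⟨i, h1, h2⟩
    have h1 : c.x (cyclicNext i) = p.1 := h1
    have h3 : p.2 = c.y i ∨ p.2 = c.y (cyclicNext i) := by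
      rcases h2 with h2 | h2
      · rw [h2]
        exact min_choice _ _
      · rw [h2]
        exact max_choice _ _
    rcases h3 with h3 | h3
    · exact ⟨i, Or.inr (Prod.ext h1.symm h3)⟩
    · exact ⟨cyclicNext i, Or.inl (Prod.ext h1.symm h3)⟩

/-- `inside` counts vertical edges to the right, `In` those to the left. Both have the parity of the
number of horizontal edges at or below the point; for the right-hand count, `odd_card_perm` is
applied to `p.1 < x` instead of `x ≤ p.1`. -/
theorem mem_inside_iff : p ∈ c.inside ↔ c.toSystem.Inn p.1 p.2 := by
  rw [EdgeSystem.Inn, ← mem_boundary_iff, inside, Set.mem_ofPred_eq, and_congr_right_iff]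
  intro _
  rw [← EdgeSystem.in_swap, EdgeSystem.In]
  have h1 : ∀ i, (p.1 < c.x (cyclicNext i) ∧ min (c.y i) (c.y (cyclicNext i)) ≤ p.2 ∧
      p.2 < max (c.y i) (c.y (cyclicNext i))) ↔
      (p.1 < c.x (cyclicPerm c.m i) ∧ (c.y i ≤ p.2 ↔ ¬ c.y (cyclicPerm c.m i) ≤ p.2)) :=
    fun i => by rw [min_le_lt_max_iff]; rfl
  have h2 : ∀ i, (c.y i ≤ p.2 ∧ min (c.x i) (c.x (cyclicNext i)) ≤ p.1 ∧
      p.1 < max (c.x i) (c.x (cyclicNext i))) ↔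
      (c.y i ≤ p.2 ∧ (p.1 < c.x i ↔ ¬ p.1 < c.x (cyclicPerm c.m i))) := fun i => by
    rw [min_le_lt_max_iff, cyclicPerm_apply, ← not_le, ← not_le]
    tauto
  have h3 := odd_card_perm (cyclicPerm c.m) (fun i => p.1 < c.x i) fun i => c.y i ≤ p.2
  simp only [← h1, ← h2] at h3
  rw [← Set.ncard_coe_finset] at h3
  simp only [Finset.coe_filter, Finset.mem_univ, true_and] at h3
  exact h3

theorem mem_region_iff : p ∈ c.region ↔ c.toSystem.Inn p.1 p.2 ∨ c.toSystem.Bd p.1 p.2 := by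
  rw [region, Set.mem_union, mem_inside_iff, mem_boundary_iff]

end Contour

namespace EdgeSystem

/-! ### Unions of edge systems -/

theorem Vert.eq_end {ι α : Type} [Fintype ι] [LinearOrder α] {S : EdgeSystem ι α} {a b : α}
    (h : S.Vert a b) {k : ι} (hk : S.hy k = b) (h1 : S.hl k ≤ a) (h2 : a ≤ S.hr k) :
    a = S.hl k ∨ a = S.hr k := by
  obtain ⟨m, rfl, h⟩ := h
  have := S.vb_lt m
  refine (S.hv k m h1 h2 ?_ ?_).1 <;> rcases h with rfl | rfl <;> rw [hk] <;>
    first | exact le_rfl | exact this.le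

/-- An overlap of positive length would contain a common point in the interior of both edges, and
such a point is no vertex. -/
theorem hh_of_meet {ι κ : Type} [Fintype ι] [Fintype κ] {S : EdgeSystem ι ℝ} {T : EdgeSystem κ ℝ}
    (hST : ∀ a b, S.Bd a b → T.Bd a b → S.Vert a b) {k : ι} {m : κ} (h : S.hy k = T.hy m) :
    S.hr k ≤ T.hl m ∨ T.hr m ≤ S.hl k := by
  by_contra h1
  push Not at h1
  have hk := S.hl_lt k
  have hm := T.hl_lt m
  obtain ⟨a, h2, h3⟩ := exists_between
    (max_lt (lt_min hk h1.2) (lt_min h1.1 hm) :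
      max (S.hl k) (T.hl m) < min (S.hr k) (T.hr m))
  rw [max_lt_iff] at h2
  rw [lt_min_iff] at h3
  have h4 := hST a (S.hy k) (Or.inl ⟨k, rfl, h2.1.le, h3.1.le⟩)
    (Or.inl ⟨m, h.symm, h2.2.le, h3.2.le⟩)
  rcases h4.eq_end rfl h2.1.le h3.1.le with h5 | h5
  · exact h2.1.ne' h5
  · exact h3.1.ne h5

variable {J : Type} [Fintype J] {ι : J → Type} [∀ j, Fintype (ι j)]

theorem odd_card_sigma (p : (Σ j, ι j) → Prop) [DecidablePred p] :
    Odd (Finset.univ.filter p).card ↔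
      Odd (∑ j, (Finset.univ.filter fun i => p ⟨j, i⟩).card) := by
  rw [Finset.card_filter, Fintype.sum_sigma]
  simp only [Finset.card_filter]

/-- The union of edge systems that meet in common vertices only. -/
def sigma (T : ∀ j, EdgeSystem (ι j) ℝ)
    (hT : ∀ i j, i ≠ j → ∀ a b, (T i).Bd a b → (T j).Bd a b → (T i).Vert a b) :
    EdgeSystem (Σ j, ι j) ℝ where
  hy := fun k => (T k.1).hy k.2
  hl := fun k => (T k.1).hl k.2
  hr := fun k => (T k.1).hr k.2
  vx := fun k => (T k.1).vx k.2
  vb := fun k => (T k.1).vb k.2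
  vt := fun k => (T k.1).vt k.2
  hl_lt := fun k => (T k.1).hl_lt k.2
  vb_lt := fun k => (T k.1).vb_lt k.2
  par_eq := by
    intro a b
    rw [odd_card_sigma, odd_card_sigma, ← ZMod.natCast_eq_one_iff_odd,
      ← ZMod.natCast_eq_one_iff_odd]
    push_cast
    rw [Finset.sum_congr rfl fun j _ => ?_]
    have h := (T j).par_eq a b
    rcases Nat.even_or_odd (Finset.univ.filter fun m => (T j).vx m ≤ a ∧ (T j).vb m ≤ b ∧
      b < (T j).vt m).card with h1 | h1
    · rw [(ZMod.natCast_eq_zero_iff_even).2 h1, eq_comm, ZMod.natCast_eq_zero_iff_even,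
        ← Nat.not_odd_iff_even, ← h, Nat.not_odd_iff_even]
      exact h1
    · rw [(ZMod.natCast_eq_one_iff_odd).2 h1, eq_comm, ZMod.natCast_eq_one_iff_odd, ← h]
      exact h1
  h_end_left := fun k => by
    obtain ⟨m, h⟩ := (T k.1).h_end_left k.2
    exact ⟨⟨k.1, m⟩, h⟩
  h_end_right := fun k => by
    obtain ⟨m, h⟩ := (T k.1).h_end_right k.2
    exact ⟨⟨k.1, m⟩, h⟩
  v_end_bottom := fun k => by
    obtain ⟨m, h⟩ := (T k.1).v_end_bottom k.2
    exact ⟨⟨k.1, m⟩, h⟩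
  v_end_top := fun k => by
    obtain ⟨m, h⟩ := (T k.1).v_end_top k.2
    exact ⟨⟨k.1, m⟩, h⟩
  hh := by
    rintro ⟨i, k⟩ ⟨j, m⟩ hkm h
    by_cases hij : i = j
    · subst hij
      exact (T i).hh k m (fun h => hkm (by rw [h])) h
    · exact hh_of_meet (hT i j hij) h
  vv := by
    rintro ⟨i, k⟩ ⟨j, m⟩ hkm h
    by_cases hij : i = j
    · subst hij
      exact (T i).vv k m (fun h => hkm (by rw [h])) h
    · exact hh_of_meet (S := (T i).swap) (T := (T j).swap) (fun a b h1 h2 => (T i).vert_swap.2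
        (hT i j hij b a (bd_swap.1 h1) (bd_swap.1 h2))) h
  hv := by
    rintro ⟨i, k⟩ ⟨j, m⟩ h1 h2 h3 h4
    by_cases hij : i = j
    · subst hij
      exact (T i).hv k m h1 h2 h3 h4
    · have b1 : (T i).Bd ((T j).vx m) ((T i).hy k) := Or.inl ⟨k, rfl, h1, h2⟩
      have b2 : (T j).Bd ((T j).vx m) ((T i).hy k) := Or.inr ⟨m, rfl, h3, h4⟩
      exact ⟨(hT i j hij _ _ b1 b2).eq_end rfl h1 h2,
        ((T j).vert_swap.2 (hT j i (Ne.symm hij) _ _ b2 b1)).eq_end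
          (S := (T j).swap) rfl h3 h4⟩

section Sigma

variable {T : ∀ j, EdgeSystem (ι j) ℝ}
  {hT : ∀ i j, i ≠ j → ∀ a b, (T i).Bd a b → (T j).Bd a b → (T i).Vert a b} {a b : ℝ}

theorem sigma_bd : (sigma T hT).Bd a b ↔ ∃ j, (T j).Bd a b := by
  simp only [Bd, HHit, VHit, exists_or, Sigma.exists]
  rfl

theorem sigma_vert : (sigma T hT).Vert a b ↔ ∃ j, (T j).Vert a b := by
  simp only [Vert, Sigma.exists]
  rfl

theorem sigma_in : (sigma T hT).In a b ↔ Odd (∑ j, (Finset.univ.filter fun m =>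
    (T j).vx m ≤ a ∧ (T j).vb m ≤ b ∧ b < (T j).vt m).card) :=
  odd_card_sigma _

end Sigma

/-- The edge system with other names for the edges. -/
def reindex {ι κ α : Type} [Fintype ι] [Fintype κ] [LinearOrder α] (S : EdgeSystem ι α)
    (e : ι ≃ κ) : EdgeSystem κ α where
  hy := S.hy ∘ e.symm
  hl := S.hl ∘ e.symm
  hr := S.hr ∘ e.symm
  vx := S.vx ∘ e.symm
  vb := S.vb ∘ e.symm
  vt := S.vt ∘ e.symm
  hl_lt := fun k => S.hl_lt _
  vb_lt := fun k => S.vb_lt _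
  par_eq := by
    intro a b
    have key : ∀ p : ι → Prop, ∀ [DecidablePred p], (Finset.univ.filter fun k => p (e.symm k)).card
        = (Finset.univ.filter p).card := by
      intro p _
      rw [Finset.card_filter, Finset.card_filter]
      exact Equiv.sum_comp e.symm fun k => if p k then 1 else 0
    have h := S.par_eq a b
    rw [← key, ← key] at h
    exact h
  h_end_left := fun k => by
    obtain ⟨m, h⟩ := S.h_end_left (e.symm k)
    exact ⟨e m, by simpa using h⟩
  h_end_right := fun k => by
    obtain ⟨m, h⟩ := S.h_end_right (e.symm k)
    exact ⟨e m, by simpa using h⟩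
  v_end_bottom := fun k => by
    obtain ⟨m, h⟩ := S.v_end_bottom (e.symm k)
    exact ⟨e m, by simpa using h⟩
  v_end_top := fun k => by
    obtain ⟨m, h⟩ := S.v_end_top (e.symm k)
    exact ⟨e m, by simpa using h⟩
  hh := fun k m h => S.hh _ _ (e.symm.injective.ne h)
  vv := fun k m h => S.vv _ _ (e.symm.injective.ne h)
  hv := fun k m => S.hv _ _

section Reindex

variable {ι κ α : Type} [Fintype ι] [Fintype κ] [LinearOrder α] {S : EdgeSystem ι α}
  {e : ι ≃ κ} {a b : α}

theorem reindex_bd : (S.reindex e).Bd a b ↔ S.Bd a b :=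
  or_congr (e.symm.exists_congr_left.trans (by simp [reindex, HHit]))
    (e.symm.exists_congr_left.trans (by simp [reindex, VHit, HHit, swap]))

theorem reindex_vert : (S.reindex e).Vert a b ↔ S.Vert a b :=
  e.symm.exists_congr_left.trans (by simp [reindex, Vert])

theorem reindex_in : (S.reindex e).In a b ↔ S.In a b := by
  unfold In
  rw [Finset.card_filter, Finset.card_filter]
  exact iff_of_eq (congrArg Odd (Equiv.sum_comp e.symm fun m =>
    if S.vx m ≤ a ∧ S.vb m ≤ b ∧ b < S.vt m then 1 else 0))

theorem Represents.reindex {S : EdgeSystem ι ℝ} {P : RectilinearPolygon} (h : S.Represents P)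
    (e : ι ≃ κ) : (S.reindex e).Represents P where
  inner := fun p => by rw [h.inner, Inn, Inn, reindex_bd, reindex_in]
  region := fun p => by rw [h.region, Inn, Inn, reindex_bd, reindex_in]
  vertices := fun p => by rw [h.vertices, reindex_vert]

end Reindex

end EdgeSystem

namespace RectilinearPolygon

/-! ### The edge system of a polygon -/

variable (P : RectilinearPolygon)

theorem contours_meet (i j : Fin P.contours.length) (hij : i ≠ j) (a b : ℝ)
    (hi : (P.contours.get i).toSystem.Bd a b) (hj : (P.contours.get j).toSystem.Bd a b) :
    (P.contours.get i).toSystem.Vert a b := by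
  have h : P.contours.Pairwise fun c d => ∀ p, p ∈ c.boundary → p ∈ d.boundary →
      p ∈ c.vertices ∧ p ∈ d.vertices := by
    rw [contours, List.pairwise_cons]
    refine ⟨fun H hH p h1 h2 => (P.hole_boundary H hH ⟨h2, h1⟩).symm, ?_⟩
    exact P.holes_pairwise.imp fun {c d} h p (h1 : p ∈ c.boundary) (h2 : p ∈ d.boundary) =>
      h.2 ⟨Or.inr h1, Or.inr h2⟩
  rw [List.pairwise_iff_get] at h
  rw [← Contour.mem_boundary_iff (p := (a, b))] at hi hj
  rw [← Contour.mem_vertices_iff (p := (a, b))]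
  rcases lt_or_gt_of_ne hij with h1 | h1
  · exact (h i j h1 _ hi hj).1
  · exact (h j i h1 _ hj hi).2

theorem holes_meet (i j : Fin P.holes.length) (hij : i ≠ j) {p : ℝ × ℝ}
    (hi : p ∈ (P.holes.get i).region) (hj : p ∈ (P.holes.get j).region) :
    p ∈ (P.holes.get i).vertices ∧ p ∈ (P.holes.get j).vertices := by
  have h := List.pairwise_iff_get.1 P.holes_pairwise
  rcases lt_or_gt_of_ne hij with h1 | h1
  · exact (h i j h1).2 ⟨hi, hj⟩
  · exact ((h j i h1).2 ⟨hj, hi⟩).symm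

theorem _root_.Contour.mem_boundary_of_mem_vertices {c : Contour} {p : ℝ × ℝ}
    (h : p ∈ c.vertices) : p ∈ c.boundary :=
  Contour.mem_boundary_iff.2 (Or.inl (Contour.mem_vertices_iff.1 h).hHit)

/-- All edges of the polygon. -/
noncomputable def sigmaSystem :
    EdgeSystem (Σ j : Fin P.contours.length, Fin (P.contours.get j).m) ℝ :=
  EdgeSystem.sigma (fun j => (P.contours.get j).toSystem) P.contours_meet

variable {P}

theorem mem_boundary_iff {p : ℝ × ℝ} : p ∈ P.boundary ↔ P.sigmaSystem.Bd p.1 p.2 := by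
  rw [sigmaSystem, EdgeSystem.sigma_bd]
  simp only [← Contour.mem_boundary_iff]
  constructor
  · rintro ⟨c, hc, hp⟩
    obtain ⟨j, rfl⟩ := List.mem_iff_get.1 hc
    exact ⟨j, hp⟩
  · rintro ⟨j, hp⟩
    exact ⟨_, List.get_mem _ j, hp⟩

theorem mem_vertices_iff {p : ℝ × ℝ} : p ∈ P.vertices ↔ P.sigmaSystem.Vert p.1 p.2 := by
  rw [sigmaSystem, EdgeSystem.sigma_vert]
  simp only [← Contour.mem_vertices_iff]
  constructor
  · rintro ⟨c, hc, hp⟩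
    obtain ⟨j, rfl⟩ := List.mem_iff_get.1 hc
    exact ⟨j, hp⟩
  · rintro ⟨j, hp⟩
    exact ⟨_, List.get_mem _ j, hp⟩

/-- Near a point inside a hole everything belongs to the outer region, whereas near the outer
contour there are points outside of it. A boundary point of one hole inside another would be a
common vertex, hence on the boundary of the latter. -/
theorem boundary_subset_region {p : ℝ × ℝ} (hp : p ∈ P.boundary) : p ∈ P.region := by
  obtain ⟨c, hc, hpc⟩ := hp
  rcases List.mem_cons.1 hc with rfl | hc
  · refine ⟨Or.inr hpc, fun H hH hin => ?_⟩
    rw [Contour.mem_inside_iff] at hin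
    obtain ⟨ε, hε, h1⟩ := EdgeSystem.locally_constant hin.1
    obtain ⟨x, y, h2, h3, h4, h5⟩ :=
      (EdgeSystem.exists_both_sides (Contour.mem_boundary_iff.1 hpc) hε).2
    obtain ⟨h6, h7⟩ := h1 x y h2 h3
    have h8 : (x, y) ∈ P.outer.region := P.hole_subset H hH
      (Contour.mem_region_iff.2 (Or.inl ⟨h6, h7.2 hin.2⟩))
    rcases Contour.mem_region_iff.1 h8 with h9 | h9
    exacts [h5 h9.2, h4 h9]
  · refine ⟨P.hole_subset c hc (Or.inr hpc), fun H hH hin => ?_⟩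
    obtain ⟨i, rfl⟩ := List.mem_iff_get.1 hc
    obtain ⟨j, rfl⟩ := List.mem_iff_get.1 hH
    by_cases hij : i = j
    · subst hij
      exact hin.1 hpc
    · exact hin.1 (Contour.mem_boundary_of_mem_vertices
        (P.holes_meet i j hij (Or.inr hpc) (Or.inl hin)).2)

/-- Off the boundary at most one hole contains the point, and then the outer contour does so too. So
the total parity is odd exactly if the outer contour and no hole contains it. -/
theorem mem_region_iff_in {p : ℝ × ℝ} (hp : p ∉ P.boundary) :
    p ∈ P.region ↔ P.sigmaSystem.In p.1 p.2 := by
  classical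
  let n : Contour → ℕ := fun c => (Finset.univ.filter fun m => c.toSystem.vx m ≤ p.1 ∧
    c.toSystem.vb m ≤ p.2 ∧ p.2 < c.toSystem.vt m).card
  have hnb : ∀ c ∈ P.contours, p ∉ c.boundary := fun c hc h => hp ⟨c, hc, h⟩
  have hn : ∀ c ∈ P.contours, Odd (n c) ↔ p ∈ c.inside := by
    intro c hc
    rw [Contour.mem_inside_iff, EdgeSystem.Inn, ← Contour.mem_boundary_iff]
    exact ⟨fun h => ⟨hnb c hc, h⟩, fun h => h.2⟩
  have hout : p ∈ P.outer.region ↔ p ∈ P.outer.inside :=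
    ⟨fun h => h.resolve_right (hnb _ List.mem_cons_self), Or.inl⟩
  have hhole : ∀ i, P.holes.get i ∈ P.contours :=
    fun i => List.mem_cons_of_mem _ (List.get_mem _ i)
  rw [sigmaSystem, EdgeSystem.sigma_in]
  change _ ↔ Odd (∑ j : Fin (P.holes.length + 1), n (P.contours.get j))
  rw [Fin.sum_univ_succ]
  change _ ↔ Odd (n P.outer + ∑ i, n (P.holes.get i))
  change (p ∈ P.outer.region ∧ ∀ H ∈ P.holes, p ∉ H.inside) ↔ _
  rw [hout]
  by_cases hex : ∃ i, p ∈ (P.holes.get i).inside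
  · obtain ⟨i, hi⟩ := hex
    have h1 : ∀ j, j ≠ i → Even (n (P.holes.get j)) := by
      intro j hj
      rw [← Nat.not_odd_iff_even, hn _ (hhole j)]
      intro hin
      exact hin.1 (Contour.mem_boundary_of_mem_vertices
        (P.holes_meet j i hj (Or.inl hin) (Or.inl hi)).1)
    rw [← Finset.add_sum_erase _ _ (Finset.mem_univ i)]
    have h2 : Even (∑ j ∈ Finset.univ.erase i, n (P.holes.get j)) :=
      Finset.even_sum _ fun j hj => h1 j (Finset.ne_of_mem_erase hj)
    have h3 : Odd (n (P.holes.get i)) := (hn _ (hhole i)).2 hi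
    have h4 : Odd (n P.outer) := (hn _ List.mem_cons_self).2
      (hout.1 (P.hole_subset _ (List.get_mem _ i) (Or.inl hi)))
    have h5 : Even (n P.outer + (n (P.holes.get i) +
        ∑ j ∈ Finset.univ.erase i, n (P.holes.get j))) := h4.add_odd (h3.add_even h2)
    exact ⟨fun h => absurd hi (h.2 _ (List.get_mem _ i)),
      fun h => absurd h5 (Nat.not_even_iff_odd.2 h)⟩
  · push Not at hex
    have h2 : Even (∑ j, n (P.holes.get j)) := Finset.even_sum _ fun j _ => by
      rw [← Nat.not_odd_iff_even, hn _ (hhole j)]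
      exact hex j
    rw [Nat.odd_add, iff_true_right h2, hn _ List.mem_cons_self]
    refine ⟨fun h => h.1, fun h => ⟨h, fun H hH => ?_⟩⟩
    obtain ⟨j, rfl⟩ := List.mem_iff_get.1 hH
    exact hex j

theorem sigmaSystem_represents : P.sigmaSystem.Represents P where
  inner := fun p => by
    rw [EdgeSystem.Inn, ← mem_boundary_iff]
    exact ⟨fun h => ⟨h.2, (mem_region_iff_in h.2).1 h.1⟩,
      fun h => ⟨(mem_region_iff_in h.1).2 h.2, h.1⟩⟩
  region := fun p => by
    rw [EdgeSystem.Inn, ← mem_boundary_iff]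
    by_cases h : p ∈ P.boundary
    · simp [h, boundary_subset_region h]
    · simp [h, mem_region_iff_in h]
  vertices := fun _ => mem_vertices_iff

theorem length_contourRecords (cs : List Contour) : ∀ b, (contourRecords b cs).length =
    (cs.map Contour.m).sum := by
  induction cs with
  | nil => exact fun _ => rfl
  | cons c cs ih => exact fun b => by simp [contourRecords, ih]

theorem sum_get_m (cs : List Contour) :
    ∑ j : Fin cs.length, (cs.get j).m = (cs.map Contour.m).sum := by
  rw [← List.sum_ofFn]
  exact congrArg List.sum (List.ofFn_getElem_eq_map cs Contour.m)

/-- The records of a contour come after those of all earlier contours. The offset is written as the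
sum that occurs in `finSigmaFinEquiv_apply`. -/
theorem contourRecords_get (cs : List Contour) : ∀ (b : ℕ) (j : Fin cs.length)
    (i : Fin (cs.get j).m), (contourRecords b cs)[(∑ l : Fin j.1,
      (cs.get (l.castLE j.2.le)).m) + i.1]? = some ((cs.get j).x i, (cs.get j).y i,
        b + ((∑ l : Fin j.1, (cs.get (l.castLE j.2.le)).m) + (cyclicNext i).1)) := by
  induction cs with
  | nil => exact fun _ j => j.elim0
  | cons c cs ih =>
    intro b j i
    obtain ⟨j, hj⟩ := j
    cases j with
    | zero =>
      have hi : i.1 < c.m := i.2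
      simp only [contourRecords, Finset.univ_eq_empty, Finset.sum_empty, Nat.zero_add]
      rw [List.getElem?_append_left (by simpa using hi), List.getElem?_ofFn, dif_pos hi]
      rfl
    | succ j =>
      have h := ih (b + c.m) ⟨j, Nat.lt_of_succ_lt_succ hj⟩ i
      have hs : (∑ l : Fin (j + 1), ((c :: cs).get (l.castLE hj.le)).m) =
          c.m + ∑ l : Fin j, (cs.get (l.castLE (Nat.lt_of_succ_lt_succ hj).le)).m := by
        rw [Fin.sum_univ_succ]
        rfl
      rw [hs]
      simp only [contourRecords]
      rw [List.getElem?_append_right (by rw [List.length_ofFn]; omega), List.length_ofFn,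
        Nat.add_assoc, Nat.add_sub_cancel_left, h, Nat.add_assoc, Nat.add_assoc]
      rfl

/-- The input of the program describes an edge system that represents the polygon. -/
theorem exists_edgeSystem (P : RectilinearPolygon) :
    ∃ (S : EdgeSystem (Fin P.size) ℝ) (x y : Fin P.size → ℝ) (nx : Equiv.Perm (Fin P.size)),
      S.Represents P ∧ (∀ k, S.hy k = y k ∧ S.hl k = min (x k) (x (nx k)) ∧
        S.hr k = max (x k) (x (nx k)) ∧ S.vx k = x (nx k) ∧ S.vb k = min (y k) (y (nx k)) ∧
        S.vt k = max (y k) (y (nx k))) ∧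
      ∀ s, HoldsPolygon P s → s.nreg 0 = P.size ∧
        ∀ k : Fin P.size, s.rarr 0 k = x k ∧ s.rarr 1 k = y k ∧ s.narr 0 k = nx k := by
  obtain ⟨e, he⟩ : ∃ e : (Σ j : Fin P.contours.length, Fin (P.contours.get j).m) ≃ Fin P.size,
      ∀ σ, (e σ : ℕ) = (∑ l : Fin σ.1.1, (P.contours.get (l.castLE σ.1.2.le)).m) + σ.2.1 :=
    ⟨finSigmaFinEquiv.trans (finCongr (sum_get_m P.contours)), fun σ => finSigmaFinEquiv_apply σ⟩
  let nx : Equiv.Perm (Σ j : Fin P.contours.length, Fin (P.contours.get j).m) :=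
    Equiv.sigmaCongrRight fun j => cyclicPerm (P.contours.get j).m
  let X : (Σ j : Fin P.contours.length, Fin (P.contours.get j).m) → ℝ :=
    fun σ => (P.contours.get σ.1).x σ.2
  let Y : (Σ j : Fin P.contours.length, Fin (P.contours.get j).m) → ℝ :=
    fun σ => (P.contours.get σ.1).y σ.2
  refine ⟨P.sigmaSystem.reindex e, fun k => X (e.symm k), fun k => Y (e.symm k),
    (e.symm.trans nx).trans e, sigmaSystem_represents.reindex e, fun k => ?_,
    fun s hs => ⟨hs.1, fun k => ?_⟩⟩
  · have h : e.symm (((e.symm.trans nx).trans e) k) = nx (e.symm k) := by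
      simp only [Equiv.trans_apply, Equiv.symm_apply_apply]
    beta_reduce
    rw [h]
    exact ⟨rfl, rfl, rfl, rfl, rfl, rfl⟩
  · obtain ⟨σ, rfl⟩ := e.surjective k
    have h := contourRecords_get P.contours 0 σ.1 σ.2
    have h' := he (nx σ)
    have h1 : ((e σ : Fin P.size) : ℕ) < (contourRecords 0 P.contours).length := by
      rw [length_contourRecords]
      exact (e σ).2
    have h2 := hs.2 (e σ) h1
    simp only [← he σ] at h
    rw [List.getElem?_eq_getElem h1, Option.some.injEq] at h
    rw [h, Prod.mk.injEq, Prod.mk.injEq] at h2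
    beta_reduce
    rw [Equiv.trans_apply, Equiv.trans_apply, Equiv.symm_apply_apply]
    refine ⟨h2.1, h2.2.1, h2.2.2.trans ?_⟩
    rw [h', Nat.zero_add]
    rfl

end RectilinearPolygon

/-! ### Reasoning about programs -/

/-- What an instruction writes to: the kind of memory (`0`, `1` for registers of natural and real
numbers, `2`, `3` for arrays of natural and real numbers) and the number. -/
def Instr.target : Instr → ℕ × ℕ
  | zero a => (0, a)
  | copy a _ => (0, a)
  | succ a => (0, a)
  | pred a => (0, a)
  | load a _ _ => (0, a)
  | store A _ _ => (2, A)
  | rcopy a _ => (1, a)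
  | rload a _ _ => (1, a)
  | rstore A _ _ => (3, A)

/-- The program contains an instruction with the given target. -/
def Prog.writes (k a : ℕ) : Prog → Bool
  | skip => false
  | instr c => Nat.beq c.target.1 k && Nat.beq c.target.2 a
  | seq p q => p.writes k a || q.writes k a
  | ite _ p q => p.writes k a || q.writes k a
  | loop _ p => p.writes k a

/-- The two memories agree in everything that the program does not write to. -/
structure Frame (p : Prog) (s s' : MState) : Prop where
  nreg : ∀ a, p.writes 0 a = false → s'.nreg a = s.nreg a
  rreg : ∀ a, p.writes 1 a = false → s'.rreg a = s.rreg a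
  narr : ∀ a, p.writes 2 a = false → s'.narr a = s.narr a
  rarr : ∀ a, p.writes 3 a = false → s'.rarr a = s.rarr a

theorem Frame.refl (p : Prog) (s : MState) : Frame p s s :=
  ⟨fun _ _ => rfl, fun _ _ => rfl, fun _ _ => rfl, fun _ _ => rfl⟩

theorem Frame.trans {p : Prog} {s₁ s₂ s₃ : MState} (h : Frame p s₁ s₂) (h' : Frame p s₂ s₃) :
    Frame p s₁ s₃ :=
  ⟨fun a ha => (h'.nreg a ha).trans (h.nreg a ha), fun a ha => (h'.rreg a ha).trans (h.rreg a ha),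
    fun a ha => (h'.narr a ha).trans (h.narr a ha), fun a ha => (h'.rarr a ha).trans (h.rarr a ha)⟩

theorem Frame.mono {p q : Prog} {s s' : MState} (h : Frame p s s')
    (hpq : ∀ k a, q.writes k a = false → p.writes k a = false) : Frame q s s' :=
  ⟨fun a ha => h.nreg a (hpq 0 a ha), fun a ha => h.rreg a (hpq 1 a ha),
    fun a ha => h.narr a (hpq 2 a ha), fun a ha => h.rarr a (hpq 3 a ha)⟩

theorem Instr.frame (c : Instr) (s : MState) : Frame (.instr c) s (c.apply s) := by
  have hne : ∀ {a b : ℕ}, Nat.beq a b = false → b ≠ a := fun h h' =>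
    Nat.ne_of_beq_eq_false h h'.symm
  constructor <;> intro a ha <;> cases c <;>
    simp only [Prog.writes, Instr.target, Bool.and_eq_false_iff] at ha <;>
    first
    | rfl
    | exact Function.update_of_ne (hne (ha.resolve_left (by decide))) _ _

/-- As `Prog.writes` is a computable Boolean, the registers and arrays that a concrete program
leaves alone can be read off by `rfl`. -/
theorem Exec.frame {M : ℕ} {p : Prog} {s s' : MState} {t : ℕ} (h : Exec M p s s' t) :
    Frame p s s' := by
  induction h with
  | skip s => exact Frame.refl _ _
  | instr c s h => exact c.frame s
  | seq h₁ h₂ ih₁ ih₂ =>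
    exact Frame.trans (ih₁.mono fun k a h => (Bool.or_eq_false_iff.1 h).1)
      (ih₂.mono fun k a h => (Bool.or_eq_false_iff.1 h).2)
  | iteTrue hb h ih => exact ih.mono fun k a h => (Bool.or_eq_false_iff.1 h).1
  | iteFalse hb h ih => exact ih.mono fun k a h => (Bool.or_eq_false_iff.1 h).2
  | loopStop hb => exact Frame.refl _ _
  | loopStep hb h₁ h₂ ih₁ ih₂ => exact Frame.trans (ih₁.mono fun k a h => h) ih₂

/-- Started on memory `s` at time `t`, the program stops, with a memory and at a time that satisfy
`Q`. -/
def WP (M : ℕ) (p : Prog) (Q : MState → ℕ → Prop) (s : MState) (t : ℕ) : Prop :=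
  ∃ s' t', Exec M p s s' t' ∧ Q s' (t + t')

namespace WP

variable {M : ℕ} {p q : Prog} {b : Test} {Q R : MState → ℕ → Prop} {s : MState} {t : ℕ}

theorem skip_iff : WP M .skip Q s t ↔ Q s t := by
  refine ⟨fun ⟨s', t', h, hQ⟩ => ?_, fun h => ⟨s, 0, .skip s, h⟩⟩
  cases h
  exact hQ

theorem instr_iff {c : Instr} : WP M (.instr c) Q s t ↔ c.Within M s ∧ Q (c.apply s) (t + 1) := by
  refine ⟨fun ⟨s', t', h, hQ⟩ => ?_, fun h => ⟨_, 1, .instr c s h.1, h.2⟩⟩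
  cases h with
  | instr _ _ h => exact ⟨h, hQ⟩

theorem seq_iff : WP M (.seq p q) Q s t ↔ WP M p (WP M q Q) s t := by
  constructor
  · rintro ⟨s', t', h, hQ⟩
    cases h with
    | seq h₁ h₂ => exact ⟨_, _, h₁, _, _, h₂, by rwa [Nat.add_assoc]⟩
  · rintro ⟨s₁, t₁, h₁, s₂, t₂, h₂, hQ⟩
    exact ⟨_, _, .seq h₁ h₂, by rwa [← Nat.add_assoc]⟩

theorem ite_iff : WP M (.ite b p q) Q s t ↔
    (b.Holds s → WP M p Q s (t + 1)) ∧ (¬ b.Holds s → WP M q Q s (t + 1)) := by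
  constructor
  · rintro ⟨s', t', h, hQ⟩
    cases h with
    | iteTrue hb h =>
      exact ⟨fun _ => ⟨_, _, h, by rwa [Nat.add_assoc, Nat.add_comm 1]⟩, fun h => absurd hb h⟩
    | iteFalse hb h =>
      exact ⟨fun h => absurd h hb, fun _ => ⟨_, _, h, by rwa [Nat.add_assoc, Nat.add_comm 1]⟩⟩
  · intro h
    by_cases hb : b.Holds s
    · obtain ⟨s', t', h', hQ⟩ := h.1 hb
      exact ⟨_, _, .iteTrue hb h', by rwa [Nat.add_comm t', ← Nat.add_assoc]⟩
    · obtain ⟨s', t', h', hQ⟩ := h.2 hb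
      exact ⟨_, _, .iteFalse hb h', by rwa [Nat.add_comm t', ← Nat.add_assoc]⟩

theorem mono (h : WP M p R s t) (hQ : ∀ s' t', Frame p s s' → R s' t' → Q s' t') :
    WP M p Q s t := by
  obtain ⟨s', t', he, hR⟩ := h
  exact ⟨s', t', he, hQ _ _ he.frame hR⟩

theorem seq (h : WP M p R s t) (hQ : ∀ s' t', Frame p s s' → R s' t' → WP M q Q s' t') :
    WP M (.seq p q) Q s t :=
  seq_iff.2 (h.mono hQ)

/-- The invariant is indexed by the number `k` of rounds already made. Termination comes from `K`:
another round may start only if `k < K`. -/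
theorem loop (I : ℕ → MState → ℕ → Prop) (K : ℕ) (h0 : I 0 s t)
    (hstep : ∀ k s' t', Frame p s s' → I k s' t' → b.Holds s' →
      k < K ∧ WP M p (I (k + 1)) s' (t' + 1))
    (hend : ∀ k s' t', Frame p s s' → I k s' t' → ¬ b.Holds s' → Q s' (t' + 1)) :
    WP M (.loop b p) Q s t := by
  suffices H : ∀ m k s' t', m + k = K → Frame p s s' → I k s' t' → WP M (.loop b p) Q s' t' from
    H K 0 s t rfl (Frame.refl _ _) h0
  intro m
  induction m with
  | zero =>
    intro k s' t' hk hf hI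
    by_cases hb : b.Holds s'
    · have := (hstep k s' t' hf hI hb).1
      omega
    · exact ⟨_, _, .loopStop hb, hend k s' t' hf hI hb⟩
  | succ m ih =>
    intro k s' t' hk hf hI
    by_cases hb : b.Holds s'
    · obtain ⟨s₁, t₁, h₁, hI₁⟩ := (hstep k s' t' hf hI hb).2
      obtain ⟨s₂, t₂, h₂, hQ⟩ := ih (k + 1) s₁ _ (by omega) (hf.trans h₁.frame) hI₁
      refine ⟨_, _, .loopStep hb h₁ h₂, ?_⟩
      convert hQ using 1
      omega
    · exact ⟨_, _, .loopStop hb, hend k s' t' hf hI hb⟩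

/-- A loop that increases the register `a` up to the value `n` of register `c`. -/
theorem for_loop {a c n i₀ : ℕ} (J : ℕ → MState → ℕ → Prop) (hc : p.writes 0 c = false)
    (hn : s.nreg c = n) (hi : s.nreg a = i₀) (hle : i₀ ≤ n) (h0 : J i₀ s t)
    (hstep : ∀ i s' t', i₀ ≤ i → i < n → Frame p s s' → s'.nreg a = i → s'.nreg c = n → J i s' t' →
      WP M p (fun s'' t'' => s''.nreg a = i + 1 ∧ J (i + 1) s'' t'') s' (t' + 1))
    (hend : ∀ s' t', Frame p s s' → s'.nreg a = n → J n s' t' → Q s' (t' + 1)) :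
    WP M (.loop (.lt a c) p) Q s t := by
  refine loop (fun k s' t' => i₀ + k ≤ n ∧ s'.nreg a = i₀ + k ∧ J (i₀ + k) s' t') n
    ⟨by omega, by omega, h0⟩ (fun k s' t' hf hI hb => ?_) (fun k s' t' hf hI hb => ?_)
  · have hb' : s'.nreg a < s'.nreg c := hb
    have h1 := hf.nreg c hc
    have h2 := hI.2.1
    refine ⟨by omega, (hstep _ _ _ (Nat.le_add_right _ _) (by omega) hf hI.2.1 (h1.trans hn)
      hI.2.2).mono fun s'' t'' _ h => ⟨by omega, h.1.trans (by omega), h.2⟩⟩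
  · have hb' : ¬ s'.nreg a < s'.nreg c := hb
    have h1 := hf.nreg c hc
    have h2 := hI.2.1
    have h3 := hI.1
    have h4 : i₀ + k = n := by omega
    exact hend _ _ hf (h2.trans h4) (h4 ▸ hI.2.2)

end WP

namespace RectilinearPolygon

variable {P : RectilinearPolygon}

/-! ### The strip cover program -/

theorem one_le_size (P : RectilinearPolygon) : 1 ≤ P.size :=
  (one_le_two.trans P.outer.two_le).trans (Nat.le_add_right _ (P.holes.map Contour.m).sum)

namespace IsTiled

theorem steps_injective (h : P.IsTiled) {k : ℕ} : ∀ {D D' E : Rect}, P.BottomSteps k D E →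
    P.BottomSteps k D' E → D = D' := by
  induction k with
  | zero => exact fun h1 h2 => Eq.trans (Eq.symm h1) h2
  | succ k ih =>
    rintro D D' E ⟨F, h1, h2⟩ ⟨F', h1', h2'⟩
    obtain rfl := ih h2 h2'
    exact h.top_unique (isTop_iff_isBottom.2 h1) (isTop_iff_isBottom.2 h1')

theorem height_of_steps (h : P.IsTiled) {k : ℕ} : ∀ {D E : Rect}, P.BottomSteps k D E →
    (¬ ∃ A, P.IsBottom E A) → P.height D = k := by
  induction k with
  | zero =>
    intro D E h1 h2
    have h1' : E = D := h1
    exact h.height_eq_zero (h1' ▸ h2)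
  | succ k ih =>
    rintro D E ⟨F, h1, h2⟩ h3
    rw [h.height_succ h1, ih h2 h3]

theorem exists_steps_bottomless (h : P.IsTiled) (D : Rect) :
    ∃ E k, P.BottomSteps k D E ∧ ¬ ∃ A, P.IsBottom E A := by
  obtain ⟨E, hE⟩ := h.exists_steps_height D
  refine ⟨E, _, hE, fun ⟨A, hA⟩ => ?_⟩
  have := h.le_height (bottomSteps_add.2 ⟨E, hE, bottomSteps_one.2 hA⟩)
  omega

end IsTiled

/-- The memory holds the base rectangle graph, with the given numbering of the nodes. -/
structure HoldsNodes (P : RectilinearPolygon) (node : ℕ → Rect) (N : ℕ) (s : MState) : Prop where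
  num : s.nreg 0 = N
  bij : Set.BijOn node (Set.Iio N) P.baseRects
  left : ∀ i < N, s.rarr 0 i = (node i).left
  top : ∀ i < N, s.rarr 1 i = (node i).top
  right : ∀ i < N, s.rarr 2 i = (node i).right
  bottom : ∀ i < N, s.rarr 3 i = (node i).bottom
  isLeft : ∀ i < N, (s.narr 0 i < N ∧ P.IsLeft (node i) (node (s.narr 0 i))) ∨
    (s.narr 0 i = N ∧ ¬ ∃ A, P.IsLeft (node i) A)
  isTop : ∀ i < N, (s.narr 1 i < N ∧ P.IsTop (node i) (node (s.narr 1 i))) ∨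
    (s.narr 1 i = N ∧ ¬ ∃ A, P.IsTop (node i) A)
  isRight : ∀ i < N, (s.narr 2 i < N ∧ P.IsRight (node i) (node (s.narr 2 i))) ∨
    (s.narr 2 i = N ∧ ¬ ∃ A, P.IsRight (node i) A)
  isBottom : ∀ i < N, (s.narr 3 i < N ∧ P.IsBottom (node i) (node (s.narr 3 i))) ∨
    (s.narr 3 i = N ∧ ¬ ∃ A, P.IsBottom (node i) A)

theorem holdsGraph_iff {s : MState} :
    HoldsGraph P s ↔ ∃ node, HoldsNodes P node (s.nreg 0) s := by
  constructor
  · rintro ⟨node, h1, h2⟩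
    refine ⟨node, rfl, h1, fun i hi => (h2 i hi).1, fun i hi => (h2 i hi).2.1,
      fun i hi => (h2 i hi).2.2.1, fun i hi => (h2 i hi).2.2.2.1, fun i hi => ?_, fun i hi => ?_,
      fun i hi => ?_, fun i hi => ?_⟩
    · exact (h2 i hi).2.2.2.2 0
    · exact (h2 i hi).2.2.2.2 1
    · exact (h2 i hi).2.2.2.2 2
    · exact (h2 i hi).2.2.2.2 3
  · rintro ⟨node, h⟩
    refine ⟨node, h.bij, fun i hi => ⟨h.left i hi, h.top i hi, h.right i hi, h.bottom i hi, ?_⟩⟩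
    intro d
    fin_cases d
    · exact h.isLeft i hi
    · exact h.isTop i hi
    · exact h.isRight i hi
    · exact h.isBottom i hi

namespace HoldsNodes

variable {node : ℕ → Rect} {N : ℕ} {s s' : MState}

theorem of_eq (h : HoldsNodes P node N s) (h0 : s'.nreg 0 = s.nreg 0)
    (hn : ∀ a < 4, s'.narr a = s.narr a) (hr : ∀ a < 4, s'.rarr a = s.rarr a) :
    HoldsNodes P node N s' where
  num := h0.trans h.num
  bij := h.bij
  left := by rw [hr 0 (by decide)]; exact h.left
  top := by rw [hr 1 (by decide)]; exact h.top
  right := by rw [hr 2 (by decide)]; exact h.right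
  bottom := by rw [hr 3 (by decide)]; exact h.bottom
  isLeft := by rw [hn 0 (by decide)]; exact h.isLeft
  isTop := by rw [hn 1 (by decide)]; exact h.isTop
  isRight := by rw [hn 2 (by decide)]; exact h.isRight
  isBottom := by rw [hn 3 (by decide)]; exact h.isBottom

theorem frame {p : Prog} (h : HoldsNodes P node N s) (hf : Frame p s s')
    (hp : (p.writes 0 0 || (List.range 4).any (fun a => p.writes 2 a || p.writes 3 a)) = false) :
    HoldsNodes P node N s' := by
  rw [Bool.or_eq_false_iff, List.any_eq_false] at hp
  have H : ∀ a < 4, p.writes 2 a = false ∧ p.writes 3 a = false := fun a ha => by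
    have := hp.2 a (List.mem_range.2 ha)
    rwa [Bool.not_eq_true, Bool.or_eq_false_iff] at this
  exact h.of_eq (hf.nreg 0 hp.1) (fun a ha => hf.narr a (H a ha).1) fun a ha => hf.rarr a (H a ha).2

theorem ncard_eq (h : HoldsNodes P node N s) : P.baseRects.ncard = N := by
  rw [← h.bij.image_eq, h.bij.injOn.ncard_image, Set.ncard_Iio_nat]

theorem mem (h : HoldsNodes P node N s) {i : ℕ} (hi : i < N) : node i ∈ P.baseRects :=
  h.bij.mapsTo hi

theorem exists_eq (h : HoldsNodes P node N s) {B : Rect} (hB : B ∈ P.baseRects) :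
    ∃ i < N, node i = B := h.bij.surjOn hB

end HoldsNodes

/-- Accounting for a loop over at most n² nodes: constant work at every node and work proportional
to n at the O(n) nodes that start a walk are quadratic together. -/
theorem sum_ite_le {p : ℕ → Prop} [DecidablePred p] {N K a b n : ℕ} (hN : N ≤ n ^ 2)
    (hK : ({j ∈ Finset.range N | ¬ p j}).card ≤ K * n) :
    ∑ j ∈ Finset.range N, (a + if p j then 0 else b * n) ≤ (a + K * b) * n ^ 2 := by
  have h1 : ∑ j ∈ Finset.range N, (a + if p j then 0 else b * n) = N * a +
      ({j ∈ Finset.range N | ¬ p j}).card * (b * n) := by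
    rw [Finset.sum_add_distrib, Finset.sum_const, Finset.card_range, smul_eq_mul,
      Finset.card_filter, Finset.sum_mul]
    refine congrArg _ (Finset.sum_congr rfl fun j _ => ?_)
    split_ifs <;> simp_all
  rw [h1]
  calc _ ≤ n ^ 2 * a + K * n * (b * n) :=
        Nat.add_le_add (Nat.mul_le_mul_right _ hN) (Nat.mul_le_mul_right _ hK)
    _ = _ := by ring

theorem HoldsNodes.card_filter_le {N : ℕ} {node : ℕ → Rect} {s : MState} (ht : P.IsTiled)
    (h : HoldsNodes P node N s) {p : Rect → Prop} [DecidablePred fun j => p (node j)] {m : ℕ}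
    (hp : {B ∈ P.baseRects | p B}.ncard ≤ m) :
    ({j ∈ Finset.range N | p (node j)}).card ≤ m := by
  rw [← Set.ncard_coe_finset]
  refine le_trans (Set.ncard_le_ncard_of_injOn node (fun j hj => ?_) (h.bij.injOn.mono
    fun j hj => ?_) (ht.finite.subset fun _ h => h.1)) hp
  · rw [Finset.mem_coe, Finset.mem_filter, Finset.mem_range] at hj
    exact ⟨h.mem hj.1, hj.2⟩
  · rw [Finset.mem_coe, Finset.mem_filter, Finset.mem_range] at hj
    exact hj.1

-- After `k` rounds register `4` holds the only node from which `k` steps down lead to node `i`, or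
-- `N` if there is none. Its height is `k` because node `i` has no bottom neighbour. Whatever is
-- written is right, so heights that were right remain so.
open Instr Test in
theorem computeHeights_column {M N : ℕ} {node : ℕ → Rect} (ht : P.IsTiled) (hM : N ≤ M) {s : MState}
    {t i : ℕ} (h : HoldsNodes P node N s) (hi : i < N) (hb : ¬ ∃ A, P.IsBottom (node i) A)
    (h4 : s.nreg 4 = i) (h7 : s.nreg 7 = 0) :
    WP M (.loop (lt 4 0) (.block [.instr (store 4 4 7), .instr (succ 7), .instr (load 4 1 4)]))
      (fun s' t' => t' ≤ t + 4 * P.size + 10 ∧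
        (∀ e < N, (∃ m, P.BottomSteps m (node e) (node i)) → s'.narr 4 e = P.height (node e)) ∧
        ∀ e < N, s.narr 4 e = P.height (node e) → s'.narr 4 e = P.height (node e)) s t := by
  refine WP.loop (fun k s' t' => s'.nreg 7 = k ∧ t' ≤ t + 4 * k ∧ k ≤ P.size + 1 ∧
    (∀ e < N, (∃ m < k, P.BottomSteps m (node e) (node i)) → s'.narr 4 e = P.height (node e)) ∧
    (∀ e < N, s.narr 4 e = P.height (node e) → s'.narr 4 e = P.height (node e)) ∧
    (s'.nreg 4 < N ∧ P.BottomSteps k (node (s'.nreg 4)) (node i) ∨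
      s'.nreg 4 = N ∧ ∀ E m, k ≤ m → ¬ P.BottomSteps m E (node i))) (P.size + 1) ?_ ?_ ?_
  · exact ⟨h7, le_rfl, by omega, fun e _ ⟨m, hm, _⟩ => absurd hm (Nat.not_lt_zero _),
      fun _ _ h => h, Or.inl ⟨by omega, by rw [h4]; rfl⟩⟩
  · rintro k s' t' hf ⟨h1, h2, h3, h5, h6, h8⟩ hlt
    have hg := h.frame hf rfl
    have hlt' : s'.nreg 4 < N := by rw [← hg.num]; exact hlt
    have hs := (h8.resolve_right fun h => hlt'.ne h.1).2
    have hk := (ht.height_of_steps hs hb).symm.trans_le (ht.height_le _)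
    refine ⟨by omega, ?_⟩
    simp +decide only [Prog.block, WP.seq_iff, WP.instr_iff, WP.skip_iff, Instr.apply, Instr.Within,
      Function.update_apply, reduceIte, true_and]
    have hE : ∀ E m, k ≤ m → P.BottomSteps m E (node i) →
        ∃ F, P.BottomSteps (m - k) E F ∧ F = node (s'.nreg 4) := fun E m hkm hE => by
      rw [← Nat.sub_add_cancel hkm, bottomSteps_add] at hE
      obtain ⟨F, h1, h2⟩ := hE
      exact ⟨F, h1, ht.steps_injective h2 hs⟩
    refine ⟨hlt'.trans_le hM, hlt'.trans_le hM, by omega, by omega, by omega, ?_, ?_, ?_⟩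
    · rintro e he ⟨m, hm, hmE⟩
      split_ifs with hc
      · rw [hc, ht.height_of_steps hs hb, h1]
      · refine h5 e he ⟨m, lt_of_le_of_ne (Nat.le_of_lt_succ hm) ?_, hmE⟩
        rintro rfl
        exact hc (h.bij.injOn he hlt' (ht.steps_injective hmE hs))
    · rintro e he h
      split_ifs with hc
      · rw [hc, ht.height_of_steps hs hb, h1]
      · exact h6 e he h
    · refine (hg.isTop _ hlt').imp (fun h => ⟨h.1, ?_⟩) fun h => ⟨h.1, fun E m hm hmE => ?_⟩
      · exact ⟨_, isTop_iff_isBottom.1 h.2, hs⟩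
      · obtain ⟨F, h1, rfl⟩ := hE E m (by omega) hmE
        obtain ⟨r, hr⟩ := Nat.exists_eq_add_of_lt (Nat.lt_of_succ_le hm)
        have : m - k = r + 1 := by omega
        rw [this, bottomSteps_add] at h1
        obtain ⟨G, -, h2⟩ := h1
        exact h.2 ⟨_, isTop_iff_isBottom.2 (bottomSteps_one.1 h2)⟩
  · rintro k s' t' hf ⟨h1, h2, h3, h5, h6, h8⟩ hlt
    have hg := h.frame hf rfl
    refine ⟨by omega, fun e he ⟨m, hm⟩ => h5 e he ⟨m, ?_, hm⟩, h6⟩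
    have h9 := (h8.resolve_left fun h => hlt (by rw [← hg.num] at h; exact h.1)).2
    by_contra hc
    exact h9 _ m (not_lt.1 hc) hm

-- Every node lies above one without bottom neighbour, so the upward walks from the latter reach all
-- nodes. By `bottomless_le` there are at most 3n such walks.
open Instr Test in
theorem computeHeights_spec {M N : ℕ} {node : ℕ → Rect} (ht : P.IsTiled) (hM : N ≤ M) {s : MState}
    {t : ℕ} (h : HoldsNodes P node N s) :
    WP M computeHeights (fun s' t' => t' ≤ t + 80 * P.size ^ 2 + 10 ∧
        (∀ e < N, s'.narr 4 e = P.height (node e))) s t := by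
  classical
  have hn := P.one_le_size
  -- A walk of at most `4 n + 10` steps and its overhead fit into `25 n`, as n is at least 1.
  let c : ℕ → ℕ := fun i => 5 + if ∃ A, P.IsBottom (node i) A then 0 else 25 * P.size
  have hc : ∑ j ∈ Finset.range N, c j ≤ (5 + 3 * 25) * P.size ^ 2 :=
    sum_ite_le (h.ncard_eq ▸ ht.ncard_le) (h.card_filter_le ht ht.bottomless_le)
  rw [computeHeights, Prog.block, WP.seq_iff, WP.instr_iff]
  refine ⟨trivial, ?_⟩
  rw [Prog.block, WP.seq_iff]
  simp only [Prog.block]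
  refine WP.for_loop (n := N) (i₀ := 0) (fun i s' t' => t' ≤ t + 2 + ∑ j ∈ Finset.range i, c j ∧
    ∀ e < N, (∃ j < i, (¬ ∃ A, P.IsBottom (node j) A) ∧ ∃ m, P.BottomSteps m (node e) (node j)) →
      s'.narr 4 e = P.height (node e)) rfl h.num rfl (Nat.zero_le _)
      ⟨by simp, fun e _ ⟨m, hm, _⟩ => absurd hm (Nat.not_lt_zero _)⟩ ?_ ?_
  · rintro i s' t' - hi hf h2 hN ⟨h3, h4⟩
    have hg : HoldsNodes P node N s' := HoldsNodes.frame (h.of_eq (s' := (zero 2).apply s) rfl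
      (fun _ _ => rfl) fun _ _ => rfl) hf rfl
    rw [Finset.sum_range_succ]
    have hlt : i < M := hi.trans_le hM
    simp +decide only [WP.seq_iff, WP.ite_iff, WP.instr_iff, WP.skip_iff, Instr.apply, Instr.Within,
      Function.update_apply, reduceIte, true_and, Test.Holds, h2, hN, hlt]
    have hci : 5 ≤ c i := Nat.le_add_right _ _
    refine ⟨fun h5 => ⟨by omega, ?_⟩, fun h5 => ?_⟩
    · rintro e he ⟨j, hj, hb, hm⟩
      refine h4 e he ⟨j, lt_of_le_of_ne (Nat.le_of_lt_succ hj) ?_, hb, hm⟩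
      rintro rfl
      exact hb ⟨_, ((hg.isBottom _ hi).resolve_right fun h => h5.ne h.1).2⟩
    · have hb := ((hg.isBottom _ hi).resolve_left fun h => h5 h.1).2
      have hci : c i = 5 + 25 * P.size := by
        simp only [c]
        rw [if_neg hb]
      refine WP.mono (computeHeights_column ht hM (hg.of_eq ?_ ?_ ?_) hi hb ?_ ?_)
        fun s'' t'' hf' ⟨h6, h7, h8⟩ => ?_
      · rfl
      · exact fun _ _ => rfl
      · exact fun _ _ => rfl
      · rfl
      · rfl
      have h9 : s''.nreg 2 = i := (hf'.nreg 2 rfl).trans h2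
      simp +decide only [WP.seq_iff, WP.instr_iff, WP.skip_iff, Instr.apply, Instr.Within,
        Function.update_apply, reduceIte, true_and, h9]
      refine ⟨by omega, ?_⟩
      rintro e he ⟨j, hj, hb, hm⟩
      obtain rfl | hj := eq_or_lt_of_le (Nat.le_of_lt_succ hj)
      · exact h7 e he hm
      · exact h8 e he (h4 e he ⟨j, hj, hb, hm⟩)
  · rintro s' t' hf h2 ⟨h3, h4⟩
    simp only [WP.skip_iff]
    refine ⟨by omega, fun e he => h4 e he ?_⟩
    obtain ⟨E, k, hE, hb⟩ := ht.exists_steps_bottomless (node e)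
    obtain ⟨j, hj, rfl⟩ := h.exists_eq (hE.bounds (h.mem he)).1
    exact ⟨j, hj, hb, k, hE⟩

/-- The direction is left open: `rank` strictly decreases along `nbr` and bounds the number of
rounds. Stopping at a lower neighbour sets register `6` to `N`, so the loop then ends as it does at
a missing neighbour. -/
theorem walk_spec {M N H K d a : ℕ} {node : ℕ → Rect} {nbr : Rect → Rect → Prop} {rank : Rect → ℕ}
    (ha : a = 4 ∨ a = 5) (hM : N ≤ M) {s : MState} {t i : ℕ} (hN : s.nreg 0 = N) (hi : i < N)
    (hd : ∀ i < N, (s.narr d i < N ∧ nbr (node i) (node (s.narr d i))) ∨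
      (s.narr d i = N ∧ ¬ ∃ A, nbr (node i) A))
    (hu : ∀ B A A', nbr B A → nbr B A' → A = A') (hrank : ∀ B A, nbr B A → rank A < rank B)
    (hK : rank (node i) ≤ K) (h2 : s.nreg 2 = i) (h3 : s.nreg 3 = H)
    (h4 : ∀ e < N, s.narr 4 e = P.height (node e)) :
    WP M (walk d a) (fun s' t' => t' ≤ t + 6 * K + 20 ∧ s'.nreg a < N ∧
      Relation.ReflTransGen (fun D A => nbr D A ∧ H ≤ P.height A) (node i) (node (s'.nreg a)) ∧
      ∀ A, nbr (node (s'.nreg a)) A → P.height A < H) s t := by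
  have hiM := hi.trans_le hM
  have H0 : ∀ j < N, s.narr d j = N ∧ (∀ A, nbr (node j) A → P.height A < H) ∨
      s.narr d j < N ∧ nbr (node j) (node (s.narr d j)) := fun j hj =>
    (hd j hj).symm.imp_left fun h => ⟨h.1, fun A hA => absurd ⟨A, hA⟩ h.2⟩
  let I : ℕ → MState → ℕ → Prop := fun k s' t' => s'.nreg a < N ∧
    Relation.ReflTransGen (fun D A => nbr D A ∧ H ≤ P.height A) (node i) (node (s'.nreg a)) ∧
    t' ≤ t + 2 + 5 * k ∧ k ≤ K + 1 ∧ ((s'.nreg 6 = N ∧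
      ∀ A, nbr (node (s'.nreg a)) A → P.height A < H) ∨ (s'.nreg 6 < N ∧
      nbr (node (s'.nreg a)) (node (s'.nreg 6)) ∧ rank (node (s'.nreg a)) + k ≤ K))
  rcases ha with rfl | rfl
  all_goals
    rw [walk]
    simp +decide only [Prog.block, WP.seq_iff, WP.instr_iff, Instr.apply,
      Instr.Within, Function.update_apply, reduceIte, true_and, h2, hiM]
    refine WP.loop I (K + 1) ?_ ?_ ?_
    · simp +decide only [I, Function.update_apply, reduceIte]
      exact ⟨hi, .refl, by omega, by omega,
        (H0 i hi).imp_right fun h => ⟨h.1, h.2, by omega⟩⟩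
    · rintro k s' t' hf ⟨g1, g2, g3, g4, g5⟩ hb
      have hN' : s'.nreg 0 = N := (hf.nreg 0 rfl).trans hN
      have h3' : s'.nreg 3 = H := (hf.nreg 3 rfl).trans h3
      have hn' : s'.narr = s.narr := funext fun a => hf.narr a rfl
      have hb' : s'.nreg 6 < N := by rw [← hN']; exact hb
      obtain ⟨g6, g7⟩ := (g5.resolve_left fun h => hb'.ne h.1).2
      have g8 := hrank _ _ g6
      refine ⟨by omega, ?_⟩
      simp +decide only [WP.seq_iff, WP.instr_iff, WP.ite_iff, WP.skip_iff, Instr.apply,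
        Instr.Within, Test.Holds, Function.update_apply, reduceIte, true_and, h3', hN', hn',
        I, h4 _ hb', lt_self_iff_false, false_and, or_false]
      refine ⟨hb'.trans_le hM, fun hlt => ⟨g1, g2, by omega, by omega, fun A hA => ?_⟩,
        fun hlt => ⟨hb'.trans_le hM, hb', g2.tail ⟨g6, not_lt.1 hlt⟩, by omega, by omega, ?_⟩⟩
      · rwa [hu _ _ _ hA g6]
      · exact (H0 _ hb').imp_right fun h => ⟨h.1, h.2, by omega⟩
    · rintro k s' t' hf ⟨g1, g2, g3, g4, g5⟩ hb
      have hN' : s'.nreg 0 = N := (hf.nreg 0 rfl).trans hN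
      simp only [WP.skip_iff]
      exact ⟨by omega, g1, g2, (g5.resolve_right fun h => hb (by
        rw [← hN'] at h; exact h.1)).2⟩

/-- A linear search through the list suffices, since the list never holds more than O(n) rectangles.
-/
theorem reportNew_spec {M : ℕ} {s : MState} {t : ℕ} {T : Set Rect} {R : Rect} (hT : HoldsOutput T s)
    (hM : s.nreg 1 < M) (h9 : s.nreg 9 = 0) (h10 : s.nreg 10 = 1) (hl : s.rreg 0 = R.left)
    (ht : s.rreg 1 = R.top) (hr : s.rreg 2 = R.right) (hb : s.rreg 3 = R.bottom) :
    WP M reportNew (fun s' t' => t' ≤ t + 12 * s.nreg 1 + 20 ∧ HoldsOutput (insert R T) s') s t := by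
  obtain ⟨out, hbij, hout⟩ := hT
  obtain ⟨c, hc⟩ : ∃ c, s.nreg 1 = c := ⟨_, rfl⟩
  rw [hc] at hbij hout hM ⊢
  rw [reportNew]
  simp +decide only [Prog.block, WP.seq_iff, WP.instr_iff, Instr.apply, Instr.Within, true_and]
  refine WP.for_loop (n := c) (i₀ := 0) (fun i s' t' => t' ≤ t + 2 + 11 * i ∧
    (s'.nreg 11 = 1 ∧ (∃ j < i, out j = R) ∨ s'.nreg 11 = 0 ∧ ∀ j < i, out j ≠ R)) rfl hc rfl
    (Nat.zero_le _) ⟨by omega, Or.inr ⟨rfl, fun j hj => absurd hj (Nat.not_lt_zero _)⟩⟩ ?_ ?_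
  · rintro i s' t' - hi hf h8 h1 ⟨h2, h3⟩
    have g0 := (hf.rreg 0 rfl).trans hl
    have g1 := (hf.rreg 1 rfl).trans ht
    have g2 := (hf.rreg 2 rfl).trans hr
    have g3 := (hf.rreg 3 rfl).trans hb
    have g10 := (hf.nreg 10 rfl).trans h10
    have ga : s'.rarr = s.rarr := funext fun a => hf.rarr a rfl
    obtain ⟨k4, k5, k6, k7⟩ := hout i hi
    have hiM := hi.trans hM
    have H : out i ≠ R → s'.nreg 11 = 1 ∧ (∃ j < i + 1, out j = R) ∨
        s'.nreg 11 = 0 ∧ ∀ j < i + 1, out j ≠ R := fun hne => h3.imp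
      (fun h => ⟨h.1, h.2.imp fun j hj => ⟨hj.1.trans (Nat.lt_succ_self i), hj.2⟩⟩)
      fun h => ⟨h.1, fun j hj => by
        obtain rfl | hj := eq_or_lt_of_le (Nat.le_of_lt_succ hj)
        exacts [hne, h.2 j hj]⟩
    simp +decide only [WP.seq_iff, WP.instr_iff, WP.ite_iff, WP.skip_iff, Instr.apply, Instr.Within,
      Test.Holds, Function.update_apply, reduceIte, true_and, g0, g1, g2, g3, g10, ga, k4, k5, k6, k7,
      h8, hiM]
    refine ⟨fun e1 => ⟨fun e2 => ⟨fun e3 => ⟨fun e4 => ⟨by omega, Or.inl ⟨i, Nat.lt_succ_self i, ?_⟩⟩,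
      fun e => ⟨by omega, H fun h => e ?_⟩⟩, fun e => ⟨by omega, H fun h => e ?_⟩⟩,
      fun e => ⟨by omega, H fun h => e ?_⟩⟩, fun e => ⟨by omega, H fun h => e ?_⟩⟩
    · ext
      exacts [e1.symm, e3.symm, e4.symm, e2.symm]
    all_goals rw [h]
  · rintro s' t' hf h8 ⟨h2, h3⟩
    have g0 := (hf.rreg 0 rfl).trans hl
    have g1 := (hf.rreg 1 rfl).trans ht
    have g2 := (hf.rreg 2 rfl).trans hr
    have g3 := (hf.rreg 3 rfl).trans hb
    have g9 := (hf.nreg 9 rfl).trans h9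
    have gc := (hf.nreg 1 rfl).trans hc
    have ga : s'.rarr = s.rarr := funext fun a => hf.rarr a rfl
    simp +decide only [WP.seq_iff, WP.instr_iff, WP.ite_iff, WP.skip_iff, Instr.apply, Instr.Within,
      Test.Holds, Function.update_apply, reduceIte, true_and, g0, g1, g2, g3, g9, gc, ga, hM]
    refine ⟨fun h => ⟨by omega, ?_⟩, fun h => ⟨by omega, ?_⟩⟩
    · obtain ⟨-, j, hj, rfl⟩ := h3.resolve_right fun h' => by omega
      rw [Set.insert_eq_of_mem (hbij.mapsTo hj)]
      refine ⟨out, by rwa [gc], ?_⟩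
      rw [gc, ga]
      exact hout
    · have hne := (h3.resolve_left fun h' => by omega).2
      refine ⟨Function.update out c R, ?_, ?_⟩
      · have h4 : Set.Iio (c + 1) = insert c (Set.Iio c) := by
          ext i
          simp only [Set.mem_Iio, Set.mem_insert_iff]
          omega
        have h5 : Set.EqOn out (Function.update out c R) (Set.Iio c) := fun i hi =>
          (Function.update_of_ne (ne_of_lt hi) _ _).symm
        simp +decide only [Function.update_apply, reduceIte]
        rw [h4]
        have h6 := (hbij.congr h5).insert (a := c) (by
          rw [Function.update_self]
          intro h
          obtain ⟨j, hj, h⟩ := hbij.surjOn h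
          exact hne j hj h)
        rwa [Function.update_self] at h6
      · intro i hi
        simp +decide only [Function.update_apply, reduceIte] at hi ⊢
        split_ifs with h
        · exact ⟨rfl, rfl, rfl, rfl⟩
        · exact hout i (by omega)

namespace IsTiled

theorem exists_rect_of_walk (h : P.IsTiled) {B B₁ B₂ : Rect} (hB : B ∈ P.baseRects)
    (w1 : Relation.ReflTransGen (fun D A => P.IsLeft D A ∧ P.height B ≤ P.height A) B B₁)
    (w2 : Relation.ReflTransGen (fun D A => P.IsRight D A ∧ P.height B ≤ P.height A) B B₂) :
    ∃ F, P.BottomSteps (P.height B) B₂ F ∧ ∃ R : Rect,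
      R.left = B₁.left ∧ R.top = B₁.top ∧ R.right = F.right ∧ R.bottom = F.bottom := by
  obtain ⟨E, hE⟩ := h.exists_steps_height B
  obtain ⟨⟨hB1, t1, b1, F1, hF1, e1⟩, l1, -⟩ := h.walk_left hB hE w1
  obtain ⟨⟨hB2, t2, b2, F2, hF2, e2⟩, l2, -⟩ := h.walk_right hB hE w2
  have g := hF2.bounds hB2
  have g' := B₂.bottom_lt_top
  have := B.left_lt_right
  exact ⟨F2, hF2, ⟨B₁.left, F2.right, F2.bottom, B₁.top, by linarith [g.2.2.1],
    by linarith [g.2.2.2.2.1]⟩, rfl, rfl, rfl, rfl⟩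

end IsTiled

open Instr Test in
theorem descend_spec {M N H : ℕ} {node : ℕ → Rect} (ht : P.IsTiled) (hM : N ≤ M) {s : MState}
    {t i : ℕ} {F : Rect} (h : HoldsNodes P node N s) (hi : i < N) (h5 : s.nreg 5 = i)
    (h7 : s.nreg 7 = 0) (h3 : s.nreg 3 = H) (hF : P.BottomSteps H (node i) F) :
    WP M (.loop (lt 7 3) (.block [.instr (load 5 3 5), .instr (succ 7)]))
      (fun s' t' => t' ≤ t + 3 * H + 1 ∧ s'.nreg 5 < N ∧ node (s'.nreg 5) = F) s t := by
  refine WP.for_loop (n := H) (i₀ := 0) (fun k s' t' => t' ≤ t + 3 * k ∧ s'.nreg 5 < N ∧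
    P.BottomSteps k (node i) (node (s'.nreg 5))) rfl h3 h7 (Nat.zero_le _) ?_ ?_ ?_
  · rw [h5]
    exact ⟨le_rfl, hi, rfl⟩
  · rintro k s' t' - hk hf g7 - ⟨g1, g2, g3⟩
    have hg := h.frame hf rfl
    obtain ⟨r, hr⟩ := Nat.exists_eq_add_of_lt hk
    have hr' : H = k + (1 + r) := by omega
    rw [hr', bottomSteps_add] at hF
    obtain ⟨D, h1, h2⟩ := hF
    obtain rfl := ht.steps_unique h1 g3
    obtain ⟨A, hA, -⟩ := bottomSteps_add.1 h2
    have g4 := (hg.isBottom _ g2).resolve_right fun h => h.2 ⟨A, bottomSteps_one.1 hA⟩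
    simp +decide only [Prog.block, WP.seq_iff, WP.instr_iff, WP.skip_iff, Instr.apply, Instr.Within,
      Function.update_apply, reduceIte, true_and, g7]
    exact ⟨g2.trans_le hM, by omega, g4.1, bottomSteps_add.2 ⟨_, g3, bottomSteps_one.2 g4.2⟩⟩
  · rintro s' t' hf g7 ⟨g1, g2, g3⟩
    exact ⟨by omega, g2, ht.steps_unique g3 hF⟩

theorem _root_.HoldsOutput.of_eq {T : Set Rect} {s s' : MState} (h : HoldsOutput T s)
    (h1 : s'.nreg 1 = s.nreg 1) (hr : s'.rarr = s.rarr) : HoldsOutput T s' := by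
  obtain ⟨out, h2, h3⟩ := h
  refine ⟨out, by rwa [h1], ?_⟩
  rw [h1, hr]
  exact h3

theorem _root_.HoldsOutput.nreg_eq {T : Set Rect} {s : MState} (h : HoldsOutput T s) :
    s.nreg 1 = T.ncard := by
  obtain ⟨out, h1, -⟩ := h
  rw [← h1.image_eq, h1.injOn.ncard_image, Set.ncard_Iio_nat]

/-- The rectangles that are reported for the first nodes. -/
def reportedBefore (P : RectilinearPolygon) (node : ℕ → Rect) (i : ℕ) : Set Rect :=
  {R | ∃ j < i, P.Reports (node j) R}

theorem reportedBefore_subset {node : ℕ → Rect} {i : ℕ} :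
    P.reportedBefore node i ⊆ P.stripCover := fun _ ⟨j, _, hj⟩ => ⟨node j, hj⟩

theorem reportedBefore_succ_of_top {node : ℕ → Rect} {i : ℕ} (hi : ∃ A, P.IsTop (node i) A) :
    P.reportedBefore node (i + 1) = P.reportedBefore node i := by
  ext R
  refine ⟨fun ⟨j, hj, hR⟩ => ⟨j, lt_of_le_of_ne (Nat.le_of_lt_succ hj) ?_, hR⟩,
    fun ⟨j, hj, hR⟩ => ⟨j, hj.trans (Nat.lt_succ_self i), hR⟩⟩
  rintro rfl
  exact hR.2.1 hi

theorem IsTiled.reportedBefore_succ (h : P.IsTiled) {node : ℕ → Rect} {i : ℕ} {R : Rect}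
    (hR : P.Reports (node i) R) :
    P.reportedBefore node (i + 1) = insert R (P.reportedBefore node i) := by
  ext R'
  refine ⟨fun ⟨j, hj, hR'⟩ => ?_, ?_⟩
  · obtain rfl | hj := eq_or_lt_of_le (Nat.le_of_lt_succ hj)
    · exact Or.inl (h.reports_unique hR' hR)
    · exact Or.inr ⟨j, hj, hR'⟩
  · rintro (rfl | ⟨j, hj, hR'⟩)
    · exact ⟨i, Nat.lt_succ_self i, hR⟩
    · exact ⟨j, hj.trans (Nat.lt_succ_self i), hR'⟩

-- The coefficient 51 consists of 6 for each of the two walks, 3 for the descent of at most n steps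
-- and 36 for the search among at most 3n rectangles. A new rectangle is stored at an index only
-- known to be at most `N`, hence `N < M`.
open Instr Test in
theorem report_node {M N : ℕ} {node : ℕ → Rect} (ht : P.IsTiled) (hM : N < M) {s : MState} {t i : ℕ}
    (h : HoldsNodes P node N s) (hi : i < N) (hb : ¬ ∃ A, P.IsTop (node i) A)
    (h4 : ∀ e < N, s.narr 4 e = P.height (node e)) (h2 : s.nreg 2 = i) (h9 : s.nreg 9 = 0)
    (h10 : s.nreg 10 = 1) (hT : HoldsOutput (P.reportedBefore node i) s) :
    WP M (.block [.instr (load 3 4 2), walk 0 4, walk 2 5, .instr (rload 0 0 4),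
        .instr (rload 1 1 4), .instr (zero 7),
        .loop (lt 7 3) (.block [.instr (load 5 3 5), .instr (succ 7)]),
        .instr (rload 2 2 5), .instr (rload 3 3 5), reportNew])
      (fun s' t' => t' ≤ t + 51 * P.size + 80 ∧
        HoldsOutput (P.reportedBefore node (i + 1)) s') s t := by
  have hiM := hi.trans hM
  rw [Prog.block, WP.seq_iff, WP.instr_iff]
  refine ⟨by rw [← h2] at hiM; exact hiM, ?_⟩
  have q2 : ((load 3 4 2).apply s).nreg 3 = P.height (node i) := by
    rw [← h4 i hi, ← h2]
    rfl
  refine WP.seq (walk_spec (node := node) (H := P.height (node i)) (Or.inl rfl) hM.le h.num hi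
    h.isLeft (fun _ _ _ => ht.left_unique) (fun _ _ => ht.leftRank_lt) (ht.leftRank_le _)
    h2 q2 h4) ?_
  rintro s₁ t₁ hf₁ ⟨u1, u2, u3, u4⟩
  have h1 : HoldsNodes P node N s₁ := HoldsNodes.frame
    (h.of_eq (s' := (load 3 4 2).apply s) rfl (fun _ _ => rfl) fun _ _ => rfl) hf₁ rfl
  refine WP.seq (walk_spec (node := node) (H := P.height (node i)) (Or.inr rfl) hM.le h1.num hi
    h1.isRight (fun _ _ _ => ht.right_unique) (fun _ _ => ht.rightRank_lt) (ht.rightRank_le _)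
    ((hf₁.nreg 2 rfl).trans h2) ((hf₁.nreg 3 rfl).trans q2)
    ((hf₁.narr 4 rfl).symm ▸ h4)) ?_
  rintro s₂ t₂ hf₂ ⟨v1, v2, v3, v4⟩
  have h2' : HoldsNodes P node N s₂ := h1.frame hf₂ rfl
  have g4 : s₂.nreg 4 = s₁.nreg 4 := hf₂.nreg 4 rfl
  have g3 : s₂.nreg 3 = P.height (node i) :=
    (hf₂.nreg 3 rfl).trans ((hf₁.nreg 3 rfl).trans q2)
  obtain ⟨F, hF, R, r1, r2, r3, r4⟩ := ht.exists_rect_of_walk (h.mem hi) u3 v3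
  rw [Prog.block, WP.seq_iff, WP.instr_iff]
  refine ⟨show s₂.nreg 4 < M by omega, ?_⟩
  rw [Prog.block, WP.seq_iff, WP.instr_iff]
  refine ⟨show s₂.nreg 4 < M by omega, ?_⟩
  rw [Prog.block, WP.seq_iff, WP.instr_iff]
  refine ⟨trivial, ?_⟩
  refine WP.seq (descend_spec ht hM.le (HoldsNodes.of_eq h2' ?_ ?_ ?_) v2 ?_ ?_ ?_ hF) ?_
  · rfl
  · exact fun _ _ => rfl
  · exact fun _ _ => rfl
  · rfl
  · rfl
  · exact g3
  rintro s₃ t₃ hf₃ ⟨w1, w2, rfl⟩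
  have w0 : s₃.rarr = s₂.rarr := funext fun a => hf₃.rarr a rfl
  have w4 : s₃.rreg 0 = R.left := (hf₃.rreg 0 rfl).trans (by
    rw [r1, ← g4]
    exact h2'.left _ (g4 ▸ u2))
  have w5 : s₃.rreg 1 = R.top := (hf₃.rreg 1 rfl).trans (by
    rw [r2, ← g4]
    exact h2'.top _ (g4 ▸ u2))
  rw [Prog.block, WP.seq_iff, WP.instr_iff]
  refine ⟨show s₃.nreg 5 < M by omega, ?_⟩
  rw [Prog.block, WP.seq_iff, WP.instr_iff]
  refine ⟨show s₃.nreg 5 < M by omega, ?_⟩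
  have x1 : s₃.nreg 1 = s.nreg 1 :=
    (hf₃.nreg 1 rfl).trans ((hf₂.nreg 1 rfl).trans (hf₁.nreg 1 rfl))
  have x9 : s₃.nreg 9 = 0 :=
    (hf₃.nreg 9 rfl).trans ((hf₂.nreg 9 rfl).trans ((hf₁.nreg 9 rfl).trans h9))
  have x10 : s₃.nreg 10 = 1 :=
    (hf₃.nreg 10 rfl).trans ((hf₂.nreg 10 rfl).trans ((hf₁.nreg 10 rfl).trans h10))
  have xr : s₃.rarr = s.rarr := funext fun a =>
    (hf₃.rarr a rfl).trans ((hf₂.rarr a rfl).trans (hf₁.rarr a rfl))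
  have y1 : s.nreg 1 ≤ 3 * P.size := by
    rw [hT.nreg_eq]
    exact (Set.ncard_le_ncard reportedBefore_subset ht.finite_stripCover).trans
      ht.ncard_stripCover_le
  have y2 : s.nreg 1 ≤ N := by
    rw [hT.nreg_eq, ← h.ncard_eq]
    exact (Set.ncard_le_ncard reportedBefore_subset ht.finite_stripCover).trans
      ht.ncard_stripCover_le_ncard
  have y3 := ht.height_le (node i)
  refine WP.seq (reportNew_spec (T := P.reportedBefore node i) (R := R)
    (HoldsOutput.of_eq hT ?_ ?_) ?_ ?_ ?_ ?_ ?_ ?_ ?_) ?_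
  · exact x1
  · exact xr
  · exact (show s₃.nreg 1 < M by omega)
  · exact x9
  · exact x10
  · exact w4
  · exact w5
  · refine Eq.trans ?_ r3.symm
    refine Eq.trans ?_ (h2'.right _ w2)
    rw [← w0]
    rfl
  · refine Eq.trans ?_ r4.symm
    refine Eq.trans ?_ (h2'.bottom _ w2)
    rw [← w0]
    rfl
  rintro s₄ t₄ - ⟨z1, z2⟩
  have z3 : t₄ ≤ t₃ + 1 + 1 + 12 * s₃.nreg 1 + 20 := z1
  rw [Prog.block, WP.skip_iff]
  refine ⟨by omega, ?_⟩
  rw [ht.reportedBefore_succ (R := R) ⟨h.mem hi, hb, _, _, _, u3, u4, v3, v4, hF, r1, r2, r3, r4⟩]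
  exact z2

theorem reportedBefore_all {N : ℕ} {node : ℕ → Rect} {s : MState} (h : HoldsNodes P node N s) :
    P.reportedBefore node N = P.stripCover := by
  refine Set.Subset.antisymm reportedBefore_subset ?_
  rintro R ⟨B, hB⟩
  obtain ⟨j, hj, rfl⟩ := h.exists_eq hB.1
  exact ⟨j, hj, hB⟩

open Instr Test in
theorem stripCoverProg_spec {M N : ℕ} {node : ℕ → Rect} (ht : P.IsTiled) (hM : N < M) {s : MState}
    {t : ℕ} (h : HoldsNodes P node N s) :
    WP M stripCoverProg (fun s' t' => t' ≤ t + 600 * P.size ^ 2 ∧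
        HoldsOutput P.stripCover s') s t := by
  classical
  have hn := P.one_le_size
  have hN := h.ncard_eq ▸ ht.ncard_le
  have hn2 : 1 ≤ P.size ^ 2 := Nat.one_le_pow _ _ hn
  -- `51 n + 80 ≤ 131 n`, the cost of one report.
  let c : ℕ → ℕ := fun i => 5 + if ∃ A, P.IsTop (node i) A then 0 else 131 * P.size
  have hc : ∑ j ∈ Finset.range N, c j ≤ (5 + 3 * 131) * P.size ^ 2 :=
    sum_ite_le hN (h.card_filter_le ht ht.topless_le)
  rw [stripCoverProg]
  refine WP.seq (computeHeights_spec (t := t) ht hM.le h) ?_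
  rintro s₁ t₁ hf₁ ⟨u1, u2⟩
  have h1 : HoldsNodes P node N s₁ := h.frame hf₁ rfl
  simp +decide only [Prog.block, WP.seq_iff, WP.instr_iff, Instr.apply, Instr.Within, true_and]
  refine WP.for_loop (n := N) (i₀ := 0) (fun i s' t' => t' ≤ t₁ + 5 + ∑ j ∈ Finset.range i, c j ∧
    HoldsOutput (P.reportedBefore node i) s') rfl h1.num rfl (Nat.zero_le _) ?_ ?_ ?_
  · refine ⟨by simp, fun i => ⟨0, 1, 0, 1, one_pos, one_pos⟩, ?_, fun i hi => absurd hi (Nat.not_lt_zero _)⟩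
    have h2 : P.reportedBefore node 0 = ∅ := by
      ext R
      exact ⟨fun ⟨j, hj, _⟩ => absurd hj (Nat.not_lt_zero _), fun h => absurd h (Set.notMem_empty R)⟩
    have h3 : Set.Iio 0 = (∅ : Set ℕ) := Set.Iio_bot
    rw [h2]
    simp +decide only [Function.update_apply, reduceIte]
    rw [h3]
    exact Set.bijOn_empty _
  · rintro i s' t' - hi hf g2 gN ⟨g3, g4⟩
    have hg : HoldsNodes P node N s' := HoldsNodes.frame (h1.of_eq
      (s' := (zero 2).apply ((zero 1).apply ((succ 10).apply ((zero 10).apply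
        ((zero 9).apply s₁))))) rfl (fun _ _ => rfl) fun _ _ => rfl) hf rfl
    have g9 : s'.nreg 9 = 0 := (hf.nreg 9 rfl).trans rfl
    have g10 : s'.nreg 10 = 1 := (hf.nreg 10 rfl).trans rfl
    have g5 : s'.narr 4 = s₁.narr 4 := hf.narr 4 rfl
    rw [Finset.sum_range_succ]
    have hlt : i < M := hi.trans hM
    have hci : 5 ≤ c i := Nat.le_add_right _ _
    rw [WP.seq_iff, WP.instr_iff]
    refine ⟨by rw [← g2] at hlt; exact hlt, ?_⟩
    have q6 : ((load 6 1 2).apply s').nreg 6 = s'.narr 1 i := by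
      rw [← g2]
      rfl
    have q0 : ((load 6 1 2).apply s').nreg 0 = N := gN
    rw [WP.seq_iff, WP.ite_iff, Test.Holds, q6, q0]
    refine ⟨fun g6 => ?_, fun g6 => ?_⟩
    · rw [reportedBefore_succ_of_top ⟨_, ((hg.isTop _ hi).resolve_right fun h => g6.ne h.1).2⟩]
      simp +decide only [WP.seq_iff, WP.instr_iff, WP.skip_iff, Instr.apply, Instr.Within,
        Function.update_apply, reduceIte, true_and, g2]
      exact ⟨by omega, g4.of_eq rfl rfl⟩
    · have hb := ((hg.isTop _ hi).resolve_left fun h => g6 h.1).2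
      have hci' : c i = 5 + 131 * P.size := by
        simp only [c]
        rw [if_neg hb]
      refine WP.mono (report_node ht hM (hg.of_eq ?_ ?_ ?_) hi hb ?_ ?_ ?_ ?_ (g4.of_eq ?_ ?_))
        fun s'' t'' hf' ⟨h6, h7⟩ => ?_
      · rfl
      · exact fun _ _ => rfl
      · exact fun _ _ => rfl
      · exact g5 ▸ u2
      · exact g2
      · exact g9
      · exact g10
      · rfl
      · rfl
      have h9 : s''.nreg 2 = i := (hf'.nreg 2 rfl).trans g2
      simp +decide only [WP.seq_iff, WP.instr_iff, WP.skip_iff, Instr.apply, Instr.Within,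
        Function.update_apply, reduceIte, true_and, h9]
      exact ⟨by omega, h7.of_eq rfl rfl⟩
  · rintro s' t' hf h2 ⟨h3, h4⟩
    rw [WP.skip_iff, ← reportedBefore_all h]
    exact ⟨by omega, h4⟩

end RectilinearPolygon

/-! ### Ranks of coordinates and extensions of edges -/

open Instr Test in
/-- Store the ranks of the numbers in the real array `A` in the array `B`, and the number of rank
`c` in cell `c` of the real array `C`. -/
def rankProg (A B C : ℕ) : Prog :=
  .block [
    .instr (zero 8),
    .loop (lt 8 0) (.block [
      .instr (rload 0 A 8),
      .instr (zero 5),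
      .instr (zero 7),
      .loop (lt 7 0) (.block [
        .instr (rload 1 A 7),
        .ite (rlt 0 1) .skip (.instr (succ 5)),
        .instr (succ 7)]),
      .instr (store B 8 5),
      .instr (rstore C 5 0),
      .instr (succ 8)])]

/-- Equal ranks belong to equal numbers, so it does no harm that `rankProg` may store the number of
a rank several times. -/
theorem Finset.card_filter_le_inj {n k l : ℕ} {f : ℕ → ℝ} (hk : k < n) (hl : l < n)
    (h : ({m ∈ Finset.range n | f m ≤ f k}).card = ({m ∈ Finset.range n | f m ≤ f l}).card) :
    f k = f l := by
  have key : ∀ {k l}, l < n → f k < f l →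
      ({m ∈ Finset.range n | f m ≤ f k}).card < ({m ∈ Finset.range n | f m ≤ f l}).card := by
    intro k l hl hkl
    refine Finset.card_lt_card ((Finset.ssubset_iff_of_subset
      (Finset.monotone_filter_right _ fun m _ hm => hm.trans hkl.le)).2 ⟨l, ?_, ?_⟩)
    · exact Finset.mem_filter.2 ⟨Finset.mem_range.2 hl, le_rfl⟩
    · exact fun h => (Finset.mem_filter.1 h).2.not_gt hkl
  rcases lt_trichotomy (f k) (f l) with h1 | h1 | h1
  · exact absurd h (key hl h1).ne
  · exact h1
  · exact absurd h (key hk h1).ne'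

theorem rankProg_spec {M n A B C : ℕ} {s : MState} {t : ℕ} (hn : s.nreg 0 = n) (hM : n < M)
    (hAC : A ≠ C) :
    WP M (rankProg A B C) (fun s' t' => t' ≤ t + n * (5 * n + 10) + 10 ∧ ∀ k < n,
      s'.narr B k = ({l ∈ Finset.range n | s.rarr A l ≤ s.rarr A k}).card ∧
      s'.rarr C (s'.narr B k) = s.rarr A k) s t := by
  obtain ⟨x, hx⟩ : ∃ x, s.rarr A = x := ⟨_, rfl⟩
  obtain ⟨rk, hrk⟩ : ∃ rk : ℕ → ℕ, ∀ k, rk k = ({l ∈ Finset.range n | x l ≤ x k}).card :=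
    ⟨_, fun _ => rfl⟩
  have hle : ∀ k, rk k ≤ n := fun k => by
    rw [hrk]
    exact (Finset.card_filter_le _ _).trans_eq (Finset.card_range n)
  simp only [hx, ← hrk]
  rw [rankProg]
  simp +decide only [Prog.block, WP.seq_iff, WP.instr_iff, Instr.apply, Instr.Within, true_and]
  refine WP.for_loop (n := n) (i₀ := 0) (fun k s' t' => t' ≤ t + 1 + k * (5 * n + 10) ∧
    s'.rarr A = x ∧ ∀ l < k, s'.narr B l = rk l ∧ s'.rarr C (rk l) = x l) rfl hn rfl
    (Nat.zero_le _) ⟨by omega, hx, fun l hl => absurd hl (Nat.not_lt_zero _)⟩ ?_ ?_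
  · rintro k s' t' - hk hf h8 h0 ⟨h1, h2, h3⟩
    have hkM := hk.trans hM
    rw [Nat.succ_mul]
    simp +decide only [WP.seq_iff, WP.instr_iff, Instr.apply, Instr.Within, true_and, h8, hkM, h2]
    refine WP.for_loop (n := n) (i₀ := 0) (fun i s₁ t₁ =>
      t₁ ≤ t + 1 + k * (5 * n + 10) + 4 + 5 * i ∧
      s₁.nreg 5 = ({l ∈ Finset.range i | x l ≤ x k}).card) rfl h0 rfl (Nat.zero_le _)
      ⟨by omega, rfl⟩ ?_ ?_
    · rintro i s₁ t₁ - hi hf₁ g7 g0 ⟨g1, g2⟩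
      have hiM := hi.trans hM
      have gr : s₁.rarr = s'.rarr := funext fun a => hf₁.rarr a rfl
      have gx : s₁.rreg 0 = x k := hf₁.rreg 0 rfl
      rw [Finset.range_add_one, Finset.filter_insert]
      simp +decide only [WP.seq_iff, WP.instr_iff, WP.ite_iff, WP.skip_iff, Instr.apply,
        Instr.Within, Test.Holds, Function.update_apply, reduceIte, true_and, g7, hiM, gr, h2, gx]
      refine ⟨fun hlt => ⟨by omega, ?_⟩, fun hlt => ⟨by omega, ?_⟩⟩
      · rw [if_neg (not_le.2 hlt), g2]
      · rw [if_pos (not_lt.1 hlt), Finset.card_insert_of_notMem (by simp), g2]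
    · rintro s₁ t₁ hf₁ g7 ⟨g1, g2⟩
      rw [← hrk] at g2
      have gr : s₁.rarr = s'.rarr := funext fun a => hf₁.rarr a rfl
      have gn : s₁.narr = s'.narr := funext fun a => hf₁.narr a rfl
      have gx : s₁.rreg 0 = x k := hf₁.rreg 0 rfl
      have g8 : s₁.nreg 8 = k := (hf₁.nreg 8 rfl).trans h8
      simp +decide only [WP.seq_iff, WP.instr_iff, WP.skip_iff, Instr.apply, Instr.Within,
        Function.update_apply, reduceIte, true_and, g8, hkM, gr, gn, h2,
        gx, g2, hAC]
      refine ⟨(hle k).trans_lt hM, by omega, fun l hl => ?_⟩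
      by_cases hlk : l = k
      · rw [hlk, if_pos rfl, if_pos rfl]
        exact ⟨rfl, rfl⟩
      · have h4 := h3 l (by omega)
        rw [if_neg hlk]
        refine ⟨h4.1, ?_⟩
        split_ifs with h5
        · rw [hrk, hrk] at h5
          exact (Finset.card_filter_le_inj (by omega) hk h5).symm
        · exact h4.2
  · rintro s' t' hf h8 ⟨h1, h2, h3⟩
    rw [WP.skip_iff]
    exact ⟨by omega, fun k hk => ⟨(h3 k hk).1, by rw [(h3 k hk).1, (h3 k hk).2]⟩⟩

open Instr Test in
/-- With `nx` in array `0`, store the minimum and the maximum of `A[k]` and `A[nx k]` in `B[k]` and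
`C[k]`, and `A[nx k]` in `D[k]`. -/
def edgeProg (A B C D : ℕ) : Prog :=
  .block [
    .instr (zero 8),
    .loop (lt 8 0) (.block [
      .instr (load 7 0 8),
      .instr (load 15 A 8),
      .instr (load 16 A 7),
      .ite (lt 15 16)
        (.block [.instr (store B 8 15), .instr (store C 8 16)])
        (.block [.instr (store B 8 16), .instr (store C 8 15)]),
      .instr (store D 8 16),
      .instr (succ 8)])]

/-- Only the two choices of arrays in use are admitted, so that clashes between arrays are decided
by computation. -/
theorem edgeProg_spec {M n A B C D : ℕ} (hA : A = 10 ∧ B = 12 ∧ C = 13 ∧ D = 14 ∨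
    A = 11 ∧ B = 15 ∧ C = 16 ∧ D = 25) {s : MState} {t : ℕ} (hn : s.nreg 0 = n) (hM : n < M)
    (hnx : ∀ k < n, s.narr 0 k < n) :
    WP M (edgeProg A B C D) (fun s' t' => t' ≤ t + 10 * n + 10 ∧ ∀ k < n,
      s'.narr B k = min (s.narr A k) (s.narr A (s.narr 0 k)) ∧
      s'.narr C k = max (s.narr A k) (s.narr A (s.narr 0 k)) ∧
      s'.narr D k = s.narr A (s.narr 0 k)) s t := by
  let J : ℕ → MState → ℕ → Prop := fun k s' t' => t' ≤ t + 1 + 10 * k ∧ ∀ l < k,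
    s'.narr B l = min (s.narr A l) (s.narr A (s.narr 0 l)) ∧
    s'.narr C l = max (s.narr A l) (s.narr A (s.narr 0 l)) ∧ s'.narr D l = s.narr A (s.narr 0 l)
  rw [edgeProg, Prog.block, WP.seq_iff, WP.instr_iff]
  refine ⟨trivial, ?_⟩
  rw [Prog.block, WP.seq_iff]
  refine WP.for_loop (n := n) (i₀ := 0) J rfl hn rfl
    (Nat.zero_le _) ⟨by omega, fun l hl => absurd hl (Nat.not_lt_zero _)⟩ ?_ ?_
  · rcases hA with ⟨rfl, rfl, rfl, rfl⟩ | ⟨rfl, rfl, rfl, rfl⟩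
    all_goals
      rintro k s' t' - hk hf h8 h0 ⟨h1, h2⟩
      have hkM := hk.trans hM
      have g0 : s'.narr 0 = s.narr 0 := hf.narr 0 rfl
      have g10 : s'.narr 10 = s.narr 10 := hf.narr 10 rfl
      have g11 : s'.narr 11 = s.narr 11 := hf.narr 11 rfl
      have hxM := (hnx k hk).trans hM
      simp +decide only [Prog.block, WP.seq_iff, WP.instr_iff, WP.ite_iff, WP.skip_iff, Instr.apply,
        Instr.Within, Test.Holds, Function.update_apply, reduceIte, true_and, h8, hkM, hxM, g0, g10,
        g11, J]
      refine ⟨fun hlt => ⟨by omega, fun l hl => ?_⟩, fun hlt => ⟨by omega, fun l hl => ?_⟩⟩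
      all_goals
        split_ifs with hlk
        · subst hlk
          refine ⟨?_, ?_, rfl⟩ <;> omega
        · exact h2 l (by omega)
  · rintro s' t' hf h8 ⟨h1, h2⟩
    rw [Prog.block, WP.skip_iff]
    exact ⟨by omega, h2⟩

open Instr Test in
/-- Edge `k` runs from `ab[k]` to at[k] on the line `ax[k]`. Among the ends of this edge and the
crossings of that line by the edges that run from `cl[m]` to `cr[m]` on the line `cy[m]`, store the
last one before and the first one after the edge in `dn[k]` and `up[k]`. -/
def reachProg (cy cl cr ax ab at' dn up : ℕ) : Prog :=
  .block [
    .instr (zero 8),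
    .loop (lt 8 0) (.block [
      .instr (load 15 ax 8),
      .instr (load 16 ab 8),
      .instr (load 17 at' 8),
      .instr (zero 18),
      .instr (copy 19 3),
      .instr (zero 7),
      .loop (lt 7 0) (.block [
        .instr (load 20 cl 7),
        .ite (lt 15 20) .skip (.block [
          .instr (load 20 cr 7),
          .ite (lt 20 15) .skip (.block [
            .instr (load 20 cy 7),
            .ite (lt 20 16) (.ite (lt 18 20) (.instr (copy 18 20)) .skip) .skip,
            .ite (lt 17 20) (.ite (lt 20 19) (.instr (copy 19 20)) .skip) .skip])]),
        .instr (succ 7)]),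
      .instr (store dn 8 18),
      .instr (store up 8 19),
      .instr (succ 8)])]

/-- A maximum and a minimum, described by which numbers bound them: then one more crossing adds one
condition, and each branch of the loop is linear arithmetic. Without any crossing they are `0` and
`n + 1`. -/
theorem reachProg_spec {M n cy cl cr ax ab at' dn up : ℕ} (hcy : cy < 17) (hcl : cl < 17)
    (hcr : cr < 17) (hax : ax < 17) (hab : ab < 17) (hat : at' < 17) (hdn : 17 ≤ dn) (hup : 17 ≤ up)
    (hdu : dn ≠ up) {s : MState} {t : ℕ} (hn : s.nreg 0 = n) (hn1 : s.nreg 3 = n + 1) (hM : n < M) :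
    WP M (reachProg cy cl cr ax ab at' dn up) (fun s' t' => t' ≤ t + n * (13 * n + 20) + 10 ∧
      ∀ k < n,
        (∀ b, s'.narr dn k ≤ b ↔ ∀ m < n, s.narr cl m ≤ s.narr ax k → s.narr ax k ≤ s.narr cr m →
          s.narr cy m < s.narr ab k → s.narr cy m ≤ b) ∧
        (∀ b, b < s'.narr up k ↔ b < n + 1 ∧ ∀ m < n, s.narr cl m ≤ s.narr ax k →
          s.narr ax k ≤ s.narr cr m → s.narr at' k < s.narr cy m → b < s.narr cy m)) s t := by
  obtain ⟨D, hD⟩ : ∃ D : ℕ → ℕ → ℕ → Prop, ∀ k i b, D k i b ↔ ∀ m < i,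
    s.narr cl m ≤ s.narr ax k → s.narr ax k ≤ s.narr cr m → s.narr cy m < s.narr ab k →
      s.narr cy m ≤ b := ⟨_, fun _ _ _ => Iff.rfl⟩
  obtain ⟨U, hU⟩ : ∃ U : ℕ → ℕ → ℕ → Prop, ∀ k i b, U k i b ↔ ∀ m < i,
    s.narr cl m ≤ s.narr ax k → s.narr ax k ≤ s.narr cr m → s.narr at' k < s.narr cy m →
      b < s.narr cy m := ⟨_, fun _ _ _ => Iff.rfl⟩
  simp only [← hD, ← hU]
  have hD1 : ∀ k i b, D k (i + 1) b ↔ D k i b ∧ (s.narr cl i ≤ s.narr ax k →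
      s.narr ax k ≤ s.narr cr i → s.narr cy i < s.narr ab k → s.narr cy i ≤ b) := fun k i b => by
    rw [hD, hD, Nat.forall_lt_succ_right]
  have hU1 : ∀ k i b, U k (i + 1) b ↔ U k i b ∧ (s.narr cl i ≤ s.narr ax k →
      s.narr ax k ≤ s.narr cr i → s.narr at' k < s.narr cy i → b < s.narr cy i) := fun k i b => by
    rw [hU, hU, Nat.forall_lt_succ_right]
  rw [reachProg, Prog.block, WP.seq_iff, WP.instr_iff]
  refine ⟨trivial, ?_⟩
  rw [Prog.block, WP.seq_iff]
  refine WP.for_loop (n := n) (i₀ := 0) (fun k s' t' => t' ≤ t + 1 + k * (13 * n + 20) ∧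
    (∀ a < 17, s'.narr a = s.narr a) ∧ ∀ l < k, (∀ b, s'.narr dn l ≤ b ↔ D l n b) ∧
      (∀ b, b < s'.narr up l ↔ b < n + 1 ∧ U l n b)) rfl hn rfl
    (Nat.zero_le _) ⟨by omega, fun _ _ => rfl, fun l hl => absurd hl (Nat.not_lt_zero _)⟩ ?_ ?_
  · rintro k s' t' - hk hf h8 h0 ⟨h1, h2, h3⟩
    have hkM := hk.trans hM
    have g3 : s'.nreg 3 = n + 1 := (hf.nreg 3 rfl).trans hn1
    rw [Nat.succ_mul]
    simp +decide only [Prog.block, WP.seq_iff, WP.instr_iff, Instr.apply, Instr.Within, true_and,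
      Function.update_apply, reduceIte, h8, hkM]
    refine WP.for_loop (n := n) (i₀ := 0) (fun i s₁ t₁ =>
      t₁ ≤ t + 1 + k * (13 * n + 20) + 7 + 13 * i ∧
      (∀ b, s₁.nreg 18 ≤ b ↔ D k i b) ∧
      (∀ b, b < s₁.nreg 19 ↔ b < n + 1 ∧ U k i b)) rfl h0 rfl (Nat.zero_le _)
      ⟨by omega, fun b => ?_, fun b => ?_⟩ ?_ ?_
    · simp +decide [hD]
    · simp +decide [hU, g3]
    · rintro i s₁ t₁ - hi hf₁ g7 g0 ⟨g1, g2, g4⟩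
      have hiM := hi.trans hM
      have gn : s₁.narr = s'.narr := funext fun a => hf₁.narr a rfl
      have g15 : s₁.nreg 15 = s.narr ax k := by
        rw [← h2 ax hax]
        exact (hf₁.nreg 15 rfl)
      have g16 : s₁.nreg 16 = s.narr ab k := by
        rw [← h2 ab hab]
        exact (hf₁.nreg 16 rfl)
      have g17 : s₁.nreg 17 = s.narr at' k := by
        rw [← h2 at' hat]
        exact (hf₁.nreg 17 rfl)
      simp +decide only [WP.seq_iff, WP.instr_iff, WP.ite_iff, WP.skip_iff, Instr.apply,
        Instr.Within, Test.Holds, Function.update_apply, reduceIte, true_and, g7, hiM, gn, h2 cl hcl,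
        h2 cr hcr, h2 cy hcy, g15, g16, g17, hD1, hU1]
      simp only [← g2, ← and_assoc (a := _ < n + 1), ← g4]
      refine ⟨fun e1 => ?_, fun e1 => ⟨fun e2 => ?_, fun e2 => ⟨fun e3 => ⟨fun e4 => ⟨fun e5 =>
        ⟨fun e6 => ?_, fun e6 => ?_⟩, fun e5 => ?_⟩, fun e4 => ⟨fun e5 =>
        ⟨fun e6 => ?_, fun e6 => ?_⟩, fun e5 => ?_⟩⟩, fun e3 => ⟨fun e5 =>
        ⟨fun e6 => ?_, fun e6 => ?_⟩, fun e5 => ?_⟩⟩⟩⟩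
      all_goals exact ⟨by omega, fun b => by omega, fun b => by omega⟩
    · rintro s₁ t₁ hf₁ g7 ⟨g1, g2, g4⟩
      have gn : s₁.narr = s'.narr := funext fun a => hf₁.narr a rfl
      have g8 : s₁.nreg 8 = k := (hf₁.nreg 8 rfl).trans h8
      simp +decide only [WP.seq_iff, WP.instr_iff, WP.skip_iff, Instr.apply,
        Instr.Within, Function.update_apply, reduceIte, true_and, g8, hkM, gn, hdu,
        hdu.symm]
      refine ⟨by omega, fun a ha => ?_, fun l hl => ?_⟩
      · rw [if_neg (by omega), if_neg (by omega), h2 a ha]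
      · split_ifs with hlk
        · rw [hlk]
          exact ⟨g2, g4⟩
        · exact h3 l (by omega)
  · rintro s' t' hf h8 ⟨h1, h2, h3⟩
    rw [Prog.block, WP.skip_iff]
    exact ⟨by omega, h3⟩

/-! ### Marking the edges and walls of a row of cells -/

open Instr Test in
/-- In the row of register `6`, mark the place of edge `k` in the array `A` if the row lies between
`lo[k]` and `hi[k]`. -/
def markIf (lo hi A : ℕ) : Prog :=
  .block [
    .instr (load 15 14 8),
    .instr (load 16 lo 8),
    .ite (lt 6 16) .skip (.block [
      .instr (load 16 hi 8),
      .ite (lt 6 16) (.instr (store A 15 2)) .skip])]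

theorem markIf_spec {M n lo hi A k r : ℕ} {s : MState} {t : ℕ} (hM : n < M) (hk : k < n)
    (h8 : s.nreg 8 = k) (h6 : s.nreg 6 = r) (h2 : s.nreg 2 = 1) (hx : s.narr 14 k ≤ n) :
    WP M (markIf lo hi A) (fun s' t' => t' ≤ t + 6 ∧ ∀ i, 0 < s'.narr A i ↔
      0 < s.narr A i ∨ s.narr 14 k = i ∧ s.narr lo k ≤ r ∧ r < s.narr hi k) s t := by
  have hkM := hk.trans hM
  have hxM := hx.trans_lt hM
  rw [markIf]
  simp +decide only [Prog.block, WP.seq_iff, WP.instr_iff, WP.ite_iff, WP.skip_iff, Instr.apply,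
    Instr.Within, Test.Holds, Function.update_apply, reduceIte, true_and, h8, h6, h2, hkM, hxM]
  refine ⟨fun h1 => ⟨by omega, fun i => by omega⟩, fun h1 => ⟨fun h3 => ⟨by omega, fun i => ?_⟩,
    fun h3 => ⟨by omega, fun i => by omega⟩⟩⟩
  split_ifs <;> omega

open Instr Test in
/-- Mark the cells of the row of register `6` that are above the wall of the horizontal edge `k`. -/
def markRow : Prog :=
  .block [
    .instr (load 16 11 8),
    .ite (lt 6 16) .skip (.ite (lt 16 6) .skip (.block [
      .instr (load 17 19 8),
      .instr (load 18 20 8),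
      .loop (lt 17 18) (.block [.instr (store 23 17 2), .instr (succ 17)])]))]

/-- The expensive loop runs only in the row of the edge. The time bound keeps this distinction so
that, summed over all rows, each edge pays once. -/
theorem markRow_spec {M n k r : ℕ} {s : MState} {t : ℕ} (hM : n < M) (hk : k < n)
    (h8 : s.nreg 8 = k) (h6 : s.nreg 6 = r) (h2 : s.nreg 2 = 1) (hdu : s.narr 19 k ≤ s.narr 20 k)
    (hup : s.narr 20 k ≤ n + 1) :
    WP M markRow (fun s' t' => t' ≤ t + 6 + (if s.narr 11 k = r then 3 * n + 3 else 0) ∧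
      ∀ i, 0 < s'.narr 23 i ↔
        0 < s.narr 23 i ∨ s.narr 11 k = r ∧ s.narr 19 k ≤ i ∧ i < s.narr 20 k) s t := by
  have hkM := hk.trans hM
  rw [markRow]
  simp +decide only [Prog.block, WP.seq_iff, WP.instr_iff, WP.ite_iff, WP.skip_iff, Instr.apply,
    Instr.Within, Test.Holds, Function.update_apply, reduceIte, true_and, h8, h6, hkM]
  refine ⟨fun h1 => ⟨by omega, fun i => by omega⟩, fun h1 => ⟨fun h3 => ⟨by omega, fun i => by omega⟩,
    fun h3 => ?_⟩⟩
  have hr : s.narr 11 k = r := by omega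
  refine WP.for_loop (n := s.narr 20 k) (i₀ := s.narr 19 k) (fun j s' t' => t' + 3 * s.narr 19 k ≤
    t + 5 + 3 * j ∧ ∀ i, 0 < s'.narr 23 i ↔ 0 < s.narr 23 i ∨ s.narr 19 k ≤ i ∧ i < j)
    rfl rfl rfl hdu ⟨by omega, fun i => by dsimp only; omega⟩ ?_ ?_
  · rintro j s' t' hj1 hj2 hf h17 - ⟨g1, g2⟩
    have g3 : s'.nreg 2 = 1 := (hf.nreg 2 rfl).trans h2
    have hjM : j < M := by omega
    simp +decide only [WP.seq_iff, WP.instr_iff, WP.skip_iff, Instr.apply, Instr.Within,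
      Function.update_apply, reduceIte, true_and, h17, hjM, g3]
    refine ⟨by omega, fun i => ?_⟩
    have := g2 i
    split_ifs <;> omega
  · rintro s' t' hf h17 ⟨g1, g2⟩
    rw [if_pos hr]
    simp only [WP.skip_iff]
    refine ⟨by omega, fun i => ?_⟩
    rw [g2 i, iff_true_intro hr, true_and]

open Instr Test in
/-- In the arrays `21`, `22`, `23`, mark the cells of the row of register `6` that have a wall on
the left side, an edge on the left side, a wall on the bottom side. -/
def markProg : Prog :=
  .block [
    .instr (zero 7),
    .loop (lt 7 3) (.block [
      .instr (store 21 7 1),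
      .instr (store 22 7 1),
      .instr (store 23 7 1),
      .instr (succ 7)]),
    .instr (zero 8),
    .loop (lt 8 0) (.block [
      markIf 17 18 21,
      markIf 15 16 22,
      markRow,
      .instr (succ 8)])]

/-- The memory is prepared for the sweep. -/
structure Prepared (n : ℕ) (s : MState) : Prop where
  size : s.nreg 0 = n
  zero : s.nreg 1 = 0
  one : s.nreg 2 = 1
  size_succ : s.nreg 3 = n + 1
  vx_le : ∀ k < n, s.narr 14 k ≤ n
  dn_le_up : ∀ k < n, s.narr 19 k ≤ s.narr 20 k
  up_le : ∀ k < n, s.narr 20 k ≤ n + 1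

theorem Prepared.of_eq {n : ℕ} {s s' : MState} (h : Prepared n s)
    (h0 : ∀ a < 4, s'.nreg a = s.nreg a) (hn : ∀ a, 14 ≤ a → a ≤ 20 → s'.narr a = s.narr a) :
    Prepared n s' where
  size := (h0 0 (by decide)).trans h.size
  zero := (h0 1 (by decide)).trans h.zero
  one := (h0 2 (by decide)).trans h.one
  size_succ := (h0 3 (by decide)).trans h.size_succ
  vx_le := hn 14 (by decide) (by decide) ▸ h.vx_le
  dn_le_up := by
    rw [hn 19 (by decide) (by decide), hn 20 (by decide) (by decide)]
    exact h.dn_le_up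
  up_le := hn 20 (by decide) (by decide) ▸ h.up_le

theorem markProg_spec {M n r : ℕ} {s : MState} {t : ℕ} (hM : n < M) (h : Prepared n s)
    (h6 : s.nreg 6 = r) :
    WP M markProg (fun s' t' => t' ≤ t + 30 * n + 20 +
        ∑ k ∈ Finset.range n, (if s.narr 11 k = r then 3 * n + 3 else 0) ∧ ∀ i ≤ n,
      (0 < s'.narr 21 i ↔ ∃ k < n, s.narr 14 k = i ∧ s.narr 17 k ≤ r ∧ r < s.narr 18 k) ∧
      (0 < s'.narr 22 i ↔ ∃ k < n, s.narr 14 k = i ∧ s.narr 15 k ≤ r ∧ r < s.narr 16 k) ∧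
      (0 < s'.narr 23 i ↔ ∃ k < n, s.narr 11 k = r ∧ s.narr 19 k ≤ i ∧ i < s.narr 20 k)) s t := by
  rw [markProg, Prog.block, WP.seq_iff, WP.instr_iff]
  refine ⟨trivial, ?_⟩
  rw [Prog.block]
  refine WP.seq (R := fun s' t' => t' ≤ t + 5 * (n + 1) + 2 ∧ ∀ i ≤ n, s'.narr 21 i = 0 ∧
    s'.narr 22 i = 0 ∧ s'.narr 23 i = 0) ?_ ?_
  · refine WP.for_loop (n := n + 1) (i₀ := 0) (fun j s' t' => t' ≤ t + 5 * j + 1 ∧ ∀ i < j,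
      s'.narr 21 i = 0 ∧ s'.narr 22 i = 0 ∧ s'.narr 23 i = 0) rfl h.size_succ rfl (Nat.zero_le _)
      ⟨by omega, fun l hl => absurd hl (Nat.not_lt_zero _)⟩ ?_ ?_
    · rintro j s' t' - hj hf h7 - ⟨g1, g2⟩
      have g3 : s'.nreg 1 = 0 := (hf.nreg 1 rfl).trans h.zero
      have hjM : j < M := by omega
      simp +decide only [Prog.block, WP.seq_iff, WP.instr_iff, WP.skip_iff, Instr.apply,
        Instr.Within, Function.update_apply, reduceIte, true_and, h7, hjM, g3]
      refine ⟨by omega, fun i hi => ?_⟩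
      split_ifs with hij
      · exact ⟨rfl, rfl, rfl⟩
      · exact g2 i (by omega)
    · rintro s' t' hf h7 ⟨g1, g2⟩
      exact ⟨by omega, fun i hi => g2 i (by omega)⟩
  rintro s₁ t₁ hf₁ ⟨u1, u2⟩
  rw [Prog.block, WP.seq_iff, WP.instr_iff]
  refine ⟨trivial, ?_⟩
  rw [Prog.block, WP.seq_iff]
  have e6 : s₁.nreg 6 = r := (hf₁.nreg 6 rfl).trans h6
  have en : ∀ a < 21, s₁.narr a = s.narr a := fun a ha => by
    refine hf₁.narr a ?_
    interval_cases a <;> rfl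
  have er : ∀ a < 7, s₁.nreg a = s.nreg a := fun a ha => by
    refine (hf₁.nreg a ?_).trans (Function.update_of_ne (by omega) _ _)
    interval_cases a <;> rfl
  refine WP.for_loop (n := n) (i₀ := 0) (fun k s' t' => t' ≤ t₁ + 1 + 20 * k +
      ∑ l ∈ Finset.range k, (if s.narr 11 l = r then 3 * n + 3 else 0) ∧ ∀ i ≤ n,
      (0 < s'.narr 21 i ↔ ∃ l < k, s.narr 14 l = i ∧ s.narr 17 l ≤ r ∧ r < s.narr 18 l) ∧
      (0 < s'.narr 22 i ↔ ∃ l < k, s.narr 14 l = i ∧ s.narr 15 l ≤ r ∧ r < s.narr 16 l) ∧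
      (0 < s'.narr 23 i ↔ ∃ l < k, s.narr 11 l = r ∧ s.narr 19 l ≤ i ∧ i < s.narr 20 l))
    rfl ((er 0 (by decide)).trans h.size) rfl (Nat.zero_le _) ⟨by simp, fun i hi => ?_⟩ ?_ ?_
  · have := u2 i hi
    simp [Instr.apply, this]
  · rintro k s' t' - hk hf h8 h0 ⟨g1, g2⟩
    have fn : ∀ a < 21, s'.narr a = s.narr a := fun a ha => by
      refine (hf.narr a ?_).trans (en a ha)
      interval_cases a <;> rfl
    have fr : ∀ a < 7, s'.nreg a = s.nreg a := fun a ha => by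
      refine (hf.nreg a ?_).trans ((Function.update_of_ne (by omega) _ _).trans (er a ha))
      interval_cases a <;> rfl
    simp only [Finset.sum_range_succ, Nat.exists_lt_succ_right]
    have hp : Prepared n s' := h.of_eq (fun a ha => fr a (by omega)) fun a _ ha => fn a (by omega)
    refine WP.seq (markIf_spec hM hk h8 ((fr 6 (by decide)).trans h6) hp.one (hp.vx_le k hk)) ?_
    rintro s₂ t₂ hf₂ ⟨a1, a2⟩
    refine WP.seq (markIf_spec hM hk ((hf₂.nreg 8 rfl).trans h8)
      ((hf₂.nreg 6 rfl).trans ((fr 6 (by decide)).trans h6)) ((hf₂.nreg 2 rfl).trans hp.one)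
      ((hf₂.narr 14 rfl) ▸ hp.vx_le k hk)) ?_
    rintro s₃ t₃ hf₃ ⟨b1, b2⟩
    have k19 : s₃.narr 19 = s'.narr 19 := (hf₃.narr 19 rfl).trans (hf₂.narr 19 rfl)
    have k20 : s₃.narr 20 = s'.narr 20 := (hf₃.narr 20 rfl).trans (hf₂.narr 20 rfl)
    have k11 : s₃.narr 11 = s'.narr 11 := (hf₃.narr 11 rfl).trans (hf₂.narr 11 rfl)
    refine WP.seq (markRow_spec (r := r) hM hk ((hf₃.nreg 8 rfl).trans ((hf₂.nreg 8 rfl).trans h8))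
      ((hf₃.nreg 6 rfl).trans ((hf₂.nreg 6 rfl).trans ((fr 6 (by decide)).trans h6)))
      ((hf₃.nreg 2 rfl).trans ((hf₂.nreg 2 rfl).trans hp.one)) ?_ ?_) ?_
    · rw [k19, k20]
      exact hp.dn_le_up k hk
    · rw [k20]
      exact hp.up_le k hk
    rintro s₄ t₄ hf₄ ⟨c1, c2⟩
    rw [k11, fn 11 (by decide)] at c1
    have e8 : s₄.nreg 8 = k := (hf₄.nreg 8 rfl).trans
      ((hf₃.nreg 8 rfl).trans ((hf₂.nreg 8 rfl).trans h8))
    simp +decide only [Prog.block, WP.seq_iff, WP.instr_iff, WP.skip_iff, Instr.apply,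
      Instr.Within, Function.update_apply, reduceIte, true_and, e8]
    refine ⟨by omega, fun i hi => ?_⟩
    obtain ⟨d1, d2, d3⟩ := g2 i hi
    have a3 := a2 i
    have b3 := b2 i
    have c3 := c2 i
    rw [hf₂.narr 22 rfl, hf₂.narr 14 rfl, hf₂.narr 15 rfl, hf₂.narr 16 rfl] at b3
    rw [k11, k19, k20, hf₃.narr 23 rfl, hf₂.narr 23 rfl] at c3
    rw [fn 14 (by decide), fn 17 (by decide), fn 18 (by decide), d1] at a3
    rw [fn 14 (by decide), fn 15 (by decide), fn 16 (by decide), d2] at b3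
    rw [fn 11 (by decide), fn 19 (by decide), fn 20 (by decide), d3] at c3
    rw [hf₄.narr 21 rfl, hf₃.narr 21 rfl, hf₄.narr 22 rfl]
    exact ⟨a3, b3, c3⟩
  · rintro s' t' hf h8 ⟨g1, g2⟩
    rw [Prog.block, WP.skip_iff]
    exact ⟨by omega, g2⟩

/-! ### The sweep -/

/-- What the sweep over the cells `(i, r)` computes: whether the cell is inside, whether it has a
wall on its left side, a wall on its bottom side, an edge on its left side; the number of its block
and the number of blocks that start before it; the neighbours and coordinates of the blocks. -/
structure CellData where
  inn : ℕ → ℕ → Prop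
  wv : ℕ → ℕ → Prop
  wh : ℕ → ℕ → Prop
  ve : ℕ → ℕ → Prop
  nid : ℕ → ℕ → ℕ
  cnt : ℕ → ℕ → ℕ
  nl : ℕ → ℕ
  nt : ℕ → ℕ
  nr : ℕ → ℕ
  nb : ℕ → ℕ
  xl : ℕ → ℝ
  yt : ℕ → ℝ
  xr : ℕ → ℝ
  yb : ℕ → ℝ
  xs : ℕ → ℝ
  ys : ℕ → ℝ

/-- The laws of cell data for an `n × n` grid with `N` blocks, where `z` is the number given to
cells that are not inside. -/
structure CellData.Lawful (D : CellData) (n N z : ℕ) : Prop where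
  inn_left : ∀ r, ¬ D.inn 0 r
  inn_bottom : ∀ i, ¬ D.inn i 0
  flip : ∀ i r, 0 < i → (D.inn i r ↔ (D.ve i r ↔ ¬ D.inn (i - 1) r))
  nid_out : ∀ i r, ¬ D.inn i r → D.nid i r = z
  nid_below : ∀ i r, D.inn i r → ¬ D.wh i r → D.nid i r = D.nid i (r - 1)
  nid_left : ∀ i r, D.inn i r → D.wh i r → ¬ D.wv i r → D.nid i r = D.nid (i - 1) r
  nid_new : ∀ i r, D.inn i r → D.wh i r → D.wv i r →
    D.nid i r = D.cnt i r ∧ D.cnt (i + 1) r = D.cnt i r + 1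
  cnt_same : ∀ i r, ¬ (D.inn i r ∧ D.wh i r ∧ D.wv i r) → D.cnt (i + 1) r = D.cnt i r
  cnt_row : ∀ r, D.cnt 1 (r + 1) = D.cnt (n + 1) r
  cnt_first : D.cnt 1 1 = 0
  nid_le : ∀ i r, D.nid i r ≤ N
  left : ∀ i r, D.wv i r → D.nid i r ≠ z →
    D.nid (i - 1) r = D.nl (D.nid i r) ∧ D.xs i = D.xl (D.nid i r)
  right : ∀ i r, D.wv i r → D.nid (i - 1) r ≠ z →
    D.nid i r = D.nr (D.nid (i - 1) r) ∧ D.xs i = D.xr (D.nid (i - 1) r)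
  bottom : ∀ i r, D.wh i r → D.nid i r ≠ z →
    D.nid i (r - 1) = D.nb (D.nid i r) ∧ D.ys r = D.yb (D.nid i r)
  top : ∀ i r, D.wh i r → D.nid i (r - 1) ≠ z →
    D.nid i r = D.nt (D.nid i (r - 1)) ∧ D.ys r = D.yt (D.nid i (r - 1))

/-- The arrays `f`, `g` hold the right values at all places in `V`, except for `z`. -/
def Recorded (f F : ℕ → ℕ) (g G : ℕ → ℝ) (z : ℕ) (V : Set ℕ) : Prop :=
  ∀ ν ∈ V, ν ≠ z → f ν = F ν ∧ g ν = G ν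

/-- Nothing is claimed at `z`. Hence the program may write at the number of an outside cell without
testing whether there is a block. -/
theorem Recorded.update {f F : ℕ → ℕ} {g G : ℕ → ℝ} {z c v : ℕ} {w : ℝ} {V W : Set ℕ}
    (h : Recorded f F g G z V) (hc : c ≠ z → v = F c ∧ w = G c) (hW : W ⊆ insert c V) :
    Recorded (Function.update f c v) F (Function.update g c w) G z W := by
  intro ν hν hz
  by_cases h1 : ν = c
  · subst h1
    rw [Function.update_self, Function.update_self]
    exact hc hz
  · rw [Function.update_of_ne h1, Function.update_of_ne h1]
    exact h ν ((hW hν).resolve_left h1) hz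

theorem Recorded.mono {f F : ℕ → ℕ} {g G : ℕ → ℝ} {z : ℕ} {V W : Set ℕ}
    (h : Recorded f F g G z V) (hW : W ⊆ V) : Recorded f F g G z W :=
  fun ν hν hz => h ν (hW hν) hz

/-- The values of `m` at the cells with `p` that come before the cell `(i, r)` in the order of the
sweep. -/
def visited (n : ℕ) (p : ℕ → ℕ → Prop) (m : ℕ → ℕ → ℕ) (i r : ℕ) : Set ℕ :=
  {ν | ∃ i' r', 0 < i' ∧ i' ≤ n ∧ 0 < r' ∧ (r' < r ∨ r' = r ∧ i' < i) ∧ p i' r' ∧ m i' r' = ν}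

section visited

variable {n i r : ℕ} {p : ℕ → ℕ → Prop} {m : ℕ → ℕ → ℕ}

theorem visited_succ_subset : visited n p m (i + 1) r ⊆ insert (m i r) (visited n p m i r) := by
  rintro ν ⟨i', r', h1, h2, h3, h4, h5, rfl⟩
  by_cases h : i' = i ∧ r' = r
  · obtain ⟨rfl, rfl⟩ := h
    exact Or.inl rfl
  · exact Or.inr ⟨i', r', h1, h2, h3, by omega, h5, rfl⟩

theorem visited_succ_subset_of_not (h : ¬ p i r) :
    visited n p m (i + 1) r ⊆ visited n p m i r := by
  rintro ν ⟨i', r', h1, h2, h3, h4, h5, rfl⟩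
  refine ⟨i', r', h1, h2, h3, ?_, h5, rfl⟩
  by_contra h6
  obtain ⟨rfl, rfl⟩ : i' = i ∧ r' = r := by omega
  exact h h5

theorem visited_row_subset : visited n p m 1 (r + 1) ⊆ visited n p m (n + 1) r := by
  rintro ν ⟨i', r', h1, h2, h3, h4, h5, rfl⟩
  exact ⟨i', r', h1, h2, h3, by omega, h5, rfl⟩

theorem visited_first : visited n p m 1 1 = ∅ := by
  refine Set.eq_empty_of_forall_notMem ?_
  rintro ν ⟨i', r', h1, h2, h3, h4, -⟩
  omega

end visited

open Instr Test in
/-- Determine whether the cell of register `7` in the current row is inside. -/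
def flipProg : Prog :=
  .block [
    .instr (load 15 22 7),
    .ite (lt 1 15) (.ite (lt 1 9) (.instr (zero 9)) (.instr (copy 9 2))) .skip]

open Instr Test in
/-- Determine the number of the block of the cell of register `7` in the current row. -/
def numberProg : Prog :=
  .block [
    .instr (load 13 21 7),
    .instr (load 14 23 7),
    .instr (load 12 24 7),
    .ite (lt 1 9)
      (.ite (lt 1 14)
        (.ite (lt 1 13) (.block [.instr (copy 11 5), .instr (succ 5)]) (.instr (copy 11 10)))
        (.instr (copy 11 12)))
      (.instr (copy 11 4))]

open Instr Test in
/-- Record the coordinate and the two neighbours if there is a wall on the left side of the cell. -/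
def verticalProg : Prog :=
  .ite (lt 1 13) (.block [
    .instr (rload 0 8 7),
    .instr (rstore 2 10 0),
    .instr (store 2 10 11),
    .instr (rstore 0 11 0),
    .instr (store 0 11 10)]) .skip

open Instr Test in
/-- Record the coordinate and the two neighbours if there is a wall on the bottom side of the
cell. -/
def horizontalProg : Prog :=
  .ite (lt 1 14) (.block [
    .instr (rload 0 9 6),
    .instr (rstore 1 12 0),
    .instr (store 1 12 11),
    .instr (rstore 3 11 0),
    .instr (store 3 11 12)]) .skip

open Instr Test in
/-- Process the cell of register `7` in the row of register `6`. -/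
def cellProg : Prog :=
  .block [flipProg, numberProg, verticalProg, horizontalProg, .instr (store 24 7 11),
    .instr (copy 10 11), .instr (succ 7)]

open Instr Test in
/-- Number the blocks and determine their neighbours and coordinates. Register `4` holds the number
to be used outside; register `5` returns the number of blocks. -/
def sweepProg : Prog :=
  .block [
    .instr (zero 7),
    .loop (lt 7 3) (.block [.instr (store 24 7 4), .instr (succ 7)]),
    .instr (zero 5),
    .instr (zero 6),
    .instr (succ 6),
    .loop (lt 6 3) (.block [
      markProg,
      .instr (zero 9),
      .instr (copy 10 4),
      .instr (zero 7),
      .instr (succ 7),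
      .loop (lt 7 3) cellProg,
      .instr (succ 6)])]

/-! ### Correctness of one cell, one row and the whole sweep -/

namespace CellData

variable (D : CellData) (n N z : ℕ)

/-- The state of the output arrays. -/
structure Recs (i r : ℕ) (s : MState) : Prop where
  left : Recorded (s.narr 0) D.nl (s.rarr 0) D.xl z (visited n D.wv D.nid i r)
  top : Recorded (s.narr 1) D.nt (s.rarr 1) D.yt z (visited n D.wh (fun i r => D.nid i (r - 1)) i r)
  right : Recorded (s.narr 2) D.nr (s.rarr 2) D.xr z
    (visited n D.wv (fun i r => D.nid (i - 1) r) i r)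
  bottom : Recorded (s.narr 3) D.nb (s.rarr 3) D.yb z (visited n D.wh D.nid i r)

/-- The state of the memory before the cell `(i, r)` is processed. -/
structure CellState (i r : ℕ) (s : MState) : Prop where
  row : s.nreg 6 = r
  zero : s.nreg 1 = 0
  one : s.nreg 2 = 1
  out : s.nreg 4 = z
  cnt : s.nreg 5 = D.cnt i r
  inn : 0 < s.nreg 9 ↔ D.inn (i - 1) r
  prev : s.nreg 10 = D.nid (i - 1) r
  wv : ∀ j ≤ n, 0 < s.narr 21 j ↔ D.wv j r
  ve : ∀ j ≤ n, 0 < s.narr 22 j ↔ D.ve j r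
  wh : ∀ j ≤ n, 0 < s.narr 23 j ↔ D.wh j r
  -- One array is enough for the numbers: it holds the current row before the cell and the previous
  -- row from the cell on.
  new : ∀ j, 0 < j → j < i → s.narr 24 j = D.nid j r
  old : ∀ j, i ≤ j → j ≤ n → s.narr 24 j = D.nid j (r - 1)
  xs : s.rarr 8 = D.xs
  ys : s.rarr 9 = D.ys
  recs : D.Recs n z i r s

variable {D n N z}

/-- The number of an inside cell is that of the cell below if no wall lies between, else that of the
cell to the left if no wall lies between. With walls on both sides, the cell is the lower left one
of its block and takes a new number. -/
theorem cellProg_spec {M i r : ℕ} (hD : D.Lawful n N z) (hnM : n < M) (hNM : N < M) (hi0 : 0 < i)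
    (hin : i ≤ n) (hrn : r ≤ n) {s : MState} {t : ℕ} (h7 : s.nreg 7 = i)
    (h : D.CellState n z i r s) :
    WP M cellProg (fun s' t' => s'.nreg 7 = i + 1 ∧ t' ≤ t + 27 ∧ D.CellState n z (i + 1) r s')
      s t := by
  have hiM := hin.trans_lt hnM
  have hrM := hrn.trans_lt hnM
  have hcM := (hD.nid_le i r).trans_lt hNM
  have hpM := (hD.nid_le (i - 1) r).trans_lt hNM
  have hbM := (hD.nid_le i (r - 1)).trans_lt hNM
  rw [cellProg, Prog.block]
  refine WP.seq (R := fun s' t' => t' ≤ t + 4 ∧ (0 < s'.nreg 9 ↔ D.inn i r)) ?_ ?_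
  · have h1 := h.inn
    have h2 := hD.flip i r hi0
    have h3 := h.ve i hin
    rw [flipProg]
    simp +decide only [Prog.block, WP.seq_iff, WP.instr_iff, WP.ite_iff, WP.skip_iff, Instr.apply,
      Instr.Within, Test.Holds, Function.update_apply, reduceIte, true_and, h7, h.zero, h.one, hiM]
    refine ⟨fun h4 => ⟨fun h5 => ⟨by omega, ?_⟩, fun h5 => ⟨by omega, ?_⟩⟩,
      fun h4 => ⟨by omega, ?_⟩⟩
    all_goals rw [h1, h3] at *; tauto
  rintro s₁ t₁ hf₁ ⟨u1, u2⟩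
  rw [Prog.block]
  refine WP.seq (R := fun s' t' => t' ≤ t₁ + 8 ∧ s'.nreg 5 = D.cnt (i + 1) r ∧
    s'.nreg 11 = D.nid i r ∧ s'.nreg 12 = D.nid i (r - 1) ∧ (0 < s'.nreg 13 ↔ D.wv i r) ∧
    (0 < s'.nreg 14 ↔ D.wh i r)) ?_ ?_
  · have n1 : s₁.narr = s.narr := funext fun a => hf₁.narr a rfl
    have r7 : s₁.nreg 7 = i := (hf₁.nreg 7 rfl).trans h7
    have r1 : s₁.nreg 1 = 0 := (hf₁.nreg 1 rfl).trans h.zero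
    have r4 : s₁.nreg 4 = z := (hf₁.nreg 4 rfl).trans h.out
    have r5 : s₁.nreg 5 = D.cnt i r := (hf₁.nreg 5 rfl).trans h.cnt
    have r10 : s₁.nreg 10 = D.nid (i - 1) r := (hf₁.nreg 10 rfl).trans h.prev
    have hold := h.old i le_rfl hin
    rw [numberProg]
    simp +decide only [Prog.block, WP.seq_iff, WP.instr_iff, WP.ite_iff, WP.skip_iff, Instr.apply,
      Instr.Within, Test.Holds, Function.update_apply, reduceIte, true_and, r7, r1, r4, r5, r10, n1,
      hold, hiM, h.wv i hin, h.wh i hin, u2]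
    refine ⟨fun hi => ⟨fun hh => ⟨fun hv => ?_, fun hv => ?_⟩, fun hh => ?_⟩, fun hi => ?_⟩
    · obtain ⟨h1, h2⟩ := hD.nid_new i r hi hh hv
      exact ⟨by omega, h2.symm, h1.symm, trivial⟩
    · exact ⟨by omega, (hD.cnt_same i r fun h => hv h.2.2).symm, (hD.nid_left i r hi hh hv).symm,
        trivial⟩
    · exact ⟨by omega, (hD.cnt_same i r fun h => hh h.2.1).symm, (hD.nid_below i r hi hh).symm,
        trivial⟩
    · exact ⟨by omega, (hD.cnt_same i r fun h => hi h.1).symm, (hD.nid_out i r hi).symm, trivial⟩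
  rintro s₂ t₂ hf₂ ⟨v1, v2, v3, v4, v5, v6⟩
  have n2 : s₂.narr = s.narr := funext fun a => (hf₂.narr a rfl).trans (hf₁.narr a rfl)
  have m2 : s₂.rarr = s.rarr := funext fun a => (hf₂.rarr a rfl).trans (hf₁.rarr a rfl)
  have r1 : s₂.nreg 1 = 0 := (hf₂.nreg 1 rfl).trans ((hf₁.nreg 1 rfl).trans h.zero)
  rw [Prog.block]
  refine WP.seq (R := fun s' t' => t' ≤ t₂ + 6 ∧
    Recorded (s'.narr 0) D.nl (s'.rarr 0) D.xl z (visited n D.wv D.nid (i + 1) r) ∧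
    Recorded (s'.narr 2) D.nr (s'.rarr 2) D.xr z
      (visited n D.wv (fun i r => D.nid (i - 1) r) (i + 1) r)) ?_ ?_
  · have r7 : s₂.nreg 7 = i := (hf₂.nreg 7 rfl).trans ((hf₁.nreg 7 rfl).trans h7)
    have r10 : s₂.nreg 10 = D.nid (i - 1) r :=
      (hf₂.nreg 10 rfl).trans ((hf₁.nreg 10 rfl).trans h.prev)
    rw [verticalProg]
    simp +decide only [Prog.block, WP.seq_iff, WP.instr_iff, WP.ite_iff, WP.skip_iff, Instr.apply,
      Instr.Within, Test.Holds, Function.update_apply, reduceIte, true_and, r7, r1, r10, v3, n2, m2,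
      hiM, hcM, hpM, v5, h.xs]
    refine ⟨fun hv => ⟨by omega, ?_, ?_⟩, fun hv => ⟨by omega, ?_, ?_⟩⟩
    · exact h.recs.left.update (hD.left i r hv) visited_succ_subset
    · exact h.recs.right.update (hD.right i r hv) visited_succ_subset
    · exact h.recs.left.mono (visited_succ_subset_of_not hv)
    · exact h.recs.right.mono (visited_succ_subset_of_not hv)
  rintro s₃ t₃ hf₃ ⟨w1, w2, w3⟩
  rw [Prog.block]
  refine WP.seq (R := fun s' t' => t' ≤ t₃ + 6 ∧
    Recorded (s'.narr 1) D.nt (s'.rarr 1) D.yt z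
      (visited n D.wh (fun i r => D.nid i (r - 1)) (i + 1) r) ∧
    Recorded (s'.narr 3) D.nb (s'.rarr 3) D.yb z (visited n D.wh D.nid (i + 1) r)) ?_ ?_
  · have r1 : s₃.nreg 1 = 0 := (hf₃.nreg 1 rfl).trans r1
    have r6 : s₃.nreg 6 = r :=
      (hf₃.nreg 6 rfl).trans ((hf₂.nreg 6 rfl).trans ((hf₁.nreg 6 rfl).trans h.row))
    have r11 : s₃.nreg 11 = D.nid i r := (hf₃.nreg 11 rfl).trans v3
    have r12 : s₃.nreg 12 = D.nid i (r - 1) := (hf₃.nreg 12 rfl).trans v4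
    have v6 : 0 < s₃.nreg 14 ↔ D.wh i r := (hf₃.nreg 14 rfl).symm ▸ v6
    have q1 : s₃.narr 1 = s.narr 1 := (hf₃.narr 1 rfl).trans (congrFun n2 1)
    have q3 : s₃.narr 3 = s.narr 3 := (hf₃.narr 3 rfl).trans (congrFun n2 3)
    have p1 : s₃.rarr 1 = s.rarr 1 := (hf₃.rarr 1 rfl).trans (congrFun m2 1)
    have p3 : s₃.rarr 3 = s.rarr 3 := (hf₃.rarr 3 rfl).trans (congrFun m2 3)
    have p9 : s₃.rarr 9 = D.ys := (hf₃.rarr 9 rfl).trans ((congrFun m2 9).trans h.ys)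
    rw [horizontalProg]
    simp +decide only [Prog.block, WP.seq_iff, WP.instr_iff, WP.ite_iff, WP.skip_iff, Instr.apply,
      Instr.Within, Test.Holds, Function.update_apply, reduceIte, true_and, r6, r1, r11, r12, q1, q3,
      p1, p3, p9, hrM, hcM, hbM, v6]
    refine ⟨fun hv => ⟨by omega, ?_, ?_⟩, fun hv => ⟨by omega, ?_, ?_⟩⟩
    · exact h.recs.top.update (hD.top i r hv) visited_succ_subset
    · exact h.recs.bottom.update (hD.bottom i r hv) visited_succ_subset
    · exact h.recs.top.mono (visited_succ_subset_of_not hv)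
    · exact h.recs.bottom.mono (visited_succ_subset_of_not hv)
  rintro s₄ t₄ hf₄ ⟨x1, x2, x3⟩
  have F : ∀ a, a = 1 ∨ a = 2 ∨ a = 4 ∨ a = 6 ∨ a = 7 → s₄.nreg a = s.nreg a := by
    rintro a (rfl | rfl | rfl | rfl | rfl) <;>
    exact (hf₄.nreg _ rfl).trans ((hf₃.nreg _ rfl).trans ((hf₂.nreg _ rfl).trans (hf₁.nreg _ rfl)))
  have G : ∀ a, 20 ≤ a ∧ a < 25 → s₄.narr a = s.narr a := by
    rintro a ⟨ha1, ha2⟩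
    refine Eq.trans ?_ (congrFun n2 a)
    interval_cases a <;> exact (hf₄.narr _ rfl).trans (hf₃.narr _ rfl)
  have r5 : s₄.nreg 5 = D.cnt (i + 1) r := (hf₄.nreg 5 rfl).trans ((hf₃.nreg 5 rfl).trans v2)
  have r11 : s₄.nreg 11 = D.nid i r := (hf₄.nreg 11 rfl).trans ((hf₃.nreg 11 rfl).trans v3)
  have r9 : s₄.nreg 9 = s₁.nreg 9 :=
    (hf₄.nreg 9 rfl).trans ((hf₃.nreg 9 rfl).trans (hf₂.nreg 9 rfl))
  have r7 : s₄.nreg 7 = i := (F 7 (by decide)).trans h7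
  simp +decide only [Prog.block, WP.seq_iff, WP.instr_iff, WP.skip_iff, Instr.apply,
    Instr.Within, Function.update_apply, reduceIte, true_and, r7, r11, hiM]
  refine ⟨by omega, ?_⟩
  constructor
  · exact (F 6 (by decide)).trans h.row
  · exact (F 1 (by decide)).trans h.zero
  · exact (F 2 (by decide)).trans h.one
  · exact (F 4 (by decide)).trans h.out
  · exact r5
  · rw [Nat.add_sub_cancel, ← u2, ← r9]
    rfl
  · rw [Nat.add_sub_cancel]
    rfl
  · exact (G 21 (by decide)) ▸ h.wv
  · exact (G 22 (by decide)) ▸ h.ve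
  · exact (G 23 (by decide)) ▸ h.wh
  · intro j hj0 hj
    simp +decide only [Function.update_apply, reduceIte]
    split_ifs with hji
    · rw [hji]
    · rw [G 24 (by decide)]
      exact h.new j hj0 (by omega)
  · intro j hj hjn
    simp +decide only [Function.update_apply, reduceIte]
    rw [if_neg (by omega), G 24 (by decide)]
    exact h.old j (by omega) hjn
  · exact (hf₄.rarr 8 rfl).trans ((hf₃.rarr 8 rfl).trans ((congrFun m2 8).trans h.xs))
  · exact (hf₄.rarr 9 rfl).trans ((hf₃.rarr 9 rfl).trans ((congrFun m2 9).trans h.ys))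
  · constructor
    · rw [← hf₄.narr 0 rfl, ← hf₄.rarr 0 rfl] at w2
      exact w2
    · exact x2
    · rw [← hf₄.narr 2 rfl, ← hf₄.rarr 2 rfl] at w3
      exact w3
    · exact x3

/-- The arrays describe the walls and edges. -/
structure Described (D : CellData) (n : ℕ) (s : MState) : Prop where
  wv : ∀ i r, r ≤ n →
    ((∃ k < n, s.narr 14 k = i ∧ s.narr 17 k ≤ r ∧ r < s.narr 18 k) ↔ D.wv i r)
  ve : ∀ i r, r ≤ n →
    ((∃ k < n, s.narr 14 k = i ∧ s.narr 15 k ≤ r ∧ r < s.narr 16 k) ↔ D.ve i r)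
  wh : ∀ i r, i ≤ n →
    ((∃ k < n, s.narr 11 k = r ∧ s.narr 19 k ≤ i ∧ i < s.narr 20 k) ↔ D.wh i r)
  xs : s.rarr 8 = D.xs
  ys : s.rarr 9 = D.ys

theorem Described.of_eq {s s' : MState} (h : D.Described n s)
    (hn : ∀ a, 11 ≤ a → a ≤ 20 → s'.narr a = s.narr a) (h8 : s'.rarr 8 = s.rarr 8)
    (h9 : s'.rarr 9 = s.rarr 9) : D.Described n s' where
  wv := by
    rw [hn 14 (by decide) (by decide), hn 17 (by decide) (by decide), hn 18 (by decide) (by decide)]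
    exact h.wv
  ve := by
    rw [hn 14 (by decide) (by decide), hn 15 (by decide) (by decide), hn 16 (by decide) (by decide)]
    exact h.ve
  wh := by
    rw [hn 11 (by decide) (by decide), hn 19 (by decide) (by decide), hn 20 (by decide) (by decide)]
    exact h.wh
  xs := h8.trans h.xs
  ys := h9.trans h.ys

theorem Recs.mono {i r i' r' : ℕ} {s : MState} (h : D.Recs n z i r s)
    (hv : ∀ p m, visited n p m i' r' ⊆ visited n p m i r) : D.Recs n z i' r' s :=
  ⟨h.left.mono (hv _ _), h.top.mono (hv _ _), h.right.mono (hv _ _), h.bottom.mono (hv _ _)⟩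

theorem Recs.of_eq {i r : ℕ} {s s' : MState} (h : D.Recs n z i r s)
    (hn : ∀ a < 4, s'.narr a = s.narr a) (hr : ∀ a < 4, s'.rarr a = s.rarr a) :
    D.Recs n z i r s' := by
  constructor
  · rw [hn 0 (by decide), hr 0 (by decide)]
    exact h.left
  · rw [hn 1 (by decide), hr 1 (by decide)]
    exact h.top
  · rw [hn 2 (by decide), hr 2 (by decide)]
    exact h.right
  · rw [hn 3 (by decide), hr 3 (by decide)]
    exact h.bottom

-- Each row starts from column `0`, which is outside; so the flag is `0` and the number of the
-- previous cell is `z`.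
open Instr Test in
theorem rowProg_spec {M r : ℕ} (hD : D.Lawful n N z) (hnM : n < M) (hNM : N < M) (hrn : r ≤ n)
    {s : MState} {t : ℕ} (hp : Prepared n s) (hd : D.Described n s) (h6 : s.nreg 6 = r)
    (h4 : s.nreg 4 = z) (h5 : s.nreg 5 = D.cnt 1 r)
    (hid : ∀ j, 0 < j → j ≤ n → s.narr 24 j = D.nid j (r - 1)) (hrec : D.Recs n z 1 r s) :
    WP M (.block [markProg, .instr (zero 9), .instr (copy 10 4), .instr (zero 7), .instr (succ 7),
        .loop (lt 7 3) cellProg, .instr (succ 6)])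
      (fun s' t' => s'.nreg 6 = r + 1 ∧ t' ≤ t + 60 * n + 30 +
          ∑ k ∈ Finset.range n, (if s.narr 11 k = r then 3 * n + 3 else 0) ∧
        s'.nreg 5 = D.cnt 1 (r + 1) ∧ (∀ j, 0 < j → j ≤ n → s'.narr 24 j = D.nid j r) ∧
        D.Recs n z 1 (r + 1) s') s t := by
  rw [Prog.block]
  refine WP.seq (markProg_spec hnM hp h6) ?_
  rintro s₁ t₁ hf₁ ⟨u1, u2⟩
  have n4 : ∀ a < 4, s₁.narr a = s.narr a := fun a ha => by
    refine hf₁.narr a ?_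
    interval_cases a <;> rfl
  have m4 : s₁.rarr = s.rarr := funext fun a => hf₁.rarr a rfl
  simp +decide only [Prog.block, WP.seq_iff, WP.instr_iff, Instr.apply, Instr.Within, true_and]
  refine WP.for_loop (n := n + 1) (i₀ := 1) (fun i s' t' => t' + 28 ≤ t₁ + 4 + 28 * i ∧
    D.CellState n z i r s') rfl ((hf₁.nreg 3 rfl).trans hp.size_succ) rfl (by omega)
    ⟨by omega, ?_⟩ ?_ ?_
  · constructor
    · exact (hf₁.nreg 6 rfl).trans h6
    · exact (hf₁.nreg 1 rfl).trans hp.zero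
    · exact (hf₁.nreg 2 rfl).trans hp.one
    · exact (hf₁.nreg 4 rfl).trans h4
    · exact (hf₁.nreg 5 rfl).trans h5
    · exact iff_of_false (lt_irrefl 0) (hD.inn_left r)
    · exact (hf₁.nreg 4 rfl).trans (h4.trans (hD.nid_out 0 r (hD.inn_left r)).symm)
    · exact fun j hj => (u2 j hj).1.trans (hd.wv j r hrn)
    · exact fun j hj => (u2 j hj).2.1.trans (hd.ve j r hrn)
    · exact fun j hj => (u2 j hj).2.2.trans (hd.wh j r hj)
    · exact fun j h1 h2 => absurd h1 (by omega)
    · exact fun j h1 h2 => (congrFun (hf₁.narr 24 rfl) j).trans (hid j h1 h2)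
    · exact (congrFun m4 8).trans hd.xs
    · exact (congrFun m4 9).trans hd.ys
    · exact hrec.of_eq n4 fun a _ => congrFun m4 a
  · rintro i s' t' hi0 hin - h7 - ⟨g1, g2⟩
    refine (cellProg_spec hD hnM hNM hi0 (by omega) hrn h7 g2).mono
      fun s'' t'' _ h => ⟨h.1, by omega, h.2.2⟩
  · rintro s' t' - h7 ⟨g1, g2⟩
    simp +decide only [WP.seq_iff, WP.instr_iff, WP.skip_iff, Instr.apply, Instr.Within,
      Function.update_apply, reduceIte, true_and, g2.row, g2.cnt]
    exact ⟨by omega, (hD.cnt_row r).symm, fun j h1 h2 => g2.new j h1 (by omega),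
      Recs.of_eq (g2.recs.mono fun _ _ => visited_row_subset) (fun _ _ => rfl) fun _ _ => rfl⟩

theorem sweepProg_spec {M : ℕ} (hD : D.Lawful n N z) (hnM : n < M) (hNM : N < M)
    {s : MState} {t : ℕ} (hp : Prepared n s) (hd : D.Described n s) (h4 : s.nreg 4 = z) :
    WP M sweepProg (fun s' t' => t' ≤ t + n * (63 * n + 64) + 60 * n + 70 ∧
      s'.nreg 5 = D.cnt 1 (n + 1) ∧ D.Recs n z 1 (n + 1) s') s t := by
  rw [sweepProg, Prog.block, WP.seq_iff, WP.instr_iff]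
  refine ⟨trivial, ?_⟩
  rw [Prog.block]
  refine WP.seq (R := fun s' t' => t' ≤ t + 3 * (n + 1) + 2 ∧ ∀ i ≤ n, s'.narr 24 i = z) ?_ ?_
  · refine WP.for_loop (n := n + 1) (i₀ := 0) (fun j s' t' => t' ≤ t + 3 * j + 1 ∧ ∀ i < j,
      s'.narr 24 i = z) rfl hp.size_succ rfl (Nat.zero_le _)
      ⟨by omega, fun l hl => absurd hl (Nat.not_lt_zero _)⟩ ?_ ?_
    · rintro j s' t' - hj hf h7 - ⟨g1, g2⟩
      have g3 : s'.nreg 4 = z := (hf.nreg 4 rfl).trans h4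
      have hjM : j < M := by omega
      simp +decide only [Prog.block, WP.seq_iff, WP.instr_iff, WP.skip_iff, Instr.apply,
        Instr.Within, Function.update_apply, reduceIte, true_and, h7, hjM, g3]
      refine ⟨by omega, fun i hi => ?_⟩
      split_ifs with hij
      · rfl
      · exact g2 i (by omega)
    · rintro s' t' hf h7 ⟨g1, g2⟩
      exact ⟨by omega, fun i hi => g2 i (by omega)⟩
  rintro s₁ t₁ hf₁ ⟨u1, u2⟩
  simp +decide only [Prog.block, WP.seq_iff, WP.instr_iff, Instr.apply, Instr.Within, true_and,
    Function.update_apply, reduceIte]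
  have en : ∀ a < 21, s₁.narr a = s.narr a := fun a ha => by
    refine hf₁.narr a ?_
    interval_cases a <;> rfl
  -- Exchanging the sums: an edge is marked over its whole extent in one row only.
  have hsum : ∑ q ∈ Finset.range (n + 1), ∑ k ∈ Finset.range n,
      (if s.narr 11 k = q then 3 * n + 3 else 0) ≤ n * (3 * n + 3) := by
    rw [Finset.sum_comm]
    refine (Finset.sum_le_card_nsmul _ _ (3 * n + 3) fun k _ => ?_).trans_eq (by simp)
    rw [Finset.sum_ite_eq]
    split_ifs <;> omega
  refine WP.for_loop (n := n + 1) (i₀ := 1) (fun r s' t' => t' ≤ t₁ + 3 + r * (60 * n + 31) +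
      ∑ q ∈ Finset.range r, ∑ k ∈ Finset.range n, (if s.narr 11 k = q then 3 * n + 3 else 0) ∧
    s'.nreg 5 = D.cnt 1 r ∧ (∀ j, 0 < j → j ≤ n → s'.narr 24 j = D.nid j (r - 1)) ∧
    D.Recs n z 1 r s') rfl ((hf₁.nreg 3 rfl).trans hp.size_succ) rfl (by omega) ?_ ?_ ?_
  · refine ⟨by omega, hD.cnt_first.symm, fun j h1 h2 => ?_, ?_⟩
    · rw [hD.nid_out _ _ (hD.inn_bottom j)]
      exact u2 j h2
    · constructor <;> rw [visited_first] <;> exact fun ν hν => absurd hν (Set.notMem_empty ν)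
  · rintro r s' t' hr0 hrn hf h6 - ⟨g1, g2, g3, g4⟩
    rw [Finset.sum_range_succ, Nat.succ_mul]
    have fn : ∀ a, 4 ≤ a → a ≤ 20 → s'.narr a = s.narr a := fun a ha1 ha2 => by
      refine (hf.narr a ?_).trans (en a (by omega))
      interval_cases a <;> rfl
    have fr : ∀ a < 5, s'.nreg a = s.nreg a := fun a ha => by
      interval_cases a <;> exact (hf.nreg _ rfl).trans (hf₁.nreg _ rfl)
    have hp' : Prepared n s' := hp.of_eq (fun a ha => fr a (by omega)) fun a ha => fn a (by omega)
    have hd' : D.Described n s' := hd.of_eq (fun a ha => fn a (by omega))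
      ((hf.rarr 8 rfl).trans (hf₁.rarr 8 rfl)) ((hf.rarr 9 rfl).trans (hf₁.rarr 9 rfl))
    have h := rowProg_spec (t := t' + 1) hD hnM hNM (by omega) hp' hd' h6
      ((fr 4 (by decide)).trans h4) g2 g3 g4
    rw [fn 11 (by decide) (by decide)] at h
    exact h.mono fun s'' t'' _ h => ⟨h.1, by omega, h.2.2⟩
  · rintro s' t' - - ⟨g1, g2, g3, g4⟩
    rw [WP.skip_iff]
    refine ⟨?_, g2, g4⟩
    rw [Nat.succ_mul] at g1
    have : n * (63 * n + 64) = n * (60 * n + 31) + n * (3 * n + 3) + 30 * n := by ring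
    omega

end CellData

namespace EdgeSystem

variable {ι : Type} [Fintype ι] {S : EdgeSystem ι ℝ}

/-! ### The numbering of the blocks -/

/-- The block to the left of a block, if the cells there are inside. -/
theorem IsBlock.exists_left {T : EdgeSystem ι ℕ} {β : Blk} (hβ : T.IsBlock β) {j : ℕ}
    (h0 : 0 < β.l) (h1 : β.b ≤ j) (h2 : j < β.t) (hin : T.In (β.l - 1) j) :
    ∃ γ, T.IsBlock γ ∧ γ.Has (β.l - 1) j ∧ γ.r = β.l ∧ γ.b = β.b ∧ γ.t = β.t := by
  obtain ⟨γ, hγ, hhas⟩ := hin.exists_block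
  have h3 := hβ.left j h1 h2
  rw [← Nat.sub_add_cancel h0] at h3
  have h4 := (hγ.r_eq_of_wV hhas h3).trans (Nat.sub_add_cancel h0)
  have h5 := hγ.side_eq hβ h4 hhas.2.2.1 hhas.2.2.2 h1 h2
  exact ⟨γ, hγ, hhas, h4, h5.1, h5.2⟩

/-- The block below a block, if the cells there are inside. -/
theorem IsBlock.exists_bottom {T : EdgeSystem ι ℕ} {β : Blk} (hβ : T.IsBlock β) {i : ℕ}
    (h0 : 0 < β.b) (h1 : β.l ≤ i) (h2 : i < β.r) (hin : T.In i (β.b - 1)) :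
    ∃ γ, T.IsBlock γ ∧ γ.Has i (β.b - 1) ∧ γ.t = β.b ∧ γ.l = β.l ∧ γ.r = β.r := by
  obtain ⟨γ, hγ, h, h3⟩ := hβ.swap.exists_left (T := T.swap) h0 h1 h2 (T.in_swap.2 hin)
  exact ⟨γ.swap, hγ.swap, ⟨h.2.2.1, h.2.2.2, h.1, h.2.1⟩, h3⟩

/-- The number of blocks whose first cell comes before the cell `(i, r)`, row by row. -/
noncomputable def blocksBefore (S : EdgeSystem ι ℝ) (i r : ℕ) : ℕ :=
  {γ | S.rank.IsBlock γ ∧ (γ.b < r ∨ γ.b = r ∧ γ.l < i)}.ncard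

/-- The number of a block. -/
noncomputable def blockNum (S : EdgeSystem ι ℝ) (β : Blk) : ℕ := S.blocksBefore β.l β.b

open Classical in
/-- The number of the block of a cell, and `z` for a cell that is not inside. -/
noncomputable def cellNum (S : EdgeSystem ι ℝ) (z i r : ℕ) : ℕ :=
  if h : S.rank.In i r then S.blockNum h.exists_block.choose else z

theorem finite_blocksBefore (i r : ℕ) :
    {γ | S.rank.IsBlock γ ∧ (γ.b < r ∨ γ.b = r ∧ γ.l < i)}.Finite :=
  S.finite_blocks.subset fun _ h => h.1

theorem cellNum_of_has {z i r : ℕ} {β : Blk} (hβ : S.rank.IsBlock β) (h : β.Has i r) :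
    S.cellNum z i r = S.blockNum β := by
  have hin := hβ.inside i r h
  rw [cellNum, dif_pos hin]
  have h1 := hin.exists_block.choose_spec
  rw [IsBlock.ext_of_has h1.1 hβ h1.2 h]

theorem cellNum_of_not {z i r : ℕ} (h : ¬ S.rank.In i r) : S.cellNum z i r = z :=
  dif_neg h

theorem blocksBefore_succ_of_corner {β : Blk} (hβ : S.rank.IsBlock β) :
    S.blocksBefore (β.l + 1) β.b = S.blocksBefore β.l β.b + 1 := by
  have h : {γ | S.rank.IsBlock γ ∧ (γ.b < β.b ∨ γ.b = β.b ∧ γ.l < β.l + 1)} =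
      insert β {γ | S.rank.IsBlock γ ∧ (γ.b < β.b ∨ γ.b = β.b ∧ γ.l < β.l)} := by
    ext γ
    refine ⟨fun ⟨h1, h2⟩ => ?_, ?_⟩
    · by_cases h3 : γ.l = β.l ∧ γ.b = β.b
      · exact Or.inl (blocks_injOn_corner h1 hβ (Prod.ext h3.1 h3.2))
      · exact Or.inr ⟨h1, by omega⟩
    · rintro (rfl | ⟨h1, h2⟩)
      · exact ⟨hβ, by omega⟩
      · exact ⟨h1, by omega⟩
  rw [blocksBefore, h, Set.ncard_insert_of_notMem _ (finite_blocksBefore _ _)]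
  · rfl
  · rintro ⟨-, h2⟩
    omega

theorem blocksBefore_le (i r : ℕ) : S.blocksBefore i r ≤ {β | S.rank.IsBlock β}.ncard :=
  Set.ncard_le_ncard (fun _ h => h.1) S.finite_blocks

theorem blockNum_lt {β : Blk} (hβ : S.rank.IsBlock β) :
    S.blockNum β < {β | S.rank.IsBlock β}.ncard := by
  rw [blockNum, ← Nat.succ_le_iff, Nat.succ_eq_add_one, ← blocksBefore_succ_of_corner hβ]
  exact blocksBefore_le _ _

/-- Of two blocks, the one with the earlier corner in row order is counted before the other, in
addition to all the blocks before itself. -/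
theorem blockNum_injOn : Set.InjOn S.blockNum {β | S.rank.IsBlock β} := by
  have key : ∀ {β γ}, S.rank.IsBlock β → β.b < γ.b ∨ β.b = γ.b ∧ β.l < γ.l →
      S.blockNum β < S.blockNum γ := by
    intro β γ hβ h
    rw [blockNum, ← Nat.succ_le_iff, Nat.succ_eq_add_one, ← blocksBefore_succ_of_corner hβ]
    refine Set.ncard_le_ncard (fun δ hδ => ⟨hδ.1, ?_⟩) (finite_blocksBefore _ _)
    have := hδ.2
    omega
  intro β hβ γ hγ h
  by_contra hne
  have h1 : ¬ (β.l = γ.l ∧ β.b = γ.b) := fun h =>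
    hne (blocks_injOn_corner hβ hγ (Prod.ext h.1 h.2))
  rcases lt_or_ge β.b γ.b with h2 | h2
  · exact (key hβ (Or.inl h2)).ne h
  rcases lt_or_ge γ.b β.b with h3 | h3
  · exact (key hγ (Or.inl h3)).ne' h
  rcases lt_or_ge β.l γ.l with h4 | h4
  · exact (key hβ (Or.inr ⟨by omega, h4⟩)).ne h
  · exact (key hγ (Or.inr ⟨by omega, by omega⟩)).ne' h

theorem blockNum_bijOn : Set.BijOn S.blockNum {β | S.rank.IsBlock β}
    (Set.Iio {β | S.rank.IsBlock β}.ncard) := by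
  refine ⟨fun β hβ => blockNum_lt hβ, blockNum_injOn, ?_⟩
  have h := Set.eq_of_subset_of_ncard_le (s := S.blockNum '' {β | S.rank.IsBlock β})
    (t := Set.Iio {β | S.rank.IsBlock β}.ncard)
    (Set.image_subset_iff.2 fun β hβ => blockNum_lt hβ)
    (by rw [blockNum_injOn.ncard_image, Set.ncard_Iio_nat]) (Set.finite_Iio _)
  exact h.symm.subset

/-- The block of the given number. -/
noncomputable def blockOf (S : EdgeSystem ι ℝ) (ν : ℕ) : Blk :=
  open Classical in if h : ∃ β, S.rank.IsBlock β ∧ S.blockNum β = ν then h.choose else ⟨0, 0, 0, 0⟩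

theorem blockOf_blockNum {β : Blk} (hβ : S.rank.IsBlock β) : S.blockOf (S.blockNum β) = β := by
  have h : ∃ γ, S.rank.IsBlock γ ∧ S.blockNum γ = S.blockNum β := ⟨β, hβ, rfl⟩
  rw [blockOf, dif_pos h]
  exact blockNum_injOn h.choose_spec.1 hβ h.choose_spec.2

/-- The cell data of an edge system. -/
noncomputable def cellData (S : EdgeSystem ι ℝ) (z : ℕ) (xs ys : ℕ → ℝ) : CellData where
  inn := S.rank.In
  wv := S.rank.WV
  wh := S.rank.WH
  ve := S.rank.VE
  nid := S.cellNum z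
  cnt := S.blocksBefore
  nl ν := S.cellNum z ((S.blockOf ν).l - 1) (S.blockOf ν).b
  nt ν := S.cellNum z (S.blockOf ν).l (S.blockOf ν).t
  nr ν := S.cellNum z (S.blockOf ν).r (S.blockOf ν).b
  nb ν := S.cellNum z (S.blockOf ν).l ((S.blockOf ν).b - 1)
  xl ν := xs (S.blockOf ν).l
  yt ν := ys (S.blockOf ν).t
  xr ν := xs (S.blockOf ν).r
  yb ν := ys (S.blockOf ν).b
  xs := xs
  ys := ys

/-- Applied to the cells beyond a side of a block: they are all outside or all in one neighbouring
block. So it does not matter which of them records the neighbour. -/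
theorem cellNum_eq_of_exists {z : ℕ} (c : ℕ → ℕ × ℕ) {p : ℕ → Prop}
    (h : ∀ j, p j → S.rank.In (c j).1 (c j).2 → ∃ γ, S.rank.IsBlock γ ∧
      ∀ j, p j → γ.Has (c j).1 (c j).2) {j j' : ℕ} (hj : p j) (hj' : p j') :
    S.cellNum z (c j).1 (c j).2 = S.cellNum z (c j').1 (c j').2 := by
  by_cases h1 : ∃ j, p j ∧ S.rank.In (c j).1 (c j).2
  · obtain ⟨j₀, h2, h3⟩ := h1
    obtain ⟨γ, hγ, h4⟩ := h j₀ h2 h3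
    rw [cellNum_of_has hγ (h4 j hj), cellNum_of_has hγ (h4 j' hj')]
  · push Not at h1
    rw [cellNum_of_not (h1 j hj), cellNum_of_not (h1 j' hj')]

theorem not_in_zero_left (r : ℕ) : ¬ S.rank.In 0 r := fun h => by
  obtain ⟨c, hc, m, hm, -⟩ := h.exists_vE
  have h1 : 0 < S.rank.vx m := rankX_pos m
  omega

theorem not_in_zero_right (i : ℕ) : ¬ S.rank.In i 0 := fun h =>
  not_in_zero_left (S := S.swap) i (S.rank.in_swap.2 h)

theorem IsBlock.l_pos {β : Blk} (hβ : S.rank.IsBlock β) : 0 < β.l :=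
  (Finset.mem_Icc.1 hβ.l_mem_Icc).1

theorem IsBlock.b_pos {β : Blk} (hβ : S.rank.IsBlock β) : 0 < β.b :=
  (Finset.mem_Icc.1 hβ.b_mem_Icc).1

/-- Cell by cell, this is the geometry of blocks: walls meet a block only along its sides, the
parity flips at edges, and a block begins at a cell with walls on the left and below. The laws on
neighbours rest on the fact that adjacent blocks share whole sides. -/
theorem cellData_lawful {z : ℕ} (hz : z ≤ {β | S.rank.IsBlock β}.ncard) (xs ys : ℕ → ℝ) :
    (S.cellData z xs ys).Lawful (Fintype.card ι) {β | S.rank.IsBlock β}.ncard z where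
  inn_left := not_in_zero_left
  inn_bottom := not_in_zero_right
  flip := fun i r hi => by
    change S.rank.In i r ↔ (S.rank.VE i r ↔ ¬ S.rank.In (i - 1) r)
    by_cases hv : S.rank.VE i r
    · rw [iff_true_left hv]
      exact in_iff_not_in_of_vE (by omega) (fun c _ _ => by omega) hv
    · rw [iff_false_left hv, not_not]
      refine (in_iff_of_not_vE (Nat.sub_le i 1) fun c h1 h2 h3 => hv ?_).symm
      obtain rfl : c = i := by omega
      exact h3
  nid_out := fun i r h => cellNum_of_not h
  nid_below := fun i r h1 h2 => by
    obtain ⟨β, hβ, h⟩ := In.exists_block h1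
    have h3 : β.b ≠ r := fun h4 => h2 (h4 ▸ hβ.bottom i h.1 h.2.1)
    have h4 : β.Has i (r - 1) := ⟨h.1, h.2.1, by have := h.2.2.1; omega, by have := h.2.2.2; omega⟩
    exact (cellNum_of_has hβ h).trans (cellNum_of_has hβ h4).symm
  nid_left := fun i r h1 _ h2 => by
    obtain ⟨β, hβ, h⟩ := In.exists_block h1
    have h3 : β.l ≠ i := fun h4 => h2 (h4 ▸ hβ.left r h.2.2.1 h.2.2.2)
    have h4 : β.Has (i - 1) r := ⟨by have := h.1; omega, by have := h.2.1; omega, h.2.2⟩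
    exact (cellNum_of_has hβ h).trans (cellNum_of_has hβ h4).symm
  nid_new := fun i r h1 h2 h3 => by
    obtain ⟨β, hβ, h⟩ := In.exists_block h1
    obtain rfl := hβ.l_eq_of_wV h h3
    obtain rfl := hβ.b_eq_of_wH h h2
    exact ⟨cellNum_of_has hβ h, blocksBefore_succ_of_corner hβ⟩
  cnt_same := fun i r h => by
    refine congrArg Set.ncard (Set.ext fun γ => and_congr_right fun hγ => ?_)
    have h1 : ¬ (γ.l = i ∧ γ.b = r) := by
      rintro ⟨rfl, rfl⟩
      exact h ⟨hγ.inside _ _ ⟨le_rfl, hγ.lr, le_rfl, hγ.bt⟩, hγ.bottom _ le_rfl hγ.lr,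
        hγ.left _ le_rfl hγ.bt⟩
    omega
  cnt_row := fun r => by
    refine congrArg Set.ncard (Set.ext fun γ => and_congr_right fun hγ => ?_)
    have h1 := Finset.mem_Icc.1 hγ.l_mem_Icc
    omega
  cnt_first := by
    refine (congrArg Set.ncard (Set.eq_empty_of_forall_notMem fun γ => ?_)).trans
      (Set.ncard_empty _)
    rintro ⟨hγ, h⟩
    have h1 := hγ.l_pos
    have h2 := hγ.b_pos
    omega
  nid_le := fun i r => by
    by_cases h : S.rank.In i r
    · obtain ⟨β, hβ, h⟩ := h.exists_block
      exact (cellNum_of_has hβ h).trans_le (blockNum_lt hβ).le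
    · exact (cellNum_of_not h).trans_le hz
  left := fun i r hw hne => by
    have hin : S.rank.In i r := by_contra fun h => hne (cellNum_of_not h)
    obtain ⟨β, hβ, h⟩ := hin.exists_block
    obtain rfl := hβ.l_eq_of_wV h hw
    simp only [cellData, cellNum_of_has hβ h, blockOf_blockNum hβ, and_true]
    refine cellNum_eq_of_exists (S := S) (z := z) (fun j => (β.l - 1, j)) (p := fun j => β.b ≤ j ∧ j < β.t)
      (j := r) (j' := β.b) (fun j hj hin => ?_) h.2.2 ⟨le_rfl, hβ.bt⟩
    obtain ⟨γ, hγ, h1, h2, h3, h4⟩ := hβ.exists_left hβ.l_pos hj.1 hj.2 hin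
    exact ⟨γ, hγ, fun j hj => ⟨h1.1, h1.2.1, h3 ▸ hj.1, h4 ▸ hj.2⟩⟩
  right := fun i r hw hne => by
    have hin : S.rank.In (i - 1) r := by_contra fun h => hne (cellNum_of_not h)
    have hi : 0 < i := Nat.pos_of_ne_zero fun h => by
      rw [h] at hin
      exact not_in_zero_left r hin
    obtain ⟨β, hβ, h⟩ := hin.exists_block
    rw [← Nat.sub_add_cancel hi] at hw
    obtain rfl : β.r = i := (hβ.r_eq_of_wV h hw).trans (Nat.sub_add_cancel hi)
    simp only [cellData, cellNum_of_has hβ h, blockOf_blockNum hβ, and_true]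
    refine cellNum_eq_of_exists (S := S) (z := z) (fun j => (β.r, j)) (p := fun j => β.b ≤ j ∧ j < β.t)
      (j := r) (j' := β.b) (fun j hj hin => ?_) h.2.2 ⟨le_rfl, hβ.bt⟩
    obtain ⟨γ, hγ, h1, h2, h3, h4⟩ := hβ.exists_right hj.1 hj.2 hin
    exact ⟨γ, hγ, fun j hj => ⟨h1.1, h1.2.1, h3 ▸ hj.1, h4 ▸ hj.2⟩⟩
  bottom := fun i r hw hne => by
    have hin : S.rank.In i r := by_contra fun h => hne (cellNum_of_not h)
    obtain ⟨β, hβ, h⟩ := hin.exists_block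
    obtain rfl := hβ.b_eq_of_wH h hw
    simp only [cellData, cellNum_of_has hβ h, blockOf_blockNum hβ, and_true]
    refine cellNum_eq_of_exists (S := S) (z := z) (fun j => (j, β.b - 1)) (p := fun j => β.l ≤ j ∧ j < β.r)
      (j := i) (j' := β.l) (fun j hj hin => ?_) ⟨h.1, h.2.1⟩ ⟨le_rfl, hβ.lr⟩
    obtain ⟨γ, hγ, h1, h2, h3, h4⟩ := hβ.exists_bottom hβ.b_pos hj.1 hj.2 hin
    exact ⟨γ, hγ, fun j hj => ⟨h3 ▸ hj.1, h4 ▸ hj.2, h1.2.2⟩⟩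
  top := fun i r hw hne => by
    have hin : S.rank.In i (r - 1) := by_contra fun h => hne (cellNum_of_not h)
    have hr : 0 < r := Nat.pos_of_ne_zero fun h => by
      rw [h] at hin
      exact not_in_zero_right i hin
    obtain ⟨β, hβ, h⟩ := hin.exists_block
    rw [← Nat.sub_add_cancel hr] at hw
    obtain rfl : β.t = r := (hβ.t_eq_of_wH h hw).trans (Nat.sub_add_cancel hr)
    simp only [cellData, cellNum_of_has hβ h, blockOf_blockNum hβ, and_true]
    refine cellNum_eq_of_exists (S := S) (z := z) (fun j => (j, β.t)) (p := fun j => β.l ≤ j ∧ j < β.r)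
      (j := i) (j' := β.l) (fun j hj hin => ?_) ⟨h.1, h.2.1⟩ ⟨le_rfl, hβ.lr⟩
    obtain ⟨γ, hγ, h1, h2, h3, h4⟩ := hβ.exists_top hj.1 hj.2 hin
    exact ⟨γ, hγ, fun j hj => ⟨h3 ▸ hj.1, h4 ▸ hj.2, h1.2.2⟩⟩

end EdgeSystem

/-! ### The program that builds the base rectangle graph -/

namespace EdgeSystem

/-- A wall is viewed here from an edge instead of from a vertex: the edge with its prolongations
both ways, between the nearest horizontal edges below and above. These bounds are what `reachProg`
stores. -/
theorem wV_iff_exists {ι α : Type} [Fintype ι] [LinearOrder α] {S : EdgeSystem ι α} {a b : α} :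
    S.WV a b ↔ ∃ k, S.vx k = a ∧ (∀ t, S.HHit a t → t < S.vb k → t ≤ b) ∧
      ∀ t, S.HHit a t → S.vt k < t → b < t := by
  constructor
  · rintro ⟨s, ⟨k, hk, rfl | rfl⟩, ⟨h1, h2⟩ | ⟨h1, h2⟩⟩
    · refine ⟨k, hk, fun t _ h4 => h4.le.trans h1, fun t h3 h4 => ?_⟩
      by_contra h5
      exact h2 t ((S.vb_lt k).trans h4) (not_lt.1 h5) h3
    · refine ⟨k, hk, fun t h3 h4 => ?_, fun t _ h4 => (h1.trans (S.vb_lt k)).trans h4⟩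
      by_contra h5
      exact h2 t (not_le.1 h5) h4 h3
    · refine ⟨k, hk, fun t _ h4 => (h4.trans (S.vb_lt k)).le.trans h1, fun t h3 h4 => ?_⟩
      by_contra h5
      exact h2 t h4 (not_lt.1 h5) h3
    · refine ⟨k, hk, fun t h3 h4 => ?_, fun t _ h4 => h1.trans h4⟩
      by_contra h5
      exact h2 t (not_le.1 h5) (h4.trans (S.vb_lt k)) h3
  · rintro ⟨k, hk, h1, h2⟩
    rcases lt_or_ge b (S.vb k) with h3 | h3
    · exact ⟨_, ⟨k, hk, Or.inl rfl⟩, Or.inr ⟨h3, fun t h4 h5 h6 => (h1 t h6 h5).not_gt h4⟩⟩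
    rcases lt_or_ge b (S.vt k) with h4 | h4
    · exact VE.wV ⟨k, hk, h3, h4⟩
    · exact ⟨_, ⟨k, hk, Or.inr rfl⟩, Or.inl ⟨h4, fun t h5 h6 h7 => (h2 t h7 h5).not_ge h6⟩⟩

/-- The walls are described by the arrays that `reachProg` computes. -/
theorem exists_reach_iff_wV {n : ℕ} {T : EdgeSystem (Fin n) ℕ} {cy cl cr ax ab at' dn up : ℕ → ℕ}
    (hcy : ∀ k : Fin n, cy k = T.hy k) (hcl : ∀ k : Fin n, cl k = T.hl k)
    (hcr : ∀ k : Fin n, cr k = T.hr k) (hax : ∀ k : Fin n, ax k = T.vx k)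
    (hab : ∀ k : Fin n, ab k = T.vb k) (hat : ∀ k : Fin n, at' k = T.vt k)
    (h : ∀ k < n, (∀ b, dn k ≤ b ↔ ∀ m < n, cl m ≤ ax k → ax k ≤ cr m → cy m < ab k → cy m ≤ b) ∧
      (∀ b, b < up k ↔ b < n + 1 ∧ ∀ m < n, cl m ≤ ax k → ax k ≤ cr m → at' k < cy m → b < cy m))
    {i r : ℕ} (hr : r ≤ n) : (∃ k < n, ax k = i ∧ dn k ≤ r ∧ r < up k) ↔ T.WV i r := by
  rw [wV_iff_exists]
  constructor
  · rintro ⟨k, hk, rfl, h1, h2⟩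
    have h3 := ((h k hk).1 r).1 h1
    have h4 := (((h k hk).2 r).1 h2).2
    rw [hax ⟨k, hk⟩, hab ⟨k, hk⟩] at h3
    rw [hax ⟨k, hk⟩, hat ⟨k, hk⟩] at h4
    refine ⟨⟨k, hk⟩, (hax ⟨k, hk⟩).symm, ?_, ?_⟩
    · rintro t ⟨m, rfl, g1, g2⟩ g3
      rw [hax ⟨k, hk⟩] at g1 g2
      have := h3 m m.2
      rw [hcl, hcr, hcy] at this
      exact this g1 g2 g3
    · rintro t ⟨m, rfl, g1, g2⟩ g3
      rw [hax ⟨k, hk⟩] at g1 g2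
      have := h4 m m.2
      rw [hcl, hcr, hcy] at this
      exact this g1 g2 g3
  · rintro ⟨k, rfl, h1, h2⟩
    refine ⟨k, k.2, hax k, ((h k k.2).1 r).2 fun m hm g1 g2 g3 => ?_,
      ((h k k.2).2 r).2 ⟨by omega, fun m hm g1 g2 g3 => ?_⟩⟩
    · rw [hcl ⟨m, hm⟩, hax] at g1
      rw [hcr ⟨m, hm⟩, hax] at g2
      rw [hcy ⟨m, hm⟩, hab] at g3
      rw [hcy ⟨m, hm⟩]
      exact h1 _ ⟨⟨m, hm⟩, rfl, g1, g2⟩ g3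
    · rw [hcl ⟨m, hm⟩, hax] at g1
      rw [hcr ⟨m, hm⟩, hax] at g2
      rw [hcy ⟨m, hm⟩, hat] at g3
      rw [hcy ⟨m, hm⟩]
      exact h2 _ ⟨⟨m, hm⟩, rfl, g1, g2⟩ g3

end EdgeSystem

open Instr Test in
/-- Prepare the sweep. -/
def prepareProg : Prog :=
  .block [.instr (zero 1), .instr (zero 2), .instr (succ 2), .instr (copy 3 0), .instr (succ 3),
    rankProg 0 10 8, rankProg 1 11 9, edgeProg 10 12 13 14, edgeProg 11 15 16 25,
    reachProg 11 12 13 14 15 16 17 18, reachProg 14 15 16 11 12 13 19 20]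

/-- The memory holds the ranks of the coordinates of the edges, and the coordinates of each rank. -/
structure HoldsRanks {n : ℕ} (S : EdgeSystem (Fin n) ℝ) (s : MState) : Prop where
  prepared : Prepared n s
  described : ∀ z, (S.cellData z (s.rarr 8) (s.rarr 9)).Described n s
  xs : ∀ k, s.rarr 8 (S.rank.vx k) = S.vx k
  ys : ∀ k, s.rarr 9 (S.rank.hy k) = S.hy k

theorem Finset.card_filter_range_fin {n : ℕ} {f : ℕ → ℝ} {x : Fin n → ℝ} (h : ∀ k : Fin n, f k = x k)
    (c : ℝ) : ({l ∈ Finset.range n | f l ≤ c}).card = ({l | x l ≤ c} : Finset (Fin n)).card := by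
  rw [Finset.card_filter, Finset.card_filter, Finset.sum_range]
  exact Finset.sum_congr rfl fun k _ => by rw [h]

theorem prepareProg_spec {M n : ℕ} {S : EdgeSystem (Fin n) ℝ} {x y : Fin n → ℝ}
    {nx : Equiv.Perm (Fin n)} (hS : ∀ k, S.hy k = y k ∧ S.hl k = min (x k) (x (nx k)) ∧
      S.hr k = max (x k) (x (nx k)) ∧ S.vx k = x (nx k) ∧ S.vb k = min (y k) (y (nx k)) ∧
      S.vt k = max (y k) (y (nx k))) (hM : n < M) {s : MState} {t : ℕ} (hn : s.nreg 0 = n)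
    (hs : ∀ k : Fin n, s.rarr 0 k = x k ∧ s.rarr 1 k = y k ∧ s.narr 0 k = nx k) :
    WP M prepareProg (fun s' t' => t' ≤ t + 36 * (n * n) + 80 * n + 65 ∧ HoldsRanks S s') s t := by
  -- The program ranks the values `x k`, while `rankX` counts the values `x (nx k)`; a permutation
  -- does not change the count.
  have hX : ∀ c, S.rankX c = ({l | x l ≤ c} : Finset (Fin n)).card := fun c => by
    rw [EdgeSystem.rankX, Finset.card_filter, Finset.card_filter]
    simp only [(hS _).2.2.2.1]
    exact Equiv.sum_comp nx fun l => if x l ≤ c then 1 else 0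
  have hY : ∀ c, S.rankY c = ({l | y l ≤ c} : Finset (Fin n)).card := fun c => by
    rw [EdgeSystem.rankY, EdgeSystem.rankX]
    simp only [EdgeSystem.swap, (hS _).1]
  have hnx : ∀ k < n, s.narr 0 k < n := fun k hk => by
    rw [(hs ⟨k, hk⟩).2.2]
    exact (nx _).2
  have e1 : n * (5 * n + 10) = 5 * (n * n) + 10 * n := by ring
  have e2 : n * (13 * n + 20) = 13 * (n * n) + 20 * n := by ring
  rw [prepareProg]
  simp +decide only [Prog.block, WP.seq_iff (p := .instr _), WP.instr_iff, Instr.apply, Instr.Within,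
    true_and]
  refine WP.seq (rankProg_spec (n := n) hn hM (by decide)) ?_
  rintro s₁ t₁ hf₁ ⟨a1, a2⟩
  refine WP.seq (rankProg_spec (n := n) ((hf₁.nreg 0 rfl).trans hn) hM (by decide)) ?_
  rintro s₂ t₂ hf₂ ⟨b1, b2⟩
  have rx : ∀ k : Fin n, s₂.narr 10 k = S.rankX (x k) ∧ s₂.rarr 8 (S.rankX (x k)) = x k := fun k => by
    have h1 := a2 k k.2
    rw [Finset.card_filter_range_fin (fun k => (hs k).1), (hs k).1, ← hX] at h1
    rw [hf₂.narr 10 rfl, hf₂.rarr 8 rfl]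
    exact ⟨h1.1, h1.1 ▸ h1.2⟩
  have ry : ∀ k : Fin n, s₂.narr 11 k = S.rankY (y k) ∧ s₂.rarr 9 (S.rankY (y k)) = y k := fun k => by
    have h1 := b2 k k.2
    have h2 : s₁.rarr 1 = s.rarr 1 := hf₁.rarr 1 rfl
    rw [h2, Finset.card_filter_range_fin (fun k => (hs k).2.1), (hs k).2.1, ← hY] at h1
    exact ⟨h1.1, h1.1 ▸ h1.2⟩
  have n2 : s₂.narr 0 = s.narr 0 := (hf₂.narr 0 rfl).trans (hf₁.narr 0 rfl)
  have r2 : s₂.nreg 0 = n := (hf₂.nreg 0 rfl).trans ((hf₁.nreg 0 rfl).trans hn)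
  refine WP.seq (edgeProg_spec (n := n) (Or.inl ⟨rfl, rfl, rfl, rfl⟩) r2 hM (n2 ▸ hnx)) ?_
  rintro s₃ t₃ hf₃ ⟨c1, c2⟩
  have n3 : s₃.narr 0 = s.narr 0 := (hf₃.narr 0 rfl).trans n2
  refine WP.seq (edgeProg_spec (n := n) (Or.inr ⟨rfl, rfl, rfl, rfl⟩) ((hf₃.nreg 0 rfl).trans r2)
    hM (n3 ▸ hnx)) ?_
  rintro s₄ t₄ hf₄ ⟨d1, d2⟩
  have hhy : ∀ k : Fin n, s₄.narr 11 k = S.rank.hy k := fun k => by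
    rw [hf₄.narr 11 rfl, hf₃.narr 11 rfl, (ry k).1, ← (hS k).1]
    rfl
  have hhl : ∀ k : Fin n, s₄.narr 12 k = S.rank.hl k := fun k => by
    rw [hf₄.narr 12 rfl, (c2 k k.2).1, n2, (hs k).2.2, (rx _).1, (rx _).1,
      ← EdgeSystem.rankX_mono.map_min, ← (hS k).2.1]
    rfl
  have hhr : ∀ k : Fin n, s₄.narr 13 k = S.rank.hr k := fun k => by
    rw [hf₄.narr 13 rfl, (c2 k k.2).2.1, n2, (hs k).2.2, (rx _).1, (rx _).1,
      ← EdgeSystem.rankX_mono.map_max, ← (hS k).2.2.1]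
    rfl
  have hvx : ∀ k : Fin n, s₄.narr 14 k = S.rank.vx k := fun k => by
    rw [hf₄.narr 14 rfl, (c2 k k.2).2.2, n2, (hs k).2.2, (rx _).1, ← (hS k).2.2.2.1]
    rfl
  have hmono : Monotone S.rankY := EdgeSystem.rankX_mono (S := S.swap)
  have n11 : s₃.narr 11 = s₂.narr 11 := hf₃.narr 11 rfl
  have hvb : ∀ k : Fin n, s₄.narr 15 k = S.rank.vb k := fun k => by
    rw [(d2 k k.2).1, n3, (hs k).2.2, n11, (ry _).1, (ry _).1, ← hmono.map_min, ← (hS k).2.2.2.2.1]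
    rfl
  have hvt : ∀ k : Fin n, s₄.narr 16 k = S.rank.vt k := fun k => by
    rw [(d2 k k.2).2.1, n3, (hs k).2.2, n11, (ry _).1, (ry _).1, ← hmono.map_max,
      ← (hS k).2.2.2.2.2]
    rfl
  obtain ⟨p0, p1, p2, p3⟩ : s₄.nreg 0 = n ∧ s₄.nreg 1 = 0 ∧ s₄.nreg 2 = 1 ∧ s₄.nreg 3 = n + 1 := by
    refine ⟨?_, ?_, ?_, ?_⟩
    · exact (hf₄.nreg 0 rfl).trans ((hf₃.nreg 0 rfl).trans r2)
    · exact (hf₄.nreg 1 rfl).trans ((hf₃.nreg 1 rfl).trans ((hf₂.nreg 1 rfl).trans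
        (hf₁.nreg 1 rfl)))
    · exact (hf₄.nreg 2 rfl).trans ((hf₃.nreg 2 rfl).trans ((hf₂.nreg 2 rfl).trans
        (hf₁.nreg 2 rfl)))
    · exact (hf₄.nreg 3 rfl).trans ((hf₃.nreg 3 rfl).trans ((hf₂.nreg 3 rfl).trans
        ((hf₁.nreg 3 rfl).trans (congrArg Nat.succ hn))))
  refine WP.seq (reachProg_spec (n := n) (by decide) (by decide) (by decide) (by decide) (by decide)
    (by decide) (by decide) (by decide) (by decide) p0 p3 hM) ?_
  rintro s₅ t₅ hf₅ ⟨f1, f2⟩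
  refine WP.seq (reachProg_spec (n := n) (by decide) (by decide) (by decide) (by decide) (by decide)
    (by decide) (by decide) (by decide) (by decide) ((hf₅.nreg 0 rfl).trans p0)
    ((hf₅.nreg 3 rfl).trans p3) hM) ?_
  rintro s₆ t₆ hf₆ ⟨g1, g2⟩
  have n5 : ∀ a < 17, s₅.narr a = s₄.narr a := fun a ha => by
    interval_cases a <;> exact hf₅.narr _ rfl
  have n6 : ∀ a < 17, s₆.narr a = s₄.narr a := fun a ha => by
    refine Eq.trans ?_ (n5 a ha)
    interval_cases a <;> exact hf₆.narr _ rfl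
  rw [n5 11 (by decide), n5 12 (by decide), n5 13 (by decide), n5 14 (by decide),
    n5 15 (by decide), n5 16 (by decide)] at g2
  have r6 : ∀ a < 4, s₆.nreg a = s₄.nreg a := fun a ha => by
    interval_cases a <;> exact (hf₆.nreg _ rfl).trans (hf₅.nreg _ rfl)
  have hcard : ∀ c, S.rankX c ≤ n := fun c => by
    simpa using S.rankX_le_card c
  have q8 : s₆.rarr 8 = s₂.rarr 8 := (hf₆.rarr 8 rfl).trans ((hf₅.rarr 8 rfl).trans
    ((hf₄.rarr 8 rfl).trans (hf₃.rarr 8 rfl)))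
  have q9 : s₆.rarr 9 = s₂.rarr 9 := (hf₆.rarr 9 rfl).trans ((hf₅.rarr 9 rfl).trans
    ((hf₄.rarr 9 rfl).trans (hf₃.rarr 9 rfl)))
  rw [WP.skip_iff]
  refine ⟨by omega, ⟨⟨(r6 0 (by decide)).trans p0, (r6 1 (by decide)).trans p1,
    (r6 2 (by decide)).trans p2, (r6 3 (by decide)).trans p3,
    fun k hk => ?_, fun k hk => ?_, fun k hk => ?_⟩, fun z => ⟨fun i r hr => ?_, fun i r hr => ?_,
    fun i r hi => ?_, rfl, rfl⟩, fun k => ?_, fun k => ?_⟩⟩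
  · rw [n6 14 (by decide), hvx ⟨k, hk⟩]
    exact hcard _
  -- The left end of edge `k` lies between the two bounds.
  · have h1 := ((g2 k hk).1 (s₄.narr 12 k)).2 fun m _ _ _ h => h.le
    have h2 : S.rank.hl ⟨k, hk⟩ < S.rank.hr ⟨k, hk⟩ := S.rank.hl_lt _
    rw [← hhl, ← hhr] at h2
    have h3 : s₄.narr 12 k ≤ n := by
      rw [hhl ⟨k, hk⟩]
      exact hcard _
    exact h1.trans (((g2 k hk).2 (s₄.narr 12 k)).2 ⟨by omega, fun m _ _ _ h => h2.trans h⟩).le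
  · by_contra h
    exact lt_irrefl _ (((g2 k hk).2 (n + 1)).1 (not_le.1 h)).1
  · rw [n6 14 (by decide), hf₆.narr 17 rfl, hf₆.narr 18 rfl]
    exact EdgeSystem.exists_reach_iff_wV hhy hhl hhr hvx hvb hvt f2 hr
  · rw [n6 14 (by decide), n6 15 (by decide), n6 16 (by decide)]
    refine ⟨fun ⟨k, hk, h1, h2, h3⟩ => ⟨⟨k, hk⟩, ?_, ?_, ?_⟩, fun ⟨k, h1, h2, h3⟩ =>
      ⟨k, k.2, (hvx k).trans h1, (hvb k).trans_le h2, h3.trans_eq (hvt k).symm⟩⟩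
    · rw [← hvx, h1]
    · rw [← hvb]
      exact h2
    · rw [← hvt]
      exact h3
  · rw [n6 11 (by decide)]
    exact EdgeSystem.exists_reach_iff_wV (T := S.rank.swap) hvx hvb hvt hhy hhl hhr g2 hi
  · have h := (rx (nx k)).2
    rw [← (hS k).2.2.2.1] at h
    rw [q8]
    exact h
  · have h := (ry k).2
    rw [← (hS k).1] at h
    rw [q9]
    exact h

open Instr Test in
/-- Compute the base rectangle graph: after the preparations, a first sweep counts the nodes, and a
second sweep, with this number for missing neighbours, builds the graph. -/
def buildGraphProg : Prog :=
  .block [prepareProg, .instr (zero 4), sweepProg, .instr (copy 4 5), sweepProg,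
    .instr (copy 0 5)]

/-! ### The recorded data are the base rectangle graph -/

namespace EdgeSystem

variable {n : ℕ} {S : EdgeSystem (Fin n) ℝ} {P : RectilinearPolygon}

theorem blocksBefore_all : S.blocksBefore 1 (n + 1) = {β | S.rank.IsBlock β}.ncard := by
  refine congrArg Set.ncard (Set.ext fun γ => and_iff_left_of_imp fun hγ => ?_)
  have h := Finset.mem_Icc.1 hγ.b_mem_Icc
  rw [Fintype.card_fin] at h
  omega

/-- A neighbour of a block is given by the number of a cell next to it. -/
theorem cellNum_neighbour {z i r : ℕ} {R : Rect → Prop} (h : S.Represents P)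
    (hz : z = {β | S.rank.IsBlock β}.ncard)
    (h1 : S.rank.In i r → ∃ γ, S.rank.IsBlock γ ∧ γ.Has i r ∧ R (S.blockRect γ))
    (h2 : ∀ γ, S.rank.IsBlock γ → R (S.blockRect γ) → S.rank.In i r)
    (h3 : ∀ A, R A → A ∈ P.baseRects) :
    (S.cellNum z i r < z ∧ R (S.blockRect (S.blockOf (S.cellNum z i r)))) ∨
      (S.cellNum z i r = z ∧ ¬ ∃ A, R A) := by
  by_cases hin : S.rank.In i r
  · obtain ⟨γ, hγ, h4, h5⟩ := h1 hin
    rw [cellNum_of_has hγ h4, blockOf_blockNum hγ, hz]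
    exact Or.inl ⟨blockNum_lt hγ, h5⟩
  · refine Or.inr ⟨cellNum_of_not hin, fun ⟨A, hA⟩ => ?_⟩
    have hA' := h3 A hA
    rw [h.baseRects_eq] at hA'
    obtain ⟨γ, hγ, rfl⟩ := hA'
    exact hin (h2 γ hγ hA)

/-- After the last row all cells of the grid have been visited, among them `(l, b)`, `(r, b)` and
`(l, t)` for each block. There the walls of the four sides have caused its data to be recorded; the
last two cells are in the grid even if they are outside `P`, as ranks are at most n. -/
theorem holdsGraph_of_recs (h : S.Represents P) {N : ℕ} (hN : N = {β | S.rank.IsBlock β}.ncard)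
    {xs ys : ℕ → ℝ} (hxs : ∀ k, xs (S.rank.vx k) = S.vx k) (hys : ∀ k, ys (S.rank.hy k) = S.hy k)
    {s : MState} (h0 : s.nreg 0 = N) (hr : (S.cellData N xs ys).Recs n N 1 (n + 1) s) :
    HoldsGraph P s := by
  have hx : ∀ {i}, (∃ k, S.rank.vx k = i) → xs i = S.valX i := by
    rintro i ⟨k, rfl⟩
    exact (hxs k).trans (valX_rankX ⟨k, rfl⟩).symm
  have hy : ∀ {i}, (∃ k, S.rank.hy k = i) → ys i = S.valY i := by
    rintro i ⟨k, rfl⟩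
    exact (hys k).trans (valX_rankX (S := S.swap) ⟨k, rfl⟩).symm
  have hxn : ∀ {i}, (∃ k, S.rank.vx k = i) → 0 < i ∧ i ≤ n := by
    rintro i ⟨k, rfl⟩
    exact ⟨rankX_pos k, (rankX_le_card _).trans_eq (Fintype.card_fin n)⟩
  have hyn : ∀ {i}, (∃ k, S.rank.hy k = i) → 0 < i ∧ i ≤ n := by
    rintro i ⟨k, rfl⟩
    exact ⟨rankX_pos (S := S.swap) k, (rankX_le_card (S := S.swap) _).trans_eq (Fintype.card_fin n)⟩
  have hblock : ∀ ν < N, ∃ β, S.rank.IsBlock β ∧ S.blockNum β = ν ∧ S.blockOf ν = β := by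
    intro ν hν
    rw [hN] at hν
    obtain ⟨β, hβ, rfl⟩ := blockNum_bijOn.surjOn hν
    exact ⟨β, hβ, rfl, blockOf_blockNum hβ⟩
  have hL : ∀ β, S.rank.IsBlock β → s.narr 0 (S.blockNum β) = S.cellNum N (β.l - 1) β.b ∧
      s.rarr 0 (S.blockNum β) = S.valX β.l := fun β hβ => by
    have h1 := hr.left (S.blockNum β) ⟨β.l, β.b, (hxn hβ.l_mem).1, (hxn hβ.l_mem).2,
      (hyn hβ.b_mem).1, Or.inl (Nat.lt_succ_of_le (hyn hβ.b_mem).2), hβ.left _ le_rfl hβ.bt,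
      cellNum_of_has hβ ⟨le_rfl, hβ.lr, le_rfl, hβ.bt⟩⟩ (hN ▸ (blockNum_lt hβ).ne)
    simp only [cellData, blockOf_blockNum hβ, hx hβ.l_mem] at h1
    exact h1
  have hB : ∀ β, S.rank.IsBlock β → s.narr 3 (S.blockNum β) = S.cellNum N β.l (β.b - 1) ∧
      s.rarr 3 (S.blockNum β) = S.valY β.b := fun β hβ => by
    have h1 := hr.bottom (S.blockNum β) ⟨β.l, β.b, (hxn hβ.l_mem).1, (hxn hβ.l_mem).2,
      (hyn hβ.b_mem).1, Or.inl (Nat.lt_succ_of_le (hyn hβ.b_mem).2), hβ.bottom _ le_rfl hβ.lr,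
      cellNum_of_has hβ ⟨le_rfl, hβ.lr, le_rfl, hβ.bt⟩⟩ (hN ▸ (blockNum_lt hβ).ne)
    simp only [cellData, blockOf_blockNum hβ, hy hβ.b_mem] at h1
    exact h1
  have hR : ∀ β, S.rank.IsBlock β → s.narr 2 (S.blockNum β) = S.cellNum N β.r β.b ∧
      s.rarr 2 (S.blockNum β) = S.valX β.r := fun β hβ => by
    have h2 := hβ.lr
    have h1 := hr.right (S.blockNum β) ⟨β.r, β.b, (hxn hβ.r_mem).1, (hxn hβ.r_mem).2,
      (hyn hβ.b_mem).1, Or.inl (Nat.lt_succ_of_le (hyn hβ.b_mem).2), hβ.right _ le_rfl hβ.bt,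
      cellNum_of_has hβ ⟨by omega, by omega, le_rfl, hβ.bt⟩⟩ (hN ▸ (blockNum_lt hβ).ne)
    simp only [cellData, blockOf_blockNum hβ, hx hβ.r_mem] at h1
    exact h1
  have hT : ∀ β, S.rank.IsBlock β → s.narr 1 (S.blockNum β) = S.cellNum N β.l β.t ∧
      s.rarr 1 (S.blockNum β) = S.valY β.t := fun β hβ => by
    have h2 := hβ.bt
    have h1 := hr.top (S.blockNum β) ⟨β.l, β.t, (hxn hβ.l_mem).1, (hxn hβ.l_mem).2,
      (hyn hβ.t_mem).1, Or.inl (Nat.lt_succ_of_le (hyn hβ.t_mem).2), hβ.top _ le_rfl hβ.lr,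
      cellNum_of_has hβ ⟨le_rfl, hβ.lr, by omega, by omega⟩⟩ (hN ▸ (blockNum_lt hβ).ne)
    simp only [cellData, blockOf_blockNum hβ, hy hβ.t_mem] at h1
    exact h1
  rw [RectilinearPolygon.holdsGraph_iff, h0]
  refine ⟨fun ν => S.blockRect (S.blockOf ν), h0, ?_, fun ν hν => ?_, fun ν hν => ?_,
    fun ν hν => ?_, fun ν hν => ?_, fun ν hν => ?_, fun ν hν => ?_, fun ν hν => ?_,
    fun ν hν => ?_⟩
  · refine ⟨fun ν hν => ?_, fun ν hν ν' hν' h1 => ?_, ?_⟩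
    · obtain ⟨β, hβ, -, h2⟩ := hblock ν hν
      rw [h.baseRects_eq]
      exact ⟨β, hβ, by dsimp only; rw [h2]⟩
    · obtain ⟨β, hβ, rfl, h2⟩ := hblock ν hν
      obtain ⟨β', hβ', rfl, h3⟩ := hblock ν' hν'
      dsimp only at h1
      rw [h2, h3] at h1
      rw [blockRect_injOn hβ hβ' h1]
    · rw [h.baseRects_eq]
      rintro _ ⟨β, hβ, rfl⟩
      exact ⟨S.blockNum β, hN ▸ blockNum_lt hβ, by dsimp only; rw [blockOf_blockNum hβ]⟩
  all_goals
    obtain ⟨β, hβ, rfl, h2⟩ := hblock ν hν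
    try dsimp only
    rw [h2]
  · rw [(hL β hβ).2, hβ.blockRect_eq]
  · rw [(hT β hβ).2, hβ.blockRect_eq]
  · rw [(hR β hβ).2, hβ.blockRect_eq]
  · rw [(hB β hβ).2, hβ.blockRect_eq]
  · rw [(hL β hβ).1]
    refine cellNum_neighbour (R := P.IsLeft (S.blockRect β)) h hN (fun hin => ?_)
      (fun γ hγ h4 => ?_) fun A hA => hA.2.1
    · obtain ⟨γ, hγ, h4, h5, h6⟩ := hβ.exists_left hβ.l_pos le_rfl hβ.bt hin
      exact ⟨γ, hγ, h4, (h.isLeft_iff hβ hγ).2 ⟨h5, h6⟩⟩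
    · obtain ⟨h5, h6, h7⟩ := (h.isLeft_iff hβ hγ).1 h4
      have := hγ.lr
      have := hγ.bt
      exact hγ.inside _ _ ⟨by omega, by omega, by omega, by omega⟩
  · rw [(hT β hβ).1]
    refine cellNum_neighbour (R := P.IsTop (S.blockRect β)) h hN (fun hin => ?_)
      (fun γ hγ h4 => ?_) fun A hA => hA.2.1
    · obtain ⟨γ, hγ, h4, h5, h6⟩ := hβ.exists_top le_rfl hβ.lr hin
      exact ⟨γ, hγ, h4, (h.isTop_iff hβ hγ).2 ⟨h5, h6⟩⟩
    · obtain ⟨h5, h6, h7⟩ := (h.isTop_iff hβ hγ).1 h4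
      have := hγ.lr
      have := hγ.bt
      exact hγ.inside _ _ ⟨by omega, by omega, by omega, by omega⟩
  · rw [(hR β hβ).1]
    refine cellNum_neighbour (R := P.IsRight (S.blockRect β)) h hN (fun hin => ?_)
      (fun γ hγ h4 => ?_) fun A hA => hA.2.1
    · obtain ⟨γ, hγ, h4, h5, h6⟩ := hβ.exists_right le_rfl hβ.bt hin
      exact ⟨γ, hγ, h4, (h.isRight_iff hβ hγ).2 ⟨h5, h6⟩⟩
    · obtain ⟨h5, h6, h7⟩ := (h.isRight_iff hβ hγ).1 h4
      have := hγ.lr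
      have := hγ.bt
      exact hγ.inside _ _ ⟨by omega, by omega, by omega, by omega⟩
  · rw [(hB β hβ).1]
    refine cellNum_neighbour (R := P.IsBottom (S.blockRect β)) h hN (fun hin => ?_)
      (fun γ hγ h4 => ?_) fun A hA => hA.2.1
    · obtain ⟨γ, hγ, h4, h5, h6⟩ := hβ.exists_bottom hβ.b_pos le_rfl hβ.lr hin
      exact ⟨γ, hγ, h4, (h.isBottom_iff hβ hγ).2 ⟨h5, h6⟩⟩
    · obtain ⟨h5, h6, h7⟩ := (h.isBottom_iff hβ hγ).1 h4
      have := hγ.lr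
      have := hγ.bt
      exact hγ.inside _ _ ⟨by omega, by omega, by omega, by omega⟩

end EdgeSystem

open EdgeSystem in
theorem buildGraphProg_spec {M n : ℕ} {P : RectilinearPolygon} {S : EdgeSystem (Fin n) ℝ}
    {x y : Fin n → ℝ} {nx : Equiv.Perm (Fin n)} (h : S.Represents P)
    (hS : ∀ k, S.hy k = y k ∧ S.hl k = min (x k) (x (nx k)) ∧
      S.hr k = max (x k) (x (nx k)) ∧ S.vx k = x (nx k) ∧ S.vb k = min (y k) (y (nx k)) ∧
      S.vt k = max (y k) (y (nx k))) (hn0 : 1 ≤ n) (hM : n < M) (hNM : P.baseRects.ncard < M)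
    {s : MState} {t : ℕ} (hn : s.nreg 0 = n)
    (hs : ∀ k : Fin n, s.rarr 0 k = x k ∧ s.rarr 1 k = y k ∧ s.narr 0 k = nx k) :
    WP M buildGraphProg (fun s' t' => t' ≤ t + 800 * n ^ 2 ∧ HoldsGraph P s') s t := by
  rw [h.ncard_baseRects] at hNM
  obtain ⟨N, hN⟩ : ∃ N, N = {β | S.rank.IsBlock β}.ncard := ⟨_, rfl⟩
  rw [← hN] at hNM
  have hlaw : ∀ z ≤ N, ∀ xs ys, (S.cellData z xs ys).Lawful n N z := fun z hz xs ys => by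
    have := S.cellData_lawful (hz.trans_eq hN) xs ys
    rwa [Fintype.card_fin, ← hN] at this
  rw [buildGraphProg, Prog.block]
  refine WP.seq (prepareProg_spec hS hM hn hs) ?_
  rintro s₁ t₁ - ⟨a1, a2⟩
  rw [Prog.block, WP.seq_iff, WP.instr_iff]
  refine ⟨trivial, ?_⟩
  rw [Prog.block]
  -- The first sweep is run for the number of blocks alone. With `z = 0` the records of block `0`
  -- are mixed up with those of outside cells, but the count is not affected.
  refine WP.seq (CellData.sweepProg_spec (z := 0) (hlaw 0 (Nat.zero_le N) (s₁.rarr 8) (s₁.rarr 9))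
    hM hNM (a2.prepared.of_eq ?_ ?_) ((a2.described 0).of_eq ?_ ?_ ?_) rfl) ?_
  · intro a ha
    exact Function.update_of_ne (by omega) _ _
  · exact fun _ _ _ => rfl
  · exact fun _ _ _ => rfl
  · rfl
  · rfl
  rintro s₂ t₂ hf₂ ⟨b1, b2, -⟩
  have b3 : s₂.nreg 5 = N := b2.trans (blocksBefore_all.trans hN.symm)
  have n2 : ∀ a, 11 ≤ a → a ≤ 20 → s₂.narr a = s₁.narr a := fun a h1 h2 => by
    interval_cases a <;> exact hf₂.narr _ rfl
  have r2 : ∀ a < 4, s₂.nreg a = s₁.nreg a := fun a h1 => by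
    interval_cases a <;> exact hf₂.nreg _ rfl
  rw [Prog.block, WP.seq_iff, WP.instr_iff]
  refine ⟨trivial, ?_⟩
  rw [Prog.block]
  -- Now `z = N` is not the number of any block, so all records are right and `N` marks missing
  -- neighbours.
  refine WP.seq (CellData.sweepProg_spec (z := N) (hlaw N le_rfl (s₁.rarr 8) (s₁.rarr 9))
    hM hNM (a2.prepared.of_eq ?_ ?_) ((a2.described N).of_eq ?_ ?_ ?_) b3) ?_
  · intro a ha
    exact (Function.update_of_ne (by omega) _ _).trans (r2 a ha)
  · exact fun a h1 h2 => n2 a (by omega) h2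
  · exact n2
  · exact hf₂.rarr 8 rfl
  · exact hf₂.rarr 9 rfl
  rintro s₃ t₃ hf₃ ⟨c1, c2, c3⟩
  have c4 : s₃.nreg 5 = N := c2.trans (blocksBefore_all.trans hN.symm)
  simp +decide only [Prog.block, WP.seq_iff, WP.instr_iff, WP.skip_iff, Instr.apply, Instr.Within,
    true_and]
  refine ⟨?_, holdsGraph_of_recs h hN a2.xs a2.ys ?_
    (CellData.Recs.of_eq c3 (fun _ _ => rfl) fun _ _ => rfl)⟩
  -- The quadratic terms are 36 n² from the preparation and 63 n² from each sweep; the lower terms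
  -- are absorbed because `1 ≤ n ≤ n²`.
  · have e1 : n * (63 * n + 64) = 63 * (n * n) + 64 * n := by ring
    have e2 : n ≤ n * n := Nat.le_mul_self n
    rw [pow_two]
    omega
  · exact c4

/-! ### Assembly of the theorem -/

theorem WP.exists_exec {M : ℕ} {p : Prog} {Q : MState → Prop} {s : MState} {b : ℕ}
    (h : WP M p (fun s' t' => t' ≤ 0 + b ∧ Q s') s 0) :
    ∃ s' t, Exec M p s s' t ∧ t ≤ b ∧ Q s' := by
  obtain ⟨s', t, h1, h2, h3⟩ := h
  exact ⟨s', t, h1, by omega, h3⟩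

open RectilinearPolygon in
theorem mainTheorem8 :
    ∃ (buildGraph : Prog) (C : ℕ), ∀ P : RectilinearPolygon,
      P.baseRects.Finite ∧
      -- the base rectangle graph is obtained from the polygon within the same bounds
      (∀ s : MState, HoldsPolygon P s → ∃ (s' : MState) (t : ℕ),
        Exec (C * P.baseRects.ncard) buildGraph s s' t ∧ t ≤ C * P.size ^ 2 ∧
        HoldsGraph P s') ∧
      -- the strip cover algorithm, run on the graph
      (∀ s : MState, HoldsGraph P s → ∃ (s' : MState) (t : ℕ),
        Exec (C * P.baseRects.ncard) stripCoverProg s s' t ∧ t ≤ C * P.size ^ 2 ∧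
        HoldsOutput P.stripCover s') ∧
      -- the run of the whole algorithm on the polygon
      (∀ s : MState, HoldsPolygon P s → ∃ (s' : MState) (t : ℕ),
        Exec (C * P.baseRects.ncard) (.seq buildGraph stripCoverProg) s s' t ∧
        t ≤ C * P.size ^ 2 ∧ HoldsOutput P.stripCover s') ∧
      -- its result
      P.IsCover P.stripCover ∧ (∀ R ∈ P.stripCover, P.IsMaximalRect R) ∧
      P.stripCover.Finite ∧ P.stripCover.ncard ≤ C * P.size := by
  -- `1400 = 800 + 600`, for building the graph and for the strip cover. Because n is at most twice
  -- the number of base rectangles, `1400` cells for each of these also exceed both n and their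
  -- number, as the array accesses require.
  refine ⟨buildGraphProg, 1400, fun P => ?_⟩
  obtain ⟨S, x, y, nx, hrep, hS, hin⟩ := P.exists_edgeSystem
  have hn := P.one_le_size
  have : Nonempty (Fin P.size) := ⟨⟨0, hn⟩⟩
  have ht : P.IsTiled := hrep.isTiled (Fintype.card_fin _)
  have hsize := ht.size_le
  have build : ∀ s : MState, HoldsPolygon P s → WP (1400 * P.baseRects.ncard) buildGraphProg
      (fun s' t' => t' ≤ 0 + 800 * P.size ^ 2 ∧ HoldsGraph P s') s 0 := fun s hs =>
    buildGraphProg_spec hrep hS hn (by omega) (by omega) (hin s hs).1 (hin s hs).2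
  have strip : ∀ (s : MState) (t : ℕ), HoldsGraph P s → WP (1400 * P.baseRects.ncard)
      stripCoverProg (fun s' t' => t' ≤ t + 600 * P.size ^ 2 ∧ HoldsOutput P.stripCover s') s t := by
    intro s t hs
    obtain ⟨node, hs⟩ := holdsGraph_iff.1 hs
    have h := hs.ncard_eq
    exact stripCoverProg_spec ht (by omega) hs
  refine ⟨ht.finite, fun s hs => ?_, fun s hs => ?_, fun s hs => ?_, ht.isCover_stripCover,
    fun R ⟨B, hB⟩ => ht.isMaximalRect_of_reports hB, ht.finite_stripCover,
    ht.ncard_stripCover_le.trans (by omega)⟩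
  · exact ((build s hs).mono fun s' t' _ h => ⟨h.1.trans (by omega), h.2⟩).exists_exec
  · exact ((strip s 0 hs).mono fun s' t' _ h => ⟨h.1.trans (by omega), h.2⟩).exists_exec
  · exact (WP.seq (build s hs) fun s₁ t₁ _ h₁ => (strip s₁ t₁ h₁.2).mono
      fun s' t' _ h => ⟨h.1.trans (by omega), h.2⟩).exists_exec
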